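/- Let $f:\mathbb R\times\mathbb R\to\mathbb R$, $(u,\mu)\mapsto f(u,\mu)$, be $C^\infty$ and odd in $u$, with the following zero set for $0\le\mu\le 1$ and $u\ge 0$. The zeros are exactly $u=0$, $u=u_-(\mu)$ and $u=u_+(\mu)$, where $u_\pm$ are continuous on $[0,1]$ and $0<u_-(\mu)<u_+(\mu)$ for $0<\mu<1$; moreover $f_u(0,\mu)<0$ for $0<\mu\le1$, $f_u(u_+(\mu),\mu)<0$ for $0\le\mu<1$, and $f_u(u_-(\mu),\mu)>0$ for $0<\mu<1$. At $\mu=0$ the zeros $0,\pm u_-$ collide in a generic subcritical pitchfork, away from $u_+$: $u_-(0)=0<u_+(0)$, $f_u(0,0)=0$, $f_{u\mu}(0,0)<0$, $f_{uuu}(0,0)>0$. At $\mu=1$ the zeros $u_\pm$ collide in a generic saddle-node at $u=1$: $u_\pm(1)=1$, $f_u(1,1)=0$, $f_\mu(1,1)<0$, $f_{uu}(1,1)<0$. Let $1\le k\le\lfloor N/2\rfloor$ and consider the all-to-all coupled steady-state system $$d\sum_{j=1}^N(u_j-u_n)+f(u_n,\mu)=0,\qquad n=1,\dots,N. \tag{1}$$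 Write $(x\,|\,y)\in\mathbb R^N$ for the vector whose first $k$ entries are $x$ and whose last $N-k$ entries are $y$, and let $\Gamma^k_{\mathrm{all}}=\Gamma_{AB}\cup\Gamma_{CD}\subset\mathbb R^N\times[0,1]$, where $$\Gamma_{AB}=\bigcup_{0\le\mu\le1}\{((u_-(\mu)|0),\mu),((u_+(\mu)|0),\mu),((u_+(\mu)|u_-(\mu)),\mu)\},$$ $$\Gamma_{CD}=\bigcup_{0\le\mu\le1}\{((0|u_-(\mu)),\mu),((0|u_+(\mu)),\mu),((u_-(\mu)|u_+(\mu)),\mu)\}.$$ By an $S_k\times S_{N-k}$-symmetric steady state we mean a solution $(U,\mu)$ of (1) whose isotropy group in $S_N$ is exactly $S_k\times S_{N-k}$, that is, $U=(x|y)$ with $x\ne y$; it is positive if all entries of $U$ are positive. Then there are $d_0,\delta_0>0$ and a family $\gamma_d$, $0\le d<d_0$, of simple closed curves in $\mathbb R^N\times\mathbb R$, parametrized with period $2$ by $t\in\mathbb R$, with the following properties. 1. $(d,t)\mapsto\gamma_d(t)$ is continuous on $[0,d_0)\times\mathbb R$ and $C^\infty$ on $(0,d_0)\times\mathbb R$.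 The velocity $\gamma_d'(t)$ exists, is nonzero, and is continuous in $(d,t)$ on $[0,d_0)\times\mathbb R$ except at the points $(0,t)$ at which $\gamma_0(t)$ has $\mu=0$ (the corners of $\Gamma^k_{\mathrm{all}}$). Moreover $\gamma_0([0,1])=\Gamma_{AB}$ and $\gamma_0([-1,0])=\Gamma_{CD}$. So $\gamma_d$ is smooth, depends smoothly on $d$, converges to $\Gamma^k_{\mathrm{all}}$ as $d\to0^+$, and is $C^1$-close to it away from its corners. For $0<d<d_0$ the curve $\gamma_d$ lies in $\mathbb R^N\times(0,1)$. 2. For $0<d<d_0$ the points $\gamma_d(0)$ and $\gamma_d(1)=\gamma_d(-1)$ lie on the homogeneous branch $u_1=\dots=u_N=u_-(\mu)$, and, as $d\to0^+$, their parameter values are respectively $$\mu=\frac{Nd}{2|f_{u\mu}(0,0)|}+O(d^2)\quad\text{and}\quad \mu=1-\frac{(Nd)^2}{2f_\mu(1,1)f_{uu}(1,1)}+O(d^3).$$ If $f=-\mu u+\dots$ near $(0,0)$ and $f=(1-\mu)-(u-1)^2+\dots$ near $(1,1)$, these are $\frac{Nd}{2}+O(d^2)$ and $1-(\frac{Nd}{2})^2+O(d^3)$.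 3. For $0<d<d_0$ the closed curve $\gamma_d$ has exactly six saddle nodes (points at which the derivative of $\mu$ along the curve vanishes), and they are all nondegenerate (the second derivative does not vanish there). 4. For every $\delta_*>0$ there is $d_*\in(0,d_0]$ such that for every $0<d<d_*$ the curve $\gamma_d$ lies in the $\delta_*$-neighbourhood of $\Gamma^k_{\mathrm{all}}$, and the positive $S_k\times S_{N-k}$-symmetric steady states $(U,\mu)$ in this neighbourhood with $\mu\in[0,1]$ are exactly the points of the two disjoint branches $\gamma_d((0,1))$ and $\gamma_d((-1,0))$. If $\delta_*\le\delta_0$, this holds without the restriction $\mu\in[0,1]$. -/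

import Mathlib

open Set Filter Topology Asymptotics
open scoped ContDiff

/-- `f(u, μ)` is a smooth odd bistable nonlinearity, and `uminus`, `uplus` are its two branches of
positive zeros over the parameter interval `[0, 1]`. On `(0, 1)` these functions are determined by
`f`; at the two ends they are the limits of these zeros. -/
structure IsBistable (f : ℝ → ℝ → ℝ) (uminus uplus : ℝ → ℝ) : Prop where
  smooth : ContDiff ℝ ∞ (Function.uncurry f)
  odd : ∀ u μ, f (-u) μ = -f u μ
  /-- The zero set for `0 ≤ μ ≤ 1` and `u ≥ 0`. -/
  zeros : ∀ μ ∈ Icc (0 : ℝ) 1, ∀ u, 0 ≤ u → (f u μ = 0 ↔ u = 0 ∨ u = uminus μ ∨ u = uplus μ)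
  order : ∀ μ ∈ Ioo (0 : ℝ) 1, 0 < uminus μ ∧ uminus μ < uplus μ
  continuousOn_uminus : ContinuousOn uminus (Icc 0 1)
  continuousOn_uplus : ContinuousOn uplus (Icc 0 1)
  /-- Stability away from the bifurcation points: `u = 0` is stable for `0 < μ ≤ 1`, `u₊` is stable
  for `0 ≤ μ < 1`, and `u₋` is unstable for `0 < μ < 1`. -/
  stable_zero : ∀ μ ∈ Ioc (0 : ℝ) 1, deriv (fun u => f u μ) 0 < 0
  stable_uplus : ∀ μ ∈ Ico (0 : ℝ) 1, deriv (fun u => f u μ) (uplus μ) < 0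
  unstable_uminus : ∀ μ ∈ Ioo (0 : ℝ) 1, 0 < deriv (fun u => f u μ) (uminus μ)
  /-- At `μ = 0` the zeros `0` and `±u₋` collide in a generic subcritical pitchfork bifurcation,
  away from the positive zero `u₊`. -/
  uminus_at_zero : uminus 0 = 0
  uplus_at_zero : 0 < uplus 0
  pitchfork_u : deriv (fun u => f u 0) 0 = 0
  pitchfork_uμ : deriv (fun μ => deriv (fun u => f u μ) 0) 0 < 0
  pitchfork_uuu : 0 < iteratedDeriv 3 (fun u => f u 0) 0
  /-- At `μ = 1` the zeros `u₋` and `u₊` collide in a generic saddle-node bifurcation at `u = 1`. -/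
  uminus_at_one : uminus 1 = 1
  uplus_at_one : uplus 1 = 1
  fold_u : deriv (fun u => f u 1) 1 = 0
  fold_μ : deriv (fun μ => f 1 μ) 1 < 0
  fold_uu : iteratedDeriv 2 (fun u => f u 1) 1 < 0

/-- `U` is a steady state of the all-to-all coupled system with `N` nodes. -/
def IsSteadyState (f : ℝ → ℝ → ℝ) (d : ℝ) {N : ℕ} (U : Fin N → ℝ) (μ : ℝ) : Prop :=
  ∀ n, d * ∑ j, (U j - U n) + f (U n) μ = 0

/-- The isotropy group of `U` in the group of all permutations of the nodes is `S_k × S_{N-k}`, the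
group of the permutations that map the first `k` nodes, and hence the last `N - k` nodes, among
themselves. -/
def HasBlockIsotropy (k : ℕ) {N : ℕ} (U : Fin N → ℝ) : Prop :=
  ∀ σ : Equiv.Perm (Fin N),
    (∀ n, U (σ n) = U n) ↔ (∀ n, ((σ n : Fin N) : ℕ) < k ↔ (n : ℕ) < k)

/-- `p = (U, μ)` is a positive steady state with isotropy group exactly `S_k × S_{N-k}`. -/
def IsPosBlockSolution (f : ℝ → ℝ → ℝ) (d : ℝ) (k : ℕ) {N : ℕ} (p : (Fin N → ℝ) × ℝ) : Prop :=
  IsSteadyState f d p.1 p.2 ∧ (∀ n, 0 < p.1 n) ∧ HasBlockIsotropy k p.1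

/-- The vector whose first `k` entries are `x` and whose last `N - k` entries are `y`. -/
def blockVec (N k : ℕ) (x y : ℝ) : Fin N → ℝ := fun n => if (n : ℕ) < k then x else y

/-- The part of the singular curve traced out by the patterns `A₋ = (u₋, 0)`, `A₊ = (u₊, 0)` and
`B = (u₊, u₋)`, where the two entries are the values on the first `k` and the last `N - k` nodes. -/
def gammaAB (uminus uplus : ℝ → ℝ) (N k : ℕ) : Set ((Fin N → ℝ) × ℝ) :=
  ⋃ μ ∈ Icc (0 : ℝ) 1, {(blockVec N k (uminus μ) 0, μ), (blockVec N k (uplus μ) 0, μ),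
    (blockVec N k (uplus μ) (uminus μ), μ)}

/-- The part of the singular curve traced out by the patterns `C₋ = (0, u₋)`, `C₊ = (0, u₊)` and
`D = (u₋, u₊)`. -/
def gammaCD (uminus uplus : ℝ → ℝ) (N k : ℕ) : Set ((Fin N → ℝ) × ℝ) :=
  ⋃ μ ∈ Icc (0 : ℝ) 1, {(blockVec N k 0 (uminus μ), μ), (blockVec N k 0 (uplus μ), μ),
    (blockVec N k (uminus μ) (uplus μ), μ)}

/-- The singular closed curve `Γ_all^k`. -/
def gammaAll (uminus uplus : ℝ → ℝ) (N k : ℕ) : Set ((Fin N → ℝ) × ℝ) :=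
  gammaAB uminus uplus N k ∪ gammaCD uminus uplus N k

/-- `γ d`, for `0 ≤ d < d₀`, is a family of simple closed curves in `ℝᴺ × ℝ`, parametrized with
period `2`, with the following regularity. The family is continuous, down to `d = 0`. For `d > 0` it
is smooth in `(d, t)`, and each curve is regular. The velocity is nonzero and continuous in `(d, t)`
also at `d = 0`, except at the points of the curve `γ 0` with `μ = 0` (where `Γ_all^k` has corners):
away from these points `γ d` converges to the regular curve `γ 0` in the `C¹` sense. -/
structure IsClosedCurveFamily {N : ℕ} (d₀ : ℝ) (γ : ℝ → ℝ → (Fin N → ℝ) × ℝ) : Prop where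
  periodic : ∀ d ∈ Ico 0 d₀, Function.Periodic (γ d) 2
  simple : ∀ d ∈ Ico 0 d₀, InjOn (γ d) (Ico (-1) 1)
  continuous : ContinuousOn (Function.uncurry γ) (Ico 0 d₀ ×ˢ univ)
  smooth : ContDiffOn ℝ ∞ (Function.uncurry γ) (Ioo 0 d₀ ×ˢ univ)
  velocity_ne_zero : ∀ d ∈ Ico 0 d₀, ∀ t, (d = 0 → (γ 0 t).2 ≠ 0) → deriv (γ d) t ≠ 0
  velocity_continuous : ContinuousOn (fun q : ℝ × ℝ => deriv (γ q.1) q.2)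
    {q | q.1 ∈ Ico 0 d₀ ∧ (q.1 = 0 → (γ 0 q.2).2 ≠ 0)}

/-! Write f = u g with g even in u. This division turns the pitchfork of f at (0, 0) into a
nondegenerate fold of g, of the same normal form as the saddle-node at (1, 1). For block vectors (x
| y), with a = N - k and b = k, system (1) is a pair of equations. One combination cancels the
coupling: b x g(x, μ) + a y g(y, μ) = 0 (`balance`). Another is divisible by x - y and leaves x y K
= d (b x + a y), where K is the divided difference of g in u. These two equations define
`branchSet`. The homogeneous states are thereby removed, except where the two-block branch crosses
them, and the branch is regular at these crossings. For d = 0 both equations hold on Γ.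

A smooth coordinate φ(u, μ) takes the positive zeros of g to the arc μ = 1 - (1 - X²)². With X =
φ(x, μ) and Y = φ(y, μ), the curve Γ becomes the boundary of a quarter disc of radius √2, which is
star-shaped about (1/2, 1/2). The angle about this point parametrizes Γ: t = 0 is the pitchfork, t =
1 is the saddle-node of both blocks, and exchanging x and y reverses t. The perturbed curve is found
by prescribing the same angle, which gives three equations in (x, y, μ) with parameters (d, t)
(`branchMap`).

Where μ > 0 the linearization is invertible, and the implicit function theorem gives a branch smooth
down to d = 0 (`exists_regular`). At the corners μ = 0 the equations are rescaled: at (u₊(0), 0, 0)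
by d = y q (`upper_corner`), at the origin by y = r x, μ = x² m, d = x² r w (`exists_isBlowup`,
`exists_square`). Either way there remains an equation D(α, β) = d, with D increasing in both
variables, and an angular equation that increases in one variable and decreases in the other. Such a
pair has exactly one small solution (`exists_corner`). Local branches are glued by uniqueness and
compactness of a period (`exists_family`).

Along Γ the parameter μ has six extrema, three corners with μ = 0 and three folds with μ = 1. At the
folds the second derivative is negative and remains so. At the corners, convexity of μ along level
sets of D follows from differentiating along a field tangent to them. Each extremum thus yields
exactly one nondegenerate critical point (`ncard_critical`). At t = 0 and t = 1 the angle forces x =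
y; then g = 0 and x g_u = N d, and the normal forms give the expansions. Completeness is a
compactness argument: limits of positive solutions as d → 0 lie on Γ, because g(0, μ) < 0 excludes
the trivial states with μ > 0. A solution close to Γ lies on some ray, and there uniqueness applies.
-/

/-! ### Divided differences, implicit functions and smooth extension. -/

theorem contDiff_nat_parametric_integral {E : Type} [NormedAddCommGroup E] [NormedSpace ℝ E]
    [FiniteDimensional ℝ E] (n : ℕ) :
    ∀ {G : Type} [NormedAddCommGroup G] [NormedSpace ℝ G] (F : E × ℝ → G),
      ContDiff ℝ ∞ F → ContDiff ℝ n (fun x => ∫ s in (0 : ℝ)..1, F (x, s)) := by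
  -- The codomain is quantified inside the induction, because the derivative of the integral is the
  -- integral of an operator-valued function.
  induction n with
  | zero =>
    intro G _ _ F hF
    exact contDiff_zero.2 (intervalIntegral.continuous_parametric_intervalIntegral_of_continuous'
      (f := fun x s => F (x, s)) (by simpa [Function.uncurry_def] using hF.continuous) 0 1)
  | succ n ih =>
    intro G _ _ F hF
    have hF1 : ContDiff ℝ ∞ (fun q : E × ℝ => (fderiv ℝ F q).comp (.inl ℝ E ℝ)) :=
      (hF.fderiv_right (m := ∞) (by norm_cast)).clm_comp contDiff_const
    have hd : ∀ x s, HasFDerivAt (fun y => F (y, s)) ((fderiv ℝ F (x, s)).comp (.inl ℝ E ℝ)) x :=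
      fun x s => ((hF.differentiable (by simp)) (x, s)).hasFDerivAt.comp x (hasFDerivAt_prodMk_left x s)
    have key : ∀ x, HasFDerivAt (fun x => ∫ s in (0 : ℝ)..1, F (x, s))
        (∫ s in (0 : ℝ)..1, (fderiv ℝ F (x, s)).comp (.inl ℝ E ℝ)) x := by
      intro x
      obtain ⟨B, hB⟩ := ((isCompact_closedBall x 1).prod (isCompact_Icc (a := (0:ℝ)) (b := 1))
        ).exists_bound_of_continuousOn hF1.continuous.continuousOn
      refine intervalIntegral.hasFDerivAt_integral_of_dominated_of_fderiv_le
        (s := Metric.closedBall x 1) (bound := fun _ => B)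
        (F' := fun x s => (fderiv ℝ F (x, s)).comp (.inl ℝ E ℝ))
        (Metric.closedBall_mem_nhds x one_pos) ?_ ?_ ?_ ?_ ?_ ?_
      · refine Eventually.of_forall fun y => Continuous.aestronglyMeasurable ?_
        exact hF.continuous.comp (by fun_prop)
      · exact Continuous.intervalIntegrable (hF.continuous.comp (by fun_prop)) _ _
      · exact Continuous.aestronglyMeasurable (hF1.continuous.comp (by fun_prop : Continuous fun s : ℝ => (x, s)))
      · refine Eventually.of_forall fun s hs y hy => hB (y, s) ⟨hy, ?_⟩
        rw [uIoc_of_le zero_le_one] at hs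
        exact ⟨hs.1.le, hs.2⟩
      · simp
      · exact Eventually.of_forall fun s _ y _ => hd y s
    rw [show ((n + 1 : ℕ) : ℕ∞ω) = (n : ℕ∞ω) + 1 by norm_cast, contDiff_succ_iff_fderiv]
    refine ⟨fun x => (key x).differentiableAt, by simp, ?_⟩
    rw [show fderiv ℝ (fun x => ∫ s in (0 : ℝ)..1, F (x, s)) = _ from funext fun x => (key x).fderiv]
    exact ih _ hF1

theorem contDiff_parametric_integral {E : Type} [NormedAddCommGroup E] [NormedSpace ℝ E]
    [FiniteDimensional ℝ E] {F : E × ℝ → ℝ} (hF : ContDiff ℝ ∞ F) :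
    ContDiff ℝ ∞ (fun x => ∫ s in (0 : ℝ)..1, F (x, s)) :=
  contDiff_infty.2 fun n => contDiff_nat_parametric_integral n F hF

/-- Smooth divided differences in the first variable. -/
theorem exists_dividedDifference {E : Type} [NormedAddCommGroup E] [NormedSpace ℝ E]
    [FiniteDimensional ℝ E] {H : ℝ × E → ℝ} (hH : ContDiff ℝ ∞ H) :
    ∃ K : ℝ × ℝ × E → ℝ, ContDiff ℝ ∞ K ∧
      (∀ x y e, H (x, e) - H (y, e) = (x - y) * K (x, y, e)) ∧
      (∀ x e, K (x, x, e) = fderiv ℝ H (x, e) (1, 0)) ∧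
      ∀ x y e, K (x, y, e) = K (y, x, e) := by
  let F : (ℝ × ℝ × E) × ℝ → ℝ := fun q =>
    fderiv ℝ H (q.1.2.1 + q.2 * (q.1.1 - q.1.2.1), q.1.2.2) (1, 0)
  have hF : ContDiff ℝ ∞ F := by
    have := hH.fderiv_right (m := ∞) (by norm_cast)
    exact (this.comp (by fun_prop : ContDiff ℝ ∞ fun q : (ℝ × ℝ × E) × ℝ =>
      (q.1.2.1 + q.2 * (q.1.1 - q.1.2.1), q.1.2.2))).clm_apply contDiff_const
  have hK := contDiff_parametric_integral hF
  have h1 : ∀ x y e, H (x, e) - H (y, e) = (x - y) * ∫ s in (0 : ℝ)..1, F ((x, y, e), s) := by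
    intro x y e
    rw [← intervalIntegral.integral_const_mul]
    have hd : ∀ s ∈ uIcc (0:ℝ) 1, HasDerivAt (fun s : ℝ => H (y + s * (x - y), e))
        ((x - y) * F ((x, y, e), s)) s := by
      intro s _
      have h2 : HasDerivAt (fun s : ℝ => (y + s * (x - y), e)) ((x - y), (0 : E)) s := by
        have := ((hasDerivAt_id s).mul_const (x - y)).const_add y
        simpa using this.prodMk (hasDerivAt_const s e)
      have h3 := ((hH.differentiable (by simp)) (y + s * (x - y), e)).hasFDerivAt.comp_hasDerivAt s h2
      rw [show ((x - y), (0 : E)) = (x - y) • ((1 : ℝ), (0 : E)) by simp, map_smul] at h3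
      exact h3
    rw [intervalIntegral.integral_eq_sub_of_hasDerivAt hd]
    · simp
    · refine Continuous.intervalIntegrable ?_ _ _
      have := hF.continuous
      exact continuous_const.mul (this.comp (by fun_prop))
  refine ⟨_, hK, h1, ?_, ?_⟩
  · intro x e
    simp [F]
  · intro x y e
    rcases eq_or_ne x y with rfl | h
    · rfl
    · have h2 := h1 x y e
      have h3 := h1 y x e
      have : x - y ≠ 0 := sub_ne_zero.2 h
      apply mul_left_cancel₀ this
      linear_combination -h2 - h3

/-- The implicit function theorem for smooth equations, with local uniqueness of the solution. -/
theorem exists_implicit {A B : Type} [NormedAddCommGroup A] [NormedSpace ℝ A] [CompleteSpace A]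
    [NormedAddCommGroup B] [NormedSpace ℝ B] [FiniteDimensional ℝ B]
    {E : A × B → B} {q₀ : A} {p₀ : B} (hE : ∀ᶠ z in 𝓝 (q₀, p₀), ContDiffAt ℝ ∞ E z)
    (h0 : E (q₀, p₀) = 0) (hinj : ∀ v, fderiv ℝ E (q₀, p₀) (0, v) = 0 → v = 0) :
    ∃ c : A → B, c q₀ = p₀ ∧ (∀ᶠ q in 𝓝 q₀, ContDiffAt ℝ ∞ c q) ∧
      ∀ᶠ z in 𝓝 (q₀, p₀), E z = 0 ↔ z.2 = c z.1 := by
  have : CompleteSpace B := FiniteDimensional.complete ℝ B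
  have invert : ∀ T : B →L[ℝ] B, (∀ v, T v = 0 → v = 0) → T.IsInvertible := by
    intro T hT
    have hi : Function.Injective T := (injective_iff_map_eq_zero T).2 hT
    exact ⟨(LinearEquiv.ofInjectiveEndo (T : B →ₗ[ℝ] B) hi).toContinuousLinearEquiv, by ext; rfl⟩
  have cd0 : ContDiffAt ℝ ∞ E (q₀, p₀) := hE.self_of_nhds
  have inv0 : (fderiv ℝ E (q₀, p₀) ∘L .inr ℝ A B).IsInvertible := invert _ (by simpa using hinj)
  have hn : (∞ : ℕ∞ω) ≠ 0 := by simp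
  set c := cd0.implicitFunction hn inv0 with hc
  have c0 : c q₀ = p₀ := cd0.implicitFunction_apply_self hn inv0
  have hcd : ContDiffAt ℝ ∞ c q₀ := cd0.contDiffAt_implicitFunction hn inv0
  have hiff : ∀ᶠ z in 𝓝 (q₀, p₀), E z = 0 ↔ z.2 = c z.1 := by
    filter_upwards [cd0.eventually_apply_eq_iff_implicitFunction hn inv0] with z hz
    rw [h0] at hz
    rw [hz, eq_comm]
  have hccont : ∀ᶠ q in 𝓝 q₀, ContinuousAt c q := by
    have : ContDiffAt ℝ 1 c q₀ := hcd.of_le (by norm_cast)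
    exact (this.eventually (by simp)).mono fun q h => h.continuousAt
  have htend : Tendsto (fun q => (q, c q)) (𝓝 q₀) (𝓝 (q₀, p₀)) := by
    have := (continuousAt_id (x := q₀)).prodMk hcd.continuousAt
    rw [ContinuousAt] at this
    simpa [c0] using this
  have hinv : ∀ᶠ z in 𝓝 (q₀, p₀), (fderiv ℝ E z ∘L .inr ℝ A B).IsInvertible := by
    have hcont : ContinuousAt (fun z => fderiv ℝ E z ∘L .inr ℝ A B) (q₀, p₀) := by
      have : ContinuousAt (fderiv ℝ E) (q₀, p₀) := cd0.continuousAt_fderiv hn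
      exact this.clm_comp continuousAt_const
    have hopen : {T : B →L[ℝ] B | T.IsInvertible} ∈ 𝓝 (fderiv ℝ E (q₀, p₀) ∘L .inr ℝ A B) := by
      obtain ⟨e, he⟩ := inv0
      rw [← he]
      filter_upwards [ContinuousLinearEquiv.nhds e] with T hT
      obtain ⟨e', rfl⟩ := hT
      exact ⟨e', rfl⟩
    exact hcont hopen
  refine ⟨c, c0, ?_, hiff⟩
  -- Smoothness of infinite order at q₀ does not by itself spread to a neighbourhood. The theorem is
  -- therefore applied again at each nearby zero, and local uniqueness identifies the new implicit
  -- function with c.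
  filter_upwards [hccont, htend.eventually hE, htend.eventually hinv,
    htend.eventually hiff.eventually_nhds] with q hq1 hq2 hq3 hq4
  have hz : E (q, c q) = 0 := hq4.self_of_nhds.2 rfl
  have h5 := hq2.eventually_apply_eq_iff_implicitFunction hn hq3
  have h6 := hq2.contDiffAt_implicitFunction hn hq3
  have h7 : Tendsto (fun q' => (q', c q')) (𝓝 q) (𝓝 (q, c q)) :=
    (continuousAt_id (x := q)).prodMk hq1
  refine h6.congr_of_eventuallyEq ?_
  filter_upwards [h7.eventually hq4, h7.eventually h5] with q' h8 h9
  exact (h9.1 ((h8.2 rfl).trans hz.symm)).symm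

theorem fderiv_fst_eq {E F : Type} [NormedAddCommGroup E] [NormedSpace ℝ E]
    [NormedAddCommGroup F] [NormedSpace ℝ F] {H : ℝ × E → F} {x : ℝ} {e : E}
    (hH : DifferentiableAt ℝ H (x, e)) :
    HasDerivAt (fun x => H (x, e)) (fderiv ℝ H (x, e) (1, 0)) x :=
  hH.hasFDerivAt.comp_hasDerivAt x ((hasDerivAt_id x).prodMk (hasDerivAt_const x e))

/-- A function on a closed set that extends smoothly near each of its points extends to a smooth
function on the whole space. -/
theorem exists_contDiff_extension {E : Type} [NormedAddCommGroup E] [NormedSpace ℝ E]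
    [FiniteDimensional ℝ E] {K : Set E} (hK : IsClosed K) (v : E → ℝ)
    (h : ∀ x ∈ K, ∃ w : E → ℝ, ∀ᶠ y in 𝓝 x, ContDiffAt ℝ ∞ w y ∧ (y ∈ K → w y = v y)) :
    ∃ φ : E → ℝ, ContDiff ℝ ∞ φ ∧ ∀ x ∈ K, φ x = v x := by
  -- A partition of unity glues the local extensions; having the prescribed value at a point of K is
  -- a convex condition and survives.
  obtain ⟨s, hs⟩ := exists_contMDiffMap_forall_mem_convex_of_local (n := (⊤ : ℕ∞)) (modelWithCornersSelf ℝ E)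
    (M := E) (F := ℝ) (t := fun x => {w | x ∈ K → w = v x}) (by
      intro x w hw w' hw' a b _ _ hab hx
      simp only [smul_eq_mul]
      rw [hw hx, hw' hx, ← add_mul, hab, one_mul]) (by
      intro x
      by_cases hx : x ∈ K
      · obtain ⟨w, hw⟩ := h x hx
        exact ⟨_, hw, w, fun y hy => (contMDiffAt_iff_contDiffAt.2 hy.1).contMDiffWithinAt,
          fun y hy => hy.2⟩
      · exact ⟨Kᶜ, hK.isOpen_compl.mem_nhds hx, fun _ => 0, contMDiffOn_const,
          fun y hy hy' => absurd hy' hy⟩)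
  exact ⟨s, contMDiff_iff_contDiff.1 s.contMDiff, fun x hx => hs x hx⟩

/-! ### The reduced nonlinearity g = f / u and its folds. -/

/-- The partial derivatives of a function of `(u, μ)`. -/
noncomputable def partialU (g : ℝ × ℝ → ℝ) (p : ℝ × ℝ) : ℝ := fderiv ℝ g p (1, 0)

noncomputable def partialM (g : ℝ × ℝ → ℝ) (p : ℝ × ℝ) : ℝ := fderiv ℝ g p (0, 1)

theorem contDiff_partialU {g : ℝ × ℝ → ℝ} (hg : ContDiff ℝ ∞ g) : ContDiff ℝ ∞ (partialU g) :=
  (hg.fderiv_right (m := ∞) (by norm_cast)).clm_apply contDiff_const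

theorem contDiff_partialM {g : ℝ × ℝ → ℝ} (hg : ContDiff ℝ ∞ g) : ContDiff ℝ ∞ (partialM g) :=
  (hg.fderiv_right (m := ∞) (by norm_cast)).clm_apply contDiff_const

theorem fderiv_pair {g : ℝ × ℝ → ℝ} (p : ℝ × ℝ) (v w : ℝ) :
    fderiv ℝ g p (v, w) = v * partialU g p + w * partialM g p := by
  rw [show (v, w) = v • ((1 : ℝ), (0 : ℝ)) + w • ((0 : ℝ), (1 : ℝ)) by simp, map_add, map_smul, map_smul]
  rfl

theorem hasDerivAt_fst {g : ℝ × ℝ → ℝ} (hg : ContDiff ℝ ∞ g) (u μ : ℝ) :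
    HasDerivAt (fun u => g (u, μ)) (partialU g (u, μ)) u :=
  fderiv_fst_eq (hg.differentiable (by simp) _)

theorem hasDerivAt_snd {g : ℝ × ℝ → ℝ} (hg : ContDiff ℝ ∞ g) (u μ : ℝ) :
    HasDerivAt (fun μ => g (u, μ)) (partialM g (u, μ)) μ :=
  (hg.differentiable (by simp) (u, μ)).hasFDerivAt.comp_hasDerivAt μ
    ((hasDerivAt_const μ u).prodMk (hasDerivAt_id μ))

theorem hasDerivAt_comp_pair {g : ℝ × ℝ → ℝ} {x m : ℝ → ℝ} {x' m' t : ℝ}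
    (hg : DifferentiableAt ℝ g (x t, m t)) (hx : HasDerivAt x x' t) (hm : HasDerivAt m m' t) :
    HasDerivAt (fun s => g (x s, m s)) (x' * partialU g (x t, m t) + m' * partialM g (x t, m t)) t := by
  have := hg.hasFDerivAt.comp_hasDerivAt t (hx.prodMk hm)
  rwa [fderiv_pair] at this

/-- The reduced nonlinearity `g(u, μ) = f(u, μ) / u` of a bistable `f`, with its branches of
positive zeros. -/
structure Profile (g : ℝ × ℝ → ℝ) (um up : ℝ → ℝ) : Prop where
  smooth : ContDiff ℝ ∞ g
  even : ∀ u μ, g (-u, μ) = g (u, μ)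
  zero_um : ∀ μ ∈ Icc (0 : ℝ) 1, g (um μ, μ) = 0
  zero_up : ∀ μ ∈ Icc (0 : ℝ) 1, g (up μ, μ) = 0
  zeros : ∀ μ ∈ Icc (0 : ℝ) 1, ∀ u > 0, g (u, μ) = 0 → u = um μ ∨ u = up μ
  um_zero : um 0 = 0
  um_one : um 1 = 1
  up_one : up 1 = 1
  um_pos : ∀ μ ∈ Ioc (0 : ℝ) 1, 0 < um μ
  lt : ∀ μ ∈ Ico (0 : ℝ) 1, um μ < up μ
  cont_um : ContinuousOn um (Icc 0 1)
  cont_up : ContinuousOn up (Icc 0 1)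
  neg_zero : ∀ μ ∈ Ioc (0 : ℝ) 1, g (0, μ) < 0
  stable : ∀ μ ∈ Ico (0 : ℝ) 1, partialU g (up μ, μ) < 0
  unstable : ∀ μ ∈ Ioo (0 : ℝ) 1, 0 < partialU g (um μ, μ)
  pitch_μ : partialM g (0, 0) < 0
  pitch_uu : 0 < partialU (partialU g) (0, 0)
  fold_u : partialU g (1, 1) = 0
  fold_μ : partialM g (1, 1) < 0
  fold_uu : partialU (partialU g) (1, 1) < 0

theorem exists_hadamard {h : ℝ → ℝ} (hh : ContDiff ℝ ∞ h) (u₀ : ℝ) :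
    ∃ k : ℝ → ℝ, ContDiff ℝ ∞ k ∧ (∀ u, h u = h u₀ + (u - u₀) * k u) ∧ k u₀ = deriv h u₀ := by
  obtain ⟨K, hK, h1, h2, -⟩ := exists_dividedDifference (E := ℝ) (H := fun p => h p.1)
    (hh.comp contDiff_fst)
  refine ⟨fun u => K (u, u₀, 0), hK.comp (by fun_prop), fun u => by linear_combination h1 u u₀ 0, ?_⟩
  simp only [h2]
  have := fderiv_fst_eq (H := fun p : ℝ × ℝ => h p.1) (x := u₀) (e := (0:ℝ))
    ((hh.comp contDiff_fst).differentiable (by simp) _)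
  exact this.deriv.symm

/-- The normal form of a function at a zero that is critical in `u`. -/
theorem exists_fold_form {g : ℝ × ℝ → ℝ} (hg : ContDiff ℝ ∞ g) {u₀ μ₀ : ℝ}
    (h0 : g (u₀, μ₀) = 0) (h1 : partialU g (u₀, μ₀) = 0) :
    ∃ (A : ℝ × ℝ → ℝ) (B : ℝ → ℝ), ContDiff ℝ ∞ A ∧ ContDiff ℝ ∞ B ∧
      (∀ u μ, g (u, μ) = (μ - μ₀) * A (u, μ) + (u - u₀) ^ 2 * B u) ∧
      A (u₀, μ₀) = partialM g (u₀, μ₀) ∧ 2 * B u₀ = partialU (partialU g) (u₀, μ₀) := by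
  obtain ⟨K, hK, k1, k2, -⟩ := exists_dividedDifference (E := ℝ) (H := fun p => g (p.2, p.1))
    (hg.comp (by fun_prop))
  have hh : ContDiff ℝ ∞ (fun u => g (u, μ₀)) := hg.comp (by fun_prop)
  obtain ⟨b, hb, b1, b2⟩ := exists_hadamard hh u₀
  have hb0 : b u₀ = 0 := by rw [b2, (hasDerivAt_fst hg u₀ μ₀).deriv, h1]
  obtain ⟨B, hB, B1, B2⟩ := exists_hadamard hb u₀
  have hbB : ∀ u, g (u, μ₀) = (u - u₀) ^ 2 * B u := fun u => by
    have := b1 u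
    have := B1 u
    simp only [h0, hb0] at *
    rw [b1 u, B1 u]; ring
  refine ⟨fun p => K (p.2, μ₀, p.1), B, hK.comp (by fun_prop), hB, fun u μ => ?_, ?_, ?_⟩
  · rw [← hbB]
    linear_combination k1 μ μ₀ u
  · simp only [k2]
    have e1 := fderiv_fst_eq (H := fun p : ℝ × ℝ => g (p.2, p.1)) (x := μ₀) (e := u₀)
      ((hg.comp (by fun_prop)).differentiable (by simp) _)
    exact e1.unique (hasDerivAt_snd hg u₀ μ₀)
  · have e1 : ∀ u, partialU g (u, μ₀) = 2 * (u - u₀) * B u + (u - u₀) ^ 2 * deriv B u := by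
      intro u
      have e2 : HasDerivAt (fun u => (u - u₀) ^ 2 * B u)
          (2 * (u - u₀) * B u + (u - u₀) ^ 2 * deriv B u) u := by
        have := (((hasDerivAt_id u).sub_const u₀).pow 2).mul
          ((hB.differentiable (by simp) u).hasDerivAt)
        exact this.congr_deriv (by simp)
      rw [← funext hbB] at e2
      exact (hasDerivAt_fst hg u μ₀).unique e2
    have e3 := hasDerivAt_fst (contDiff_partialU hg) u₀ μ₀
    have e4 : HasDerivAt (fun u => 2 * (u - u₀) * B u + (u - u₀) ^ 2 * deriv B u) (2 * B u₀) u₀ := by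
      have hB' : ContDiff ℝ ∞ (deriv B) := ((contDiff_infty_iff_deriv).1 hB).2
      have f1 := (((hasDerivAt_id u₀).sub_const u₀).const_mul 2).mul
          ((hB.differentiable (by simp) u₀).hasDerivAt)
      have f2 := (((hasDerivAt_id u₀).sub_const u₀).pow 2).mul
          ((hB'.differentiable (by simp) u₀).hasDerivAt)
      exact (f1.add f2).congr_deriv (by simp)
    rw [← funext e1] at e4
    exact (e3.unique e4).symm

/-- Near a nondegenerate fold, the zero set is `μ - μ₀ = (u - u₀)² k(u)`. -/
theorem exists_fold_param {g : ℝ × ℝ → ℝ} (hg : ContDiff ℝ ∞ g) {u₀ μ₀ : ℝ}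
    (h0 : g (u₀, μ₀) = 0) (h1 : partialU g (u₀, μ₀) = 0) (hm : partialM g (u₀, μ₀) ≠ 0) :
    ∃ k : ℝ → ℝ, (∀ᶠ u in 𝓝 u₀, ContDiffAt ℝ ∞ k u) ∧
      k u₀ = -partialU (partialU g) (u₀, μ₀) / (2 * partialM g (u₀, μ₀)) ∧
      ∀ᶠ p in 𝓝 (u₀, μ₀), g p = 0 ↔ p.2 - μ₀ = (p.1 - u₀) ^ 2 * k p.1 := by
  obtain ⟨A, B, hA, hB, hAB, hA0, hB0⟩ := exists_fold_form hg h0 h1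
  obtain ⟨c, hc0, hc, hiff⟩ := exists_implicit (E := g) (q₀ := u₀) (p₀ := μ₀)
    (Eventually.of_forall fun z => hg.contDiffAt) h0 (by
      intro v hv
      rw [fderiv_pair] at hv
      simpa [hm] using hv)
  have hAne : ∀ᶠ p in 𝓝 (u₀, μ₀), A p ≠ 0 :=
    hA.continuous.continuousAt.eventually_ne (by rwa [hA0])
  have htend : Tendsto (fun u => (u, c u)) (𝓝 u₀) (𝓝 (u₀, μ₀)) := by
    have := (continuousAt_id (x := u₀)).prodMk hc.self_of_nhds.continuousAt
    rw [ContinuousAt] at this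
    simpa [hc0] using this
  have hck : ∀ᶠ u in 𝓝 u₀, c u - μ₀ = (u - u₀) ^ 2 * (-B u / A (u, c u)) := by
    filter_upwards [htend.eventually hAne, htend.eventually hiff] with u h2 h3
    have h4 : g (u, c u) = 0 := h3.2 rfl
    rw [hAB] at h4
    field_simp
    linear_combination h4
  refine ⟨fun u => -B u / A (u, c u), ?_, ?_, ?_⟩
  · filter_upwards [hc, htend.eventually hAne] with u h2 h3
    exact hB.contDiffAt.neg.div (hA.contDiffAt.comp u (contDiffAt_id.prodMk h2)) h3
  · simp only [hc0, hA0, ← hB0]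
    field_simp
  · filter_upwards [hiff, continuousAt_fst.eventually hck] with p h2 h3
    rw [h2, ← h3]
    constructor <;> intro h <;> linarith

/-! ### A coordinate that straightens the curve of zeros. -/

/-- The values of the planar coordinate on the two branches of zeros. -/
noncomputable def coordPlus (μ : ℝ) : ℝ := √(1 + √(1 - μ))

noncomputable def coordMinus (μ : ℝ) : ℝ := √(1 - √(1 - μ))

/-- A smooth coordinate which maps the curve of positive zeros of `g` onto the arc
`μ = 1 - (1 - X²)²`, `0 ≤ X ≤ √2`. -/
structure IsCoordinate (um up : ℝ → ℝ) (φ : ℝ × ℝ → ℝ) : Prop where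
  smooth : ContDiff ℝ ∞ φ
  on_up : ∀ μ ∈ Icc (0 : ℝ) 1, φ (up μ, μ) = coordPlus μ
  on_um : ∀ μ ∈ Icc (0 : ℝ) 1, φ (um μ, μ) = coordMinus μ
  strip : ∃ ε > 0, ∀ u μ, |u| ≤ ε → φ (u, μ) = φ (u, 0)
  zero : φ (0, 0) = 0
  pos_zero : 0 < partialU φ (0, 0)
  pos_fold : 0 < partialU φ (1, 1)
  corner : ∀ᶠ p in 𝓝 (up 0, 0), φ p = coordPlus p.2

theorem contDiffAt_coordPlus {μ : ℝ} (h : μ < 1) : ContDiffAt ℝ ∞ coordPlus μ := by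
  have h1 : 0 < √(1 - μ) := Real.sqrt_pos.2 (by linarith)
  refine ContDiffAt.sqrt (contDiffAt_const.add (ContDiffAt.sqrt (by fun_prop) (by linarith))) ?_
  positivity

theorem contDiffAt_coordMinus {μ : ℝ} (h0 : 0 < μ) (h : μ < 1) : ContDiffAt ℝ ∞ coordMinus μ := by
  have h1 : √(1 - μ) < 1 := by rw [Real.sqrt_lt' one_pos]; linarith
  refine ContDiffAt.sqrt (contDiffAt_const.sub (ContDiffAt.sqrt (by fun_prop) (by linarith))) ?_
  linarith

namespace Profile

variable {g : ℝ × ℝ → ℝ} {um up : ℝ → ℝ}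

theorem g_zero (hg : Profile g um up) : g (0, 0) = 0 := by
  have := hg.zero_um 0 (by simp)
  rwa [hg.um_zero] at this

theorem partialU_zero (hg : Profile g um up) (μ : ℝ) : partialU g (0, μ) = 0 := by
  have h1 := hasDerivAt_fst hg.smooth 0 μ
  have h2 : HasDerivAt (fun u => g (u, μ)) (-partialU g (0, μ)) 0 := by
    have h3 : HasDerivAt (fun u => g (u, μ)) (partialU g (0, μ)) (-0) := by simpa using h1
    have := h3.scomp (0 : ℝ) (hasDerivAt_neg (0 : ℝ))
    rw [show (fun u => g (u, μ)) = (fun u => g (u, μ)) ∘ Neg.neg from funext fun u => by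
      simp [hg.even]]
    exact this.congr_deriv (by simp)
  linarith [h1.unique h2]

theorem up_pos (hg : Profile g um up) {μ : ℝ} (hμ : μ ∈ Icc (0 : ℝ) 1) : 0 < up μ := by
  rcases eq_or_lt_of_le hμ.2 with rfl | h
  · rw [hg.up_one]; exact one_pos
  · rcases eq_or_lt_of_le hμ.1 with rfl | h'
    · have := hg.lt 0 (by simp); rwa [hg.um_zero] at this
    · exact (hg.um_pos μ ⟨h', h.le⟩).trans (hg.lt μ ⟨h'.le, h⟩)

theorem um_nonneg (hg : Profile g um up) {μ : ℝ} (hμ : μ ∈ Icc (0 : ℝ) 1) : 0 ≤ um μ := by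
  rcases eq_or_lt_of_le hμ.1 with rfl | h
  · rw [hg.um_zero]
  · exact (hg.um_pos μ ⟨h, hμ.2⟩).le

theorem isCompact_up (hg : Profile g um up) :
    IsCompact {p : ℝ × ℝ | p.2 ∈ Icc (0 : ℝ) 1 ∧ p.1 = up p.2} := by
  have := (isCompact_Icc (a := (0:ℝ)) (b := 1)).image_of_continuousOn
    (hg.cont_up.prodMk continuousOn_id)
  convert this using 1
  ext ⟨u, μ⟩
  simp only [mem_ofPred_eq, mem_image, Prod.mk.injEq, id]
  constructor
  · rintro ⟨h, rfl⟩; exact ⟨μ, h, rfl, rfl⟩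
  · rintro ⟨ν, h, rfl, rfl⟩; exact ⟨h, rfl⟩

theorem isCompact_um (hg : Profile g um up) :
    IsCompact {p : ℝ × ℝ | p.2 ∈ Icc (0 : ℝ) 1 ∧ p.1 = um p.2} := by
  have := (isCompact_Icc (a := (0:ℝ)) (b := 1)).image_of_continuousOn
    (hg.cont_um.prodMk continuousOn_id)
  convert this using 1
  ext ⟨u, μ⟩
  simp only [mem_ofPred_eq, mem_image, Prod.mk.injEq, id]
  constructor
  · rintro ⟨h, rfl⟩; exact ⟨μ, h, rfl, rfl⟩
  · rintro ⟨ν, h, rfl, rfl⟩; exact ⟨h, rfl⟩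

theorem eventually_ne_um (hg : Profile g um up) {u μ : ℝ} (hu : u ≠ um μ) :
    ∀ᶠ p in 𝓝 (u, μ), p.2 ∈ Icc (0 : ℝ) 1 → p.1 ≠ um p.2 := by
  have := hg.isCompact_um.isClosed.isOpen_compl.mem_nhds (show (u, μ) ∈ _ from fun h' => hu h'.2)
  filter_upwards [this] with p hp h1 h2 using hp ⟨h1, h2⟩

theorem eventually_ne_up (hg : Profile g um up) {u μ : ℝ} (hu : u ≠ up μ) :
    ∀ᶠ p in 𝓝 (u, μ), p.2 ∈ Icc (0 : ℝ) 1 → p.1 ≠ up p.2 := by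
  have := hg.isCompact_up.isClosed.isOpen_compl.mem_nhds (show (u, μ) ∈ _ from fun h' => hu h'.2)
  filter_upwards [this] with p hp h1 h2 using hp ⟨h1, h2⟩

/-- The coordinate near the pitchfork, as a function of `u` only. -/
theorem exists_coord_zero (hg : Profile g um up) : ∃ φ₀ : ℝ → ℝ,
    (∀ᶠ u in 𝓝 0, ContDiffAt ℝ ∞ φ₀ u) ∧ φ₀ 0 = 0 ∧ 0 < deriv φ₀ 0 ∧
      ∀ᶠ p in 𝓝 ((0 : ℝ), (0 : ℝ)), p.2 ∈ Icc (0 : ℝ) 1 → p.1 = um p.2 →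
        φ₀ p.1 = coordMinus p.2 := by
  obtain ⟨k, hk, hk0, hiff⟩ := exists_fold_param hg.smooth hg.g_zero (hg.partialU_zero 0)
    hg.pitch_μ.ne
  have hk0' : 0 < k 0 := by
    rw [hk0]
    exact div_pos_of_neg_of_neg (by linarith [hg.pitch_uu]) (by linarith [hg.pitch_μ])
  have hkpos : ∀ᶠ u in 𝓝 0, 0 < k u := hk.self_of_nhds.continuousAt.eventually_const_lt hk0'
  have hklt : ∀ᶠ u in 𝓝 0, 0 < 1 - u ^ 2 * k u := by
    have : ContinuousAt (fun u => 1 - u ^ 2 * k u) 0 := by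
      have := hk.self_of_nhds.continuousAt
      fun_prop
    exact this.eventually_const_lt (by simp)
  have hsm : ∀ᶠ u in 𝓝 0, ContDiffAt ℝ ∞ (fun u => √(k u / (1 + √(1 - u ^ 2 * k u)))) u := by
    filter_upwards [hk, hkpos, hklt] with u h1 h2 h3
    have h4 : 0 < 1 + √(1 - u ^ 2 * k u) := by positivity
    refine ContDiffAt.sqrt (h1.div (contDiffAt_const.add (ContDiffAt.sqrt ?_ h3.ne')) h4.ne') ?_
    · exact contDiffAt_const.sub ((contDiffAt_id.pow 2).mul h1)
    · positivity
  -- With μ = u² k(u), the identity 1 - √(1 - μ) = μ / (1 + √(1 - μ)) pulls the factor u out of the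
  -- root, which makes the coordinate smooth at 0.
  refine ⟨fun u => u * √(k u / (1 + √(1 - u ^ 2 * k u))), ?_, by simp, ?_, ?_⟩
  · filter_upwards [hsm] with u h using contDiffAt_id.mul h
  · have := (hasDerivAt_id (0:ℝ)).mul ((hsm.self_of_nhds.differentiableAt (by simp)).hasDerivAt)
    have h2 : deriv (fun u => u * √(k u / (1 + √(1 - u ^ 2 * k u)))) 0 = _ := this.deriv
    rw [h2]
    simp only [id]
    have : (0:ℝ) < √(k 0 / (1 + √(1 - 0 ^ 2 * k 0))) := by
      apply Real.sqrt_pos.2; positivity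
    simpa using this
  · filter_upwards [hiff, continuousAt_fst.eventually hkpos, continuousAt_fst.eventually hklt]
      with p h1 h2 h3 h4 h5
    have h6 : p.2 = p.1 ^ 2 * k p.1 := by
      have := h1.1 (by have := hg.zero_um p.2 h4; rw [← h5] at this; simpa using this)
      simpa using this
    rw [← h6]
    have h7 : 0 ≤ p.1 := by rw [h5]; exact hg.um_nonneg h4
    have h8 : 0 ≤ √(1 - p.2) := Real.sqrt_nonneg _
    have h9 : √(1 - p.2) ^ 2 = 1 - p.2 := Real.sq_sqrt (by linarith [h4.2])
    have h10 : p.1 * √(k p.1 / (1 + √(1 - p.2))) = √(p.1 ^ 2 * (k p.1 / (1 + √(1 - p.2)))) := by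
      rw [Real.sqrt_mul (by positivity), Real.sqrt_sq h7]
    rw [h10, coordMinus]
    congr 1
    rw [← mul_div_assoc, ← h6]
    field_simp
    linarith

/-- The zeros near the fold are μ = 1 + (u - 1)² k(u). Along them g_u vanishes at u = 1 with
derivative g_uu(1, 1) < 0, so g_u has the sign of 1 - u; the stability signs of u₊ and u₋ then
decide on which side each branch lies. -/
theorem eventually_fold_sign (hg : Profile g um up) :
    ∀ᶠ p in 𝓝 ((1 : ℝ), (1 : ℝ)), p.2 ∈ Icc (0 : ℝ) 1 →
      (p.1 = up p.2 → 1 ≤ p.1) ∧ (p.1 = um p.2 → p.1 ≤ 1) := by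
  have h0 : g (1, 1) = 0 := by have := hg.zero_um 1 (by simp); rwa [hg.um_one] at this
  obtain ⟨k, hk, -, hiff⟩ := exists_fold_param hg.smooth h0 hg.fold_u hg.fold_μ.ne
  have hm : HasDerivAt (fun u => 1 + (u - 1) ^ 2 * k u) 0 1 := by
    have := ((((hasDerivAt_id (1:ℝ)).sub_const 1).pow 2).mul
      ((hk.self_of_nhds.differentiableAt (by simp)).hasDerivAt)).const_add 1
    exact this.congr_deriv (by simp)
  have hF := hasDerivAt_comp_pair (g := partialU g) (t := (1:ℝ)) (x := id)
    (m := fun u => 1 + (u - 1) ^ 2 * k u)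
    ((contDiff_partialU hg.smooth).differentiable (by simp) _) (hasDerivAt_id 1) hm
  simp only [id, sub_self, ne_eq, OfNat.ofNat_ne_zero, not_false_eq_true, zero_pow, zero_mul,
    add_zero, one_mul] at hF
  rw [hasDerivAt_iff_tendsto_slope] at hF
  have hs := (hF.eventually_lt_const hg.fold_uu)
  rw [eventually_nhdsWithin_iff] at hs
  filter_upwards [hiff, continuousAt_fst.eventually hs,
    continuousAt_snd.eventually (lt_mem_nhds (show (0:ℝ) < 1 by norm_num))] with p h1 h2 h2' h3
  have key : g p = 0 → p.1 ≠ 1 → partialU g p / (p.1 - 1) < 0 := by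
    intro h4 h5
    have h6 := h2 h5
    have h7 := h1.1 h4
    rw [slope_def_field] at h6
    simp only [sub_self, ne_eq, OfNat.ofNat_ne_zero, not_false_eq_true, zero_pow, zero_mul,
      add_zero, hg.fold_u, sub_zero, ← h7] at h6
    simpa using h6
  have hne : p.2 = 1 → (p.1 = up p.2 ∨ p.1 = um p.2) → p.1 = 1 := by
    rintro h4 (h5 | h5)
    · rw [h5, h4, hg.up_one]
    · rw [h5, h4, hg.um_one]
  constructor
  · intro h4
    by_contra h5
    push Not at h5
    have h6 : p.2 ≠ 1 := fun h => h5.ne (hne h (Or.inl h4))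
    have h7 := key (by have := hg.zero_up _ h3; rwa [← h4] at this) h5.ne
    have h8 := hg.stable p.2 ⟨h3.1, lt_of_le_of_ne h3.2 h6⟩
    rw [← h4] at h8
    exact absurd h7 (not_lt.2 (div_nonneg_of_nonpos h8.le (by linarith)))
  · intro h4
    by_contra h5
    push Not at h5
    have h6 : p.2 ≠ 1 := fun h => h5.ne' (hne h (Or.inr h4))
    have h7 := key (by have := hg.zero_um _ h3; rwa [← h4] at this) h5.ne'
    have h8 := hg.unstable p.2 ⟨h2', lt_of_le_of_ne h3.2 h6⟩
    rw [← h4] at h8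
    exact absurd h7 (not_lt.2 (div_nonneg h8.le (by linarith)))

/-- The coordinate near the fold, as a function of `u` only. -/
theorem exists_coord_fold (hg : Profile g um up) : ∃ φ₁ : ℝ → ℝ,
    (∀ᶠ u in 𝓝 1, ContDiffAt ℝ ∞ φ₁ u) ∧ 0 < deriv φ₁ 1 ∧
      ∀ᶠ p in 𝓝 ((1 : ℝ), (1 : ℝ)), p.2 ∈ Icc (0 : ℝ) 1 →
        (p.1 = up p.2 → φ₁ p.1 = coordPlus p.2) ∧ (p.1 = um p.2 → φ₁ p.1 = coordMinus p.2) := by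
  have h0 : g (1, 1) = 0 := by have := hg.zero_um 1 (by simp); rwa [hg.um_one] at this
  obtain ⟨k, hk, hk1, hiff⟩ := exists_fold_param hg.smooth h0 hg.fold_u hg.fold_μ.ne
  have hk1' : 0 < -k 1 := by
    rw [hk1, ← neg_div, neg_neg]
    exact div_pos_of_neg_of_neg hg.fold_uu (by linarith [hg.fold_μ])
  have hkc : ContinuousAt (fun u => -k u) 1 := hk.self_of_nhds.continuousAt.neg
  have hkpos : ∀ᶠ u in 𝓝 1, 0 < -k u := hkc.eventually_const_lt hk1'
  have hz : ∀ᶠ u in 𝓝 1, ContDiffAt ℝ ∞ (fun u => 1 + (u - 1) * √(-k u)) u := by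
    filter_upwards [hk, hkpos] with u h1 h2
    exact contDiffAt_const.add ((contDiffAt_id.sub contDiffAt_const).mul (h1.neg.sqrt h2.ne'))
  have hzpos : ∀ᶠ u in 𝓝 1, 0 < 1 + (u - 1) * √(-k u) :=
    hz.self_of_nhds.continuousAt.eventually_const_lt (by simp)
  -- On the zero set 1 - μ = ((u - 1) √(-k))², so (u - 1) √(-k) is a smooth version of ±√(1 - μ),
  -- with the plus sign on the upper branch by `eventually_fold_sign`.
  refine ⟨fun u => √(1 + (u - 1) * √(-k u)), ?_, ?_, ?_⟩
  · filter_upwards [hz, hzpos] with u h1 h2 using h1.sqrt h2.ne'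
  · have h1 : HasDerivAt (fun u => √(-k u)) (deriv (fun u => √(-k u)) 1) 1 :=
      ((hk.self_of_nhds.neg.sqrt hk1'.ne').differentiableAt (by simp)).hasDerivAt
    have h2 : HasDerivAt (fun u => 1 + (u - 1) * √(-k u)) (√(-k 1)) 1 :=
      ((((hasDerivAt_id (1:ℝ)).sub_const 1).mul h1).const_add 1).congr_deriv (by simp)
    have h3 := h2.sqrt (by simp)
    rw [h3.deriv]
    have := Real.sqrt_pos.2 hk1'
    simp only [sub_self, zero_mul, add_zero, Real.sqrt_one]
    positivity
  · filter_upwards [hiff, hg.eventually_fold_sign, continuousAt_fst.eventually hkpos]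
      with p h1 h2 h3 h4
    have key : g p = 0 → 1 - p.2 = ((p.1 - 1) * √(-k p.1)) ^ 2 := by
      intro h5
      have h6 := h1.1 h5
      rw [mul_pow, Real.sq_sqrt h3.le]
      linarith
    have hs := Real.sqrt_nonneg (-k p.1)
    constructor
    · intro h5
      have h6 := key (by have := hg.zero_up _ h4; rwa [← h5] at this)
      have h7 : 0 ≤ p.1 - 1 := by linarith [(h2 h4).1 h5]
      rw [coordPlus, h6, Real.sqrt_sq (by positivity)]
    · intro h5
      have h6 := key (by have := hg.zero_um _ h4; rwa [← h5] at this)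
      have h7 : 0 ≤ 1 - p.1 := by linarith [(h2 h4).2 h5]
      rw [coordMinus, h6, ← neg_sq, Real.sqrt_sq (by nlinarith)]
      congr 1; ring

end Profile

theorem coordPlus_one : coordPlus 1 = 1 := by simp [coordPlus]

theorem coordMinus_one : coordMinus 1 = 1 := by simp [coordMinus]

theorem coordMinus_zero : coordMinus 0 = 0 := by simp [coordMinus]

namespace Profile

variable {g : ℝ × ℝ → ℝ} {um up : ℝ → ℝ}

/-- Values are prescribed on a closed set: the zero curve, a strip |u| ≤ ε and a ball about (u₊(0),
0). They extend smoothly near each of its points, by the coordinates at the pitchfork and at the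
fold, and by functions of μ alone elsewhere. Independence of μ in the strip and of u in the ball
simplifies the angular equation at the corners. -/
theorem exists_isCoordinate (hg : Profile g um up) : ∃ φ, IsCoordinate um up φ := by
  obtain ⟨φ₀, hs0, hz0, hd0, hm0⟩ := hg.exists_coord_zero
  obtain ⟨φ₁, hs1, hd1, hm1⟩ := hg.exists_coord_fold
  have h00 : (0:ℝ) ∈ Icc (0:ℝ) 1 := by simp
  have hup0 : 0 < up 0 := hg.up_pos h00
  -- a strip in which only the lower branch occurs
  obtain ⟨ε₀, hε₀, hstrip⟩ : ∃ ε > 0, ∀ p : ℝ × ℝ, p.2 ∈ Icc (0:ℝ) 1 → p.1 < ε →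
      (p.1 = um p.2 → φ₀ p.1 = coordMinus p.2) ∧ p.1 ≠ up p.2 := by
    obtain ⟨V, hV, hVo, hV0⟩ := mem_nhds_iff.1 hm0
    have hK1 : IsCompact ({p : ℝ × ℝ | p.2 ∈ Icc (0 : ℝ) 1 ∧ p.1 = um p.2} \ V) :=
      hg.isCompact_um.diff hVo
    obtain ⟨a, ha, ha'⟩ : ∃ a > 0, ∀ p ∈ {p : ℝ × ℝ | p.2 ∈ Icc (0 : ℝ) 1 ∧ p.1 = um p.2} \ V,
        a ≤ p.1 := by
      refine hK1.exists_forall_le' continuous_fst.continuousOn fun p hp => ?_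
      rw [hp.1.2]
      refine hg.um_pos _ ⟨lt_of_le_of_ne hp.1.1.1 fun h => hp.2 ?_, hp.1.1.2⟩
      have : p = (0, 0) := by
        ext
        · rw [hp.1.2, ← h, hg.um_zero]
        · exact h.symm
      rwa [this]
    obtain ⟨b, hb, hb'⟩ : ∃ b > 0, ∀ p ∈ {p : ℝ × ℝ | p.2 ∈ Icc (0 : ℝ) 1 ∧ p.1 = up p.2},
        b ≤ p.1 := by
      refine hg.isCompact_up.exists_forall_le' continuous_fst.continuousOn fun p hp => ?_
      rw [hp.2]
      exact hg.up_pos hp.1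
    refine ⟨min a b, lt_min ha hb, fun p hp hlt => ⟨fun h => ?_, fun h => ?_⟩⟩
    · have : p ∈ V := by
        by_contra h'
        exact absurd (ha' p ⟨⟨hp, h⟩, h'⟩) (not_le.2 (hlt.trans_le (min_le_left _ _)))
      exact hV this hp h
    · exact absurd (hb' p ⟨hp, h⟩) (not_le.2 (hlt.trans_le (min_le_right _ _)))
  obtain ⟨ε₁, hε₁, hsm0⟩ := Metric.eventually_nhds_iff.1 hs0
  have hcorner : ∀ᶠ p in 𝓝 (up 0, (0:ℝ)), p.2 < 1 ∧ (p.2 ∈ Icc (0:ℝ) 1 → p.1 ≠ um p.2) := by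
    refine ((continuousAt_snd (X := ℝ) (Y := ℝ)).eventually
      (gt_mem_nhds (show (0:ℝ) < 1 by norm_num))).and (hg.eventually_ne_um ?_)
    rw [hg.um_zero]; exact hup0.ne'
  obtain ⟨ε₂, hε₂, hcor⟩ := Metric.eventually_nhds_iff.1 hcorner
  -- The formulas must hold on neighbourhoods of the strip and of the ball, up to size 3 ε; the
  -- bound 6 ε < u₊(0) keeps these apart.
  obtain ⟨ε, hε, e0, e1, e2, e3⟩ : ∃ ε > 0, 3 * ε < ε₀ ∧ 3 * ε < ε₁ ∧ 3 * ε < ε₂ ∧ 6 * ε < up 0 := by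
    refine ⟨min (min ε₀ ε₁) (min ε₂ (up 0)) / 7, by positivity, ?_⟩
    have h1 := min_le_left (min ε₀ ε₁) (min ε₂ (up 0))
    have h2 := min_le_right (min ε₀ ε₁) (min ε₂ (up 0))
    have h3 := min_le_left ε₀ ε₁
    have h4 := min_le_right ε₀ ε₁
    have h5 := min_le_left ε₂ (up 0)
    have h6 := min_le_right ε₂ (up 0)
    have h7 : 0 < min (min ε₀ ε₁) (min ε₂ (up 0)) := by positivity
    refine ⟨?_, ?_, ?_, ?_⟩ <;> linarith
  set Zp : Set (ℝ × ℝ) := {p | p.2 ∈ Icc (0 : ℝ) 1 ∧ p.1 = up p.2} with hZp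
  set Zm : Set (ℝ × ℝ) := {p | p.2 ∈ Icc (0 : ℝ) 1 ∧ p.1 = um p.2} with hZm
  set S : Set (ℝ × ℝ) := {p | |p.1| ≤ ε} with hS
  set D : Set (ℝ × ℝ) := Metric.closedBall (up 0, 0) ε with hD
  have hSc : IsClosed S := isClosed_le (by fun_prop) continuous_const
  have hDc : IsClosed D := Metric.isClosed_closedBall
  have hDfst : ∀ p : ℝ × ℝ, dist p (up 0, 0) < 3 * ε → 3 * ε < p.1 := by
    intro p hp
    have := (abs_lt.1 ((le_max_left _ _).trans_lt hp)).1
    simp at this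
    linarith
  classical
  let v : ℝ × ℝ → ℝ := fun p =>
    if p ∈ S then φ₀ p.1 else if p ∈ D then coordPlus p.2 else
      if p.1 = up p.2 then coordPlus p.2 else coordMinus p.2
  have v_up : ∀ p ∈ Zp, v p = coordPlus p.2 := by
    intro p hp
    have h1 : p ∉ S := fun h => (hstrip p hp.1 (by
      have := (abs_le.1 (show |p.1| ≤ ε from h)).2; linarith)).2 hp.2
    simp only [v, h1, if_false, hp.2, if_true, ite_self]
  have v_um : ∀ p ∈ Zm, v p = coordMinus p.2 := by
    intro p hp
    by_cases h1 : p ∈ S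
    · simp only [v, h1, if_true]
      exact (hstrip p hp.1 (by have := (abs_le.1 (show |p.1| ≤ ε from h1)).2; linarith)).1 hp.2
    · have h2 : p ∉ D := fun h => (hcor (show dist p (up 0, 0) < ε₂ by
        have : dist p (up 0, 0) ≤ ε := h
        linarith)).2 hp.1 hp.2
      simp only [v, h1, h2, if_false]
      split_ifs with h3
      · rcases eq_or_lt_of_le hp.1.2 with h4 | h4
        · rw [h4, coordPlus_one, coordMinus_one]
        · have := hg.lt p.2 ⟨hp.1.1, h4⟩
          rw [← hp.2, ← h3] at this
          exact absurd this (lt_irrefl _)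
      · rfl
  have hlt : ∀ p : ℝ × ℝ, p ∉ S → p ∉ D → p ∈ S ∪ D ∪ (Zp ∪ Zm) → p ∈ Zp ∨ p ∈ Zm := by
    rintro p h1 h2 ((h | h) | h)
    · exact absurd h h1
    · exact absurd h h2
    · exact h
  obtain ⟨φ, hφ, hφv⟩ := exists_contDiff_extension
    (K := S ∪ D ∪ (Zp ∪ Zm)) ((hSc.union hDc).union
      (hg.isCompact_up.isClosed.union hg.isCompact_um.isClosed)) v (by
    intro x hx
    by_cases hxS : |x.1| < 2 * ε
    · refine ⟨fun p => φ₀ p.1, ?_⟩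
      have hc : ContinuousAt (fun p : ℝ × ℝ => |p.1|) x := by fun_prop
      filter_upwards [hc.eventually_lt_const (show |x.1| < 3 * ε by linarith)] with p hp
      have hp1 := (abs_lt.1 hp).2
      refine ⟨(hsm0 (by simpa using hp.trans e1)).comp p contDiffAt_fst, fun hpK => ?_⟩
      by_cases h1 : p ∈ S
      · simp only [v, h1, if_true]
      · have h2 : p ∉ D := fun h => by
          have : dist p (up 0, 0) ≤ ε := h
          have := hDfst p (by linarith)
          linarith
        rcases hlt p h1 h2 hpK with h | h
        · exact absurd h.2 (hstrip p h.1 (by linarith)).2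
        · rw [v_um p h]
          exact (hstrip p h.1 (by linarith)).1 h.2
    · have hxS' : x ∉ S := fun h => hxS (by have : |x.1| ≤ ε := h; linarith)
      by_cases hxD : dist x (up 0, 0) < 2 * ε
      · refine ⟨fun p => coordPlus p.2, ?_⟩
        have hc : ContinuousAt (fun p : ℝ × ℝ => dist p (up 0, 0)) x := by fun_prop
        filter_upwards [hc.eventually_lt_const (show _ < 3 * ε by linarith)] with p hp
        have h0 := hcor (hp.trans e2)
        refine ⟨(contDiffAt_coordPlus h0.1).comp p contDiffAt_snd, fun hpK => ?_⟩
        have h1 : p ∉ S := fun h => by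
          have h2 := (abs_le.1 (show |p.1| ≤ ε from h)).2
          have := hDfst p hp
          linarith
        by_cases h2 : p ∈ D
        · simp only [v, h1, h2, if_true, if_false]
        · rcases hlt p h1 h2 hpK with h | h
          · rw [v_up p h]
          · exact absurd h.2 (h0.2 h.1)
      · have hxD' : x ∉ D := fun h => hxD (by
          have : dist x (up 0, 0) ≤ ε := h
          linarith)
        have hev1 : ∀ᶠ p in 𝓝 x, p ∉ S := hSc.isOpen_compl.mem_nhds hxS'
        have hev2 : ∀ᶠ p in 𝓝 x, p ∉ D := hDc.isOpen_compl.mem_nhds hxD'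
        have hxZ := hlt x hxS' hxD' hx
        have hxI : x.2 ∈ Icc (0:ℝ) 1 := by rcases hxZ with h | h <;> exact h.1
        rcases eq_or_lt_of_le hxI.2 with hx1 | hx1
        · have hx' : x = (1, 1) := by
            rcases hxZ with h | h
            · ext
              · rw [h.2, hx1, hg.up_one]
              · exact hx1
            · ext
              · rw [h.2, hx1, hg.um_one]
              · exact hx1
          refine ⟨fun p => φ₁ p.1, ?_⟩
          rw [hx'] at hev1 hev2 ⊢
          filter_upwards [hev1, hev2, hm1, continuousAt_fst.eventually hs1] with p h1 h2 h3 h4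
          refine ⟨ContDiffAt.comp p h4 contDiffAt_fst, fun hpK => ?_⟩
          rcases hlt p h1 h2 hpK with h | h
          · rw [v_up p h]; exact (h3 h.1).1 h.2
          · rw [v_um p h]; exact (h3 h.1).2 h.2
        · rcases hxZ with hxZ | hxZ
          · refine ⟨fun p => coordPlus p.2, ?_⟩
            have hne : x.1 ≠ um x.2 := by
              rw [hxZ.2]; exact (hg.lt _ ⟨hxI.1, hx1⟩).ne'
            filter_upwards [hev1, hev2, hg.eventually_ne_um hne,
              continuousAt_snd.eventually_lt_const hx1] with p h1 h2 h3 h4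
            refine ⟨(contDiffAt_coordPlus h4).comp p contDiffAt_snd, fun hpK => ?_⟩
            rcases hlt p h1 h2 hpK with h | h
            · rw [v_up p h]
            · exact absurd h.2 (h3 h.1)
          · have hx0 : 0 < x.2 := by
              refine lt_of_le_of_ne hxI.1 fun h => hxS ?_
              rw [hxZ.2, ← h, hg.um_zero]; simpa using hε
            refine ⟨fun p => coordMinus p.2, ?_⟩
            have hne : x.1 ≠ up x.2 := by
              rw [hxZ.2]; exact (hg.lt _ ⟨hxI.1, hx1⟩).ne
            filter_upwards [hev1, hev2, hg.eventually_ne_up hne,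
              continuousAt_snd.eventually_lt_const hx1, continuousAt_snd.eventually_const_lt hx0]
              with p h1 h2 h3 h4 h5
            refine ⟨(contDiffAt_coordMinus h5 h4).comp p contDiffAt_snd, fun hpK => ?_⟩
            rcases hlt p h1 h2 hpK with h | h
            · exact absurd h.2 (h3 h.1)
            · rw [v_um p h])
  have hφS : ∀ u μ, |u| ≤ ε → φ (u, μ) = φ₀ u := by
    intro u μ hu
    have h1 : (u, μ) ∈ S := hu
    rw [hφv _ (Or.inl (Or.inl h1))]
    simp only [v, h1, if_true]
  have hφp : ∀ p ∈ Zp, φ p = coordPlus p.2 := fun p hp => by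
    rw [hφv p (Or.inr (Or.inl hp)), v_up p hp]
  have hφm : ∀ p ∈ Zm, φ p = coordMinus p.2 := fun p hp => by
    rw [hφv p (Or.inr (Or.inr hp)), v_um p hp]
  refine ⟨φ, hφ, fun μ hμ => hφp (up μ, μ) ⟨hμ, rfl⟩, fun μ hμ => hφm (um μ, μ) ⟨hμ, rfl⟩,
    ⟨ε, hε, fun u μ hu => by rw [hφS u μ hu, hφS u 0 hu]⟩, ?_, ?_, ?_, ?_⟩
  · rw [hφS 0 0 (by simpa using hε.le), hz0]
  · rw [← (hasDerivAt_fst hφ 0 0).deriv]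
    convert hd0 using 1
    apply Filter.EventuallyEq.deriv_eq
    filter_upwards [Metric.closedBall_mem_nhds (0:ℝ) hε] with u hu
    exact hφS u 0 (by simpa using hu)
  -- The zero curve is tangent to the u-direction at the fold, so φ_u(1, 1) is the derivative of φ
  -- along that curve, where φ agrees with the fold coordinate.
  · have h0 : g (1, 1) = 0 := by have := hg.zero_um 1 (by simp); rwa [hg.um_one] at this
    obtain ⟨k, hk, hk1, hiff⟩ := exists_fold_param hg.smooth h0 hg.fold_u hg.fold_μ.ne
    have hk1' : k 1 < 0 := by
      rw [hk1]
      exact div_neg_of_pos_of_neg (by linarith [hg.fold_uu]) (by linarith [hg.fold_μ])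
    have hkd := (hk.self_of_nhds.differentiableAt (by simp)).hasDerivAt
    have hm : HasDerivAt (fun u => 1 + (u - 1) ^ 2 * k u) 0 1 :=
      ((((hasDerivAt_id (1:ℝ)).sub_const 1).pow 2).mul hkd).const_add 1 |>.congr_deriv (by simp)
    have hF := hasDerivAt_comp_pair (g := φ) (t := (1:ℝ)) (x := id)
      (m := fun u => 1 + (u - 1) ^ 2 * k u) (hφ.differentiable (by simp) _) (hasDerivAt_id 1) hm
    simp only [id, sub_self, ne_eq, OfNat.ofNat_ne_zero, not_false_eq_true, zero_pow, zero_mul,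
      add_zero, one_mul] at hF
    rw [← hF.deriv]
    convert hd1 using 1
    apply Filter.EventuallyEq.deriv_eq
    have hpath : Tendsto (fun u => (u, 1 + (u - 1) ^ 2 * k u)) (𝓝 1) (𝓝 (1, 1)) := by
      have := (continuousAt_id (x := (1:ℝ))).prodMk hm.continuousAt
      rw [ContinuousAt] at this
      simpa using this
    filter_upwards [hpath.eventually hiff, hpath.eventually hm1,
      hk.self_of_nhds.continuousAt.eventually_lt_const hk1',
      lt_mem_nhds (show (0:ℝ) < 1 by norm_num),
      hm.continuousAt.eventually_const_lt (show (0:ℝ) < _ by simp)] with u h1 h2 h3 h4 h5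
    have h6 : 1 + (u - 1) ^ 2 * k u ∈ Icc (0:ℝ) 1 := ⟨h5.le, by nlinarith [sq_nonneg (u - 1)]⟩
    have h7 : g (u, 1 + (u - 1) ^ 2 * k u) = 0 := h1.2 (by simp)
    rcases hg.zeros _ h6 u h4 h7 with h8 | h8
    · exact (hφm (u, _) ⟨h6, h8⟩).trans ((h2 h6).2 h8).symm
    · exact (hφp (u, _) ⟨h6, h8⟩).trans ((h2 h6).1 h8).symm
  · filter_upwards [Metric.closedBall_mem_nhds (up 0, (0:ℝ)) hε] with p hp
    have h1 : p ∉ S := fun h => by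
      have h2 := (abs_le.1 (show |p.1| ≤ ε from h)).2
      have hp' : dist p (up 0, 0) ≤ ε := hp
      have := hDfst p (by linarith)
      linarith
    have h2 : p ∈ D := hp
    rw [hφv p (Or.inl (Or.inr h2))]
    simp only [v, h1, h2, if_true, if_false]

end Profile

/-! ### Rays in the plane and the boundary of the quarter disc. -/

/-- `w` lies on the ray from the origin with angle parameter `t`. -/
def OnRay (t : ℝ) (w : ℝ × ℝ) : Prop :=
  ∃ ρ > 0, w = (-(ρ * Real.cos (Real.pi * t)), ρ * Real.sin (Real.pi * t))

/-- Splits membership in a ray into an equation, which can be imposed in an implicit function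
theorem, and an open inequality, which persists by continuity. -/
theorem onRay_iff {t : ℝ} {w : ℝ × ℝ} : OnRay t w ↔
    w.1 * Real.sin (Real.pi * t) + w.2 * Real.cos (Real.pi * t) = 0 ∧
      0 < w.2 * Real.sin (Real.pi * t) - w.1 * Real.cos (Real.pi * t) := by
  have h := Real.sin_sq_add_cos_sq (Real.pi * t)
  constructor
  · rintro ⟨ρ, hρ, rfl⟩
    constructor
    · simp only; ring
    · simp only; nlinarith
  · rintro ⟨h1, h2⟩
    refine ⟨_, h2, ?_⟩
    ext
    · simp only
      linear_combination w.1 * (-h) + Real.sin (Real.pi * t) * h1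
    · simp only
      linear_combination w.2 * (-h) + Real.cos (Real.pi * t) * h1

theorem OnRay.add_two {t : ℝ} {w : ℝ × ℝ} : OnRay (t + 2) w ↔ OnRay t w := by
  have : Real.pi * (t + 2) = Real.pi * t + 2 * Real.pi := by ring
  simp only [OnRay, this, Real.cos_add_two_pi, Real.sin_add_two_pi]

theorem onRay_neg {t : ℝ} {w : ℝ × ℝ} : OnRay (-t) (w.1, -w.2) ↔ OnRay t w := by
  simp only [onRay_iff, mul_neg, Real.sin_neg, Real.cos_neg]
  constructor <;> rintro ⟨h1, h2⟩ <;> constructor <;> linarith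

theorem OnRay.eq_add {t t' : ℝ} {w : ℝ × ℝ} (h : OnRay t w) (h' : OnRay t' w) :
    ∃ n : ℤ, t' = t + 2 * n := by
  obtain ⟨ρ, hρ, rfl⟩ := h
  obtain ⟨ρ', hρ', h'⟩ := h'
  simp only [Prod.mk.injEq, neg_inj] at h'
  have h1 := Real.sin_sq_add_cos_sq (Real.pi * t)
  have h2 := Real.sin_sq_add_cos_sq (Real.pi * t')
  have h3 : ρ = ρ' := by
    have : ρ ^ 2 = ρ' ^ 2 := by
      calc ρ ^ 2 = (ρ * Real.cos (Real.pi * t)) ^ 2 + (ρ * Real.sin (Real.pi * t)) ^ 2 := by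
            linear_combination (-ρ ^ 2) * h1
        _ = ρ' ^ 2 := by rw [h'.1, h'.2]; linear_combination ρ' ^ 2 * h2
    nlinarith
  subst h3
  have hc := mul_left_cancel₀ hρ.ne' h'.1
  have hs := mul_left_cancel₀ hρ.ne' h'.2
  have : Real.cos (Real.pi * t' - Real.pi * t) = 1 := by
    rw [Real.cos_sub, hc, hs]; linarith
  obtain ⟨n, hn⟩ := (Real.cos_eq_one_iff _).1 this
  refine ⟨n, ?_⟩
  have hpi := Real.pi_pos
  have : Real.pi * (t' - t - 2 * n) = 0 := by linear_combination -hn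
  rcases mul_eq_zero.1 this with h | h <;> linarith

theorem exists_onRay {w : ℝ × ℝ} (hw : w ≠ 0) :
    ∃ t ∈ Ioc (-1 : ℝ) 1, OnRay t w ∧ (0 ≤ w.2 → 0 ≤ t) := by
  set z : ℂ := ⟨-w.1, w.2⟩ with hz
  have hz0 : z ≠ 0 := by
    intro h
    apply hw
    have h1 := congrArg Complex.re h
    have h2 := congrArg Complex.im h
    simp [hz] at h1 h2
    ext <;> simpa
  have hpi := Real.pi_pos
  have e : Real.pi * (z.arg / Real.pi) = z.arg := by field_simp
  refine ⟨z.arg / Real.pi, ⟨?_, ?_⟩, ⟨‖z‖, norm_pos_iff.2 hz0, ?_⟩, fun h => ?_⟩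
  · rw [lt_div_iff₀ hpi]; linarith [Complex.neg_pi_lt_arg z]
  · rw [div_le_iff₀ hpi]; linarith [Complex.arg_le_pi z]
  · rw [e, Complex.norm_mul_cos_arg, Complex.norm_mul_sin_arg]
    simp [hz]
  · exact div_nonneg (Complex.arg_nonneg_iff.2 h) hpi.le

/-- Let A > 0 and B be the components of W along and across the ray; the angle then changes by
arctan (B / A), which is continuous and vanishes at the base point. -/
theorem eventually_onRay {X : Type*} [TopologicalSpace X] {W : X → ℝ × ℝ} {p₀ : X} {t₀ : ℝ}
    (hW : ContinuousAt W p₀) (h : OnRay t₀ (W p₀)) {ε : ℝ} (hε : 0 < ε) :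
    ∀ᶠ p in 𝓝 p₀, ∃ t, |t - t₀| < ε ∧ OnRay t (W p) := by
  obtain ⟨hB, hA⟩ := onRay_iff.1 h
  set s := Real.sin (Real.pi * t₀)
  set c := Real.cos (Real.pi * t₀)
  have cA : ContinuousAt (fun p => (W p).2 * s - (W p).1 * c) p₀ := by fun_prop
  have cB : ContinuousAt (fun p => (W p).1 * s + (W p).2 * c) p₀ := by fun_prop
  have cD : ContinuousAt (fun p => |Real.arctan (((W p).1 * s + (W p).2 * c) /
      ((W p).2 * s - (W p).1 * c)) / Real.pi|) p₀ := by
    have := Real.continuous_arctan.continuousAt.comp (cB.div cA hA.ne')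
    exact (this.div_const _).abs
  filter_upwards [cA.eventually_const_lt hA, cD.eventually_lt_const (show _ < ε by simp only [hB]; simpa using hε)]
    with p h1 h2
  set A := (W p).2 * s - (W p).1 * c with hAdef
  set B := (W p).1 * s + (W p).2 * c with hBdef
  set α := Real.arctan (B / A) with hα
  have hc : 0 < Real.cos α := Real.cos_arctan_pos _
  have ht : Real.sin α = B / A * Real.cos α := by
    rw [← Real.tan_arctan (B / A), Real.tan_mul_cos hc.ne']
  have e : Real.pi * (t₀ + α / Real.pi) = Real.pi * t₀ + α := by
    have := Real.pi_pos.ne'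
    field_simp
  refine ⟨t₀ + α / Real.pi, by simpa using h2, onRay_iff.2 ?_⟩
  rw [e, Real.sin_add, Real.cos_add]
  have e1 : A * Real.sin α = B * Real.cos α := by rw [ht]; field_simp
  constructor
  · linear_combination -e1
  · have : 0 < A * Real.cos α + B * Real.sin α := by
      rw [ht, show A * Real.cos α + B * (B / A * Real.cos α) = (A + B ^ 2 / A) * Real.cos α by ring]
      positivity
    linarith

/-- The defining function of the boundary of the quarter disc of radius `√2`. -/
noncomputable def quarterDisc (X Y : ℝ) : ℝ := min (min X Y) (2 - X ^ 2 - Y ^ 2)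

/-- The centre (1/2, 1/2) is interior, while a displacement by 3 in one coordinate leaves the
quarter disc, so the boundary is met in between. -/
theorem exists_quarterDisc_eq_zero {v w : ℝ} (h : v ≠ 0 ∨ w ≠ 0) :
    ∃ ρ > 0, quarterDisc (1 / 2 + ρ * v) (1 / 2 + ρ * w) = 0 := by
  have hc : Continuous fun ρ : ℝ => quarterDisc (1 / 2 + ρ * v) (1 / 2 + ρ * w) := by
    unfold quarterDisc; fun_prop
  have h0 : 0 < quarterDisc (1 / 2 + 0 * v) (1 / 2 + 0 * w) := by
    simp only [quarterDisc, lt_min_iff]; norm_num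
  obtain ⟨ρ₁, h1, h2⟩ : ∃ ρ₁ > 0, quarterDisc (1 / 2 + ρ₁ * v) (1 / 2 + ρ₁ * w) ≤ 0 := by
    have key : ∀ v : ℝ, v ≠ 0 → ∀ x : ℝ, 1 / 2 + 3 / |v| * v ≤ 0 ∨
        2 - (1 / 2 + 3 / |v| * v) ^ 2 - x ^ 2 ≤ 0 := by
      intro v hv x
      rcases lt_or_gt_of_ne hv with h | h
      · left
        have : 3 / |v| * v = -3 := by rw [abs_of_neg h]; field_simp
        rw [this]; norm_num
      · right
        have : 3 / |v| * v = 3 := by rw [abs_of_pos h]; field_simp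
        rw [this]; nlinarith [sq_nonneg x]
    rcases h with h | h
    · refine ⟨3 / |v|, by positivity, ?_⟩
      rcases key v h (1 / 2 + 3 / |v| * w) with h' | h'
      · exact ((min_le_left _ _).trans (min_le_left _ _)).trans h'
      · exact (min_le_right _ _).trans h'
    · refine ⟨3 / |w|, by positivity, ?_⟩
      rcases key w h (1 / 2 + 3 / |w| * v) with h' | h'
      · exact ((min_le_left _ _).trans (min_le_right _ _)).trans h'
      · exact (min_le_right _ _).trans (by linarith)
  obtain ⟨ρ, hρ, hρ0⟩ := intermediate_value_Icc' h1.le hc.continuousOn ⟨h2, h0.le⟩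
  refine ⟨ρ, lt_of_le_of_ne hρ.1 ?_, hρ0⟩
  rintro rfl
  exact h0.ne' hρ0

/-- The three functions under the minimum are concave along a ray and positive at the centre, so
they are positive strictly before any point at which they are nonnegative. -/
theorem quarterDisc_unique {v w ρ ρ' : ℝ} (h1 : 0 < ρ)
    (e1 : quarterDisc (1 / 2 + ρ * v) (1 / 2 + ρ * w) = 0)
    (e2 : quarterDisc (1 / 2 + ρ' * v) (1 / 2 + ρ' * w) = 0) : ρ' ≤ ρ := by
  by_contra hlt
  push Not at hlt
  have hp : 0 < ρ' := h1.trans hlt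
  have a1 : 0 ≤ 1 / 2 + ρ' * v := by rw [← e2]; exact (min_le_left _ _).trans (min_le_left _ _)
  have a2 : 0 ≤ 1 / 2 + ρ' * w := by rw [← e2]; exact (min_le_left _ _).trans (min_le_right _ _)
  have a3 : 0 ≤ 2 - (1 / 2 + ρ' * v) ^ 2 - (1 / 2 + ρ' * w) ^ 2 := by
    rw [← e2]; exact min_le_right _ _
  have b1 : 0 < 1 / 2 + ρ * v := by
    have : 0 < ρ' * (1 / 2 + ρ * v) := by nlinarith
    exact pos_of_mul_pos_right this hp.le
  have b2 : 0 < 1 / 2 + ρ * w := by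
    have : 0 < ρ' * (1 / 2 + ρ * w) := by nlinarith
    exact pos_of_mul_pos_right this hp.le
  have b3 : 0 < 2 - (1 / 2 + ρ * v) ^ 2 - (1 / 2 + ρ * w) ^ 2 := by
    have : 0 < ρ' * (2 - (1 / 2 + ρ * v) ^ 2 - (1 / 2 + ρ * w) ^ 2) := by
      have h3 : 0 < ρ * (ρ' - ρ) * ρ' := mul_pos (mul_pos h1 (by linarith)) hp
      nlinarith [mul_nonneg h3.le (add_nonneg (sq_nonneg v) (sq_nonneg w)), mul_nonneg h1.le a3]
    exact pos_of_mul_pos_right this hp.le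
  have : 0 < quarterDisc (1 / 2 + ρ * v) (1 / 2 + ρ * w) := lt_min (lt_min b1 b2) b3
  exact this.ne' e1

theorem coordMinus_mem {μ : ℝ} (h : μ ∈ Icc (0 : ℝ) 1) :
    0 ≤ coordMinus μ ∧ coordMinus μ ≤ 1 ∧ (1 - coordMinus μ ^ 2) = √(1 - μ) := by
  have h1 : √(1 - μ) ≤ 1 := Real.sqrt_le_iff.2 ⟨zero_le_one, by linarith [h.1]⟩
  have h2 : coordMinus μ ^ 2 = 1 - √(1 - μ) := Real.sq_sqrt (by linarith)
  have h3 : 0 ≤ coordMinus μ := Real.sqrt_nonneg _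
  refine ⟨h3, ?_, by linarith⟩
  nlinarith [Real.sqrt_nonneg (1 - μ)]

theorem coordPlus_mem (μ : ℝ) :
    1 ≤ coordPlus μ ∧ (coordPlus μ ^ 2 - 1) = √(1 - μ) := by
  have h0 := Real.sqrt_nonneg (1 - μ)
  have h2 : coordPlus μ ^ 2 = 1 + √(1 - μ) := Real.sq_sqrt (by linarith)
  have h3 : 0 ≤ coordPlus μ := Real.sqrt_nonneg _
  refine ⟨by nlinarith, by linarith⟩

/-! ### The singular curve and its parametrization by angle. -/

/-- The two halves of the singular curve in the space of `(x, y, μ)`. -/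
def halfAB (um up : ℝ → ℝ) : Set (ℝ × ℝ × ℝ) :=
  {p | p.2.2 ∈ Icc (0 : ℝ) 1 ∧ ((p.1 = um p.2.2 ∧ p.2.1 = 0) ∨ (p.1 = up p.2.2 ∧ p.2.1 = 0) ∨
    (p.1 = up p.2.2 ∧ p.2.1 = um p.2.2))}

def swapXY (p : ℝ × ℝ × ℝ) : ℝ × ℝ × ℝ := (p.2.1, p.1, p.2.2)

def halfCD (um up : ℝ → ℝ) : Set (ℝ × ℝ × ℝ) := swapXY ⁻¹' halfAB um up

def singularCurve (um up : ℝ → ℝ) : Set (ℝ × ℝ × ℝ) := halfAB um up ∪ halfCD um up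

/-- The planar coordinates, centered inside the quarter disc and rotated. -/
def planar (φ : ℝ × ℝ → ℝ) (p : ℝ × ℝ × ℝ) : ℝ × ℝ :=
  (φ (p.1, p.2.2) + φ (p.2.1, p.2.2) - 1, φ (p.1, p.2.2) - φ (p.2.1, p.2.2))

theorem planar_swap (φ : ℝ × ℝ → ℝ) (p : ℝ × ℝ × ℝ) :
    planar φ (swapXY p) = ((planar φ p).1, -(planar φ p).2) := by
  simp only [planar, swapXY, Prod.mk.injEq]
  constructor <;> ring

theorem contDiff_planar {φ : ℝ × ℝ → ℝ} (h : ContDiff ℝ ∞ φ) : ContDiff ℝ ∞ (planar φ) := by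
  unfold planar
  have h1 : ContDiff ℝ ∞ fun p : ℝ × ℝ × ℝ => φ (p.1, p.2.2) := h.comp (by fun_prop)
  have h2 : ContDiff ℝ ∞ fun p : ℝ × ℝ × ℝ => φ (p.2.1, p.2.2) := h.comp (by fun_prop)
  exact ((h1.add h2).sub contDiff_const).prodMk (h1.sub h2)

noncomputable def arcLevel (X : ℝ) : ℝ := 1 - (1 - X ^ 2) ^ 2

open Classical in
/-- The zero of `g` with coordinate `X`. -/
noncomputable def zeroAt (um up : ℝ → ℝ) (X : ℝ) : ℝ :=
  if X ≤ 1 then um (arcLevel X) else up (arcLevel X)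

theorem arcLevel_coordMinus {μ : ℝ} (h : μ ∈ Icc (0 : ℝ) 1) : arcLevel (coordMinus μ) = μ := by
  rw [arcLevel, (coordMinus_mem h).2.2, Real.sq_sqrt (by linarith [h.2])]; ring

theorem arcLevel_coordPlus {μ : ℝ} (h : μ ∈ Icc (0 : ℝ) 1) : arcLevel (coordPlus μ) = μ := by
  rw [arcLevel, ← neg_sq, neg_sub, (coordPlus_mem μ).2, Real.sq_sqrt (by linarith [h.2])]; ring

/-- Cluster points of f in the compact set K satisfy the closed relation C, and uniqueness leaves
only one candidate. -/
theorem continuous_of_unique {T X : Type*} [TopologicalSpace T] [TopologicalSpace X]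
    {C : Set (T × X)} (hC : IsClosed C) {K : Set X} (hK : IsCompact K) {f : T → X}
    (hf : ∀ t, f t ∈ K) (hfC : ∀ t, (t, f t) ∈ C) (huniq : ∀ t, ∀ p ∈ K, (t, p) ∈ C → p = f t) :
    Continuous f := by
  rw [continuous_iff_continuousAt]
  intro t
  refine hK.tendsto_nhds_of_unique_mapClusterPt (Eventually.of_forall hf) fun y hy hcl => ?_
  refine huniq t y hy (hC.closure_eq ▸ ?_)
  rw [mem_closure_iff_nhds]
  intro U hU
  obtain ⟨V, hV, V', hV', hVU⟩ := mem_nhds_prod_iff.1 hU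
  obtain ⟨s, hs, hs'⟩ := ((mapClusterPt_iff_frequently.1 hcl V' hV').and_eventually hV).exists
  exact ⟨(s, f s), hVU ⟨hs', hs⟩, hfC s⟩

section

variable {g φ : ℝ × ℝ → ℝ} {um up : ℝ → ℝ}

theorem Profile.zeroAt_coordMinus {μ : ℝ} (h : μ ∈ Icc (0 : ℝ) 1) :
    zeroAt um up (coordMinus μ) = um μ := by
  rw [zeroAt, if_pos (coordMinus_mem h).2.1, arcLevel_coordMinus h]

theorem Profile.zeroAt_coordPlus (hg : Profile g um up) {μ : ℝ} (h : μ ∈ Icc (0 : ℝ) 1) :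
    zeroAt um up (coordPlus μ) = up μ := by
  rw [zeroAt, arcLevel_coordPlus h]
  split_ifs with h1
  · have h2 := coordPlus_mem μ
    have h3 : coordPlus μ = 1 := le_antisymm h1 h2.1
    have h4 : √(1 - μ) = 0 := by rw [← h2.2, h3]; norm_num
    have h5 : μ = 1 := by
      have := (Real.sqrt_eq_zero (by linarith [h.2])).1 h4
      linarith
    rw [h5, hg.um_one, hg.up_one]
  · rfl

theorem Profile.zeroAt_zero (hg : Profile g um up) : zeroAt um up 0 = 0 := by
  have := Profile.zeroAt_coordMinus (um := um) (up := up) (μ := 0) (by simp)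
  rwa [coordMinus_zero, hg.um_zero] at this

theorem IsCoordinate.axis (hφ : IsCoordinate um up φ) (μ : ℝ) : φ (0, μ) = 0 := by
  obtain ⟨ε, hε, h⟩ := hφ.strip
  rw [h 0 μ (by simpa using hε.le), hφ.zero]

theorem arcLevel_mem {X : ℝ} (h2 : X ^ 2 ≤ 2) : arcLevel X ∈ Icc (0 : ℝ) 1 := by
  unfold arcLevel
  constructor
  · nlinarith [sq_nonneg X]
  · nlinarith [sq_nonneg (1 - X ^ 2)]

theorem IsCoordinate.coord_zeroAt (hφ : IsCoordinate um up φ) {X : ℝ} (h0 : 0 ≤ X)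
    (h2 : X ^ 2 ≤ 2) : φ (zeroAt um up X, arcLevel X) = X := by
  have hm := arcLevel_mem h2
  rw [zeroAt]
  split_ifs with h1
  · rw [hφ.on_um _ hm, coordMinus, arcLevel, show 1 - (1 - (1 - X ^ 2) ^ 2) = (1 - X ^ 2) ^ 2 by ring,
      Real.sqrt_sq (by nlinarith), show 1 - (1 - X ^ 2) = X ^ 2 by ring, Real.sqrt_sq h0]
  · rw [hφ.on_up _ hm, coordPlus, arcLevel, show 1 - (1 - (1 - X ^ 2) ^ 2) = (X ^ 2 - 1) ^ 2 by ring,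
      Real.sqrt_sq (by nlinarith), show 1 + (X ^ 2 - 1) = X ^ 2 by ring, Real.sqrt_sq h0]

/-- The inverse of the planar coordinates on the singular curve. -/
noncomputable def liftPlane (um up : ℝ → ℝ) (X Y : ℝ) : ℝ × ℝ × ℝ :=
  (zeroAt um up X, zeroAt um up Y, max (arcLevel X) (arcLevel Y))

theorem arcLevel_zero : arcLevel 0 = 0 := by norm_num [arcLevel]

/-- The maximum in `liftPlane` recovers μ in every case: on an axis the other coordinate has level
0, and on the arc X² + Y² = 2 the two levels agree. -/
theorem Profile.halfAB_spec (hg : Profile g um up) (hφ : IsCoordinate um up φ) {p : ℝ × ℝ × ℝ}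
    (hp : p ∈ halfAB um up) : quarterDisc (φ (p.1, p.2.2)) (φ (p.2.1, p.2.2)) = 0 ∧
      φ (p.2.1, p.2.2) ≤ φ (p.1, p.2.2) ∧
      p = liftPlane um up (φ (p.1, p.2.2)) (φ (p.2.1, p.2.2)) := by
  obtain ⟨x, y, μ⟩ := p
  obtain ⟨hμ, h⟩ := hp
  simp only at hμ h ⊢
  obtain ⟨m1, m2, m3⟩ := coordMinus_mem hμ
  obtain ⟨q1, q2⟩ := coordPlus_mem μ
  have s0 := Real.sqrt_nonneg (1 - μ)
  have s1 : √(1 - μ) ≤ 1 := Real.sqrt_le_iff.2 ⟨zero_le_one, by linarith [hμ.1]⟩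
  rcases h with ⟨rfl, rfl⟩ | ⟨rfl, rfl⟩ | ⟨rfl, rfl⟩
  · rw [hφ.on_um _ hμ, hφ.axis, liftPlane, Profile.zeroAt_coordMinus hμ, hg.zeroAt_zero,
      arcLevel_coordMinus hμ, arcLevel_zero, max_eq_left hμ.1]
    refine ⟨?_, m1, rfl⟩
    rw [quarterDisc, min_eq_right m1, min_eq_left]
    nlinarith
  · rw [hφ.on_up _ hμ, hφ.axis, liftPlane, hg.zeroAt_coordPlus hμ, hg.zeroAt_zero,
      arcLevel_coordPlus hμ, arcLevel_zero, max_eq_left hμ.1]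
    refine ⟨?_, by linarith, rfl⟩
    rw [quarterDisc, min_eq_right (show (0:ℝ) ≤ coordPlus μ by linarith), min_eq_left]
    nlinarith
  · rw [hφ.on_up _ hμ, hφ.on_um _ hμ, liftPlane, hg.zeroAt_coordPlus hμ,
      Profile.zeroAt_coordMinus hμ, arcLevel_coordPlus hμ, arcLevel_coordMinus hμ, max_self]
    refine ⟨?_, by linarith, rfl⟩
    rw [quarterDisc, min_eq_right]
    · linarith
    · rw [le_min_iff]; constructor <;> linarith

theorem quarterDisc_comm (X Y : ℝ) : quarterDisc X Y = quarterDisc Y X := by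
  rw [quarterDisc, quarterDisc, min_comm X Y, show 2 - X ^ 2 - Y ^ 2 = 2 - Y ^ 2 - X ^ 2 by ring]

theorem Profile.singularCurve_spec (hg : Profile g um up) (hφ : IsCoordinate um up φ)
    {p : ℝ × ℝ × ℝ} (hp : p ∈ singularCurve um up) :
    quarterDisc (φ (p.1, p.2.2)) (φ (p.2.1, p.2.2)) = 0 ∧
      p = liftPlane um up (φ (p.1, p.2.2)) (φ (p.2.1, p.2.2)) := by
  rcases hp with h | h
  · exact ⟨(hg.halfAB_spec hφ h).1, (hg.halfAB_spec hφ h).2.2⟩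
  · obtain ⟨h1, -, h3⟩ := hg.halfAB_spec hφ h
    simp only [swapXY] at h1 h3
    refine ⟨by rw [quarterDisc_comm, h1], ?_⟩
    simp only [liftPlane, Prod.mk.injEq] at h3 ⊢
    obtain ⟨a, b, c⟩ := h3
    ext
    · exact b
    · exact a
    · rw [max_comm]; exact c

theorem Profile.planar_ne_zero (hg : Profile g um up) (hφ : IsCoordinate um up φ)
    {p : ℝ × ℝ × ℝ} (hp : p ∈ singularCurve um up) : planar φ p ≠ 0 := by
  intro h
  have h1 := (hg.singularCurve_spec hφ hp).1
  simp only [planar, Prod.mk_eq_zero] at h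
  have e1 : φ (p.1, p.2.2) = 1 / 2 := by linarith
  have e2 : φ (p.2.1, p.2.2) = 1 / 2 := by linarith
  rw [e1, e2] at h1
  norm_num [quarterDisc] at h1

/-- By reflection Y ≤ X. Then either Y = 0, which gives A₋ or A₊, or X² + Y² = 2; in the second case
1 - Y² = X² - 1, so both coordinates have the same level and the pattern is B. -/
theorem Profile.liftPlane_mem (hg : Profile g um up) (hφ : IsCoordinate um up φ) {X Y : ℝ}
    (h : quarterDisc X Y = 0) : liftPlane um up X Y ∈ singularCurve um up ∧
      planar φ (liftPlane um up X Y) = (X + Y - 1, X - Y) := by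
  wlog hXY : Y ≤ X generalizing X Y with H
  · rw [quarterDisc_comm] at h
    obtain ⟨h1, h2⟩ := H h (by linarith)
    have e : liftPlane um up Y X = swapXY (liftPlane um up X Y) := by
      simp only [liftPlane, swapXY, max_comm]
    rw [e] at h1 h2
    constructor
    · rcases h1 with h1 | h1
      · exact Or.inr h1
      · exact Or.inl h1
    · rw [planar_swap] at h2
      simp only [Prod.mk.injEq] at h2
      ext
      · rw [h2.1]; ring
      · simp only; linarith
  have hX0 : 0 ≤ X := by rw [← h]; exact (min_le_left _ _).trans (min_le_left _ _)
  have hY0 : 0 ≤ Y := by rw [← h]; exact (min_le_left _ _).trans (min_le_right _ _)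
  have hR : X ^ 2 + Y ^ 2 ≤ 2 := by
    have : 0 ≤ 2 - X ^ 2 - Y ^ 2 := by rw [← h]; exact min_le_right _ _
    linarith
  have hX2 : X ^ 2 ≤ 2 := by nlinarith
  have hY2 : Y ^ 2 ≤ 2 := by nlinarith
  rw [quarterDisc, min_eq_right hXY] at h
  rcases min_choice Y (2 - X ^ 2 - Y ^ 2) with h' | h'
  · have hY : Y = 0 := by rw [← h', h]
    subst hY
    have hm : max (arcLevel X) (arcLevel 0) = arcLevel X := by
      rw [arcLevel_zero]; exact max_eq_left (arcLevel_mem hX2).1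
    simp only [liftPlane, hm, planar, hφ.coord_zeroAt hX0 hX2, hg.zeroAt_zero, hφ.axis]
    refine ⟨Or.inl ⟨arcLevel_mem hX2, ?_⟩, trivial⟩
    simp only [zeroAt]
    split_ifs
    · exact Or.inl ⟨rfl, trivial⟩
    · exact Or.inr (Or.inl ⟨rfl, trivial⟩)
  · have hR' : X ^ 2 + Y ^ 2 = 2 := by
      have : 2 - X ^ 2 - Y ^ 2 = 0 := by rw [← h', h]
      linarith
    have hm : arcLevel Y = arcLevel X := by
      simp only [arcLevel]
      rw [show Y ^ 2 = 2 - X ^ 2 by linarith]; ring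
    have hY1 : Y ≤ 1 := by nlinarith
    have hX1 : 1 ≤ X := by nlinarith
    have hμ := arcLevel_mem hX2
    have hYc := hφ.coord_zeroAt hY0 hY2
    rw [hm] at hYc
    simp only [liftPlane, hm, max_self, planar, hφ.coord_zeroAt hX0 hX2, hYc]
    refine ⟨Or.inl ⟨hμ, Or.inr (Or.inr ⟨?_, ?_⟩)⟩, trivial⟩
    · simp only [zeroAt]
      split_ifs with h1
      · have : X = 1 := le_antisymm h1 hX1
        rw [this]
        norm_num [arcLevel, hg.um_one, hg.up_one]
      · rfl
    · simp only [zeroAt, if_pos hY1, hm]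

theorem Profile.isCompact_singularCurve (hg : Profile g um up) : IsCompact (singularCurve um up) := by
  have hAB : IsCompact (halfAB um up) := by
    have hI := isCompact_Icc (a := (0:ℝ)) (b := 1)
    have h1 := hI.image_of_continuousOn (hg.cont_um.prodMk
      ((continuousOn_const (c := (0:ℝ))).prodMk continuousOn_id))
    have h2 := hI.image_of_continuousOn (hg.cont_up.prodMk
      ((continuousOn_const (c := (0:ℝ))).prodMk continuousOn_id))
    have h3 := hI.image_of_continuousOn (hg.cont_up.prodMk (hg.cont_um.prodMk continuousOn_id))
    convert h1.union (h2.union h3) using 1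
    ext ⟨x, y, μ⟩
    simp only [halfAB, mem_ofPred_eq, mem_union, mem_image, Prod.mk.injEq, id]
    constructor
    · rintro ⟨h, ⟨rfl, rfl⟩ | ⟨rfl, rfl⟩ | ⟨rfl, rfl⟩⟩
      · exact Or.inl ⟨μ, h, rfl, rfl, rfl⟩
      · exact Or.inr (Or.inl ⟨μ, h, rfl, rfl, rfl⟩)
      · exact Or.inr (Or.inr ⟨μ, h, rfl, rfl, rfl⟩)
    · rintro (⟨ν, h, rfl, rfl, rfl⟩ | ⟨ν, h, rfl, rfl, rfl⟩ | ⟨ν, h, rfl, rfl, rfl⟩)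
      · exact ⟨h, Or.inl ⟨rfl, rfl⟩⟩
      · exact ⟨h, Or.inr (Or.inl ⟨rfl, rfl⟩)⟩
      · exact ⟨h, Or.inr (Or.inr ⟨rfl, rfl⟩)⟩
  have hs : Continuous swapXY := by unfold swapXY; fun_prop
  have : halfCD um up = swapXY '' halfAB um up := by
    ext p
    constructor
    · intro h; exact ⟨swapXY p, h, rfl⟩
    · rintro ⟨q, h, rfl⟩; exact h
  rw [singularCurve, this]
  exact hAB.union (hAB.image hs)

/-- The parametrization of the singular curve by the angle of its planar coordinates. -/
theorem Profile.exists_singular_param (hg : Profile g um up) (hφ : IsCoordinate um up φ) :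
    ∃ γ : ℝ → ℝ × ℝ × ℝ, Continuous γ ∧ (∀ t, γ t ∈ singularCurve um up) ∧
      (∀ t, OnRay t (planar φ (γ t))) ∧
      (∀ t, ∀ p ∈ singularCurve um up, OnRay t (planar φ p) → p = γ t) ∧
      (∀ t, γ (t + 2) = γ t) ∧ (∀ t, γ (-t) = swapXY (γ t)) ∧
      γ '' Icc 0 1 = halfAB um up ∧ γ '' Icc (-1) 0 = halfCD um up := by
  have hex : ∀ t, ∃ p ∈ singularCurve um up, OnRay t (planar φ p) := by
    intro t
    set s := Real.sin (Real.pi * t) with hs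
    set c := Real.cos (Real.pi * t) with hc
    have hsc : s ^ 2 + c ^ 2 = 1 := Real.sin_sq_add_cos_sq _
    -- This is the direction of the ray, pulled back through (X, Y) ↦ (X + Y - 1, X - Y).
    obtain ⟨ρ, hρ, h⟩ := exists_quarterDisc_eq_zero (v := (s - c) / 2) (w := (-s - c) / 2) (by
      by_contra h
      push Not at h
      have h1 : s = 0 := by linarith [h.1, h.2]
      have h2 : c = 0 := by linarith [h.1, h.2]
      rw [h1, h2] at hsc; norm_num at hsc)
    obtain ⟨h1, h2⟩ := hg.liftPlane_mem hφ h
    refine ⟨_, h1, ρ, hρ, ?_⟩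
    rw [h2]
    ext <;> simp only <;> ring
  have huniq : ∀ t, ∀ p ∈ singularCurve um up, ∀ p' ∈ singularCurve um up,
      OnRay t (planar φ p) → OnRay t (planar φ p') → p = p' := by
    rintro t p hp p' hp' ⟨ρ, hρ, h⟩ ⟨ρ', hρ', h'⟩
    obtain ⟨a1, a2⟩ := hg.singularCurve_spec hφ hp
    obtain ⟨b1, b2⟩ := hg.singularCurve_spec hφ hp'
    simp only [planar, Prod.mk.injEq] at h h'
    set s := Real.sin (Real.pi * t) with hs
    set c := Real.cos (Real.pi * t) with hc
    have e1 : φ (p.1, p.2.2) = 1 / 2 + ρ * ((s - c) / 2) := by linarith [h.1, h.2]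
    have e2 : φ (p.2.1, p.2.2) = 1 / 2 + ρ * ((-s - c) / 2) := by linarith [h.1, h.2]
    have e3 : φ (p'.1, p'.2.2) = 1 / 2 + ρ' * ((s - c) / 2) := by linarith [h'.1, h'.2]
    have e4 : φ (p'.2.1, p'.2.2) = 1 / 2 + ρ' * ((-s - c) / 2) := by linarith [h'.1, h'.2]
    rw [e1, e2] at a1 a2
    rw [e3, e4] at b1 b2
    have : ρ = ρ' := le_antisymm (quarterDisc_unique hρ' b1 a1) (quarterDisc_unique hρ a1 b1)
    rw [a2, b2, this]
  choose γ hγ hray using hex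
  have hu : ∀ t, ∀ p ∈ singularCurve um up, OnRay t (planar φ p) → p = γ t :=
    fun t p hp h => huniq t p hp _ (hγ t) h (hray t)
  have hcont : Continuous γ := by
    have hpl : Continuous fun q : ℝ × ℝ × ℝ × ℝ => planar φ q.2 :=
      (contDiff_planar hφ.smooth).continuous.comp continuous_snd
    have hs : Continuous fun q : ℝ × ℝ × ℝ × ℝ => Real.sin (Real.pi * q.1) := by fun_prop
    have hc : Continuous fun q : ℝ × ℝ × ℝ × ℝ => Real.cos (Real.pi * q.1) := by fun_prop
    refine continuous_of_unique (C := {q : ℝ × ℝ × ℝ × ℝ |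
        (planar φ q.2).1 * Real.sin (Real.pi * q.1) + (planar φ q.2).2 * Real.cos (Real.pi * q.1) = 0 ∧
        0 ≤ (planar φ q.2).2 * Real.sin (Real.pi * q.1) - (planar φ q.2).1 * Real.cos (Real.pi * q.1)})
      ?_ hg.isCompact_singularCurve hγ ?_ ?_
    · exact (isClosed_eq ((hpl.fst.mul hs).add (hpl.snd.mul hc)) continuous_const).inter
        (isClosed_le continuous_const ((hpl.snd.mul hs).sub (hpl.fst.mul hc)))
    · intro t
      have := onRay_iff.1 (hray t)
      exact ⟨this.1, this.2.le⟩
    · rintro t p hp ⟨h1, h2⟩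
      simp only at h1 h2
      refine hu t p hp (onRay_iff.2 ⟨h1, lt_of_le_of_ne h2 fun h3 => hg.planar_ne_zero hφ hp ?_⟩)
      have h := Real.sin_sq_add_cos_sq (Real.pi * t)
      ext
      · simp only [Prod.fst_zero]
        linear_combination Real.sin (Real.pi * t) * h1 + Real.cos (Real.pi * t) * h3
          - (planar φ p).1 * h
      · simp only [Prod.snd_zero]
        linear_combination Real.cos (Real.pi * t) * h1 - Real.sin (Real.pi * t) * h3
          - (planar φ p).2 * h
  have hswapmem : ∀ p ∈ singularCurve um up, swapXY p ∈ singularCurve um up := by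
    rintro p (h | h)
    · exact Or.inr h
    · exact Or.inl h
  have hneg : ∀ t, γ (-t) = swapXY (γ t) := fun t =>
    (hu (-t) _ (hswapmem _ (hγ t)) (by rw [planar_swap, onRay_neg]; exact hray t)).symm
  have hAB : γ '' Icc 0 1 = halfAB um up := by
    ext p
    constructor
    · rintro ⟨t, ht, rfl⟩
      rcases hγ t with h | h
      · exact h
      -- For 0 ≤ t ≤ 1 the sine is nonnegative, hence Y ≤ X. On the CD half this leaves only the two
      -- points shared with AB, namely (0, 0, 0) and (1, 1, 1).
      · obtain ⟨ρ, hρ, h1⟩ := hray t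
        have h2 : 0 ≤ (planar φ (γ t)).2 := by
          rw [h1]
          exact mul_nonneg hρ.le (Real.sin_nonneg_of_nonneg_of_le_pi
            (mul_nonneg Real.pi_pos.le ht.1) (by nlinarith [Real.pi_pos, ht.2]))
        simp only [planar] at h2
        generalize γ t = q at *
        obtain ⟨x, y, μ⟩ := q
        obtain ⟨hμ, h⟩ := h
        simp only [swapXY] at hμ h h2
        have q1 := coordPlus_mem μ
        have m1 := coordMinus_mem hμ
        rcases h with ⟨rfl, rfl⟩ | ⟨rfl, rfl⟩ | ⟨rfl, rfl⟩
        · rw [hφ.axis, hφ.on_um _ hμ] at h2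
          have h3 : coordMinus μ = 0 := by linarith [m1.1]
          have h4 : μ = 0 := by
            have := arcLevel_coordMinus hμ
            rw [h3, arcLevel_zero] at this; exact this.symm
          subst h4
          exact ⟨by simp, Or.inl ⟨by simp [hg.um_zero], by simp [hg.um_zero]⟩⟩
        · rw [hφ.axis, hφ.on_up _ hμ] at h2
          linarith
        · rw [hφ.on_up _ hμ, hφ.on_um _ hμ] at h2
          have h3 : coordMinus μ = 1 := by linarith [m1.2.1]
          have h4 : μ = 1 := by
            have := arcLevel_coordMinus hμ
            rw [h3] at this; rw [← this]; norm_num [arcLevel]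
          subst h4
          exact ⟨by simp, Or.inr (Or.inr ⟨by simp [hg.um_one, hg.up_one], by simp [hg.um_one, hg.up_one]⟩)⟩
    · intro h
      obtain ⟨t, ht, ht1, ht2⟩ := exists_onRay (hg.planar_ne_zero hφ (Or.inl h))
      have := (hg.halfAB_spec hφ h).2.1
      exact ⟨t, ⟨ht2 (by simp only [planar]; linarith), ht.2⟩, (hu t p (Or.inl h) ht1).symm⟩
  refine ⟨γ, hcont, hγ, hray, hu, fun t => ?_, hneg, hAB, ?_⟩
  · exact (hu (t + 2) _ (hγ t) (OnRay.add_two.2 (hray t))).symm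
  · ext p
    constructor
    · rintro ⟨t, ht, rfl⟩
      change swapXY (γ t) ∈ halfAB um up
      rw [← hneg, ← hAB]
      exact ⟨-t, ⟨by linarith [ht.2], by linarith [ht.1]⟩, rfl⟩
    · intro h
      have h' : swapXY p ∈ halfAB um up := h
      rw [← hAB] at h'
      obtain ⟨t, ht, h1⟩ := h'
      refine ⟨-t, ⟨by linarith [ht.2], by linarith [ht.1]⟩, ?_⟩
      rw [hneg, h1]
      rfl

end

/-! ### Uniformity over a period and gluing of local branches. -/

/-- Compactness of one period: a finite cover is served by its smallest radius, and periodicity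
carries this radius to all t. -/
theorem uniform_of_local {A : ℝ → ℝ → Prop} (anti : ∀ r r' t, r' ≤ r → A r t → A r' t)
    (per : ∀ r t, A r (t + 2) ↔ A r t) (loc : ∀ t₀, ∃ r > 0, ∀ t, |t - t₀| < r → A r t) :
    ∃ r > 0, ∀ t, A r t := by
  have key : ∃ r > 0, ∀ t ∈ Icc (0:ℝ) 2, A r t := by
    refine (isCompact_Icc (a := (0:ℝ)) (b := 2)).induction_on
      (p := fun s => ∃ r > 0, ∀ t ∈ s, A r t) ⟨1, one_pos, by simp⟩ ?_ ?_ ?_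
    · rintro s s' hs ⟨r, hr, h⟩
      exact ⟨r, hr, fun t ht => h t (hs ht)⟩
    · rintro s s' ⟨r, hr, h⟩ ⟨r', hr', h'⟩
      refine ⟨min r r', lt_min hr hr', ?_⟩
      rintro t (ht | ht)
      · exact anti _ _ _ (min_le_left _ _) (h t ht)
      · exact anti _ _ _ (min_le_right _ _) (h' t ht)
    · intro t₀ _
      obtain ⟨r, hr, h⟩ := loc t₀
      refine ⟨Metric.ball t₀ r, mem_nhdsWithin_of_mem_nhds (Metric.ball_mem_nhds _ hr), r, hr, ?_⟩
      intro t ht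
      exact h t (by rwa [Metric.mem_ball, Real.dist_eq] at ht)
  obtain ⟨r, hr, h⟩ := key
  refine ⟨r, hr, fun t => ?_⟩
  have hp : Function.Periodic (A r) 2 := fun t => propext (per r t)
  obtain ⟨y, hy, hty⟩ := hp.exists_mem_Ico₀ two_pos t
  rw [hty]
  exact h y ⟨hy.1, hy.2.le⟩

/-- The filter of points `(d, t)` with `d > 0` that tend to `(0, t₀)`. -/
def posFilter (t₀ : ℝ) : Filter (ℝ × ℝ) := 𝓝[{q | 0 < q.1}] (0, t₀)

theorem posFilter_le (t₀ : ℝ) : posFilter t₀ ≤ 𝓝 (0, t₀) := nhdsWithin_le_nhds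

theorem eventually_posFilter {P : ℝ × ℝ → Prop} {t₀ : ℝ} : (∀ᶠ q in posFilter t₀, P q) ↔
    ∃ r > 0, ∀ d ∈ Ioo 0 r, ∀ t, |t - t₀| < r → P (d, t) := by
  rw [posFilter, eventually_nhdsWithin_iff, Metric.eventually_nhds_iff]
  constructor
  · rintro ⟨r, hr, h⟩
    refine ⟨r, hr, fun d hd t ht => h ?_ hd.1⟩
    rw [Prod.dist_eq, max_lt_iff]
    simp only [Real.dist_eq, sub_zero]
    exact ⟨by rw [abs_of_pos hd.1]; exact hd.2, ht⟩
  · rintro ⟨r, hr, h⟩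
    refine ⟨r, hr, fun q hq hq0 => ?_⟩
    rw [Prod.dist_eq, max_lt_iff] at hq
    simp only [Real.dist_eq, sub_zero] at hq
    exact h q.1 ⟨hq0, (le_abs_self _).trans_lt hq.1⟩ q.2 hq.2

theorem eventually_pos_posFilter (t₀ : ℝ) : ∀ᶠ q in posFilter t₀, 0 < q.1 :=
  eventually_mem_nhdsWithin

theorem eventually_lt_posFilter (t₀ : ℝ) {r : ℝ} (hr : 0 < r) : ∀ᶠ q in posFilter t₀, q.1 < r :=
  posFilter_le t₀ (continuousAt_fst.eventually_lt_const (by simpa using hr))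

/-- The condition d > 0 is open, so at a point with d > 0 the one-sided filter is the full
neighbourhood filter. -/
theorem eventually_nhds_of_posFilter {P : ℝ × ℝ → Prop} {t₀ : ℝ} (h : ∀ᶠ q in posFilter t₀, P q) :
    ∀ᶠ q in posFilter t₀, ∀ᶠ q' in 𝓝 q, P q' := by
  have ho : IsOpen {q : ℝ × ℝ | 0 < q.1} := isOpen_lt continuous_const continuous_fst
  have := eventually_eventually_nhdsWithin.2 h
  filter_upwards [this, eventually_pos_posFilter t₀] with q h1 h2
  rwa [ho.nhdsWithin_eq h2] at h1

theorem tendsto_snd_posFilter (t₀ : ℝ) : Tendsto Prod.snd (posFilter t₀) (𝓝 t₀) :=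
  (continuous_snd.tendsto ((0 : ℝ), t₀)).mono_left (posFilter_le t₀)

theorem uniform_of_posFilter {P : ℝ × ℝ → Prop} (per : ∀ d t, P (d, t + 2) ↔ P (d, t))
    (loc : ∀ t₀, ∀ᶠ q in posFilter t₀, P q) : ∃ r > 0, ∀ d ∈ Ioo 0 r, ∀ t, P (d, t) := by
  obtain ⟨r, hr, h⟩ := uniform_of_local (A := fun r t => ∀ d ∈ Ioo 0 r, P (d, t))
    (fun r r' t hr h d hd => h d ⟨hd.1, hd.2.trans_le hr⟩)
    (fun r t => by simp only [per]) (fun t₀ => by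
      obtain ⟨r, hr, h⟩ := eventually_posFilter.1 (loc t₀)
      exact ⟨r, hr, fun t ht d hd => h d hd t ht⟩)
  exact ⟨r, hr, fun d hd t => h t d hd⟩

/-- For `d > 0` near `0` and `t` near `t₀`, the point `c (d, t)` is the unique point near `p₀` of
the solution set `Sol d` on the ray with angle parameter `t`. -/
structure IsLocalBranch (Sol : ℝ → Set (ℝ × ℝ × ℝ)) (W : ℝ × ℝ × ℝ → ℝ × ℝ) (t₀ : ℝ)
    (p₀ : ℝ × ℝ × ℝ) (c : ℝ × ℝ → ℝ × ℝ × ℝ) : Prop where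
  tendsto : Tendsto c (posFilter t₀) (𝓝 p₀)
  mem : ∀ᶠ q in posFilter t₀, c q ∈ Sol q.1 ∧ OnRay q.2 (W (c q))
  smooth : ∀ᶠ q in posFilter t₀, ContDiffAt ℝ ∞ c q
  unique : ∃ V ∈ 𝓝 p₀, ∀ᶠ q in posFilter t₀, ∀ p ∈ V, p ∈ Sol q.1 → OnRay q.2 (W p) → p = c q

/-- Local uniqueness and compactness give one radius δ within which a solution on a prescribed ray
is unique, for all t at once. Any choice of a solution in the δ-ball about `γ₀ t` on the ray t
therefore agrees with every local branch. Conversely, a solution near `γ₀ t` lies on a ray t' with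
t' close to t, and so it is the chosen one. -/
theorem exists_family {Sol : ℝ → Set (ℝ × ℝ × ℝ)} {W : ℝ × ℝ × ℝ → ℝ × ℝ} (hW : Continuous W)
    {γ₀ : ℝ → ℝ × ℝ × ℝ} (hγ : Continuous γ₀) (hray : ∀ t, OnRay t (W (γ₀ t)))
    (hper : ∀ t, γ₀ (t + 2) = γ₀ t) (hloc : ∀ t₀, ∃ c, IsLocalBranch Sol W t₀ (γ₀ t₀) c) :
    ∃ d₀ > 0, ∃ γ : ℝ → ℝ → ℝ × ℝ × ℝ, γ 0 = γ₀ ∧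
      (∀ d ∈ Ico 0 d₀, ∀ t, γ d (t + 2) = γ d t) ∧
      (∀ d ∈ Ico 0 d₀, ∀ t, OnRay t (W (γ d t))) ∧ (∀ d ∈ Ioo 0 d₀, ∀ t, γ d t ∈ Sol d) ∧
      (∀ t₀ c, IsLocalBranch Sol W t₀ (γ₀ t₀) c → ∀ᶠ q in posFilter t₀, γ q.1 q.2 = c q) ∧
      ∃ δ > 0, δ ≤ d₀ ∧ ∀ d ∈ Ioo 0 δ, ∀ t p, dist p (γ₀ t) < δ → p ∈ Sol d → ∃ t', p = γ d t' := by
  have hγt : ∀ t₀ : ℝ, ∀ η > 0, ∃ r > 0, ∀ t, |t - t₀| < r → dist (γ₀ t) (γ₀ t₀) < η := by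
    intro t₀ η hη
    exact Metric.continuousAt_iff.1 hγ.continuousAt η hη
  obtain ⟨δ, hδ, hU⟩ := uniform_of_local (A := fun r t => ∀ d ∈ Ioo 0 r, ∀ p p', dist p (γ₀ t) < r →
      dist p' (γ₀ t) < r → p ∈ Sol d → OnRay t (W p) → p' ∈ Sol d → OnRay t (W p') → p = p')
    (fun r r' t hr h d hd p p' h1 h2 => h d ⟨hd.1, hd.2.trans_le hr⟩ p p' (h1.trans_le hr)
      (h2.trans_le hr))
    (fun r t => by simp only [hper, OnRay.add_two]) (fun t₀ => by
      obtain ⟨c, hc⟩ := hloc t₀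
      obtain ⟨V, hV, hVc⟩ := hc.unique
      obtain ⟨η, hη, hηV⟩ := Metric.mem_nhds_iff.1 hV
      obtain ⟨r₁, hr₁, h1⟩ := eventually_posFilter.1 hVc
      obtain ⟨r₂, hr₂, h2⟩ := hγt t₀ (η / 2) (by positivity)
      refine ⟨min (η / 2) (min r₁ r₂), by positivity, fun t ht d hd p p' hp hp' a1 a2 a3 a4 => ?_⟩
      have hV' : ∀ p, dist p (γ₀ t) < min (η / 2) (min r₁ r₂) → p ∈ V := fun p hp => hηV (by
        have e1 := h2 t (ht.trans_le ((min_le_right _ _).trans (min_le_right _ _)))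
        have e2 := hp.trans_le (min_le_left _ _)
        have := dist_triangle p (γ₀ t) (γ₀ t₀)
        rw [Metric.mem_ball]; linarith)
      have e := h1 d ⟨hd.1, hd.2.trans_le ((min_le_right _ _).trans (min_le_left _ _))⟩ t
        (ht.trans_le ((min_le_right _ _).trans (min_le_left _ _)))
      rw [e p (hV' p hp) a1 a2, e p' (hV' p' hp') a3 a4])
  have hE' : ∀ t₀ c, IsLocalBranch Sol W t₀ (γ₀ t₀) c → ∀ᶠ q in posFilter t₀,
      dist (c q) (γ₀ q.2) < δ ∧ c q ∈ Sol q.1 ∧ OnRay q.2 (W (c q)) := by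
    intro t₀ c hc
    have h1 : Tendsto (fun q : ℝ × ℝ => dist (c q) (γ₀ q.2)) (posFilter t₀) (𝓝 0) := by
      have := hc.tendsto.dist ((hγ.tendsto t₀).comp (tendsto_snd_posFilter t₀))
      simpa using this
    filter_upwards [h1.eventually_lt_const hδ, hc.mem] with q h2 h3 using ⟨h2, h3.1, h3.2⟩
  obtain ⟨r, hr, hE⟩ := uniform_of_posFilter
    (P := fun q => ∃ p, dist p (γ₀ q.2) < δ ∧ p ∈ Sol q.1 ∧ OnRay q.2 (W p))
    (fun d t => by simp only [hper, OnRay.add_two]) (fun t₀ => by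
      obtain ⟨c, hc⟩ := hloc t₀
      filter_upwards [hE' t₀ c hc] with q hq using ⟨_, hq⟩)
  classical
  let γ : ℝ → ℝ → ℝ × ℝ × ℝ := fun d t =>
    if h : 0 < d ∧ ∃ p, dist p (γ₀ t) < δ ∧ p ∈ Sol d ∧ OnRay t (W p) then h.2.choose else γ₀ t
  have hγ0 : γ 0 = γ₀ := by
    funext t
    simp only [γ, lt_irrefl, false_and, dite_false]
  have hspec : ∀ d ∈ Ioo 0 r, ∀ t, dist (γ d t) (γ₀ t) < δ ∧ γ d t ∈ Sol d ∧ OnRay t (W (γ d t)) := by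
    intro d hd t
    have h : 0 < d ∧ ∃ p, dist p (γ₀ t) < δ ∧ p ∈ Sol d ∧ OnRay t (W p) := ⟨hd.1, hE d hd t⟩
    simp only [γ, dif_pos h]
    exact h.2.choose_spec
  have huniq : ∀ d ∈ Ioo 0 (min r δ), ∀ t p, dist p (γ₀ t) < δ → p ∈ Sol d → OnRay t (W p) →
      p = γ d t := by
    intro d hd t p h1 h2 h3
    obtain ⟨a1, a2, a3⟩ := hspec d ⟨hd.1, hd.2.trans_le (min_le_left _ _)⟩ t
    exact hU t d ⟨hd.1, hd.2.trans_le (min_le_right _ _)⟩ p _ h1 a1 h2 h3 a2 a3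
  have hd0 : 0 < min r δ := lt_min hr hδ
  refine ⟨min r δ, hd0, γ, hγ0, ?_, ?_, ?_, ?_, ?_⟩
  · intro d hd t
    rcases eq_or_lt_of_le hd.1 with rfl | h
    · rw [hγ0, hper]
    · obtain ⟨a1, a2, a3⟩ := hspec d ⟨h, hd.2.trans_le (min_le_left _ _)⟩ (t + 2)
      rw [hper] at a1
      exact huniq d ⟨h, hd.2⟩ t _ a1 a2 (OnRay.add_two.1 a3)
  · intro d hd t
    rcases eq_or_lt_of_le hd.1 with rfl | h
    · rw [hγ0]; exact hray t
    · exact (hspec d ⟨h, hd.2.trans_le (min_le_left _ _)⟩ t).2.2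
  · exact fun d hd t => (hspec d ⟨hd.1, hd.2.trans_le (min_le_left _ _)⟩ t).2.1
  · intro t₀ c hc
    filter_upwards [hE' t₀ c hc, eventually_pos_posFilter t₀, eventually_lt_posFilter t₀ hd0]
      with q h1 h2 h3
    exact (huniq q.1 ⟨h2, h3⟩ q.2 _ h1.1 h1.2.1 h1.2.2).symm
  · obtain ⟨δ', hδ', hS⟩ := uniform_of_local (A := fun r t => ∀ p, dist p (γ₀ t) < r →
        ∃ t', dist p (γ₀ t') < δ ∧ OnRay t' (W p))
      (fun r r' t hr h p hp => h p (hp.trans_le hr)) (fun r t => by simp only [hper])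
      (fun t₀ => by
        obtain ⟨r₂, hr₂, h2⟩ := hγt t₀ (δ / 2) (by positivity)
        have hA := eventually_onRay (p₀ := γ₀ t₀) hW.continuousAt (hray t₀) hr₂
        obtain ⟨η, hη, hA'⟩ := Metric.eventually_nhds_iff.1 hA
        obtain ⟨r₃, hr₃, h3⟩ := hγt t₀ (min (η / 2) (δ / 4)) (by positivity)
        refine ⟨min (min (η / 2) (δ / 4)) r₃, by positivity, fun t ht p hp => ?_⟩
        have e1 := h3 t (ht.trans_le (min_le_right _ _))
        have e2 := hp.trans_le (min_le_left _ _)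
        have e3 := dist_triangle p (γ₀ t) (γ₀ t₀)
        have e4 := min_le_left (η / 2) (δ / 4)
        have e5 := min_le_right (η / 2) (δ / 4)
        obtain ⟨t', ht', hr'⟩ := hA' (show dist p (γ₀ t₀) < η by linarith)
        refine ⟨t', ?_, hr'⟩
        have e6 := h2 t' ht'
        have e7 := dist_triangle p (γ₀ t₀) (γ₀ t')
        rw [dist_comm (γ₀ t₀)] at e7
        linarith)
    refine ⟨min δ' (min r δ), lt_min hδ' hd0, min_le_right _ _, fun d hd t p hp hpS => ?_⟩
    obtain ⟨t', h1, h2⟩ := hS t p (hp.trans_le (min_le_left _ _))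
    exact ⟨t', huniq d ⟨hd.1, hd.2.trans_le (min_le_right _ _)⟩ t' p h1 hpS h2⟩

/-! ### The desingularized equations and their derivatives. -/

/-- `K` is the smooth divided difference of `g` in its first variable. -/
structure IsDividedDifference (g : ℝ × ℝ → ℝ) (K : ℝ × ℝ × ℝ → ℝ) : Prop where
  smooth : ContDiff ℝ ∞ K
  sub_eq : ∀ x y μ, g (x, μ) - g (y, μ) = (x - y) * K (x, y, μ)
  diag : ∀ x μ, K (x, x, μ) = partialU g (x, μ)
  symm : ∀ x y μ, K (x, y, μ) = K (y, x, μ)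

theorem exists_isDividedDifference {g : ℝ × ℝ → ℝ} (hg : ContDiff ℝ ∞ g) :
    ∃ K, IsDividedDifference g K := by
  obtain ⟨K, h1, h2, h3, h4⟩ := exists_dividedDifference hg
  exact ⟨K, h1, h2, h3, h4⟩

/-- The combination of the two block equations in which the coupling cancels. -/
def balance (a b : ℝ) (g : ℝ × ℝ → ℝ) (p : ℝ × ℝ × ℝ) : ℝ :=
  b * (p.1 * g (p.1, p.2.2)) + a * (p.2.1 * g (p.2.1, p.2.2))

/-- The positive steady states with values `x` and `y`, after division by `x - y`. -/
def branchSet (a b : ℝ) (g : ℝ × ℝ → ℝ) (K : ℝ × ℝ × ℝ → ℝ) (d : ℝ) : Set (ℝ × ℝ × ℝ) :=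
  {p | (0 < p.1 ∧ 0 < p.2.1) ∧ balance a b g p = 0 ∧
    p.1 * p.2.1 * K p = d * (b * p.1 + a * p.2.1)}

noncomputable def rayDefect (φ : ℝ × ℝ → ℝ) (t : ℝ) (p : ℝ × ℝ × ℝ) : ℝ :=
  (planar φ p).1 * Real.sin (Real.pi * t) + (planar φ p).2 * Real.cos (Real.pi * t)

/-- Three equations for (x, y, μ) with parameters (d, t). It makes sense at d = 0, where Γ consists
of zeros, and it does not degenerate at x = y because the factor x - y is gone. -/
noncomputable def branchMap (a b : ℝ) (g : ℝ × ℝ → ℝ) (K : ℝ × ℝ × ℝ → ℝ) (φ : ℝ × ℝ → ℝ)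
    (z : (ℝ × ℝ) × (ℝ × ℝ × ℝ)) : ℝ × ℝ × ℝ :=
  (balance a b g z.2, z.2.1 * z.2.2.1 * K z.2 - z.1.1 * (b * z.2.1 + a * z.2.2.1),
    rayDefect φ z.1.2 z.2)

section calculus

variable {g φ : ℝ × ℝ → ℝ} {K : ℝ × ℝ × ℝ → ℝ} {a b : ℝ}

theorem contDiff_balance (hg : ContDiff ℝ ∞ g) : ContDiff ℝ ∞ (balance a b g) := by
  have h1 : ContDiff ℝ ∞ fun p : ℝ × ℝ × ℝ => g (p.1, p.2.2) := hg.comp (by fun_prop)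
  have h2 : ContDiff ℝ ∞ fun p : ℝ × ℝ × ℝ => g (p.2.1, p.2.2) := hg.comp (by fun_prop)
  unfold balance
  fun_prop

theorem contDiff_branchMap (hg : ContDiff ℝ ∞ g) (hK : ContDiff ℝ ∞ K) (hφ : ContDiff ℝ ∞ φ) :
    ContDiff ℝ ∞ (branchMap a b g K φ) := by
  have h1 : ContDiff ℝ ∞ fun z : (ℝ × ℝ) × (ℝ × ℝ × ℝ) => balance a b g z.2 :=
    (contDiff_balance hg).comp contDiff_snd
  have h2 : ContDiff ℝ ∞ fun z : (ℝ × ℝ) × (ℝ × ℝ × ℝ) => K z.2 := hK.comp contDiff_snd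
  have h3 : ContDiff ℝ ∞ fun z : (ℝ × ℝ) × (ℝ × ℝ × ℝ) => planar φ z.2 :=
    (contDiff_planar hφ).comp contDiff_snd
  have h4 := h3.fst
  have h5 := h3.snd
  have h6 : ContDiff ℝ ∞ fun z : (ℝ × ℝ) × (ℝ × ℝ × ℝ) => Real.sin (Real.pi * z.1.2) :=
    Real.contDiff_sin.comp (by fun_prop)
  have h7 : ContDiff ℝ ∞ fun z : (ℝ × ℝ) × (ℝ × ℝ × ℝ) => Real.cos (Real.pi * z.1.2) :=
    Real.contDiff_cos.comp (by fun_prop)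
  unfold branchMap rayDefect
  exact h1.prodMk ((by fun_prop : ContDiff ℝ ∞ fun z : (ℝ × ℝ) × (ℝ × ℝ × ℝ) =>
    z.2.1 * z.2.2.1 * K z.2 - z.1.1 * (b * z.2.1 + a * z.2.2.1)).prodMk
      ((h4.mul h6).add (h5.mul h7)))

theorem branchMap_eq_zero {z : (ℝ × ℝ) × (ℝ × ℝ × ℝ)} : branchMap a b g K φ z = 0 ↔
    balance a b g z.2 = 0 ∧ z.2.1 * z.2.2.1 * K z.2 = z.1.1 * (b * z.2.1 + a * z.2.2.1) ∧
      rayDefect φ z.1.2 z.2 = 0 := by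
  simp only [branchMap, Prod.mk_eq_zero, sub_eq_zero]

theorem fderiv_eq_of_line {E F : Type*} [NormedAddCommGroup E] [NormedSpace ℝ E]
    [NormedAddCommGroup F] [NormedSpace ℝ F] {f : E → F} {p v : E} {D : F}
    (hf : DifferentiableAt ℝ f p) (h : HasDerivAt (fun s : ℝ => f (p + s • v)) D 0) :
    fderiv ℝ f p v = D := by
  have h1 : HasDerivAt (fun s : ℝ => p + s • v) v 0 := by
    have := ((hasDerivAt_id (0:ℝ)).smul_const v).const_add p
    exact this.congr_deriv (by simp)
  have hf' : HasFDerivAt f (fderiv ℝ f p) (p + (0:ℝ) • v) := by simpa using hf.hasFDerivAt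
  exact (hf'.comp_hasDerivAt 0 h1).unique h

theorem line_coords (p v : ℝ × ℝ × ℝ) :
    HasDerivAt (fun s : ℝ => (p + s • v).1) v.1 0 ∧ HasDerivAt (fun s : ℝ => (p + s • v).2.1) v.2.1 0 ∧
      HasDerivAt (fun s : ℝ => (p + s • v).2.2) v.2.2 0 := by
  have h : ∀ x w : ℝ, HasDerivAt (fun s : ℝ => x + s * w) w 0 := fun x w =>
    (((hasDerivAt_id (0:ℝ)).mul_const w).const_add x).congr_deriv (by simp)
  exact ⟨h _ _, h _ _, h _ _⟩

theorem line_comp (hg : ContDiff ℝ ∞ g) (p v : ℝ × ℝ × ℝ) :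
    HasDerivAt (fun s : ℝ => g ((p + s • v).1, (p + s • v).2.2))
      (v.1 * partialU g (p.1, p.2.2) + v.2.2 * partialM g (p.1, p.2.2)) 0 ∧
    HasDerivAt (fun s : ℝ => g ((p + s • v).2.1, (p + s • v).2.2))
      (v.2.1 * partialU g (p.2.1, p.2.2) + v.2.2 * partialM g (p.2.1, p.2.2)) 0 := by
  obtain ⟨h1, h2, h3⟩ := line_coords p v
  constructor
  · have := hasDerivAt_comp_pair (g := g) (hg.differentiable (by simp) _) h1 h3
    exact this.congr_deriv (by simp)
  · have := hasDerivAt_comp_pair (g := g) (hg.differentiable (by simp) _) h2 h3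
    exact this.congr_deriv (by simp)

theorem line_balance (hg : ContDiff ℝ ∞ g) (p v : ℝ × ℝ × ℝ) :
    HasDerivAt (fun s : ℝ => balance a b g (p + s • v))
      (b * (v.1 * g (p.1, p.2.2) + p.1 * (v.1 * partialU g (p.1, p.2.2) +
        v.2.2 * partialM g (p.1, p.2.2))) + a * (v.2.1 * g (p.2.1, p.2.2) + p.2.1 * (v.2.1 *
        partialU g (p.2.1, p.2.2) + v.2.2 * partialM g (p.2.1, p.2.2)))) 0 := by
  obtain ⟨h1, h2, h3⟩ := line_coords p v
  obtain ⟨k1, k2⟩ := line_comp hg p v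
  have := ((h1.mul k1).const_mul b).add ((h2.mul k2).const_mul a)
  exact this.congr_deriv (by simp)

theorem fderiv_balance (hg : ContDiff ℝ ∞ g) (p v : ℝ × ℝ × ℝ) :
    fderiv ℝ (balance a b g) p v =
      b * (v.1 * g (p.1, p.2.2) + p.1 * (v.1 * partialU g (p.1, p.2.2) +
        v.2.2 * partialM g (p.1, p.2.2))) + a * (v.2.1 * g (p.2.1, p.2.2) + p.2.1 * (v.2.1 *
        partialU g (p.2.1, p.2.2) + v.2.2 * partialM g (p.2.1, p.2.2))) :=
  fderiv_eq_of_line ((contDiff_balance hg).differentiable (by simp) _) (line_balance hg p v)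

theorem line_of_contDiff {h : ℝ × ℝ × ℝ → ℝ} (hh : ContDiff ℝ ∞ h) (p v : ℝ × ℝ × ℝ) :
    HasDerivAt (fun s : ℝ => h (p + s • v)) (fderiv ℝ h p v) 0 := by
  have h1 : HasDerivAt (fun s : ℝ => p + s • v) v 0 :=
    (((hasDerivAt_id (0:ℝ)).smul_const v).const_add p).congr_deriv (by simp)
  have := (hh.differentiable (by simp) (p + (0:ℝ) • v)).hasFDerivAt.comp_hasDerivAt 0 h1
  exact this.congr_deriv (by simp)

theorem line_product (hK : ContDiff ℝ ∞ K) (p v : ℝ × ℝ × ℝ) :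
    HasDerivAt (fun s : ℝ => (p + s • v).1 * (p + s • v).2.1 * K (p + s • v))
      ((v.1 * p.2.1 + p.1 * v.2.1) * K p + p.1 * p.2.1 * fderiv ℝ K p v) 0 := by
  obtain ⟨h1, h2, h3⟩ := line_coords p v
  exact ((h1.mul h2).mul (line_of_contDiff hK p v)).congr_deriv (by simp)

theorem line_rayDefect (hφ : ContDiff ℝ ∞ φ) (t : ℝ) (p v : ℝ × ℝ × ℝ) :
    HasDerivAt (fun s : ℝ => rayDefect φ t (p + s • v))
      ((v.1 * partialU φ (p.1, p.2.2) + v.2.2 * partialM φ (p.1, p.2.2)) *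
        (Real.sin (Real.pi * t) + Real.cos (Real.pi * t)) +
      (v.2.1 * partialU φ (p.2.1, p.2.2) + v.2.2 * partialM φ (p.2.1, p.2.2)) *
        (Real.sin (Real.pi * t) - Real.cos (Real.pi * t))) 0 := by
  obtain ⟨k1, k2⟩ := line_comp hφ p v
  have := (((k1.add k2).sub_const 1).mul_const (Real.sin (Real.pi * t))).add
    ((k1.sub k2).mul_const (Real.cos (Real.pi * t)))
  exact this.congr_deriv (by ring)

theorem fderiv_branchMap_right (hg : ContDiff ℝ ∞ g) (hK : ContDiff ℝ ∞ K) (hφ : ContDiff ℝ ∞ φ)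
    (t : ℝ) (p v : ℝ × ℝ × ℝ) : fderiv ℝ (branchMap a b g K φ) ((0, t), p) (0, v) =
      (fderiv ℝ (balance a b g) p v,
        (v.1 * p.2.1 + p.1 * v.2.1) * K p + p.1 * p.2.1 * fderiv ℝ K p v,
        (v.1 * partialU φ (p.1, p.2.2) + v.2.2 * partialM φ (p.1, p.2.2)) *
        (Real.sin (Real.pi * t) + Real.cos (Real.pi * t)) +
      (v.2.1 * partialU φ (p.2.1, p.2.2) + v.2.2 * partialM φ (p.2.1, p.2.2)) *
        (Real.sin (Real.pi * t) - Real.cos (Real.pi * t))) := by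
  refine fderiv_eq_of_line ((contDiff_branchMap hg hK hφ).differentiable (by simp) _) ?_
  have := (line_of_contDiff (contDiff_balance (a := a) (b := b) hg) p v).prodMk
    ((line_product hK p v).prodMk (line_rayDefect hφ t p v))
  refine this.congr_of_eventuallyEq (Eventually.of_forall fun s => ?_)
  simp [branchMap]

theorem IsDividedDifference.fderiv_eq (hg : ContDiff ℝ ∞ g) (hK : IsDividedDifference g K)
    (p v : ℝ × ℝ × ℝ) : (v.1 - v.2.1) * K p + (p.1 - p.2.1) * fderiv ℝ K p v =
      (v.1 * partialU g (p.1, p.2.2) + v.2.2 * partialM g (p.1, p.2.2)) -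
      (v.2.1 * partialU g (p.2.1, p.2.2) + v.2.2 * partialM g (p.2.1, p.2.2)) := by
  obtain ⟨h1, h2, h3⟩ := line_coords p v
  obtain ⟨k1, k2⟩ := line_comp hg p v
  have e1 := ((h1.sub h2).mul (line_of_contDiff hK.smooth p v)).congr_deriv
    (show _ = (v.1 - v.2.1) * K p + (p.1 - p.2.1) * fderiv ℝ K p v by simp)
  refine e1.unique ?_
  refine (k1.sub k2).congr_of_eventuallyEq (Eventually.of_forall fun s => ?_)
  exact (hK.sub_eq _ _ _).symm

/-- By symmetry of K, exchanging the first two components of v does not change the derivative. Their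
sum is a direction tangent to the diagonal, where K is g_u. -/
theorem IsDividedDifference.fderiv_diag (hg : ContDiff ℝ ∞ g) (hK : IsDividedDifference g K)
    (x μ : ℝ) (v : ℝ × ℝ × ℝ) : 2 * fderiv ℝ K (x, x, μ) v =
      (v.1 + v.2.1) * partialU (partialU g) (x, μ) + 2 * v.2.2 * partialM (partialU g) (x, μ) := by
  have e1 : fderiv ℝ K (x, x, μ) v = fderiv ℝ K (x, x, μ) (v.2.1, v.1, v.2.2) := by
    refine fderiv_eq_of_line (hK.smooth.differentiable (by simp) _) ?_
    refine (line_of_contDiff hK.smooth (x, x, μ) (v.2.1, v.1, v.2.2)).congr_of_eventuallyEq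
      (Eventually.of_forall fun s => ?_)
    exact hK.symm _ _ _
  have e2 : fderiv ℝ K (x, x, μ) (v.1 + v.2.1, v.1 + v.2.1, 2 * v.2.2) =
      (v.1 + v.2.1) * partialU (partialU g) (x, μ) + 2 * v.2.2 * partialM (partialU g) (x, μ) := by
    refine fderiv_eq_of_line (hK.smooth.differentiable (by simp) _) ?_
    refine (line_comp (contDiff_partialU hg) (x, x, μ)
      (v.1 + v.2.1, v.1 + v.2.1, 2 * v.2.2)).1.congr_of_eventuallyEq
      (Eventually.of_forall fun s => ?_)
    exact hK.diag _ _
  rw [← e2, two_mul]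
  nth_rw 2 [e1]
  rw [← map_add]
  congr 1
  ext
  · simp
  · simp [add_comm]
  · simp; ring

/-- Up to the positive factor ρ, these are the coefficients of dX and dY in the linearized angular
equation; their signs are read off from the position of (X, Y). -/
theorem OnRay.coeffs {t : ℝ} {p : ℝ × ℝ × ℝ} (h : OnRay t (planar φ p)) : ∃ ρ > 0,
    ρ * (Real.sin (Real.pi * t) + Real.cos (Real.pi * t)) = 1 - 2 * φ (p.2.1, p.2.2) ∧
    ρ * (Real.sin (Real.pi * t) - Real.cos (Real.pi * t)) = 2 * φ (p.1, p.2.2) - 1 := by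
  obtain ⟨ρ, hρ, h⟩ := h
  simp only [planar, Prod.mk.injEq] at h
  exact ⟨ρ, hρ, by linarith [h.1, h.2], by linarith [h.1, h.2]⟩

/-- A curve whose angle parameter is its argument is regular. -/
theorem velocity_ne_zero_of_onRay (hφ : ContDiff ℝ ∞ φ) {c : ℝ → ℝ × ℝ × ℝ} {t : ℝ}
    (hc : DifferentiableAt ℝ c t) (h : ∀ᶠ s in 𝓝 t, OnRay s (planar φ (c s))) : deriv c t ≠ 0 := by
  intro h0
  have hW := ((contDiff_planar hφ).differentiable (by simp) (c t)).hasFDerivAt.comp_hasDerivAt t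
    hc.hasDerivAt
  rw [h0, map_zero] at hW
  have h1 : HasDerivAt (fun s => (planar φ (c s)).1) 0 t := hW.fst
  have h2 : HasDerivAt (fun s => (planar φ (c s)).2) 0 t := hW.snd
  have hl : HasDerivAt (fun s : ℝ => Real.pi * s) Real.pi t :=
    ((hasDerivAt_id t).const_mul Real.pi).congr_deriv (by simp)
  -- The angular equation holds identically along the curve. If the velocity vanished, its
  -- derivative would consist of the contribution of the angle alone, which is -π times the positive
  -- radius.
  have h3 := (h1.mul hl.sin).add (h2.mul hl.cos)
  have h4 : HasDerivAt (fun _ : ℝ => (0:ℝ)) _ t := h3.congr_of_eventuallyEq (by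
    filter_upwards [h] with s hs
    exact (onRay_iff.1 hs).1.symm)
  have h5 := h4.unique (hasDerivAt_const t 0)
  have h6 := (onRay_iff.1 h.self_of_nhds).2
  have h7 := Real.pi_pos
  have : Real.pi * ((planar φ (c t)).2 * Real.sin (Real.pi * t) -
      (planar φ (c t)).1 * Real.cos (Real.pi * t)) = 0 := by linear_combination -h5
  have := mul_pos h7 h6
  linarith

/-- The first two derivatives in the second variable, as smooth functions of both variables. -/
theorem eventually_slice_deriv {h : ℝ × ℝ → ℝ} {q₀ : ℝ × ℝ}
    (hh : ∀ᶠ q in 𝓝 q₀, ContDiffAt ℝ ∞ h q) :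
    (∀ᶠ q in 𝓝 q₀, ContDiffAt ℝ ∞ (fun q : ℝ × ℝ => deriv (fun s => h (q.1, s)) q.2) q) ∧
    ∀ᶠ q in 𝓝 q₀, ContDiffAt ℝ ∞ (fun q : ℝ × ℝ => iteratedDeriv 2 (fun s => h (q.1, s)) q.2) q := by
  have key : ∀ h : ℝ × ℝ → ℝ, (∀ᶠ q in 𝓝 q₀, ContDiffAt ℝ ∞ h q) →
      ∀ᶠ q in 𝓝 q₀, ContDiffAt ℝ ∞ (fun q : ℝ × ℝ => deriv (fun s => h (q.1, s)) q.2) q := by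
    intro h hh
    filter_upwards [hh.eventually_nhds] with q hq
    have h1 : ContDiffAt ℝ ∞ (fun q => fderiv ℝ h q (0, 1)) q :=
      (hq.self_of_nhds.fderiv_right (m := ∞) (by norm_cast)).clm_apply contDiffAt_const
    refine h1.congr_of_eventuallyEq ?_
    filter_upwards [hq] with q' hq'
    exact ((hq'.differentiableAt (by simp)).hasFDerivAt.comp_hasDerivAt q'.2
      ((hasDerivAt_const q'.2 q'.1).prodMk (hasDerivAt_id q'.2))).deriv
  refine ⟨key h hh, ?_⟩
  simp only [iteratedDeriv_succ, iteratedDeriv_zero]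
  exact key _ (key h hh)

end calculus

/-! ### Tangent vectors of the singular curve away from its corners. -/

section regular

variable {g φ : ℝ × ℝ → ℝ} {K : ℝ × ℝ × ℝ → ℝ} {a b : ℝ} {um up : ℝ → ℝ}

/-- The linearization at `d = 0` of the equations of `branchSet`. -/
def IsTangent (a b : ℝ) (g : ℝ × ℝ → ℝ) (K : ℝ × ℝ × ℝ → ℝ) (p v : ℝ × ℝ × ℝ) : Prop :=
  fderiv ℝ (balance a b g) p v = 0 ∧
    (v.1 * p.2.1 + p.1 * v.2.1) * K p + p.1 * p.2.1 * fderiv ℝ K p v = 0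

/-- At y = 0 the derivative of x y K is y' x K, and x K = -g(0, μ) ≠ 0; hence y' = 0, and the
balance leaves the tangent equation of the zero curve. -/
theorem IsTangent.axis (hg : ContDiff ℝ ∞ g) (hK : IsDividedDifference g K) (hb : 0 < b)
    {x μ : ℝ} {v : ℝ × ℝ × ℝ} (h : IsTangent a b g K (x, 0, μ) v) (hx : 0 < x)
    (h0 : g (x, μ) = 0) (hneg : g (0, μ) < 0) :
    v.2.1 = 0 ∧ v.1 * partialU g (x, μ) + v.2.2 * partialM g (x, μ) = 0 := by
  obtain ⟨h1, h2⟩ := h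
  rw [fderiv_balance hg] at h1
  have h3 := hK.sub_eq x 0 μ
  simp only [h0, mul_zero, zero_mul, zero_add, add_zero, sub_zero, zero_sub] at h1 h2 h3
  have hKx : x * K (x, 0, μ) ≠ 0 := by rw [← h3]; linarith
  have h4 : v.2.1 = 0 := by
    have : v.2.1 * (x * K (x, 0, μ)) = 0 := by linear_combination h2
    exact (mul_eq_zero.1 this).resolve_right hKx
  refine ⟨h4, ?_⟩
  rw [h4] at h1
  have : (b * x) * (v.1 * partialU g (x, μ) + v.2.2 * partialM g (x, μ)) = 0 := by
    linear_combination h1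
  exact (mul_eq_zero.1 this).resolve_left (by positivity)

/-- Here K = 0, so also dK = 0, and differentiating (x - y) K = g(x) - g(y) shows that the
variations of g at x and at y are equal. The balance, with positive weights, makes both vanish. -/
theorem IsTangent.offDiag (hg : ContDiff ℝ ∞ g) (hK : IsDividedDifference g K) (ha : 0 < a)
    (hb : 0 < b) {x y μ : ℝ} {v : ℝ × ℝ × ℝ} (h : IsTangent a b g K (x, y, μ) v) (hx : 0 < x)
    (hy : 0 < y) (hxy : x ≠ y) (h0 : g (x, μ) = 0) (h0' : g (y, μ) = 0) :
    v.1 * partialU g (x, μ) + v.2.2 * partialM g (x, μ) = 0 ∧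
      v.2.1 * partialU g (y, μ) + v.2.2 * partialM g (y, μ) = 0 := by
  obtain ⟨h1, h2⟩ := h
  rw [fderiv_balance hg] at h1
  have h3 := hK.sub_eq x y μ
  have h5 := hK.fderiv_eq hg (x, y, μ) v
  simp only [h0, h0', sub_zero, mul_zero, zero_add] at h1 h2 h3 h5
  have hK0 : K (x, y, μ) = 0 := (mul_eq_zero.1 h3.symm).resolve_left (sub_ne_zero.2 hxy)
  rw [hK0] at h2 h5
  have hdK : fderiv ℝ K (x, y, μ) v = 0 := by
    have : (x * y) * fderiv ℝ K (x, y, μ) v = 0 := by linear_combination h2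
    exact (mul_eq_zero.1 this).resolve_left (by positivity)
  rw [hdK] at h5
  have h6 : v.1 * partialU g (x, μ) + v.2.2 * partialM g (x, μ) = 0 := by
    have : (b * x + a * y) * (v.1 * partialU g (x, μ) + v.2.2 * partialM g (x, μ)) = 0 := by
      linear_combination h1 - a * y * h5
    exact (mul_eq_zero.1 this).resolve_left (by positivity)
  exact ⟨h6, by linear_combination h6 + h5⟩

/-- At the fold of both blocks g and g_u vanish, so the balance sees only μ'. Once μ' = 0, symmetry
of K makes dK a multiple of x' + y'. -/
theorem IsTangent.diag (hg : ContDiff ℝ ∞ g) (hK : IsDividedDifference g K) (ha : 0 < a)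
    (hb : 0 < b) {v : ℝ × ℝ × ℝ} (h : IsTangent a b g K (1, 1, 1) v) (h0 : g (1, 1) = 0)
    (hu : partialU g (1, 1) = 0) (hm : partialM g (1, 1) ≠ 0)
    (huu : partialU (partialU g) (1, 1) ≠ 0) : v.2.2 = 0 ∧ v.2.1 = -v.1 := by
  obtain ⟨h1, h2⟩ := h
  rw [fderiv_balance hg] at h1
  simp only [h0, hu, hK.diag, mul_zero, zero_add] at h1 h2
  have h3 : v.2.2 = 0 := by
    have : (b + a) * partialM g (1, 1) * v.2.2 = 0 := by linear_combination h1
    exact (mul_eq_zero.1 this).resolve_left (mul_ne_zero (by positivity) hm)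
  have h4 := hK.fderiv_diag hg 1 1 v
  rw [h3] at h4
  have : (v.1 + v.2.1) * partialU (partialU g) (1, 1) = 0 := by linear_combination 2 * h2 - h4
  exact ⟨h3, by linarith [(mul_eq_zero.1 this).resolve_right huu]⟩

/-- The derivative of a coordinate along a curve of zeros. -/
theorem tangent_coord (hg : ContDiff ℝ ∞ g) (hφ : ContDiff ℝ ∞ φ) {h C : ℝ → ℝ} {μ C' : ℝ}
    (hc : ContinuousAt h μ) (h0 : ∀ᶠ ν in 𝓝 μ, g (h ν, ν) = 0 ∧ φ (h ν, ν) = C ν)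
    (hC : HasDerivAt C C' μ) (hu : partialU g (h μ, μ) ≠ 0) {v w : ℝ}
    (hv : v * partialU g (h μ, μ) + w * partialM g (h μ, μ) = 0) :
    v * partialU φ (h μ, μ) + w * partialM φ (h μ, μ) = C' * w := by
  obtain ⟨c, hc0, hcs, hiff⟩ := exists_implicit (E := fun z : ℝ × ℝ => g (z.2, z.1)) (q₀ := μ)
    (p₀ := h μ) (Eventually.of_forall fun z => (hg.comp (by fun_prop)).contDiffAt)
    h0.self_of_nhds.1 (by
      intro v hv
      have h1 : HasDerivAt (fun s : ℝ => g (((μ, h μ) + s • ((0:ℝ), v)).2,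
          ((μ, h μ) + s • ((0:ℝ), v)).1)) (v * partialU g (h μ, μ)) 0 := by
        have e1 : HasDerivAt (fun s : ℝ => h μ + s * v) v 0 :=
          (((hasDerivAt_id (0:ℝ)).mul_const v).const_add _).congr_deriv (by simp)
        have e2 : HasDerivAt (fun s : ℝ => μ + s * 0) 0 0 :=
          (((hasDerivAt_id (0:ℝ)).mul_const 0).const_add _).congr_deriv (by simp)
        have := hasDerivAt_comp_pair (g := g) (hg.differentiable (by simp) _) e1 e2
        exact this.congr_deriv (by simp)
      have h2 := fderiv_eq_of_line (f := fun z : ℝ × ℝ => g (z.2, z.1))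
        ((hg.comp (by fun_prop : ContDiff ℝ ∞ fun z : ℝ × ℝ => (z.2, z.1))).differentiable
          (by simp) _) h1
      rw [h2] at hv
      exact (mul_eq_zero.1 hv).resolve_right hu)
  -- The branch of zeros is assumed only continuous; local uniqueness of the implicit function makes
  -- it differentiable.
  have he : h =ᶠ[𝓝 μ] c := by
    have ht : Tendsto (fun ν => (ν, h ν)) (𝓝 μ) (𝓝 (μ, h μ)) := continuousAt_id.prodMk hc
    filter_upwards [ht.eventually hiff, h0] with ν h1 h2 using h1.1 h2.1
  have hd : HasDerivAt h (deriv c μ) μ :=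
    (hcs.self_of_nhds.differentiableAt (by simp)).hasDerivAt.congr_of_eventuallyEq he
  have d1 := hasDerivAt_comp_pair (g := g) (hg.differentiable (by simp) _) hd (hasDerivAt_id μ)
  have d2 := hasDerivAt_comp_pair (g := φ) (hφ.differentiable (by simp) _) hd (hasDerivAt_id μ)
  have d3 := d1.unique ((hasDerivAt_const μ (0:ℝ)).congr_of_eventuallyEq (h0.mono fun ν h => h.1))
  have d4 := d2.unique (hC.congr_of_eventuallyEq (h0.mono fun ν h => h.2))
  simp only [id, one_mul] at d3 d4
  have hv' : v = deriv c μ * w := by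
    have : (v - deriv c μ * w) * partialU g (h μ, μ) = 0 := by linear_combination hv - w * d3
    linarith [(mul_eq_zero.1 this).resolve_right hu]
  rw [hv']
  linear_combination w * d4

theorem hasDerivAt_coordPlus {μ : ℝ} (h : μ < 1) :
    HasDerivAt coordPlus (-1 / (4 * √(1 - μ) * coordPlus μ)) μ := by
  have h1 : 0 < √(1 - μ) := Real.sqrt_pos.2 (by linarith)
  have e := (((hasDerivAt_id μ).const_sub 1).sqrt (by simp; linarith)).const_add 1
  have := e.sqrt (by simp only [id]; positivity)
  refine this.congr_deriv ?_
  simp only [id, coordPlus]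
  have : √(1 + √(1 - μ)) ≠ 0 := by positivity
  field_simp
  ring

theorem hasDerivAt_coordMinus {μ : ℝ} (h0 : 0 < μ) (h : μ < 1) :
    HasDerivAt coordMinus (1 / (4 * √(1 - μ) * coordMinus μ)) μ := by
  have h1 : 0 < √(1 - μ) := Real.sqrt_pos.2 (by linarith)
  have h2 : √(1 - μ) < 1 := by rw [Real.sqrt_lt' one_pos]; linarith
  have e := (((hasDerivAt_id μ).const_sub 1).sqrt (by simp; linarith)).const_sub 1
  have := e.sqrt (by simp only [id]; linarith)
  refine this.congr_deriv ?_
  simp only [id, coordMinus]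
  have : √(1 - √(1 - μ)) ≠ 0 := (Real.sqrt_pos.2 (by linarith)).ne'
  field_simp
  ring

theorem coordMinus_pos {μ : ℝ} (h0 : 0 < μ) : 0 < coordMinus μ := by
  refine Real.sqrt_pos.2 ?_
  have h2 : √(1 - μ) < 1 := by rw [Real.sqrt_lt' one_pos]; linarith
  linarith

theorem IsCoordinate.partialM_axis (hφ : IsCoordinate um up φ) (μ : ℝ) :
    partialM φ (0, μ) = 0 := by
  have h := hasDerivAt_snd hφ.smooth 0 μ
  simp only [hφ.axis] at h
  exact h.unique (hasDerivAt_const μ (0:ℝ))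

/-- Both branches of zeros are transverse to the levels of the coordinate. -/
theorem Profile.tangent_up (hg : Profile g um up) (hφ : IsCoordinate um up φ) {μ v w : ℝ}
    (hμ : μ ∈ Ioo (0:ℝ) 1)
    (hv : v * partialU g (up μ, μ) + w * partialM g (up μ, μ) = 0) :
    v * partialU φ (up μ, μ) + w * partialM φ (up μ, μ) = -1 / (4 * √(1 - μ) * coordPlus μ) * w := by
  have hn : Icc (0:ℝ) 1 ∈ 𝓝 μ := Icc_mem_nhds hμ.1 hμ.2
  exact tangent_coord hg.smooth hφ.smooth (hg.cont_up.continuousAt hn)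
    (by filter_upwards [hn] with ν hν using ⟨hg.zero_up ν hν, hφ.on_up ν hν⟩)
    (hasDerivAt_coordPlus hμ.2) (hg.stable μ ⟨hμ.1.le, hμ.2⟩).ne hv

theorem Profile.tangent_um (hg : Profile g um up) (hφ : IsCoordinate um up φ) {μ v w : ℝ}
    (hμ : μ ∈ Ioo (0:ℝ) 1)
    (hv : v * partialU g (um μ, μ) + w * partialM g (um μ, μ) = 0) :
    v * partialU φ (um μ, μ) + w * partialM φ (um μ, μ) = 1 / (4 * √(1 - μ) * coordMinus μ) * w := by
  have hn : Icc (0:ℝ) 1 ∈ 𝓝 μ := Icc_mem_nhds hμ.1 hμ.2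
  exact tangent_coord hg.smooth hφ.smooth (hg.cont_um.continuousAt hn)
    (by filter_upwards [hn] with ν hν using ⟨hg.zero_um ν hν, hφ.on_um ν hν⟩)
    (hasDerivAt_coordMinus hμ.1 hμ.2) (hg.unstable μ hμ).ne' hv

theorem Profile.g_one (hg : Profile g um up) : g (1, 1) = 0 := by
  have := hg.zero_um 1 (by simp); rwa [hg.um_one] at this

theorem eq_zero_of_coords {v : ℝ × ℝ × ℝ} (h1 : v.1 = 0) (h2 : v.2.1 = 0) (h3 : v.2.2 = 0) :
    v = 0 := Prod.ext h1 (Prod.ext h2 h3)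

/-- The singular curve is regular away from its corners, and transverse to the rays. -/
theorem Profile.regular_of_halfAB (hg : Profile g um up) (hφ : IsCoordinate um up φ)
    (hK : IsDividedDifference g K) (ha : 0 < a) (hb : 0 < b) {t : ℝ} {p v : ℝ × ℝ × ℝ}
    (hp : p ∈ halfAB um up) (hμ : 0 < p.2.2) (hray : OnRay t (planar φ p))
    (hv : IsTangent a b g K p v) :
    ((v.1 * partialU φ (p.1, p.2.2) + v.2.2 * partialM φ (p.1, p.2.2)) *
        (Real.sin (Real.pi * t) + Real.cos (Real.pi * t)) +
      (v.2.1 * partialU φ (p.2.1, p.2.2) + v.2.2 * partialM φ (p.2.1, p.2.2)) *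
        (Real.sin (Real.pi * t) - Real.cos (Real.pi * t)) = 0 → v = 0) ∧
    (p.2.2 < 1 → v.2.2 = 0 → v = 0) ∧
    (p.2.2 = 1 → p.1 = 1 ∧ v.2.2 = 0 ∧ (v.1 = 0 → v = 0)) := by
  obtain ⟨ρ, hρ, r1, r2⟩ := hray.coeffs
  obtain ⟨x, y, μ⟩ := p
  obtain ⟨hI, hc⟩ := hp
  simp only at hI hc hμ r1 r2 ⊢
  set σ := Real.sin (Real.pi * t) + Real.cos (Real.pi * t)
  set τ := Real.sin (Real.pi * t) - Real.cos (Real.pi * t)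
  rcases eq_or_lt_of_le hI.2 with rfl | h1
  · -- the fold
    rw [hg.um_one, hg.up_one] at hc
    have hx : x = 1 := by rcases hc with h | h | h <;> exact h.1
    have hneg := hg.neg_zero 1 (by simp)
    subst hx
    have hφ1 : φ (1, 1) = 1 := by
      have := hφ.on_um 1 (by simp); rwa [hg.um_one, coordMinus_one] at this
    have hy : y = 0 ∨ y = 1 := by rcases hc with h | h | h <;> simp [h.2]
    rcases hy with rfl | rfl
    · obtain ⟨k1, k2⟩ := hv.axis hg.smooth hK hb one_pos hg.g_one hneg
      rw [hg.fold_u, mul_zero, zero_add] at k2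
      have k3 := (mul_eq_zero.1 k2).resolve_right hg.fold_μ.ne
      rw [hφ.axis] at r1
      have hσ : σ ≠ 0 := by rintro h; rw [h] at r1; norm_num at r1
      refine ⟨fun h => ?_, fun h => absurd h (lt_irrefl _), fun _ => ⟨rfl, k3, fun h =>
        eq_zero_of_coords h k1 k3⟩⟩
      rw [k1, k3] at h
      have : v.1 * (partialU φ (1, 1) * σ) = 0 := by linear_combination h
      exact eq_zero_of_coords ((mul_eq_zero.1 this).resolve_right
        (mul_ne_zero hφ.pos_fold.ne' hσ)) k1 k3
    · obtain ⟨k3, k1⟩ := hv.diag hg.smooth hK ha hb hg.g_one hg.fold_u hg.fold_μ.ne hg.fold_uu.ne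
      rw [hφ1] at r1 r2
      refine ⟨fun h => ?_, fun h => absurd h (lt_irrefl _), fun _ => ⟨rfl, k3, fun h =>
        eq_zero_of_coords h (by rw [k1, h, _root_.neg_zero]) k3⟩⟩
      rw [k1, k3] at h
      have : v.1 * partialU φ (1, 1) = 0 := by
        linear_combination (-ρ / 2) * h + v.1 * partialU φ (1, 1) / 2 * r1 -
          v.1 * partialU φ (1, 1) / 2 * r2
      have h4 := (mul_eq_zero.1 this).resolve_right hφ.pos_fold.ne'
      exact eq_zero_of_coords h4 (by rw [k1, h4, _root_.neg_zero]) k3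
  · have hμ' : μ ∈ Ioo (0:ℝ) 1 := ⟨hμ, h1⟩
    have hs : 0 < √(1 - μ) := Real.sqrt_pos.2 (by linarith)
    have hX : 0 < coordPlus μ := one_pos.trans_le (coordPlus_mem μ).1
    have hY := coordMinus_pos hμ
    have hneg := hg.neg_zero μ ⟨hμ, h1.le⟩
    have hu1 := (hg.stable μ ⟨hμ.le, h1⟩).ne
    have hu2 := (hg.unstable μ hμ').ne'
    suffices h : ((v.1 * partialU φ (x, μ) + v.2.2 * partialM φ (x, μ)) * σ +
        (v.2.1 * partialU φ (y, μ) + v.2.2 * partialM φ (y, μ)) * τ = 0 → v.2.2 = 0) ∧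
        (v.2.2 = 0 → v = 0) from
      ⟨fun h' => h.2 (h.1 h'), fun _ => h.2, fun h' => absurd h' h1.ne⟩
    have axis : ∀ h C' : ℝ, 0 < h → g (h, μ) = 0 → partialU g (h, μ) ≠ 0 → C' ≠ 0 →
        (v.1 * partialU g (h, μ) + v.2.2 * partialM g (h, μ) = 0 →
          v.1 * partialU φ (h, μ) + v.2.2 * partialM φ (h, μ) = C' * v.2.2) →
        x = h → y = 0 → ((v.1 * partialU φ (x, μ) + v.2.2 * partialM φ (x, μ)) * σ +
        (v.2.1 * partialU φ (y, μ) + v.2.2 * partialM φ (y, μ)) * τ = 0 → v.2.2 = 0) ∧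
        (v.2.2 = 0 → v = 0) := by
      rintro h C' hh h0 hu hC hT rfl rfl
      obtain ⟨k1, k2⟩ := hv.axis hg.smooth hK hb hh h0 hneg
      rw [hφ.axis] at r1
      have hσ : σ ≠ 0 := by rintro h; rw [h] at r1; norm_num at r1
      rw [hT k2, k1, hφ.partialM_axis]
      refine ⟨fun h => ?_, fun h => ?_⟩
      · have : v.2.2 * (C' * σ) = 0 := by linear_combination h
        exact (mul_eq_zero.1 this).resolve_right (mul_ne_zero hC hσ)
      · rw [h, zero_mul, add_zero] at k2
        exact eq_zero_of_coords ((mul_eq_zero.1 k2).resolve_right hu) k1 h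
    rcases hc with hc | hc | hc
    · exact axis (um μ) _ (hg.um_pos μ ⟨hμ, h1.le⟩) (hg.zero_um μ hI) hu2
        (by positivity) (hg.tangent_um hφ hμ') hc.1 hc.2
    · exact axis (up μ) _ (hg.up_pos hI) (hg.zero_up μ hI) hu1
        (div_ne_zero (by norm_num) (by positivity)) (hg.tangent_up hφ hμ') hc.1 hc.2
    · obtain ⟨rfl, rfl⟩ := hc
      obtain ⟨k1, k2⟩ := hv.offDiag hg.smooth hK ha hb (hg.up_pos hI) (hg.um_pos μ ⟨hμ, h1.le⟩)
        (hg.lt μ ⟨hμ.le, h1⟩).ne' (hg.zero_up μ hI) (hg.zero_um μ hI)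
      rw [hg.tangent_up hφ hμ' k1, hg.tangent_um hφ hμ' k2]
      rw [hφ.on_um μ hI] at r1
      rw [hφ.on_up μ hI] at r2
      have e1 := (coordPlus_mem μ).2
      have e2 := (coordMinus_mem hI).2.2
      refine ⟨fun h => ?_, fun h => ?_⟩
      · set X := coordPlus μ
        set Y := coordMinus μ
        set s := √(1 - μ)
        have h5 : v.2.2 * (-(σ * ρ) * Y + (τ * ρ) * X) = 0 := by
          field_simp at h
          linear_combination ρ * h
        -- Along B one has dX = -μ' / (4 s X) and dY = μ' / (4 s Y). Up to positive factors, the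
        -- angular equation has the coefficient (2 X - 1) X - (1 - 2 Y) Y = 2 (X² + Y²) - X - Y = 4
        -- - X - Y, which is positive on the arc.
        have h6 : v.2.2 * (4 - X - Y) = 0 := by
          linear_combination h5 + v.2.2 * Y * r1 - v.2.2 * X * r2 - 2 * v.2.2 * e1 + 2 * v.2.2 * e2
        have h7 : 0 < 4 - X - Y := by nlinarith [sq_nonneg (X - 1), sq_nonneg (Y - 1)]
        exact (mul_eq_zero.1 h6).resolve_right h7.ne'
      · rw [h, zero_mul, add_zero] at k1 k2
        exact eq_zero_of_coords ((mul_eq_zero.1 k1).resolve_right hu1)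
          ((mul_eq_zero.1 k2).resolve_right hu2) h

theorem Profile.branch_eq_of_halfAB (hg : Profile g um up) (hK : IsDividedDifference g K)
    {p : ℝ × ℝ × ℝ} (hp : p ∈ halfAB um up) :
    balance a b g p = 0 ∧ p.1 * p.2.1 * K p = 0 := by
  obtain ⟨x, y, μ⟩ := p
  obtain ⟨hI, hc⟩ := hp
  simp only at hI hc
  simp only [balance]
  rcases hc with ⟨rfl, rfl⟩ | ⟨rfl, rfl⟩ | ⟨rfl, rfl⟩
  · simp [hg.zero_um μ hI]
  · simp [hg.zero_up μ hI]
  · refine ⟨by simp [hg.zero_um μ hI, hg.zero_up μ hI], ?_⟩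
    rcases eq_or_lt_of_le hI.2 with rfl | h1
    · rw [hg.um_one, hg.up_one, hK.diag, hg.fold_u, mul_zero]
    · have h3 := hK.sub_eq (up μ) (um μ) μ
      rw [hg.zero_um μ hI, hg.zero_up μ hI, sub_zero] at h3
      rw [(mul_eq_zero.1 h3.symm).resolve_left (sub_ne_zero.2 (hg.lt μ ⟨hI.1, h1⟩).ne'), mul_zero]

theorem swapXY_swapXY (p : ℝ × ℝ × ℝ) : swapXY (swapXY p) = p := rfl

theorem IsDividedDifference.swap (hK : IsDividedDifference g K) (p : ℝ × ℝ × ℝ) :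
    K (swapXY p) = K p := hK.symm _ _ _

theorem balance_swap (p : ℝ × ℝ × ℝ) : balance a b g (swapXY p) = balance b a g p := by
  simp only [balance, swapXY]; ring

theorem Profile.branch_eq_of_singularCurve (hg : Profile g um up) (hK : IsDividedDifference g K)
    {p : ℝ × ℝ × ℝ} (hp : p ∈ singularCurve um up) :
    balance a b g p = 0 ∧ p.1 * p.2.1 * K p = 0 := by
  rcases hp with h | h
  · exact hg.branch_eq_of_halfAB hK h
  · obtain ⟨h1, h2⟩ := hg.branch_eq_of_halfAB (a := b) (b := a) hK h
    rw [balance_swap] at h1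
    rw [hK.swap] at h2
    refine ⟨h1, ?_⟩
    simp only [swapXY] at h2
    linear_combination h2

/-- A zero `x > 0` on the singular curve determines the parameter. -/
theorem Profile.arcLevel_fst (hφ : IsCoordinate um up φ) {p : ℝ × ℝ × ℝ}
    (hp : p ∈ singularCurve um up) (hx : p.1 ≠ 0) : arcLevel (φ (p.1, p.2.2)) = p.2.2 := by
  obtain ⟨x, y, μ⟩ := p
  simp only [singularCurve, halfCD, halfAB, swapXY, mem_union, mem_preimage, mem_ofPred_eq] at hp hx ⊢
  rcases hp with ⟨hI, h⟩ | ⟨hI, h⟩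
  · rcases h with h | h | h <;> rw [h.1]
    · rw [hφ.on_um μ hI, arcLevel_coordMinus hI]
    · rw [hφ.on_up μ hI, arcLevel_coordPlus hI]
    · rw [hφ.on_up μ hI, arcLevel_coordPlus hI]
  · rcases h with h | h | h
    · exact absurd h.2 hx
    · exact absurd h.2 hx
    · rw [h.2, hφ.on_um μ hI, arcLevel_coordMinus hI]

end regular

/-! ### Local branches at regular points of the singular curve. -/

/-- The parametrization of the singular curve by the angle of its planar coordinates. -/
structure IsSingularParam (um up : ℝ → ℝ) (φ : ℝ × ℝ → ℝ) (γ₀ : ℝ → ℝ × ℝ × ℝ) : Prop where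
  cont : Continuous γ₀
  mem : ∀ t, γ₀ t ∈ singularCurve um up
  ray : ∀ t, OnRay t (planar φ (γ₀ t))
  unique : ∀ t, ∀ p ∈ singularCurve um up, OnRay t (planar φ p) → p = γ₀ t
  neg : ∀ t, γ₀ (-t) = swapXY (γ₀ t)

/-- A local branch of solutions near `γ₀ t₀` along which `μ` lies in `(0, 1)` and has at most
nondegenerate critical points. -/
structure IsGoodBranch (a b : ℝ) (g : ℝ × ℝ → ℝ) (K : ℝ × ℝ × ℝ → ℝ) (φ : ℝ × ℝ → ℝ)
    (γ₀ : ℝ → ℝ × ℝ × ℝ) (t₀ : ℝ) (c : ℝ × ℝ → ℝ × ℝ × ℝ) : Prop where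
  branch : IsLocalBranch (branchSet a b g K) (planar φ) t₀ (γ₀ t₀) c
  level : ∀ᶠ q in posFilter t₀, (c q).2.2 ∈ Ioo (0:ℝ) 1
  monotone : 0 < (γ₀ t₀).2.2 → (γ₀ t₀).2.2 < 1 →
    ∀ᶠ q in posFilter t₀, deriv (fun s => (c (q.1, s)).2.2) q.2 ≠ 0
  fold : (γ₀ t₀).2.2 = 1 → ∀ᶠ q in posFilter t₀, deriv (fun s => (c (q.1, s)).2.2) q.2 = 0 →
    iteratedDeriv 2 (fun s => (c (q.1, s)).2.2) q.2 < 0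
  corner : (γ₀ t₀).2.2 = 0 → ∀ᶠ q in posFilter t₀, deriv (fun s => (c (q.1, s)).2.2) q.2 = 0 →
    0 < iteratedDeriv 2 (fun s => (c (q.1, s)).2.2) q.2
  regular : (γ₀ t₀).2.2 ≠ 0 → (∀ᶠ q in 𝓝 (0, t₀), ContDiffAt ℝ ∞ c q) ∧
    ∀ᶠ t in 𝓝 t₀, c (0, t) = γ₀ t

section good

variable {g φ : ℝ × ℝ → ℝ} {K : ℝ × ℝ × ℝ → ℝ} {a b : ℝ} {um up : ℝ → ℝ}
  {γ₀ : ℝ → ℝ × ℝ × ℝ}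

theorem contDiffAt_deriv {h : ℝ → ℝ} {t : ℝ} (hh : ContDiffAt ℝ ∞ h t) :
    ContDiffAt ℝ ∞ (deriv h) t :=
  (hh.fderiv_right (m := ∞) (by norm_cast)).clm_apply contDiffAt_const

theorem contDiff_swapXY : ContDiff ℝ ∞ swapXY := by unfold swapXY; fun_prop

theorem swap_mem_branchSet (hK : IsDividedDifference g K) {d : ℝ} {p : ℝ × ℝ × ℝ} :
    swapXY p ∈ branchSet a b g K d ↔ p ∈ branchSet b a g K d := by
  simp only [branchSet, mem_ofPred_eq, balance_swap, hK.swap]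
  simp only [swapXY]
  rw [and_comm (a := 0 < p.2.1), mul_comm p.2.1, add_comm (b * p.2.1)]

theorem tendsto_neg_posFilter (t₀ : ℝ) :
    Tendsto (fun q : ℝ × ℝ => (q.1, -q.2)) (posFilter t₀) (posFilter (-t₀)) := by
  refine tendsto_nhdsWithin_iff.2 ⟨?_, eventually_pos_posFilter t₀⟩
  have : Continuous fun q : ℝ × ℝ => (q.1, -q.2) := by fun_prop
  exact (this.tendsto (0, t₀)).mono_left (posFilter_le t₀)

/-- Exchanging x and y exchanges a with b and reverses t, so the local analysis is needed on the AB
half only, but for both orders of the weights. -/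
theorem IsGoodBranch.swap (hK : IsDividedDifference g K) (hγ : IsSingularParam um up φ γ₀)
    {t₀ : ℝ} {c : ℝ × ℝ → ℝ × ℝ × ℝ} (h : IsGoodBranch b a g K φ γ₀ (-t₀) c) :
    IsGoodBranch a b g K φ γ₀ t₀ (fun q => swapXY (c (q.1, -q.2))) := by
  have hp : γ₀ t₀ = swapXY (γ₀ (-t₀)) := by rw [hγ.neg, swapXY_swapXY]
  have hT := tendsto_neg_posFilter t₀
  have hcont : Continuous swapXY := contDiff_swapXY.continuous
  have hneg : ContDiff ℝ ∞ fun q : ℝ × ℝ => (q.1, -q.2) := by fun_prop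
  have hμ : (γ₀ t₀).2.2 = (γ₀ (-t₀)).2.2 := by rw [hp]; rfl
  have hd : ∀ q : ℝ × ℝ, deriv (fun s => (swapXY (c (q.1, -s))).2.2) q.2 =
      -deriv (fun s => (c (q.1, s)).2.2) (-q.2) := fun q =>
    deriv_comp_neg (fun s => (c (q.1, s)).2.2) q.2
  have hd2 : ∀ q : ℝ × ℝ, iteratedDeriv 2 (fun s => (swapXY (c (q.1, -s))).2.2) q.2 =
      iteratedDeriv 2 (fun s => (c (q.1, s)).2.2) (-q.2) := fun q => by
    have := iteratedDeriv_comp_neg 2 (fun s => (c (q.1, s)).2.2) q.2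
    simp only [even_two, Even.neg_pow, one_pow, one_smul] at this
    exact this
  refine ⟨⟨?_, ?_, ?_, ?_⟩, ?_, ?_, ?_, ?_, ?_⟩
  · rw [hp]
    exact (hcont.tendsto _).comp (h.branch.tendsto.comp hT)
  · filter_upwards [hT.eventually h.branch.mem] with q hq
    refine ⟨(swap_mem_branchSet hK).2 hq.1, ?_⟩
    rw [planar_swap, ← onRay_neg]
    simpa using hq.2
  · filter_upwards [hT.eventually h.branch.smooth] with q hq
    exact contDiff_swapXY.contDiffAt.comp q (hq.comp q hneg.contDiffAt)
  · obtain ⟨V, hV, hVu⟩ := h.branch.unique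
    refine ⟨swapXY ⁻¹' V, hcont.continuousAt.preimage_mem_nhds (by rwa [hp, swapXY_swapXY]), ?_⟩
    filter_upwards [hT.eventually hVu] with q hq p hpV hpS hpR
    have := hq (swapXY p) hpV ((swap_mem_branchSet hK).2 hpS) (by rw [planar_swap, onRay_neg]; exact hpR)
    rw [← this, swapXY_swapXY]
  · filter_upwards [hT.eventually h.level] with q hq using hq
  · rw [hμ]
    intro h0 h1
    filter_upwards [hT.eventually (h.monotone h0 h1)] with q hq
    rw [hd]; exact neg_ne_zero.2 hq
  · rw [hμ]
    intro h1
    filter_upwards [hT.eventually (h.fold h1)] with q hq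
    rw [hd, hd2, neg_eq_zero]; exact hq
  · rw [hμ]
    intro h1
    filter_upwards [hT.eventually (h.corner h1)] with q hq
    rw [hd, hd2, neg_eq_zero]; exact hq
  · rw [hμ]
    intro h1
    obtain ⟨r1, r2⟩ := h.regular h1
    constructor
    · have ht : Tendsto (fun q : ℝ × ℝ => (q.1, -q.2)) (𝓝 (0, t₀)) (𝓝 (0, -t₀)) :=
        hneg.continuous.tendsto (0, t₀)
      filter_upwards [ht.eventually r1] with q hq
      exact contDiff_swapXY.contDiffAt.comp q (hq.comp q hneg.contDiffAt)
    · have ht : Tendsto (fun t : ℝ => -t) (𝓝 t₀) (𝓝 (-t₀)) := continuous_neg.tendsto _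
      filter_upwards [ht.eventually r2] with t ht
      rw [ht, hγ.neg, swapXY_swapXY]

theorem IsCoordinate.at_one (hg : Profile g um up) (hφ : IsCoordinate um up φ) : φ (1, 1) = 1 := by
  have := hφ.on_um 1 (by simp); rwa [hg.um_one, coordMinus_one] at this

/-- Near the fold there are no positive solutions with `μ ≥ 1`. -/
theorem Profile.eventually_fold_nonpos (hg : Profile g um up) :
    ∀ᶠ p in 𝓝 ((1:ℝ), (1:ℝ)), 1 ≤ p.2 → g p ≤ 0 ∧ (g p = 0 → p = (1, 1)) := by
  obtain ⟨A, B, hA, hB, hAB, hA0, hB0⟩ := exists_fold_form hg.smooth hg.g_one hg.fold_u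
  have h1 : ∀ᶠ p in 𝓝 ((1:ℝ), (1:ℝ)), A p < 0 :=
    hA.continuous.continuousAt.eventually_lt_const (by rw [hA0]; exact hg.fold_μ)
  have h2 : ∀ᶠ p in 𝓝 ((1:ℝ), (1:ℝ)), B p.1 < 0 :=
    (hB.continuous.comp continuous_fst).continuousAt.eventually_lt_const
      (by simp only [Function.comp]; linarith [hg.fold_uu])
  filter_upwards [h1, h2] with p h1 h2 hp
  have e := hAB p.1 p.2
  have f1 : (p.2 - 1) * A p ≤ 0 := mul_nonpos_of_nonneg_of_nonpos (by linarith) h1.le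
  have f2 : (p.1 - 1) ^ 2 * B p.1 ≤ 0 := mul_nonpos_of_nonneg_of_nonpos (sq_nonneg _) h2.le
  refine ⟨by rw [e]; linarith, fun h0 => ?_⟩
  rw [e] at h0
  have g1 : (p.2 - 1) * A p = 0 := by change (p.2 - 1) * A (p.1, p.2) ≤ 0 at f1; exact le_antisymm f1 (by linarith)
  have g2 : (p.1 - 1) ^ 2 * B p.1 = 0 := by rw [g1] at h0; linarith
  have g3 := (mul_eq_zero.1 g1).resolve_right h1.ne
  have g4 := pow_eq_zero_iff (two_ne_zero) |>.1 ((mul_eq_zero.1 g2).resolve_right h2.ne)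
  exact Prod.ext (by simp only; linarith) (by simp only; linarith)

/-- Near regular points of the singular curve, solutions are positive and have `μ < 1`. -/
theorem Profile.eventually_level (hg : Profile g um up) (hK : IsDividedDifference g K) (ha : 0 < a)
    (hb : 0 < b) {p₀ : ℝ × ℝ × ℝ} (hp : p₀ ∈ halfAB um up) (hμ : 0 < p₀.2.2) :
    ∀ᶠ p in 𝓝 p₀, ∀ d, 0 < d → d * a < 1 / 2 * p₀.1 * |K p₀| ∨ p₀.2.1 ≠ 0 →
      balance a b g p = 0 → p.1 * p.2.1 * K p = d * (b * p.1 + a * p.2.1) →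
      (0 < p.1 ∧ 0 < p.2.1) ∧ p.2.2 ∈ Ioo (0:ℝ) 1 := by
  obtain ⟨x, y, μ⟩ := p₀
  obtain ⟨hI, hc⟩ := hp
  simp only at hI hc hμ ⊢
  have hx : 0 < x := by
    rcases hc with h | h | h <;> rw [h.1]
    · exact hg.um_pos μ ⟨hμ, hI.2⟩
    · exact hg.up_pos hI
    · exact hg.up_pos hI
  have hgx : g (x, μ) = 0 := by
    rcases hc with h | h | h <;> rw [h.1]
    · exact hg.zero_um μ hI
    · exact hg.zero_up μ hI
    · exact hg.zero_up μ hI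
  have ex : ∀ᶠ p : ℝ × ℝ × ℝ in 𝓝 (x, y, μ), 0 < p.1 := continuousAt_fst.eventually_const_lt hx
  have em : ∀ᶠ p : ℝ × ℝ × ℝ in 𝓝 (x, y, μ), 0 < p.2.2 :=
    (by fun_prop : ContinuousAt (fun p : ℝ × ℝ × ℝ => p.2.2) (x, y, μ)).eventually_const_lt hμ
  have ty : Tendsto (fun p : ℝ × ℝ × ℝ => (p.2.1, p.2.2)) (𝓝 (x, y, μ)) (𝓝 (y, μ)) :=
    (by fun_prop : Continuous fun p : ℝ × ℝ × ℝ => (p.2.1, p.2.2)).tendsto _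
  have tx : Tendsto (fun p : ℝ × ℝ × ℝ => (p.1, p.2.2)) (𝓝 (x, y, μ)) (𝓝 (x, μ)) :=
    (by fun_prop : Continuous fun p : ℝ × ℝ × ℝ => (p.1, p.2.2)).tendsto _
  have key1 : ∀ᶠ p : ℝ × ℝ × ℝ in 𝓝 (x, y, μ), p.2.2 < 1 ∨ (μ = 1 ∧ 1 ≤ p.2.2 ∧ g (p.1, p.2.2) ≤ 0 ∧
      (g (p.1, p.2.2) = 0 → (p.1, p.2.2) = (1, 1))) := by
    rcases eq_or_lt_of_le hI.2 with rfl | h1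
    · have hx1 : x = 1 := by
        rcases hc with h | h | h <;> rw [h.1]
        · exact hg.um_one
        · exact hg.up_one
        · exact hg.up_one
      subst hx1
      filter_upwards [tx.eventually hg.eventually_fold_nonpos] with p h1
      rcases lt_or_ge p.2.2 1 with h | h
      · exact Or.inl h
      · exact Or.inr ⟨rfl, h, h1 h⟩
    · filter_upwards [(by fun_prop : ContinuousAt (fun p : ℝ × ℝ × ℝ => p.2.2)
        (x, y, μ)).eventually_lt_const h1] with p h using Or.inl h
  have hy : y = 0 ∨ (x = up μ ∧ y = um μ) := by
    rcases hc with h | h | h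
    · exact Or.inl h.2
    · exact Or.inl h.2
    · exact Or.inr h
  rcases hy with rfl | ⟨hxu, hyu⟩
  · have hneg := hg.neg_zero μ ⟨hμ, hI.2⟩
    have hKx := hK.sub_eq x 0 μ
    rw [hgx, sub_zero, zero_sub] at hKx
    have hKp : 0 < x * K (x, 0, μ) := by rw [← hKx]; linarith
    have hK0 : 0 < K (x, 0, μ) := pos_of_mul_pos_right hKp hx.le
    have eK : ∀ᶠ p : ℝ × ℝ × ℝ in 𝓝 (x, 0, μ), 1 / 2 * x * K (x, 0, μ) < p.1 * K p :=
      (continuousAt_fst.mul hK.smooth.continuous.continuousAt).eventually_const_lt (by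
        simp only [Pi.mul_apply]; linarith)
    have eg : ∀ᶠ p : ℝ × ℝ × ℝ in 𝓝 (x, 0, μ), g (p.2.1, p.2.2) < 0 :=
      ty.eventually (hg.smooth.continuous.continuousAt.eventually_lt_const hneg)
    filter_upwards [ex, em, eK, eg, key1] with p h1 h2 h3 h4 h5 d hd hda hbal hprod
    have hda' : d * a < 1 / 2 * x * K (x, 0, μ) := by
      rw [abs_of_pos hK0] at hda
      exact hda.resolve_right (by simp)
    have hyp : 0 < p.2.1 := by
      -- The second equation solved for y: the product x K exceeds a constant larger than d a, so y
      -- is positive.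
      have e1 : p.2.1 * (p.1 * K p - d * a) = d * b * p.1 := by linear_combination hprod
      have e2 : 0 < p.1 * K p - d * a := by linarith
      exact pos_of_mul_pos_left (by rw [e1]; positivity) e2.le
    refine ⟨⟨h1, hyp⟩, h2, h5.resolve_right ?_⟩
    -- At a level μ ≥ 1 the first term of the balance would be nonpositive and the second negative.
    rintro ⟨-, -, h6, -⟩
    unfold balance at hbal
    have f1 : b * (p.1 * g (p.1, p.2.2)) ≤ 0 :=
      mul_nonpos_of_nonneg_of_nonpos hb.le (mul_nonpos_of_nonneg_of_nonpos h1.le h6)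
    have f2 : a * (p.2.1 * g (p.2.1, p.2.2)) < 0 :=
      mul_neg_of_pos_of_neg ha (mul_neg_of_pos_of_neg hyp h4)
    linarith
  · have hy0 : 0 < y := by rw [hyu]; exact hg.um_pos μ ⟨hμ, hI.2⟩
    have ey : ∀ᶠ p : ℝ × ℝ × ℝ in 𝓝 (x, y, μ), 0 < p.2.1 :=
      (by fun_prop : ContinuousAt (fun p : ℝ × ℝ × ℝ => p.2.1) (x, y, μ)).eventually_const_lt hy0
    have key2 : ∀ᶠ p : ℝ × ℝ × ℝ in 𝓝 (x, y, μ), μ = 1 → 1 ≤ p.2.2 → g (p.2.1, p.2.2) ≤ 0 ∧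
        (g (p.2.1, p.2.2) = 0 → (p.2.1, p.2.2) = (1, 1)) := by
      by_cases h1 : μ = 1
      · subst h1
        rw [hg.um_one] at hyu
        subst hyu
        filter_upwards [ty.eventually hg.eventually_fold_nonpos] with p h _ using h
      · exact Eventually.of_forall fun p h => absurd h h1
    filter_upwards [ex, em, ey, key1, key2] with p h1 h2 h3 h4 h5 d hd _ hbal hprod
    refine ⟨⟨h1, h3⟩, h2, h4.resolve_right ?_⟩
    rintro ⟨hμ1, h6, h7, h8⟩
    obtain ⟨h9, h10⟩ := h5 hμ1 h6
    unfold balance at hbal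
    have f1 : p.1 * g (p.1, p.2.2) ≤ 0 := mul_nonpos_of_nonneg_of_nonpos h1.le h7
    have f2 : p.2.1 * g (p.2.1, p.2.2) ≤ 0 := mul_nonpos_of_nonneg_of_nonpos h3.le h9
    have f3 : b * (p.1 * g (p.1, p.2.2)) ≤ 0 := mul_nonpos_of_nonneg_of_nonpos hb.le f1
    have f4 : a * (p.2.1 * g (p.2.1, p.2.2)) ≤ 0 := mul_nonpos_of_nonneg_of_nonpos ha.le f2
    have f5 : b * (p.1 * g (p.1, p.2.2)) = 0 := by linarith
    have f6 : a * (p.2.1 * g (p.2.1, p.2.2)) = 0 := by linarith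
    have f7 := (mul_eq_zero.1 ((mul_eq_zero.1 f5).resolve_left hb.ne')).resolve_left h1.ne'
    have f8 := (mul_eq_zero.1 ((mul_eq_zero.1 f6).resolve_left ha.ne')).resolve_left h3.ne'
    have g1 := h8 f7
    have g2 := h10 f8
    simp only [Prod.mk.injEq] at g1 g2
    -- For μ ≥ 1 only the fold point itself satisfies the balance, but there K = 0 while d > 0.
    have hpe : p = (1, 1, 1) := Prod.ext g1.1 (Prod.ext g2.1 g1.2)
    rw [hpe, hK.diag, hg.fold_u] at hprod
    simp only at hprod
    have : 0 < d * (b * 1 + a * 1) := by positivity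
    linarith

/-- A kernel vector of the linearization of `branchMap` is tangent to the equations and preserves
the angle to first order, so it vanishes by `regular_of_halfAB`. The velocity at d = 0 is itself
tangent and nonzero; the same lemma then gives μ' ≠ 0 for 0 < μ < 1. -/
theorem IsSingularParam.exists_regular (hg : Profile g um up) (hφ : IsCoordinate um up φ)
    (hK : IsDividedDifference g K) (hγ : IsSingularParam um up φ γ₀) (ha : 0 < a) (hb : 0 < b)
    {t₀ : ℝ} (hp : γ₀ t₀ ∈ halfAB um up) (hμ : 0 < (γ₀ t₀).2.2) :
    ∃ c, IsGoodBranch a b g K φ γ₀ t₀ c := by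
  have hreg : ∀ v, IsTangent a b g K (γ₀ t₀) v → _ := fun v hv =>
    hg.regular_of_halfAB hφ hK ha hb hp hμ (hγ.ray t₀) hv
  have hE := contDiff_branchMap (a := a) (b := b) hg.smooth hK.smooth hφ.smooth
  have hz : ∀ t, branchMap a b g K φ ((0, t), γ₀ t) = 0 := fun t => by
    obtain ⟨h1, h2⟩ := hg.branch_eq_of_singularCurve (a := a) (b := b) hK (hγ.mem t)
    exact branchMap_eq_zero.2 ⟨h1, by rw [h2, zero_mul], (onRay_iff.1 (hγ.ray t)).1⟩
  obtain ⟨c, hc0, hcs, hiff⟩ := exists_implicit (E := branchMap a b g K φ) (q₀ := ((0:ℝ), t₀))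
    (p₀ := γ₀ t₀) (Eventually.of_forall fun z => hE.contDiffAt) (hz t₀) (by
      intro v hv
      rw [fderiv_branchMap_right hg.smooth hK.smooth hφ.smooth, Prod.mk_eq_zero, Prod.mk_eq_zero] at hv
      exact (hreg v ⟨hv.1, hv.2.1⟩).1 hv.2.2)
  have hcc : ContinuousAt c (0, t₀) := hcs.self_of_nhds.continuousAt
  have hct : Tendsto c (𝓝 (0, t₀)) (𝓝 (γ₀ t₀)) := by have := hcc.tendsto; rwa [hc0] at this
  have hzt : Tendsto (fun q => (q, c q)) (𝓝 (0, t₀)) (𝓝 ((0, t₀), γ₀ t₀)) := by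
    have := (continuousAt_id (x := ((0:ℝ), t₀))).prodMk hcc
    rw [ContinuousAt, hc0] at this
    exact this
  have hmap : ∀ᶠ q in 𝓝 ((0:ℝ), t₀), branchMap a b g K φ (q, c q) = 0 := by
    filter_upwards [hzt.eventually hiff] with q hq using hq.2 rfl
  have ht0 : Tendsto (fun t : ℝ => ((0:ℝ), t)) (𝓝 t₀) (𝓝 (0, t₀)) :=
    (by fun_prop : Continuous fun t : ℝ => ((0:ℝ), t)).tendsto _
  have hcγ : ∀ᶠ t in 𝓝 t₀, c (0, t) = γ₀ t := by
    filter_upwards [(ht0.prodMk_nhds (hγ.cont.tendsto t₀)).eventually hiff] with t ht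
    exact (ht.1 (hz t)).symm
  have hW := (contDiff_planar hφ.smooth).continuous
  -- the ray condition is open
  have hray : ∀ᶠ z : (ℝ × ℝ) × (ℝ × ℝ × ℝ) in 𝓝 ((0, t₀), γ₀ t₀),
      0 < (planar φ z.2).2 * Real.sin (Real.pi * z.1.2) -
        (planar φ z.2).1 * Real.cos (Real.pi * z.1.2) := by
    have : Continuous fun z : (ℝ × ℝ) × (ℝ × ℝ × ℝ) => (planar φ z.2).2 * Real.sin (Real.pi * z.1.2) -
        (planar φ z.2).1 * Real.cos (Real.pi * z.1.2) := by
      have h1 : Continuous fun z : (ℝ × ℝ) × (ℝ × ℝ × ℝ) => planar φ z.2 := hW.comp continuous_snd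
      have h2 := h1.fst
      have h3 := h1.snd
      fun_prop
    exact this.continuousAt.eventually_const_lt (onRay_iff.1 (hγ.ray t₀)).2
  have hlev := hg.eventually_level hK ha hb hp hμ
  have hsmall : ∀ᶠ q in 𝓝 ((0:ℝ), t₀), q.1 * a < 1 / 2 * (γ₀ t₀).1 * |K (γ₀ t₀)| ∨
      (γ₀ t₀).2.1 ≠ 0 := by
    by_cases hy : (γ₀ t₀).2.1 = 0
    · have hK0 : (γ₀ t₀).1 * K (γ₀ t₀) = -g (0, (γ₀ t₀).2.2) := by
        have h1 := hK.sub_eq (γ₀ t₀).1 0 (γ₀ t₀).2.2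
        have h2 : g ((γ₀ t₀).1, (γ₀ t₀).2.2) = 0 := by
          rcases hp.2 with h | h | h <;> rw [h.1]
          · exact hg.zero_um _ hp.1
          · exact hg.zero_up _ hp.1
          · exact hg.zero_up _ hp.1
        rw [h2] at h1
        have h3 : γ₀ t₀ = ((γ₀ t₀).1, 0, (γ₀ t₀).2.2) := Prod.ext rfl (Prod.ext hy rfl)
        rw [← h3] at h1
        linear_combination -h1
      have hneg := hg.neg_zero (γ₀ t₀).2.2 ⟨hμ, hp.1.2⟩
      have hx : 0 < (γ₀ t₀).1 := by
        rcases hp.2 with h | h | h <;> rw [h.1]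
        · exact hg.um_pos _ ⟨hμ, hp.1.2⟩
        · exact hg.up_pos hp.1
        · exact hg.up_pos hp.1
      have hKp : 0 < K (γ₀ t₀) := pos_of_mul_pos_right (by rw [hK0]; linarith) hx.le
      have : ContinuousAt (fun q : ℝ × ℝ => q.1 * a) (0, t₀) := by fun_prop
      filter_upwards [this.eventually_lt_const
        (show (0:ℝ) * a < 1 / 2 * (γ₀ t₀).1 * |K (γ₀ t₀)| by
          rw [abs_of_pos hKp, zero_mul]; positivity)] with q hq using Or.inl hq
    · exact Eventually.of_forall fun q => Or.inr hy
  have hmem : ∀ᶠ q in posFilter t₀, (c q ∈ branchSet a b g K q.1 ∧ OnRay q.2 (planar φ (c q))) ∧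
      (c q).2.2 ∈ Ioo (0:ℝ) 1 := by
    filter_upwards [posFilter_le t₀ hmap, posFilter_le t₀ (hzt.eventually hray),
      posFilter_le t₀ (hct.eventually hlev), posFilter_le t₀ hsmall, eventually_pos_posFilter t₀]
      with q h1 h2 h3 h4 h5
    obtain ⟨e1, e2, e3⟩ := branchMap_eq_zero.1 h1
    obtain ⟨f1, f2⟩ := h3 q.1 h5 h4 e1 e2
    exact ⟨⟨⟨f1, e1, e2⟩, onRay_iff.2 ⟨e3, h2⟩⟩, f2⟩
  -- the curve at `d = 0`
  have hcs0 : ∀ᶠ t in 𝓝 t₀, ContDiffAt ℝ ∞ (fun s => c (0, s)) t := by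
    filter_upwards [ht0.eventually hcs] with t ht
    exact ht.comp t (by fun_prop)
  set v := deriv (fun s => c (0, s)) t₀ with hvdef
  have hvd : HasDerivAt (fun s => c (0, s)) v t₀ :=
    (hcs0.self_of_nhds.differentiableAt (by simp)).hasDerivAt
  have hv0 : v ≠ 0 := by
    refine velocity_ne_zero_of_onRay hφ.smooth hvd.differentiableAt ?_
    filter_upwards [hcγ] with s hs
    rw [hs]; exact hγ.ray s
  have hvT : IsTangent a b g K (γ₀ t₀) v := by
    constructor
    · have h1 := ((contDiff_balance (a := a) (b := b) hg.smooth).differentiable (by simp)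
        (c (0, t₀))).hasFDerivAt.comp_hasDerivAt t₀ hvd
      rw [hc0] at h1
      refine h1.unique ((hasDerivAt_const t₀ (0:ℝ)).congr_of_eventuallyEq ?_)
      filter_upwards [ht0.eventually hmap] with t ht using (branchMap_eq_zero.1 ht).1
    · have h2 := (hK.smooth.differentiable (by simp) (c (0, t₀))).hasFDerivAt.comp_hasDerivAt t₀ hvd
      have e1 : HasDerivAt (fun s => (c (0, s)).1) v.1 t₀ := hvd.fst
      have e2 : HasDerivAt (fun s => (c (0, s)).2.1) v.2.1 t₀ := hvd.snd.fst
      have h1 := (e1.mul e2).mul h2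
      have h3 := h1.unique ((hasDerivAt_const t₀ (0:ℝ)).congr_of_eventuallyEq (by
        filter_upwards [ht0.eventually hmap] with t ht
        have := (branchMap_eq_zero.1 ht).2.1
        simp only [zero_mul] at this
        exact this))
      simp only [Function.comp, Pi.mul_apply, hc0] at h3
      linear_combination h3
  have hμs : ∀ᶠ q in 𝓝 ((0:ℝ), t₀), ContDiffAt ℝ ∞ (fun q => (c q).2.2) q := by
    filter_upwards [hcs] with q hq using contDiffAt_snd.comp q (contDiffAt_snd.comp q hq)
  obtain ⟨s1, s2⟩ := eventually_slice_deriv hμs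
  have hxd : HasDerivAt (fun s => (c (0, s)).1) v.1 t₀ := hvd.fst
  have hmd : HasDerivAt (fun s => (c (0, s)).2.2) v.2.2 t₀ := hvd.snd.snd
  refine ⟨c, ⟨?_, hmem.mono fun q h => h.1, posFilter_le t₀ hcs, ?_⟩, hmem.mono fun q h => h.2,
    ?_, ?_, fun h => absurd h hμ.ne', fun _ => ⟨hcs, hcγ⟩⟩
  · exact hct.mono_left (posFilter_le t₀)
  · rw [nhds_prod_eq] at hiff
    obtain ⟨P, hP, V, hV, hPV⟩ := eventually_prod_iff.1 hiff
    refine ⟨{p | V p}, hV, ?_⟩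
    filter_upwards [posFilter_le t₀ hP] with q hq p hpV hpS hpR
    exact (hPV hq hpV).1 (branchMap_eq_zero.2 ⟨hpS.2.1, hpS.2.2, (onRay_iff.1 hpR).1⟩)
  · intro _ h1
    refine posFilter_le t₀ (s1.self_of_nhds.continuousAt.eventually_ne ?_)
    simp only
    rw [hmd.deriv]
    exact fun h => hv0 ((hreg v hvT).2.1 h1 h)
  · intro h1
    obtain ⟨hx1, hvμ, hv1⟩ := (hreg v hvT).2.2 h1
    have hv1' : v.1 ≠ 0 := fun h => hv0 (hv1 h)
    -- At d = 0 the parameter μ is `arcLevel` of the coordinate X of x. This coordinate passes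
    -- through 1 with X' ≠ 0, so the second derivative is -8 X'², and its sign persists for small d.
    suffices h : iteratedDeriv 2 (fun s => (c (0, s)).2.2) t₀ < 0 by
      filter_upwards [posFilter_le t₀ (s2.self_of_nhds.continuousAt.eventually_lt_const h)] with q hq _
        using hq
    set X : ℝ → ℝ := fun s => φ ((c (0, s)).1, (c (0, s)).2.2) with hX
    have hXs : ∀ᶠ t in 𝓝 t₀, ContDiffAt ℝ ∞ X t := by
      filter_upwards [hcs0] with t ht
      exact hφ.smooth.contDiffAt.comp t ((contDiffAt_fst.comp t ht).prodMk
        (contDiffAt_snd.comp t (contDiffAt_snd.comp t ht)))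
    have hX' : HasDerivAt X (v.1 * partialU φ (1, 1)) t₀ := by
      have := hasDerivAt_comp_pair (g := φ) (hφ.smooth.differentiable (by simp) _) hxd hmd
      refine this.congr_deriv ?_
      rw [hc0, hx1, h1, hvμ, zero_mul, add_zero]
    have hX1 : X t₀ = 1 := by simp only [hX, hc0, hx1, h1]; exact hφ.at_one hg
    have hmX : (fun s => (c (0, s)).2.2) =ᶠ[𝓝 t₀] fun s => arcLevel (X s) := by
      have hne : ∀ᶠ t in 𝓝 t₀, (γ₀ t).1 ≠ 0 :=
        (hγ.cont.fst.continuousAt).eventually_ne (by rw [hx1]; exact one_ne_zero)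
      filter_upwards [hcγ, hne] with t e1 e2
      simp only [hX, e1]
      exact (Profile.arcLevel_fst hφ (hγ.mem t) e2).symm
    have hdm : deriv (fun s => (c (0, s)).2.2) =ᶠ[𝓝 t₀]
        fun s => 4 * X s * (1 - X s ^ 2) * deriv X s := by
      filter_upwards [hmX.eventually_nhds, hXs] with s e1 e2
      rw [EventuallyEq.deriv_eq e1]
      have hd := (e2.differentiableAt (by simp)).hasDerivAt
      have := (((hd.pow 2).const_sub 1).pow 2).const_sub 1
      refine HasDerivAt.deriv (this.congr_deriv ?_)
      simp; ring
    have hXd : DifferentiableAt ℝ (deriv X) t₀ :=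
      (contDiffAt_deriv hXs.self_of_nhds).differentiableAt (by simp)
    rw [iteratedDeriv_succ, iteratedDeriv_one, hdm.deriv_eq]
    have := (((hX'.const_mul 4).mul ((hX'.pow 2).const_sub 1)).mul hXd.hasDerivAt).deriv
    rw [show deriv (fun s => 4 * X s * (1 - X s ^ 2) * deriv X s) t₀ = _ from this]
    simp only [hX1, hX'.deriv, Pi.pow_apply, Pi.mul_apply]
    have : 0 < (v.1 * partialU φ (1, 1)) ^ 2 := by
      have := mul_ne_zero hv1' hφ.pos_fold.ne'
      positivity
    norm_num
    nlinarith

end good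

/-! ### Two monotone equations in a small quadrant. -/

section cornerEquations

/-- A level set of a function that increases in both variables, parametrized continuously. -/
theorem exists_level_zero {D e : ℝ × ℝ → ℝ} {α₀ β₁ ε d : ℝ} (hα : α₀ ≤ ε) (hβ : β₁ ≤ ε)
    (hD : ContinuousOn D (Icc α₀ ε ×ˢ Icc β₁ ε)) (he : ContinuousOn e (Icc α₀ ε ×ˢ Icc β₁ ε))
    (hm : ∀ α ∈ Icc α₀ ε, StrictMonoOn (fun β => D (α, β)) (Icc β₁ ε))
    (hlow : ∀ α ∈ Icc α₀ ε, D (α, β₁) ≤ d) (hup : ∀ α ∈ Icc α₀ ε, d ≤ D (α, ε))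
    (h0 : ∀ β ∈ Icc β₁ ε, D (α₀, β) = d → e (α₀, β) ≤ 0)
    (h1 : ∀ β ∈ Icc β₁ ε, D (ε, β) = d → 0 ≤ e (ε, β)) :
    ∃ z ∈ Icc α₀ ε ×ˢ Icc β₁ ε, D z = d ∧ e z = 0 := by
  have hex : ∀ α ∈ Icc α₀ ε, ∃ β ∈ Icc β₁ ε, D (α, β) = d := by
    intro α hα
    have hc : ContinuousOn (fun β => D (α, β)) (Icc β₁ ε) :=
      hD.comp (by fun_prop) (fun β hβ => ⟨hα, hβ⟩)
    exact intermediate_value_Icc hβ hc ⟨hlow α hα, hup α hα⟩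
  choose f hf using hex
  let F : Icc α₀ ε → ℝ := fun α => f α α.2
  have hclamp : ∀ β, max β₁ (min β ε) ∈ Icc β₁ ε := fun β =>
    ⟨le_max_left _ _, max_le hβ (min_le_right _ _)⟩
  have hF : Continuous F := by
    have hC : Continuous fun x : Icc α₀ ε × ℝ => D (x.1, max β₁ (min x.2 ε)) :=
      hD.comp_continuous (by fun_prop) fun x => ⟨x.1.2, hclamp _⟩
    have hcl : ∀ β ∈ Icc β₁ ε, max β₁ (min β ε) = β := fun β hβ => by
      rw [min_eq_left hβ.2, max_eq_right hβ.1]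
    refine continuous_of_unique (isClosed_eq hC (continuous_const (y := d))) (isCompact_Icc (a := β₁) (b := ε))
      (fun t => (hf t t.2).1) (fun t => ?_) (fun t β hβ h => ?_)
    · change D (t, max β₁ (min (f t t.2) ε)) = d
      rw [hcl _ (hf t t.2).1]; exact (hf t t.2).2
    · change D (t, max β₁ (min β ε)) = d at h
      rw [hcl _ hβ] at h
      exact (hm t t.2).injOn hβ (hf t t.2).1 (h.trans (hf t t.2).2.symm)
  have hG : Continuous fun α : Icc α₀ ε => e (α, F α) :=
    he.comp_continuous (by fun_prop) fun α => ⟨α.2, (hf α α.2).1⟩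
  have : PreconnectedSpace (Icc α₀ ε) := Subtype.preconnectedSpace isPreconnected_Icc
  have a1 : α₀ ∈ Icc α₀ ε := ⟨le_rfl, hα⟩
  have a2 : ε ∈ Icc α₀ ε := ⟨hα, le_rfl⟩
  obtain ⟨α, hα0⟩ := mem_range_of_exists_le_of_exists_ge hG
    ⟨⟨α₀, a1⟩, h0 _ (hf _ a1).1 (hf _ a1).2⟩ ⟨⟨ε, a2⟩, h1 _ (hf _ a2).1 (hf _ a2).2⟩
  exact ⟨(α, F α), ⟨α.2, (hf α α.2).1⟩, (hf α α.2).2, hα0⟩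

theorem hasDerivAt_slice_fst {D : ℝ × ℝ → ℝ} {α β : ℝ} (h : DifferentiableAt ℝ D (α, β)) :
    HasDerivAt (fun α => D (α, β)) (partialU D (α, β)) α := fderiv_fst_eq h

theorem hasDerivAt_slice_snd {D : ℝ × ℝ → ℝ} {α β : ℝ} (h : DifferentiableAt ℝ D (α, β)) :
    HasDerivAt (fun β => D (α, β)) (partialM D (α, β)) β :=
  h.hasFDerivAt.comp_hasDerivAt β ((hasDerivAt_const β α).prodMk (hasDerivAt_id β))

theorem strictMonoOn_of_hasDerivAt {h h' : ℝ → ℝ} {s : Set ℝ} (hs : Convex ℝ s)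
    (hd : ∀ x ∈ s, HasDerivAt h (h' x) x) (hpos : ∀ x ∈ s, 0 < h' x) : StrictMonoOn h s :=
  strictMonoOn_of_deriv_pos hs (fun x hx => (hd x hx).continuousAt.continuousWithinAt)
    fun x hx => by rw [(hd x (interior_subset hx)).deriv]; exact hpos x (interior_subset hx)

/-- The equations `D(α, β) = d`, `e(α, β, t) = 0` near a corner. -/
theorem exists_corner {D : ℝ × ℝ → ℝ} {e : (ℝ × ℝ) × ℝ → ℝ} {ε C t₀ : ℝ} (hε : 0 < ε)
    (hD : ∀ z ∈ Ioo 0 ε ×ˢ Ioo 0 ε, ContDiffAt ℝ ∞ D z ∧ 0 < partialU D z ∧ 0 < partialM D z ∧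
      0 < D z ∧ D z ≤ C * z.1 * z.2)
    (he : ∀ᶠ w in 𝓝 (((0:ℝ), (0:ℝ)), t₀), ContDiffAt ℝ ∞ e w) (h0 : e ((0, 0), t₀) = 0)
    (hα : 0 < fderiv ℝ e ((0, 0), t₀) ((1, 0), 0)) (hβ : fderiv ℝ e ((0, 0), t₀) ((0, 1), 0) < 0) :
    ∃ h : ℝ × ℝ → ℝ × ℝ, Tendsto h (posFilter t₀) (𝓝 (0, 0)) ∧
      (∀ᶠ q in posFilter t₀, h q ∈ Ioo 0 ε ×ˢ Ioo 0 ε ∧ D (h q) = q.1 ∧ e (h q, q.2) = 0) ∧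
      (∀ᶠ q in posFilter t₀, ContDiffAt ℝ ∞ h q) ∧
      ∃ ε' > 0, ε' ≤ ε ∧ ∀ᶠ q in posFilter t₀, ∀ z ∈ Ioo 0 ε' ×ˢ Ioo 0 ε', D z = q.1 →
        e (z, q.2) = 0 → z = h q := by
  have hcf : ContinuousAt (fderiv ℝ e) ((0, 0), t₀) :=
    (he.self_of_nhds.fderiv_right (m := ∞) (by norm_cast)).continuousAt
  have hα' : ∀ᶠ w in 𝓝 (((0:ℝ), (0:ℝ)), t₀), 0 < fderiv ℝ e w ((1, 0), 0) :=
    (hcf.clm_apply continuousAt_const).eventually_const_lt hα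
  have hβ' : ∀ᶠ w in 𝓝 (((0:ℝ), (0:ℝ)), t₀), fderiv ℝ e w ((0, 1), 0) < 0 :=
    (hcf.clm_apply continuousAt_const).eventually_lt_const hβ
  obtain ⟨r, hr, hball⟩ := Metric.eventually_nhds_iff.1 (he.and (hα'.and hβ'))
  have hbox : ∀ α β t, |α| < r → |β| < r → |t - t₀| < r → ContDiffAt ℝ ∞ e ((α, β), t) ∧
      0 < fderiv ℝ e ((α, β), t) ((1, 0), 0) ∧ fderiv ℝ e ((α, β), t) ((0, 1), 0) < 0 := by
    intro α β t h1 h2 h3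
    refine hball ?_
    simp only [Prod.dist_eq, Real.dist_eq, sub_zero, max_lt_iff]
    exact ⟨⟨h1, h2⟩, h3⟩
  have hconv : Convex ℝ {x : ℝ | |x| < r} := by
    have : {x : ℝ | |x| < r} = Ioo (-r) r := by ext x; simp [abs_lt]
    rw [this]; exact convex_Ioo _ _
  have emα : ∀ β t, |β| < r → |t - t₀| < r → StrictMonoOn (fun α => e ((α, β), t)) {x | |x| < r} := by
    intro β t h2 h3
    refine strictMonoOn_of_hasDerivAt hconv (fun α h1 => ?_) (fun α h1 => (hbox α β t h1 h2 h3).2.1)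
    exact ((hbox α β t h1 h2 h3).1.differentiableAt (by simp)).hasFDerivAt.comp_hasDerivAt α
      (((hasDerivAt_id α).prodMk (hasDerivAt_const α β)).prodMk (hasDerivAt_const α t))
  have emβ : ∀ α t, |α| < r → |t - t₀| < r → StrictAntiOn (fun β => e ((α, β), t)) {x | |x| < r} := by
    intro α t h1 h3
    have : StrictMonoOn (fun β => -e ((α, β), t)) {x | |x| < r} := by
      refine strictMonoOn_of_hasDerivAt hconv (fun β h2 => ?_)
        (fun β h2 => neg_pos.2 (hbox α β t h1 h2 h3).2.2)
      exact (((hbox α β t h1 h2 h3).1.differentiableAt (by simp)).hasFDerivAt.comp_hasDerivAt β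
        (((hasDerivAt_const β α).prodMk (hasDerivAt_id β)).prodMk (hasDerivAt_const β t))).neg
    exact fun x hx y hy hxy => neg_lt_neg_iff.1 (this hx hy hxy)
  have dmα : ∀ β ∈ Ioo 0 ε, StrictMonoOn (fun α => D (α, β)) (Ioo 0 ε) := fun β hβ =>
    strictMonoOn_of_hasDerivAt (convex_Ioo _ _)
      (fun α hα => hasDerivAt_slice_fst ((hD (α, β) ⟨hα, hβ⟩).1.differentiableAt (by simp)))
      fun α hα => (hD (α, β) ⟨hα, hβ⟩).2.1
  have dmβ : ∀ α ∈ Ioo 0 ε, StrictMonoOn (fun β => D (α, β)) (Ioo 0 ε) := fun α hα =>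
    strictMonoOn_of_hasDerivAt (convex_Ioo _ _)
      (fun β hβ => hasDerivAt_slice_snd ((hD (α, β) ⟨hα, hβ⟩).1.differentiableAt (by simp)))
      fun β hβ => (hD (α, β) ⟨hα, hβ⟩).2.2.1
  have hC : 0 < C := by
    have h := hD (ε / 2, ε / 2) ⟨⟨by linarith, by linarith⟩, ⟨by linarith, by linarith⟩⟩
    have h1 := h.2.2.2.1.trans_le h.2.2.2.2
    simp only at h1
    have : 0 < C * (ε / 2 * (ε / 2)) := by linarith
    exact pos_of_mul_pos_left this (by positivity)
  set ε₁ := min ε r with hε₁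
  have hε₁0 : 0 < ε₁ := lt_min hε hr
  have inR : ∀ x ∈ Ioo 0 ε₁, |x| < r := fun x hx => by
    rw [abs_of_pos hx.1]; exact hx.2.trans_le (min_le_right _ _)
  have inE : ∀ x ∈ Ioo 0 ε₁, x ∈ Ioo 0 ε := fun x hx => ⟨hx.1, hx.2.trans_le (min_le_left _ _)⟩
  -- uniqueness
  have huniq : ∀ t, |t - t₀| < r → ∀ z ∈ Ioo 0 ε₁ ×ˢ Ioo 0 ε₁, ∀ z' ∈ Ioo 0 ε₁ ×ˢ Ioo 0 ε₁,
      D z = D z' → e (z, t) = 0 → e (z', t) = 0 → z = z' := by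
    intro t ht
    have key : ∀ z ∈ Ioo 0 ε₁ ×ˢ Ioo 0 ε₁, ∀ z' ∈ Ioo 0 ε₁ ×ˢ Ioo 0 ε₁,
        D z = D z' → e (z, t) = 0 → e (z', t) = 0 → ¬ z.1 < z'.1 := by
      rintro ⟨α, β⟩ ⟨h1, h2⟩ ⟨α', β'⟩ ⟨h1', h2'⟩ hDD e1 e2 hlt
      simp only at h1 h2 h1' h2' hlt
      -- On a level set of D the two variables move in opposite directions, and then e is strictly
      -- monotone; two zeros of e on one level set must coincide.
      rcases le_or_gt β β' with h | h
      · have f1 := dmα β (inE _ h2) (inE _ h1) (inE _ h1') hlt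
        have f2 := (dmβ α' (inE _ h1')).monotoneOn (inE _ h2) (inE _ h2') h
        simp only at f1 f2
        linarith
      · have f1 := emα β t (inR _ h2) ht (inR _ h1) (inR _ h1') hlt
        have f2 := emβ α' t (inR _ h1') ht (inR _ h2') (inR _ h2) h
        simp only at f1 f2
        linarith
    intro z hz z' hz' hDD e1 e2
    have hα := le_antisymm (not_lt.1 (key z' hz' z hz hDD.symm e2 e1)) (not_lt.1 (key z hz z' hz' hDD e1 e2))
    obtain ⟨α, β⟩ := z
    obtain ⟨α', β'⟩ := z'
    simp only at hα
    subst hα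
    exact Prod.ext rfl ((dmβ α (inE _ hz.1)).injOn (inE _ hz.2) (inE _ hz'.2) hDD)
  -- existence
  have hexist : ∀ ε' ∈ Ioo 0 ε₁, ∀ᶠ q in posFilter t₀, ∃ z ∈ Ioo 0 ε' ×ˢ Ioo 0 ε',
      D z = q.1 ∧ e (z, q.2) = 0 := by
    intro ε' hε'
    have hεR := inR _ hε'
    have hεE := inE _ hε'
    have z0 : |(0:ℝ)| < r := by simpa using hr
    have t0 : |t₀ - t₀| < r := by simpa using hr
    have p1 : 0 < e ((ε', 0), t₀) := by
      have := emα 0 t₀ z0 t0 z0 hεR hε'.1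
      simp only [h0] at this; exact this
    have p2 : e ((0, ε'), t₀) < 0 := by
      have := emβ 0 t₀ z0 t0 z0 hεR hε'.1
      simp only [h0] at this; exact this
    have c1 : ContinuousAt (fun w : ℝ × ℝ => e ((ε', w.1), w.2)) (0, t₀) :=
      ContinuousAt.comp (g := e) (f := fun w : ℝ × ℝ => ((ε', w.1), w.2))
        (hbox ε' 0 t₀ hεR z0 t0).1.continuousAt (by fun_prop)
    have c2 : ContinuousAt (fun w : ℝ × ℝ => e ((w.1, ε'), w.2)) (0, t₀) :=
      ContinuousAt.comp (g := e) (f := fun w : ℝ × ℝ => ((w.1, ε'), w.2))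
        (hbox 0 ε' t₀ z0 hεR t0).1.continuousAt (by fun_prop)
    obtain ⟨η, hη, hηb⟩ := Metric.eventually_nhds_iff.1
      ((c1.eventually_const_lt p1).and (c2.eventually_lt_const p2))
    have hηb' : ∀ β t, |β| < η → |t - t₀| < η → 0 < e ((ε', β), t) ∧ e ((β, ε'), t) < 0 := by
      intro β t h1 h2
      refine hηb (y := (β, t)) ?_
      simp only [Prod.dist_eq, Real.dist_eq, sub_zero, max_lt_iff]
      exact ⟨h1, h2⟩
    -- The level curve leaves the box through α = ε' and β = ε'. For d below D(ε', κ) and D(κ, ε')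
    -- the other coordinate is less than κ there, close enough to the axis for the sign of e to be
    -- known.
    obtain ⟨κ, hκ, hκη, hκε⟩ : ∃ κ > 0, κ < η ∧ κ < ε' :=
      ⟨min η ε' / 2, by have := lt_min hη hε'.1; linarith,
        by have := lt_min hη hε'.1; have := min_le_left η ε'; linarith,
        by have := lt_min hη hε'.1; have := min_le_right η ε'; linarith⟩
    have hκE : κ ∈ Ioo 0 ε := ⟨hκ, hκε.trans hεE.2⟩
    refine eventually_posFilter.2 ⟨min (min η r) (min (D (ε', κ)) (D (κ, ε'))),
      lt_min (lt_min hη hr) (lt_min (hD _ ⟨hεE, hκE⟩).2.2.2.1 (hD _ ⟨hκE, hεE⟩).2.2.2.1),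
      fun d hd t ht => ?_⟩
    have htη := ht.trans_le ((min_le_left _ _).trans (min_le_left _ _))
    have htr := ht.trans_le ((min_le_left _ _).trans (min_le_right _ _))
    have hd1 := hd.2.trans_le ((min_le_right _ _).trans (min_le_left _ _))
    have hd2 := hd.2.trans_le ((min_le_right _ _).trans (min_le_right _ _))
    have hd0 := hd.1
    -- The bound D ≤ C α β puts the line β = β₁ below the level d. The relevant part of the level
    -- curve then lies in a compact box away from the axes, where D need not be regular.
    obtain ⟨β₁, hβ₁, hβ₁κ, hβ₁d⟩ : ∃ β₁ > 0, β₁ < κ ∧ C * ε' * β₁ < d := by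
      refine ⟨min κ (d / (C * ε')) / 2, ?_, ?_, ?_⟩
      · have : 0 < min κ (d / (C * ε')) := lt_min hκ (by have := hε'.1; positivity)
        linarith
      · have : 0 < min κ (d / (C * ε')) := lt_min hκ (by have := hε'.1; positivity)
        have := min_le_left κ (d / (C * ε')); linarith
      · have h1 := min_le_right κ (d / (C * ε'))
        have h2 : 0 < C * ε' := mul_pos hC hε'.1
        have h3 : C * ε' * (d / (C * ε')) = d := mul_div_cancel₀ d h2.ne'
        nlinarith
    have hlow : ∀ α ∈ Ioc 0 ε', D (α, β₁) < d := by
      intro α hα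
      have h1 := (hD (α, β₁) ⟨⟨hα.1, hα.2.trans_lt hεE.2⟩, hβ₁, (hβ₁κ.trans hκε).trans hεE.2⟩).2.2.2.2
      have h2 : C * α * β₁ ≤ C * ε' * β₁ := by
        have := hα.2; gcongr
      simp only at h1
      linarith
    obtain ⟨α₀, hα₀, hα₀D⟩ : ∃ α₀ ∈ Icc β₁ κ, D (α₀, ε') = d := by
      have hc : ContinuousOn (fun α => D (α, ε')) (Icc β₁ κ) := fun α hα =>
        (hasDerivAt_slice_fst ((hD (α, ε') ⟨⟨hβ₁.trans_le hα.1, hα.2.trans_lt hκE.2⟩,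
          hεE⟩).1.differentiableAt (by simp))).continuousAt.continuousWithinAt
      refine intermediate_value_Icc hβ₁κ.le hc ⟨?_, hd2.le⟩
      have h1 := (hD (β₁, ε') ⟨⟨hβ₁, hβ₁κ.trans hκE.2⟩, hεE⟩).2.2.2.2
      simp only at h1 ⊢
      linarith [mul_right_comm C β₁ ε']
    have hsub : ∀ z ∈ Icc α₀ ε' ×ˢ Icc β₁ ε', z.1 ∈ Ioo 0 ε₁ ∧ z.2 ∈ Ioo 0 ε₁ := fun z hz =>
      ⟨⟨(hβ₁.trans_le hα₀.1).trans_le hz.1.1, hz.1.2.trans_lt hε'.2⟩,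
        hβ₁.trans_le hz.2.1, hz.2.2.trans_lt hε'.2⟩
    have hα₀ε : α₀ ≤ ε' := hα₀.2.trans hκε.le
    have hβ₁ε : β₁ ≤ ε' := (hβ₁κ.trans hκε).le
    obtain ⟨z, hz, hzD, hze⟩ := exists_level_zero (D := D) (e := fun z => e (z, t)) (d := d) hα₀ε hβ₁ε
      (fun z hz => (hD z ⟨inE _ (hsub z hz).1, inE _ (hsub z hz).2⟩).1.continuousAt.continuousWithinAt)
      (fun z hz => (ContinuousAt.comp (g := e) (f := fun z : ℝ × ℝ => (z, t))
        (hbox z.1 z.2 t (inR _ (hsub z hz).1) (inR _ (hsub z hz).2)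
        htr).1.continuousAt (by fun_prop)).continuousWithinAt)
      (fun α hα => (dmβ α (inE _ (hsub (α, ε') ⟨hα, hβ₁ε, le_rfl⟩).1)).mono fun β hβ =>
        inE _ (hsub (α, β) ⟨hα, hβ⟩).2)
      (fun α hα => (hlow α ⟨(hβ₁.trans_le hα₀.1).trans_le hα.1, hα.2⟩).le)
      (fun α hα => by
        rw [← hα₀D]
        exact (dmα ε' hεE).monotoneOn (inE _ (hsub (α₀, ε') ⟨⟨le_rfl, hα₀ε⟩, hβ₁ε, le_rfl⟩).1)
          (inE _ (hsub (α, ε') ⟨hα, hβ₁ε, le_rfl⟩).1) hα.1)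
      (fun β hβ hβD => by
        have : β = ε' := (dmβ α₀ (inE _ (hsub (α₀, ε') ⟨⟨le_rfl, hα₀ε⟩, hβ₁ε, le_rfl⟩).1)).injOn
          (inE _ (hsub (α₀, β) ⟨⟨le_rfl, hα₀ε⟩, hβ⟩).2) hεE (hβD.trans hα₀D.symm)
        rw [this]
        refine (hηb' α₀ t ?_ htη).2.le
        rw [abs_of_pos (hβ₁.trans_le hα₀.1)]; exact hα₀.2.trans_lt hκη)
      (fun β hβ hβD => by
        refine (hηb' β t ?_ htη).1.le
        rw [abs_of_pos (hβ₁.trans_le hβ.1)]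
        refine lt_trans ?_ hκη
        refine ((dmβ ε' hεE).lt_iff_lt (inE _ (hsub (ε', β) ⟨⟨hα₀ε, le_rfl⟩, hβ⟩).2) hκE).1 ?_
        simp only [hβD]; exact hd1)
    obtain ⟨α, β⟩ := z
    refine ⟨(α, β), ⟨⟨(hsub _ hz).1.1, lt_of_le_of_ne hz.1.2 ?_⟩, (hsub _ hz).2.1,
      lt_of_le_of_ne hz.2.2 ?_⟩, hzD, hze⟩
    · rintro rfl
      refine absurd hze (hηb' β t ?_ htη).1.ne'
      rw [abs_of_pos (hsub _ hz).2.1]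
      refine lt_trans ?_ hκη
      refine ((dmβ _ hεE).lt_iff_lt (inE _ (hsub _ hz).2) hκE).1 ?_
      simp only [hzD]; exact hd1
    · rintro rfl
      refine absurd hze (hηb' α t ?_ htη).2.ne
      rw [abs_of_pos (hsub _ hz).1.1]
      refine lt_trans ?_ hκη
      refine ((dmα _ hεE).lt_iff_lt (inE _ (hsub _ hz).1) hκE).1 ?_
      simp only [hzD]; exact hd2
  classical
  let P : ℝ × ℝ → ℝ × ℝ → Prop := fun q z => z ∈ Ioo 0 (ε₁ / 2) ×ˢ Ioo 0 (ε₁ / 2) ∧ D z = q.1 ∧ e (z, q.2) = 0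
  let h : ℝ × ℝ → ℝ × ℝ := fun q => if hq : ∃ z, P q z then hq.choose else (0, 0)
  have half_sub : ∀ δ ≤ ε₁, Ioo 0 δ ×ˢ Ioo 0 δ ⊆ Ioo 0 ε₁ ×ˢ Ioo 0 ε₁ := fun δ hδ =>
    prod_mono (Ioo_subset_Ioo_right hδ) (Ioo_subset_Ioo_right hδ)
  have hh : ∀ᶠ q in posFilter t₀, P q (h q) := by
    filter_upwards [hexist (ε₁ / 2) ⟨by linarith, by linarith⟩] with q hq
    have hq' : ∃ z, P q z := hq
    simp only [h, dif_pos hq']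
    exact hq'.choose_spec
  have hclose : ∀ᶠ q in posFilter t₀, |q.2 - t₀| < r :=
    (tendsto_snd_posFilter t₀).eventually (by
      have := Metric.ball_mem_nhds t₀ hr
      filter_upwards [this] with t ht
      rwa [Metric.mem_ball, Real.dist_eq] at ht)
  have hu : ∀ᶠ q in posFilter t₀, ∀ z ∈ Ioo 0 ε₁ ×ˢ Ioo 0 ε₁, D z = q.1 → e (z, q.2) = 0 → z = h q := by
    filter_upwards [hh, hclose] with q h1 h2 z hz hzD hze
    exact huniq q.2 h2 z hz _ (half_sub _ (by linarith) h1.1) (hzD.trans h1.2.1.symm) hze h1.2.2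
  refine ⟨h, ?_, ?_, ?_, ε₁, hε₁0, min_le_left _ _, hu⟩
  · rw [Metric.tendsto_nhds]
    intro δ hδ
    have hm : 0 < min δ ε₁ := lt_min hδ hε₁0
    filter_upwards [hexist (min δ ε₁ / 2) ⟨by linarith, by linarith [min_le_right δ ε₁]⟩, hu]
      with q h1 h2
    obtain ⟨z, hz, hzD, hze⟩ := h1
    rw [← h2 z (half_sub _ (by linarith [min_le_right δ ε₁]) hz) hzD hze]
    simp only [Prod.dist_eq, Real.dist_eq, sub_zero, max_lt_iff]
    rw [abs_of_pos hz.1.1, abs_of_pos hz.2.1]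
    have := min_le_left δ ε₁
    exact ⟨by linarith [hz.1.2], by linarith [hz.2.2]⟩
  · filter_upwards [hh] with q hq
    exact ⟨⟨inE _ (half_sub _ (by linarith) hq.1).1, inE _ (half_sub _ (by linarith) hq.1).2⟩, hq.2⟩
  · filter_upwards [hh, hclose, eventually_nhds_of_posFilter hu] with q h1 h2 h3
    obtain ⟨hz, hzD, hze⟩ := h1
    have hz1 := half_sub _ (by linarith) hz
    have hopen : IsOpen (Ioo 0 ε₁ ×ˢ Ioo 0 ε₁) := isOpen_Ioo.prod isOpen_Ioo
    have hDs : ∀ z ∈ Ioo 0 ε₁ ×ˢ Ioo 0 ε₁, ContDiffAt ℝ ∞ D z := fun z hz =>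
      (hD z ⟨inE _ hz.1, inE _ hz.2⟩).1
    have hes : ∀ z ∈ Ioo 0 ε₁ ×ˢ Ioo 0 ε₁, ∀ t, |t - t₀| < r → ContDiffAt ℝ ∞ e (z, t) :=
      fun z hz t ht => (hbox z.1 z.2 t (inR _ hz.1) (inR _ hz.2) ht).1
    let E : (ℝ × ℝ) × (ℝ × ℝ) → ℝ × ℝ := fun w => (D w.2 - w.1.1, e (w.2, w.1.2))
    have hopen2 : IsOpen {w : (ℝ × ℝ) × (ℝ × ℝ) | w.2 ∈ Ioo 0 ε₁ ×ˢ Ioo 0 ε₁ ∧ |w.1.2 - t₀| < r} :=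
      (hopen.preimage continuous_snd).inter
        (isOpen_lt (f := fun w : (ℝ × ℝ) × (ℝ × ℝ) => |w.1.2 - t₀|) (by fun_prop) continuous_const)
    have hEs : ∀ᶠ w in 𝓝 (q, h q), ContDiffAt ℝ ∞ E w := by
      filter_upwards [hopen2.mem_nhds (show (q, h q) ∈ _ from ⟨hz1, h2⟩)] with w hw
      refine ContDiffAt.prodMk (((hDs w.2 hw.1).comp w contDiffAt_snd).sub (by fun_prop)) ?_
      exact ContDiffAt.comp (g := e) (f := fun w : (ℝ × ℝ) × (ℝ × ℝ) => (w.2, w.1.2)) w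
        (hes w.2 hw.1 w.1.2 hw.2) (by fun_prop)
    obtain ⟨c, hc0, hcs, hiff⟩ := exists_implicit hEs (by simp [E, hzD, hze]) (by
      intro v hv
      have hline : HasDerivAt (fun s : ℝ => h q + s • v) v 0 :=
        (((hasDerivAt_id (0:ℝ)).smul_const v).const_add (h q)).congr_deriv (by simp)
      have d1 := (((hDs _ hz1).differentiableAt (by simp)).hasFDerivAt)
      have d2 := (((hes _ hz1 q.2 h2).differentiableAt (by simp)).hasFDerivAt)
      have hE' : HasDerivAt (fun s : ℝ => E ((q, h q) + s • ((0 : ℝ × ℝ), v)))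
          (fderiv ℝ D (h q) v, fderiv ℝ e (h q, q.2) (v, 0)) 0 := by
        have d1' : HasFDerivAt D (fderiv ℝ D (h q)) (h q + (0:ℝ) • v) := by simpa using d1
        have d2' : HasFDerivAt e (fderiv ℝ e (h q, q.2)) (h q + (0:ℝ) • v, q.2) := by simpa using d2
        have k1 := (d1'.comp_hasDerivAt 0 hline).sub_const q.1
        have k2 := d2'.comp_hasDerivAt 0 (hline.prodMk (hasDerivAt_const (0:ℝ) q.2))
        refine (k1.prodMk k2).congr_of_eventuallyEq (Eventually.of_forall fun s => ?_)
        simp [E]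
      rw [fderiv_eq_of_line (hEs.self_of_nhds.differentiableAt (by simp)) hE', Prod.mk_eq_zero] at hv
      obtain ⟨v1, v2⟩ := v
      have k1 : v1 * partialU D (h q) + v2 * partialM D (h q) = 0 := by
        rw [← fderiv_pair]; exact hv.1
      have k2 : v1 * fderiv ℝ e (h q, q.2) ((1, 0), 0) + v2 * fderiv ℝ e (h q, q.2) ((0, 1), 0) = 0 := by
        have := hv.2
        rw [show (((v1, v2) : ℝ × ℝ), (0:ℝ)) = v1 • (((1:ℝ), (0:ℝ)), (0:ℝ)) +
          v2 • (((0:ℝ), (1:ℝ)), (0:ℝ)) by simp, map_add, map_smul, map_smul] at this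
        exact this
      obtain ⟨-, f1, f2, -⟩ := hD (h q) ⟨inE _ hz1.1, inE _ hz1.2⟩
      obtain ⟨-, f3, f4⟩ := hbox (h q).1 (h q).2 q.2 (inR _ hz1.1) (inR _ hz1.2) h2
      change 0 < fderiv ℝ e (h q, q.2) ((1, 0), 0) at f3
      change fderiv ℝ e (h q, q.2) ((0, 1), 0) < 0 at f4
      set A := partialU D (h q)
      set B := partialM D (h q)
      set A' := fderiv ℝ e (h q, q.2) ((1, 0), 0)
      set B' := fderiv ℝ e (h q, q.2) ((0, 1), 0)
      -- The opposite monotonicities of D and e fix the sign of the Jacobian determinant, so the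
      -- implicit function theorem applies.
      have hdet : A * B' - B * A' < 0 := by nlinarith
      have w1 : v1 * (A * B' - B * A') = 0 := by linear_combination B' * k1 - B * k2
      have w2 : v2 * (A * B' - B * A') = 0 := by linear_combination A * k2 - A' * k1
      exact Prod.ext ((mul_eq_zero.1 w1).resolve_right hdet.ne) ((mul_eq_zero.1 w2).resolve_right hdet.ne))
    have hcc := hcs.self_of_nhds.continuousAt
    have hE0 : ∀ᶠ q' in 𝓝 q, E (q', c q') = 0 := by
      have : Tendsto (fun q' => (q', c q')) (𝓝 q) (𝓝 (q, h q)) := by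
        have := (continuousAt_id (x := q)).prodMk hcc
        rw [ContinuousAt, hc0] at this
        exact this
      filter_upwards [this.eventually hiff] with q' hq' using hq'.2 rfl
    refine hcs.self_of_nhds.congr_of_eventuallyEq ?_
    have hct : ∀ᶠ q' in 𝓝 q, c q' ∈ Ioo 0 ε₁ ×ˢ Ioo 0 ε₁ :=
      hcc.eventually (hopen.mem_nhds (by rw [hc0]; exact hz1))
    filter_upwards [h3, hE0, hct] with q' k1 k2 k3
    simp only [E, Prod.mk_eq_zero, sub_eq_zero] at k2
    exact (k1 _ k3 k2.1 k2.2).symm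

end cornerEquations

/-! ### Convexity along integral curves, and the corner at u₊(0). -/

section cornerBranch

variable {g φ : ℝ × ℝ → ℝ} {K : ℝ × ℝ × ℝ → ℝ} {a b : ℝ} {um up : ℝ → ℝ}
  {γ₀ : ℝ → ℝ × ℝ × ℝ}

/-- The derivative along a vector field. -/
noncomputable def fieldDeriv (Θ : ℝ × ℝ → ℝ × ℝ) (f : ℝ × ℝ → ℝ) (z : ℝ × ℝ) : ℝ := fderiv ℝ f z (Θ z)

theorem contDiffAt_fieldDeriv {Θ : ℝ × ℝ → ℝ × ℝ} {f : ℝ × ℝ → ℝ} {z : ℝ × ℝ} (hΘ : ContDiffAt ℝ ∞ Θ z)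
    (hf : ContDiffAt ℝ ∞ f z) : ContDiffAt ℝ ∞ (fieldDeriv Θ f) z :=
  (hf.fderiv_right (m := ∞) (by norm_cast)).clm_apply hΘ

theorem fieldDeriv_congr {Θ : ℝ × ℝ → ℝ × ℝ} {f f' : ℝ × ℝ → ℝ} {z : ℝ × ℝ} (h : f =ᶠ[𝓝 z] f') :
    fieldDeriv Θ f =ᶠ[𝓝 z] fieldDeriv Θ f' := by
  filter_upwards [h.eventuallyEq_nhds] with w hw
  rw [fieldDeriv, fieldDeriv, hw.fderiv_eq]

theorem fieldDeriv_add {Θ : ℝ × ℝ → ℝ × ℝ} {f f' : ℝ × ℝ → ℝ} {z : ℝ × ℝ} (h : DifferentiableAt ℝ f z)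
    (h' : DifferentiableAt ℝ f' z) : fieldDeriv Θ (fun w => f w + f' w) z = fieldDeriv Θ f z + fieldDeriv Θ f' z := by
  simp only [fieldDeriv]
  rw [show fderiv ℝ (fun w => f w + f' w) z = _ from (h.hasFDerivAt.add h'.hasFDerivAt).fderiv]
  rfl

theorem fieldDeriv_mul {Θ : ℝ × ℝ → ℝ × ℝ} {f f' : ℝ × ℝ → ℝ} {z : ℝ × ℝ} (h : DifferentiableAt ℝ f z)
    (h' : DifferentiableAt ℝ f' z) :
    fieldDeriv Θ (fun w => f w * f' w) z = f z * fieldDeriv Θ f' z + f' z * fieldDeriv Θ f z := by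
  simp only [fieldDeriv]
  rw [show fderiv ℝ (fun w => f w * f' w) z = _ from (h.hasFDerivAt.mul h'.hasFDerivAt).fderiv]
  simp

/-- The second derivative along an integral curve of a vector field, up to parametrization. -/
theorem iteratedDeriv_pos_of_fieldDeriv {Θ : ℝ × ℝ → ℝ × ℝ} {M : ℝ × ℝ → ℝ} {z : ℝ → ℝ × ℝ} {τ : ℝ → ℝ}
    {t : ℝ} (hΘ : ContDiffAt ℝ ∞ Θ (z t)) (hM : ContDiffAt ℝ ∞ M (z t))
    (hz : ∀ᶠ s in 𝓝 t, HasDerivAt z (τ s • Θ (z s)) s) (hτ : DifferentiableAt ℝ τ t)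
    (hτ0 : τ t ≠ 0) (hpos : 0 < fieldDeriv Θ (fieldDeriv Θ M) (z t)) (h0 : deriv (fun s => M (z s)) t = 0) :
    0 < iteratedDeriv 2 (fun s => M (z s)) t := by
  have hzt := hz.self_of_nhds
  have hMd : ∀ᶠ w in 𝓝 (z t), DifferentiableAt ℝ M w := by
    filter_upwards [(hM.of_le (m := 1) (by norm_cast)).eventually (by simp)] with w hw
    exact hw.differentiableAt (by simp)
  have key : ∀ {F : ℝ × ℝ → ℝ} {s : ℝ}, DifferentiableAt ℝ F (z s) →
      HasDerivAt z (τ s • Θ (z s)) s → HasDerivAt (fun s => F (z s)) (τ s * fieldDeriv Θ F (z s)) s := by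
    intro F s hF hz
    refine (hF.hasFDerivAt.comp_hasDerivAt s hz).congr_deriv ?_
    rw [map_smul, smul_eq_mul, fieldDeriv]
  have h1 : deriv (fun s => M (z s)) =ᶠ[𝓝 t] fun s => τ s * fieldDeriv Θ M (z s) := by
    filter_upwards [hz, hzt.continuousAt.eventually hMd] with s h1 h2 using (key h2 h1).deriv
  have hl : fieldDeriv Θ M (z t) = 0 := by
    rw [h1.self_of_nhds] at h0
    exact (mul_eq_zero.1 h0).resolve_left hτ0
  rw [iteratedDeriv_succ, iteratedDeriv_one, h1.deriv_eq]
  -- At a critical point the term with τ' drops out, and τ² times the second derivative along the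
  -- field remains.
  have h2 := hτ.hasDerivAt.mul (key ((contDiffAt_fieldDeriv hΘ hM).differentiableAt (by simp)) hzt)
  rw [show deriv (fun s => τ s * fieldDeriv Θ M (z s)) t = _ from h2.deriv, hl]
  have : 0 < τ t * τ t := mul_self_pos.2 hτ0
  nlinarith

/-- Solutions near a corner have `μ > 0`, and `μ` is convex at its critical points along curves of
solutions. -/
def IsConvexCorner (a b : ℝ) (g : ℝ × ℝ → ℝ) (K : ℝ × ℝ × ℝ → ℝ) (p₀ : ℝ × ℝ × ℝ) : Prop :=
  ∀ᶠ p in 𝓝 p₀, ∀ d, 0 < d → p ∈ branchSet a b g K d → 0 < p.2.2 ∧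
    ∀ (σ : ℝ → ℝ × ℝ × ℝ) (t : ℝ), σ t = p → ContDiffAt ℝ ∞ σ t →
      (∀ᶠ s in 𝓝 t, σ s ∈ branchSet a b g K d) → deriv σ t ≠ 0 →
      deriv (fun s => (σ s).2.2) t = 0 → 0 < iteratedDeriv 2 (fun s => (σ s).2.2) t

/-- The curves t ↦ c(d, t) are regular because t is their angle, so the convexity statement applies
to them. -/
theorem IsConvexCorner.isGoodBranch (hφ : ContDiff ℝ ∞ φ) {t₀ : ℝ} {c : ℝ × ℝ → ℝ × ℝ × ℝ}
    (h : IsConvexCorner a b g K (γ₀ t₀)) (h0 : (γ₀ t₀).2.2 = 0)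
    (hc : IsLocalBranch (branchSet a b g K) (planar φ) t₀ (γ₀ t₀) c) :
    IsGoodBranch a b g K φ γ₀ t₀ c := by
  have hlt : ∀ᶠ p : ℝ × ℝ × ℝ in 𝓝 (γ₀ t₀), p.2.2 < 1 :=
    (by fun_prop : ContinuousAt (fun p : ℝ × ℝ × ℝ => p.2.2) (γ₀ t₀)).eventually_lt_const
      (by simp only [h0]; exact one_pos)
  refine ⟨hc, ?_, fun h => absurd h0 h.ne', fun h => by rw [h0] at h; exact absurd h zero_ne_one,
    fun _ => ?_, fun h => absurd h0 h⟩
  · filter_upwards [hc.tendsto.eventually h, hc.tendsto.eventually hlt, hc.mem,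
      eventually_pos_posFilter t₀] with q h1 h2 h3 h4
    exact ⟨(h1 q.1 h4 h3.1).1, h2⟩
  · filter_upwards [hc.tendsto.eventually h, eventually_nhds_of_posFilter hc.mem, hc.smooth,
      eventually_pos_posFilter t₀] with q h1 h3 h5 h4 hd
    have hq : ContDiffAt ℝ ∞ (fun s => c (q.1, s)) q.2 := ContDiffAt.comp (g := c) (f := fun s => (q.1, s)) q.2 h5 (by fun_prop)
    have ht : Tendsto (fun s : ℝ => (q.1, s)) (𝓝 q.2) (𝓝 q) :=
      (by fun_prop : Continuous fun s : ℝ => (q.1, s)).tendsto _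
    refine (h1 q.1 h4 h3.self_of_nhds.1).2 (fun s => c (q.1, s)) q.2 rfl hq ?_ ?_ hd
    · filter_upwards [ht.eventually h3] with s hs using hs.1
    · refine velocity_ne_zero_of_onRay hφ (hq.differentiableAt (by simp)) ?_
      filter_upwards [ht.eventually h3] with s hs using hs.2

/-- Transfers `exists_corner` to solutions: P is a chart of all solutions near the corner, D is the
value of d in this chart, and e is the angular equation. The chart need not be smooth up to the edge
of the quadrant. -/
theorem exists_localBranch_of_corner {Sol : ℝ → Set (ℝ × ℝ × ℝ)} {t₀ : ℝ} {p₀ : ℝ × ℝ × ℝ}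
    (hφ : ContDiff ℝ ∞ φ) (hray : OnRay t₀ (planar φ p₀))
    {P : ℝ × ℝ → ℝ × ℝ × ℝ} {D : ℝ × ℝ → ℝ} {e : (ℝ × ℝ) × ℝ → ℝ} {ε C : ℝ} (hε : 0 < ε)
    (hD : ∀ z ∈ Ioo 0 ε ×ˢ Ioo 0 ε, ContDiffAt ℝ ∞ D z ∧ 0 < partialU D z ∧ 0 < partialM D z ∧
      0 < D z ∧ D z ≤ C * z.1 * z.2)
    (he : ∀ᶠ w in 𝓝 (((0:ℝ), (0:ℝ)), t₀), ContDiffAt ℝ ∞ e w) (h0 : e ((0, 0), t₀) = 0)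
    (hα : 0 < fderiv ℝ e ((0, 0), t₀) ((1, 0), 0)) (hβ : fderiv ℝ e ((0, 0), t₀) ((0, 1), 0) < 0)
    (hP : Tendsto P (𝓝[Ioo 0 ε ×ˢ Ioo 0 ε] (0, 0)) (𝓝 p₀))
    (hPs : ∀ z ∈ Ioo 0 ε ×ˢ Ioo 0 ε, ContDiffAt ℝ ∞ P z)
    (hSol : ∀ z ∈ Ioo 0 ε ×ˢ Ioo 0 ε, P z ∈ Sol (D z))
    (heP : ∀ z ∈ Ioo 0 ε ×ˢ Ioo 0 ε, ∀ t, e (z, t) = rayDefect φ t (P z))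
    (hinv : ∀ ε' > 0, ε' ≤ ε → ∀ᶠ p in 𝓝 p₀, ∀ d, 0 < d → p ∈ Sol d →
      ∃ z ∈ Ioo 0 ε' ×ˢ Ioo 0 ε', P z = p ∧ D z = d) :
    ∃ c, IsLocalBranch Sol (planar φ) t₀ p₀ c := by
  obtain ⟨h, ht, hm, hs, ε', hε', hε'ε, hu⟩ := exists_corner hε hD he h0 hα hβ
  have htw : Tendsto h (posFilter t₀) (𝓝[Ioo 0 ε ×ˢ Ioo 0 ε] (0, 0)) :=
    tendsto_nhdsWithin_iff.2 ⟨ht, hm.mono fun q hq => hq.1⟩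
  have hT := hP.comp htw
  have hW := (contDiff_planar hφ).continuous
  have hpos : ∀ᶠ w : ℝ × ℝ × ℝ × ℝ in 𝓝 (t₀, p₀),
      0 < (planar φ w.2).2 * Real.sin (Real.pi * w.1) - (planar φ w.2).1 * Real.cos (Real.pi * w.1) := by
    have : Continuous fun w : ℝ × ℝ × ℝ × ℝ =>
        (planar φ w.2).2 * Real.sin (Real.pi * w.1) - (planar φ w.2).1 * Real.cos (Real.pi * w.1) := by
      have h1 : Continuous fun z : ℝ × ℝ × ℝ × ℝ => planar φ z.2 := hW.comp continuous_snd
      have h2 := h1.fst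
      have h3 := h1.snd
      fun_prop
    exact this.continuousAt.eventually_const_lt (onRay_iff.1 hray).2
  refine ⟨P ∘ h, hT, ?_, ?_, ?_⟩
  · filter_upwards [hm, ((tendsto_snd_posFilter t₀).prodMk_nhds hT).eventually hpos] with q h1 h2
    refine ⟨?_, onRay_iff.2 ⟨?_, h2⟩⟩
    · have := hSol _ h1.1
      rwa [h1.2.1] at this
    · have := heP _ h1.1 q.2
      rw [h1.2.2] at this
      exact this.symm
  · filter_upwards [hs, hm] with q h1 h2
    exact (hPs _ h2.1).comp q h1
  · refine ⟨_, hinv ε' hε' hε'ε, ?_⟩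
    filter_upwards [hu, eventually_pos_posFilter t₀] with q h1 h2 p hp hpS hpR
    obtain ⟨z, hz, rfl, hzD⟩ := hp q.1 h2 hpS
    rw [Function.comp, ← h1 z hz hzD ?_]
    rw [heP z ⟨Ioo_subset_Ioo_right hε'ε hz.1, Ioo_subset_Ioo_right hε'ε hz.2⟩]
    exact (onRay_iff.1 hpR).1

/-! ### The corner at the upper branch -/

/-- With q = d / y the equation of the second block can be divided by y; both equations then make
sense at y = 0, with y and q as independent parameters. -/
theorem branchSet_iff_quotient (hK : IsDividedDifference g K) (hb : 0 < b) (ha : 0 < a)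
    {x y μ d : ℝ} (hx : 0 < x) (hy : 0 < y) : (x, y, μ) ∈ branchSet a b g K d ∧ x ≠ y ↔
      x ≠ y ∧ x * g (x, μ) + a * (d / y) * y * (y - x) = 0 ∧ g (y, μ) + b * (d / y) * (x - y) = 0 := by
  have h := hK.sub_eq x y μ
  have hq : d = y * (d / y) := by field_simp
  set q := d / y
  simp only [branchSet, balance, mem_ofPred_eq]
  have hbx : 0 < b * x + a * y := by positivity
  constructor
  · rintro ⟨⟨-, h1, h2⟩, hne⟩
    have h3 : g (y, μ) + b * q * (x - y) = 0 := by
      have : y * (b * x + a * y) * (g (y, μ) + b * q * (x - y)) = 0 := by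
        linear_combination y * h1 - b * (x - y) * h2 - b * x * y * h - b * (b * x + a * y) * (x - y) * hq
      exact (mul_eq_zero.1 this).resolve_left (by positivity)
    refine ⟨hne, ?_, h3⟩
    have : b * (x * g (x, μ) + a * q * y * (y - x)) = 0 := by
      linear_combination h1 - a * y * h3
    exact (mul_eq_zero.1 this).resolve_left hb.ne'
  · rintro ⟨hne, h1, h2⟩
    refine ⟨⟨⟨hx, hy⟩, by linear_combination b * h1 + a * y * h2, ?_⟩, hne⟩
    have : (x - y) * (x * y * K (x, y, μ) - d * (b * x + a * y)) = 0 := by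
      linear_combination (-(x * y)) * h + y * h1 - x * y * h2 - (b * x + a * y) * (x - y) * hq
    exact sub_eq_zero.1 ((mul_eq_zero.1 this).resolve_left (sub_ne_zero.2 hne))

theorem eventually_box {ε : ℝ} (hε : 0 < ε) :
    ∀ᶠ z : ℝ × ℝ in 𝓝 (0, 0), 0 < z.1 → 0 < z.2 → z ∈ Ioo 0 ε ×ˢ Ioo 0 ε := by
  have h1 : ∀ᶠ z : ℝ × ℝ in 𝓝 (0, 0), z.1 < ε := continuousAt_fst.eventually_lt_const hε
  have h2 : ∀ᶠ z : ℝ × ℝ in 𝓝 (0, 0), z.2 < ε := continuousAt_snd.eventually_lt_const hε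
  filter_upwards [h1, h2] with z h1 h2 h3 h4 using ⟨⟨h3, h1⟩, h4, h2⟩

theorem exists_box {Q : ℝ × ℝ → Prop} (h : ∀ᶠ z in 𝓝 ((0:ℝ), (0:ℝ)), Q z) :
    ∃ ε > 0, ∀ z ∈ Ioo 0 ε ×ˢ Ioo 0 ε, Q z := by
  obtain ⟨r, hr, h⟩ := Metric.eventually_nhds_iff.1 h
  refine ⟨r, hr, fun z hz => h ?_⟩
  simp only [Prod.dist_eq, Real.dist_eq, sub_zero, max_lt_iff]
  exact ⟨by rw [abs_of_pos hz.1.1]; exact hz.1.2, by rw [abs_of_pos hz.2.1]; exact hz.2.2⟩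

/-- The two scaled equations near the upper corner, in the unknowns `(x, μ)` and with parameters
`(y, d / y)`. -/
def cornerMap (a b : ℝ) (g : ℝ × ℝ → ℝ) (w : (ℝ × ℝ) × (ℝ × ℝ)) : ℝ × ℝ :=
  (w.2.1 * g (w.2.1, w.2.2) + a * w.1.2 * w.1.1 * (w.1.1 - w.2.1),
    g (w.1.1, w.2.2) + b * w.1.2 * (w.2.1 - w.1.1))

theorem contDiff_cornerMap (hg : ContDiff ℝ ∞ g) : ContDiff ℝ ∞ (cornerMap a b g) := by
  have h1 : ContDiff ℝ ∞ fun w : (ℝ × ℝ) × (ℝ × ℝ) => g (w.2.1, w.2.2) := hg.comp (by fun_prop)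
  have h2 : ContDiff ℝ ∞ fun w : (ℝ × ℝ) × (ℝ × ℝ) => g (w.1.1, w.2.2) := hg.comp (by fun_prop)
  unfold cornerMap
  fun_prop

/-- The Euler-type field that is tangent to the level sets of `y q`. -/
def hyperbolicField (z : ℝ × ℝ) : ℝ × ℝ := (z.1, -z.2)

theorem contDiff_hyperbolicField : ContDiff ℝ ∞ hyperbolicField := by
  unfold hyperbolicField; fun_prop

theorem fieldDeriv_hyperbolic_origin (f : ℝ × ℝ → ℝ) :
    fieldDeriv hyperbolicField f (0, 0) = 0 := by
  simp only [fieldDeriv, hyperbolicField, neg_zero]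
  exact map_zero _

theorem fieldDeriv_hyperbolic_fst (z : ℝ × ℝ) : fieldDeriv hyperbolicField Prod.fst z = z.1 := by
  simp [fieldDeriv, hyperbolicField, fderiv_fst]

theorem fieldDeriv_hyperbolic_snd (z : ℝ × ℝ) : fieldDeriv hyperbolicField Prod.snd z = -z.2 := by
  simp [fieldDeriv, hyperbolicField, fderiv_snd]

/-- Convexity of `y² k + q L` along the hyperbolic field. -/
theorem eventually_hyperbolic_convex {M k L : ℝ × ℝ → ℝ}
    (hk : ∀ᶠ z in 𝓝 ((0:ℝ), (0:ℝ)), ContDiffAt ℝ ∞ k z)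
    (hL : ∀ᶠ z in 𝓝 ((0:ℝ), (0:ℝ)), ContDiffAt ℝ ∞ L z)
    (hM : ∀ᶠ z in 𝓝 ((0:ℝ), (0:ℝ)), M z = z.1 ^ 2 * k z + z.2 * L z)
    (hk0 : 0 < k (0, 0)) (hL0 : 0 < L (0, 0)) :
    ∀ᶠ z in 𝓝 ((0:ℝ), (0:ℝ)), 0 < z.1 → 0 < z.2 →
      0 < fieldDeriv hyperbolicField (fieldDeriv hyperbolicField M) z := by
  set H := hyperbolicField
  have hH : ∀ z, ContDiffAt ℝ ∞ H z := fun z => contDiff_hyperbolicField.contDiffAt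
  have dfst : ∀ z : ℝ × ℝ, DifferentiableAt ℝ (Prod.fst : ℝ × ℝ → ℝ) z := fun z => differentiableAt_fst
  have dsnd : ∀ z : ℝ × ℝ, DifferentiableAt ℝ (Prod.snd : ℝ × ℝ → ℝ) z := fun z => differentiableAt_snd
  -- the derivative of an expression of this shape has the same shape
  have step : ∀ {k L : ℝ × ℝ → ℝ} {z : ℝ × ℝ}, DifferentiableAt ℝ k z → DifferentiableAt ℝ L z →
      fieldDeriv H (fun z => z.1 ^ 2 * k z + z.2 * L z) z =
        z.1 ^ 2 * (2 * k z + fieldDeriv H k z) + z.2 * (-L z + fieldDeriv H L z) := by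
    intro k L z h1 h2
    have e1 : DifferentiableAt ℝ (fun z : ℝ × ℝ => z.1 ^ 2) z := by fun_prop
    have e2 : fieldDeriv H (fun z : ℝ × ℝ => z.1 ^ 2) z = 2 * z.1 ^ 2 := by
      have := fieldDeriv_mul (Θ := H) (dfst z) (dfst z)
      simp only [pow_two]
      rw [this, fieldDeriv_hyperbolic_fst]; ring
    rw [fieldDeriv_add (e1.fun_mul h1) ((dsnd z).fun_mul h2), fieldDeriv_mul e1 h1, e2,
      fieldDeriv_mul (dsnd z) h2, fieldDeriv_hyperbolic_snd]
    ring
  set k' : ℝ × ℝ → ℝ := fun z => 2 * k z + fieldDeriv H k z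
  set L' : ℝ × ℝ → ℝ := fun z => -L z + fieldDeriv H L z
  have hk' : ∀ᶠ z in 𝓝 ((0:ℝ), (0:ℝ)), ContDiffAt ℝ ∞ k' z := hk.mono fun z h =>
    (contDiffAt_const.mul h).add (contDiffAt_fieldDeriv (hH z) h)
  have hL' : ∀ᶠ z in 𝓝 ((0:ℝ), (0:ℝ)), ContDiffAt ℝ ∞ L' z := hL.mono fun z h =>
    h.neg.add (contDiffAt_fieldDeriv (hH z) h)
  set k'' : ℝ × ℝ → ℝ := fun z => 2 * k' z + fieldDeriv H k' z
  set L'' : ℝ × ℝ → ℝ := fun z => -L' z + fieldDeriv H L' z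
  have hk'' : ContinuousAt k'' (0, 0) :=
    ((contDiffAt_const.mul hk'.self_of_nhds).add
      (contDiffAt_fieldDeriv (hH _) hk'.self_of_nhds)).continuousAt
  have hL'' : ContinuousAt L'' (0, 0) :=
    (hL'.self_of_nhds.neg.add (contDiffAt_fieldDeriv (hH _) hL'.self_of_nhds)).continuousAt
  -- The field multiplies y² by 2 and q by -1, and derivatives along it vanish at the origin. Two
  -- applications therefore produce the leading coefficients 4 k and L.
  have pk : 0 < k'' (0, 0) := by
    simp only [k'', k', fieldDeriv_hyperbolic_origin, H]; linarith
  have pL : 0 < L'' (0, 0) := by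
    simp only [L'', L', fieldDeriv_hyperbolic_origin, H]; linarith
  filter_upwards [hM.eventually_nhds, hk.eventually_nhds, hL.eventually_nhds, hk', hL',
    hk''.eventually_const_lt pk, hL''.eventually_const_lt pL] with z h1 h2 h3 h4 h5 h6 h7 hz1 hz2
  have e1 : fieldDeriv H M =ᶠ[𝓝 z] fun z => z.1 ^ 2 * k' z + z.2 * L' z := by
    have h1' : M =ᶠ[𝓝 z] fun z => z.1 ^ 2 * k z + z.2 * L z := h1
    filter_upwards [fieldDeriv_congr (Θ := H) h1', h2, h3] with w e1 e2 e3
    rw [e1, step (e2.differentiableAt (by simp)) (e3.differentiableAt (by simp))]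
  rw [(fieldDeriv_congr e1).self_of_nhds, step (h4.differentiableAt (by simp))
    (h5.differentiableAt (by simp))]
  change 0 < z.1 ^ 2 * k'' z + z.2 * L'' z
  positivity

/-- Since g_u(u₊(0), 0) and g_μ(0, 0) are nonzero, the rescaled equations determine (x, μ) smoothly
from (y, q). The equation for y becomes μ = y² k + q L with k, L > 0, whence μ > 0, and d = y q, so
`eventually_hyperbolic_convex` gives the convexity. -/
theorem Profile.upper_corner (hg : Profile g um up) (hφ : IsCoordinate um up φ)
    (hK : IsDividedDifference g K) (ha : 0 < a) (hb : 0 < b) {t₀ : ℝ}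
    (hray : OnRay t₀ (planar φ (up 0, 0, 0))) :
    IsConvexCorner a b g K (up 0, 0, 0) ∧
      ∃ c, IsLocalBranch (branchSet a b g K) (planar φ) t₀ (up 0, 0, 0) c := by
  have hx0 : 0 < up 0 := hg.up_pos (by simp)
  have hgu := (hg.stable 0 (by simp)).ne
  have hg0 : g (up 0, 0) = 0 := hg.zero_up 0 (by simp)
  obtain ⟨A, B, hA, hB, hAB, hA0, hB0⟩ := exists_fold_form hg.smooth hg.g_zero (hg.partialU_zero 0)
  simp only [sub_zero] at hAB
  obtain ⟨c, hc0, hcs, hiff⟩ := exists_implicit (E := cornerMap a b g) (q₀ := ((0:ℝ), (0:ℝ)))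
    (p₀ := (up 0, (0:ℝ))) (Eventually.of_forall fun z => (contDiff_cornerMap hg.smooth).contDiffAt)
    (by simp [cornerMap, hg0, hg.g_zero]) (by
      intro v hv
      have e1 : HasDerivAt (fun s : ℝ => up 0 + s * v.1) v.1 0 :=
        (((hasDerivAt_id (0:ℝ)).mul_const v.1).const_add _).congr_deriv (by simp)
      have e2 : HasDerivAt (fun s : ℝ => 0 + s * v.2) v.2 0 :=
        (((hasDerivAt_id (0:ℝ)).mul_const v.2).const_add _).congr_deriv (by simp)
      have f1 := hasDerivAt_comp_pair (g := g) (hg.smooth.differentiable (by simp) _) e1 e2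
      have f2 := hasDerivAt_comp_pair (g := g) (hg.smooth.differentiable (by simp) _)
        (hasDerivAt_const (0:ℝ) (0:ℝ)) e2
      have h1 : HasDerivAt (fun s : ℝ => cornerMap a b g ((((0:ℝ), (0:ℝ)), (up 0, (0:ℝ))) + s • (0, v)))
          (up 0 * (v.1 * partialU g (up 0, 0) + v.2 * partialM g (up 0, 0)), v.2 * partialM g (0, 0)) 0 := by
        refine ((e1.mul f1).prodMk f2).congr_of_eventuallyEq (Eventually.of_forall fun s => ?_)
          |>.congr_deriv ?_
        · simp [cornerMap]
        · simp [hg0]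
      rw [fderiv_eq_of_line ((contDiff_cornerMap hg.smooth).differentiable (by simp) _) h1,
        Prod.mk_eq_zero] at hv
      have v2 := (mul_eq_zero.1 hv.2).resolve_right hg.pitch_μ.ne
      have v1 := (mul_eq_zero.1 hv.1).resolve_left hx0.ne'
      rw [v2, zero_mul, add_zero] at v1
      exact Prod.ext ((mul_eq_zero.1 v1).resolve_right hgu) v2)
  have hcc := hcs.self_of_nhds.continuousAt
  have hzt : Tendsto (fun z => (z, c z)) (𝓝 (0, 0)) (𝓝 ((0, 0), (up 0, 0))) := by
    have := (continuousAt_id (x := ((0:ℝ), (0:ℝ)))).prodMk hcc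
    rw [ContinuousAt, hc0] at this
    exact this
  have hct : Tendsto c (𝓝 (0, 0)) (𝓝 (up 0, 0)) := by have := hcc.tendsto; rwa [hc0] at this
  have hmap : ∀ᶠ z in 𝓝 ((0:ℝ), (0:ℝ)), cornerMap a b g (z, c z) = 0 := by
    filter_upwards [hzt.eventually hiff] with z hz using hz.2 rfl
  set P : ℝ × ℝ → ℝ × ℝ × ℝ := fun z => ((c z).1, z.1, (c z).2) with hP
  have hPs : ∀ᶠ z in 𝓝 ((0:ℝ), (0:ℝ)), ContDiffAt ℝ ∞ P z := by
    filter_upwards [hcs] with z hz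
    exact (contDiffAt_fst.comp z hz).prodMk (contDiffAt_fst.prodMk (contDiffAt_snd.comp z hz))
  have hP0 : P (0, 0) = (up 0, 0, 0) := by simp [hP, hc0]
  have hPt : Tendsto P (𝓝 (0, 0)) (𝓝 (up 0, 0, 0)) := by
    rw [← hP0]; exact hPs.self_of_nhds.continuousAt
  -- the level as a function of `(y, q)`
  have hden : ∀ᶠ z in 𝓝 ((0:ℝ), (0:ℝ)), A (z.1, (c z).2) < 0 := by
    have : ContinuousAt (fun z : ℝ × ℝ => A (z.1, (c z).2)) (0, 0) :=
      ContinuousAt.comp (g := A) (f := fun z : ℝ × ℝ => (z.1, (c z).2)) hA.continuous.continuousAt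
        (continuousAt_fst.prodMk hcc.snd)
    exact this.eventually_lt_const (by simp only [hc0, hA0]; exact hg.pitch_μ)
  have hden0 : A (0, 0) < 0 := by rw [hA0]; exact hg.pitch_μ
  set k : ℝ × ℝ → ℝ := fun z => B z.1 / -A (z.1, (c z).2) with hk
  set L : ℝ × ℝ → ℝ := fun z => b * ((c z).1 - z.1) / -A (z.1, (c z).2) with hL
  have hAs : ∀ᶠ z in 𝓝 ((0:ℝ), (0:ℝ)), ContDiffAt ℝ ∞ (fun z => -A (z.1, (c z).2)) z := by
    filter_upwards [hcs] with z hz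
    exact (hA.contDiffAt.comp z (contDiffAt_fst.prodMk (contDiffAt_snd.comp z hz))).neg
  have hks : ∀ᶠ z in 𝓝 ((0:ℝ), (0:ℝ)), ContDiffAt ℝ ∞ k z := by
    filter_upwards [hAs, hden] with z h1 h2
    exact (hB.contDiffAt.comp z contDiffAt_fst).div h1 (neg_ne_zero.2 h2.ne)
  have hLs : ∀ᶠ z in 𝓝 ((0:ℝ), (0:ℝ)), ContDiffAt ℝ ∞ L z := by
    filter_upwards [hAs, hden, hcs] with z h1 h2 h3
    exact (contDiffAt_const.mul ((contDiffAt_fst.comp z h3).sub contDiffAt_fst)).div h1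
      (neg_ne_zero.2 h2.ne)
  have hk0 : 0 < k (0, 0) := by
    simp only [hk, hc0]
    exact div_pos (by linarith [hg.pitch_uu]) (neg_pos.2 hden0)
  have hL0 : 0 < L (0, 0) := by
    simp only [hL, hc0, sub_zero]
    exact div_pos (by positivity) (neg_pos.2 hden0)
  have hM : ∀ᶠ z in 𝓝 ((0:ℝ), (0:ℝ)), (c z).2 = z.1 ^ 2 * k z + z.2 * L z := by
    filter_upwards [hmap, hden] with z h1 h2
    have h3 : g (z.1, (c z).2) + b * z.2 * ((c z).1 - z.1) = 0 := (Prod.mk_eq_zero.1 h1).2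
    rw [hAB] at h3
    simp only [hk, hL]
    rw [← mul_div_assoc, ← mul_div_assoc, ← add_div, eq_div_iff (neg_ne_zero.2 h2.ne)]
    linear_combination -h3
  have hkp := hks.self_of_nhds.continuousAt.eventually_const_lt hk0
  have hLp := hLs.self_of_nhds.continuousAt.eventually_const_lt hL0
  have hconv := eventually_hyperbolic_convex hks hLs hM hk0 hL0
  -- solutions near the corner
  have hsol : ∀ᶠ z in 𝓝 ((0:ℝ), (0:ℝ)), 0 < z.1 → 0 < z.2 → P z ∈ branchSet a b g K (z.1 * z.2) := by
    have h1 : ∀ᶠ z in 𝓝 ((0:ℝ), (0:ℝ)), z.1 < (c z).1 :=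
      continuousAt_fst.eventually_lt hcc.fst (by simp only [hc0]; exact hx0)
    filter_upwards [hmap, h1] with z h1 h2 hz1 hz2
    obtain ⟨e1, e2⟩ := Prod.mk_eq_zero.1 h1
    have hd : z.1 * z.2 / z.1 = z.2 := by field_simp
    refine ((branchSet_iff_quotient hK hb ha (hz1.trans h2) hz1).2 ⟨h2.ne', ?_, ?_⟩).1
    · rw [hd]; exact e1
    · rw [hd]; exact e2
  -- The equation recovers q from the point p alone, which shows that d / y is small for every
  -- solution close to the corner.
  have hqt : Tendsto (fun p : ℝ × ℝ × ℝ => (p.2.1, -g (p.2.1, p.2.2) / (b * (p.1 - p.2.1))))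
      (𝓝 (up 0, 0, 0)) (𝓝 (0, 0)) := by
    have : ContinuousAt (fun p : ℝ × ℝ × ℝ => (p.2.1, -g (p.2.1, p.2.2) / (b * (p.1 - p.2.1))))
        (up 0, 0, 0) := by
      have h1 : Continuous fun p : ℝ × ℝ × ℝ => g (p.2.1, p.2.2) :=
        hg.smooth.continuous.comp (by fun_prop)
      refine ContinuousAt.prodMk (by fun_prop) (ContinuousAt.div h1.neg.continuousAt (by fun_prop) ?_)
      simp only [sub_zero]; positivity
    have h2 := this.tendsto
    simpa [hg.g_zero] using h2
  have hinv : ∀ᶠ p in 𝓝 (up 0, (0:ℝ), (0:ℝ)), ∀ d, 0 < d → p ∈ branchSet a b g K d →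
      0 < p.2.1 ∧ (p.2.1, -g (p.2.1, p.2.2) / (b * (p.1 - p.2.1))) = (p.2.1, d / p.2.1) ∧
      P (p.2.1, d / p.2.1) = p := by
    have h1 : ∀ᶠ p : ℝ × ℝ × ℝ in 𝓝 (up 0, 0, 0), p.2.1 < p.1 :=
      ContinuousAt.eventually_lt (f := fun p : ℝ × ℝ × ℝ => p.2.1) (by fun_prop) continuousAt_fst hx0
    have h2 : Tendsto (fun p : ℝ × ℝ × ℝ => (p.1, p.2.2)) (𝓝 (up 0, 0, 0)) (𝓝 (up 0, 0)) :=
      (by fun_prop : Continuous fun p : ℝ × ℝ × ℝ => (p.1, p.2.2)).tendsto _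
    filter_upwards [h1, (hqt.prodMk_nhds h2).eventually hiff] with p h1 h2 d hd hp
    obtain ⟨x, y, μ⟩ := p
    obtain ⟨hxp, hyp⟩ := hp.1
    obtain ⟨-, e1, e2⟩ := (branchSet_iff_quotient hK hb ha hxp hyp).1 ⟨hp, ne_of_gt h1⟩
    simp only at h1 h2 hxp hyp ⊢
    have hq : -g (y, μ) / (b * (x - y)) = d / y := by
      have : x - y ≠ 0 := sub_ne_zero.2 h1.ne'
      rw [div_eq_iff (by positivity)]
      linear_combination -e2
    rw [hq] at h2 ⊢
    refine ⟨hyp, rfl, ?_⟩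
    have := h2.1 (Prod.mk_eq_zero.2 ⟨e1, e2⟩)
    simp only [hP, ← this]
  constructor
  · filter_upwards [hinv.eventually_nhds, hqt.eventually (((hkp.and hLp).and
      (hM.eventually_nhds.and hconv)).and ((hcs.and hPs)))] with p h1 h2 d hd hp
    obtain ⟨hy, hz, hPz⟩ := h1.self_of_nhds d hd hp
    rw [hz] at h2
    obtain ⟨⟨⟨h2k, h2L⟩, h2M, h2c⟩, h2s, h2P⟩ := h2
    have hq : 0 < d / p.2.1 := by positivity
    constructor
    · have : p.2.2 = (c (p.2.1, d / p.2.1)).2 := by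
        conv_lhs => rw [← hPz]
      rw [this, h2M.self_of_nhds]
      simp only
      positivity
    · rintro σ t rfl hσ hσm hσ' hcrit
      have hy' : ∀ᶠ s in 𝓝 t, HasDerivAt (fun s => (σ s).2.1) (deriv (fun s => (σ s).2.1) s) s := by
        have : ContDiffAt ℝ ∞ (fun s => (σ s).2.1) t := contDiffAt_fst.comp t (contDiffAt_snd.comp t hσ)
        filter_upwards [(this.of_le (m := 1) (by norm_cast)).eventually (by simp)] with s hs
        exact (hs.differentiableAt (by simp)).hasDerivAt
      have hys : ContDiffAt ℝ ∞ (fun s => (σ s).2.1) t := contDiffAt_fst.comp t (contDiffAt_snd.comp t hσ)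
      set z : ℝ → ℝ × ℝ := fun s => ((σ s).2.1, d / (σ s).2.1) with hzdef
      set τ : ℝ → ℝ := fun s => deriv (fun s => (σ s).2.1) s / (σ s).2.1 with hτ
      have hσz : ∀ᶠ s in 𝓝 t, 0 < (σ s).2.1 ∧ P (z s) = σ s := by
        filter_upwards [hσ.continuousAt.eventually h1, hσm] with s e1 e2
        exact ⟨(e1 d hd e2).1, (e1 d hd e2).2.2⟩
      have hzd : ∀ᶠ s in 𝓝 t, HasDerivAt z (τ s • hyperbolicField (z s)) s := by
        filter_upwards [hy', hσz] with s e1 e2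
        have hne := e2.1.ne'
        refine (e1.prodMk ((hasDerivAt_const s d).div e1 hne)).congr_deriv ?_
        simp only [hyperbolicField, hzdef, hτ, Prod.smul_mk, smul_eq_mul, Prod.mk.injEq]
        constructor
        · field_simp
        · field_simp; ring
      have hμz : (fun s => (σ s).2.2) =ᶠ[𝓝 t] fun s => (c (z s)).2 := by
        filter_upwards [hσz] with s hs
        conv_lhs => rw [← hs.2]
      rw [hμz.deriv_eq] at hcrit
      rw [show iteratedDeriv 2 (fun s => (σ s).2.2) t = _ from hμz.iteratedDeriv_eq 2]
      refine iteratedDeriv_pos_of_fieldDeriv (M := fun z => (c z).2) contDiff_hyperbolicField.contDiffAt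
        (contDiffAt_snd.comp _ h2s) hzd ?_ ?_ (h2c hy (by rw [show -g _ / _ = _ from congrArg Prod.snd hz]; exact hq)) hcrit
      · exact ((contDiffAt_deriv hys).differentiableAt (by simp)).div (hys.differentiableAt (by simp)) hy.ne'
      · intro h0
        have hz0 := hzd.self_of_nhds
        rw [h0, zero_smul] at hz0
        apply hσ'
        have e1 := ((h2P.differentiableAt (by simp)).hasFDerivAt).comp_hasDerivAt t hz0
        rw [map_zero] at e1
        exact (e1.congr_of_eventuallyEq (hσz.mono fun s hs => hs.2.symm)).deriv
  · obtain ⟨ε, hε, hbox⟩ := exists_box (hsol.and hPs)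
    obtain ⟨ρ, hρ, r1, r2⟩ := hray.coeffs
    simp only [hφ.axis, hφ.on_up 0 (by simp)] at r1 r2
    have hsq : 0 < 2 * coordPlus 0 - 1 := by linarith [(coordPlus_mem 0).1]
    have hσpos : 0 < Real.sin (Real.pi * t₀) + Real.cos (Real.pi * t₀) :=
      pos_of_mul_pos_right (by rw [r1]; norm_num) hρ.le
    have hτpos : 0 < Real.sin (Real.pi * t₀) - Real.cos (Real.pi * t₀) :=
      pos_of_mul_pos_right (by rw [r2]; exact hsq) hρ.le
    have hes : ∀ᶠ w in 𝓝 (((0:ℝ), (0:ℝ)), t₀), ContDiffAt ℝ ∞ (fun w => rayDefect φ w.2 (P w.1)) w := by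
      have : ∀ᶠ w in 𝓝 (((0:ℝ), (0:ℝ)), t₀), ContDiffAt ℝ ∞ P w.1 :=
        (continuous_fst.tendsto (((0:ℝ), (0:ℝ)), t₀)).eventually hPs
      filter_upwards [this] with w hw
      have h1 : ContDiffAt ℝ ∞ (fun w : (ℝ × ℝ) × ℝ => planar φ (P w.1)) w :=
        (contDiff_planar hφ.smooth).contDiffAt.comp w (hw.comp w contDiffAt_fst)
      have h2 : ContDiffAt ℝ ∞ (fun w : (ℝ × ℝ) × ℝ => Real.sin (Real.pi * w.2)) w :=
        (Real.contDiff_sin.comp (by fun_prop)).contDiffAt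
      have h3 : ContDiffAt ℝ ∞ (fun w : (ℝ × ℝ) × ℝ => Real.cos (Real.pi * w.2)) w :=
        (Real.contDiff_cos.comp (by fun_prop)).contDiffAt
      exact ((contDiffAt_fst.comp w h1).mul h2).add ((contDiffAt_snd.comp w h1).mul h3)
    -- the derivatives of the angular equation
    have hline : ∀ v : ℝ × ℝ, fderiv ℝ (fun w => rayDefect φ w.2 (P w.1)) ((0, 0), t₀) (v, 0) =
        deriv coordPlus 0 * (v.2 * L (0, 0)) * (Real.sin (Real.pi * t₀) + Real.cos (Real.pi * t₀)) +
        v.1 * partialU φ (0, 0) * (Real.sin (Real.pi * t₀) - Real.cos (Real.pi * t₀)) := by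
      intro v
      have hl : HasDerivAt (fun s : ℝ => s • v) v 0 :=
        ((hasDerivAt_id (0:ℝ)).smul_const v).congr_deriv (by simp)
      have hl1 : HasDerivAt (fun s : ℝ => (s • v).1) v.1 0 := hl.fst
      have hl2 : HasDerivAt (fun s : ℝ => (s • v).2) v.2 0 := hl.snd
      have hlt : Tendsto (fun s : ℝ => s • v) (𝓝 0) (𝓝 (0, 0)) := by
        have := hl.continuousAt.tendsto
        rwa [zero_smul] at this
      have hm : HasDerivAt (fun s : ℝ => (c (s • v)).2) (v.2 * L (0, 0)) 0 := by
        have hkd : DifferentiableAt ℝ (fun s : ℝ => k (s • v)) 0 :=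
          DifferentiableAt.comp (g := k) (f := fun s : ℝ => s • v) 0
            (by rw [zero_smul]; exact hks.self_of_nhds.differentiableAt (by simp)) hl.differentiableAt
        have hLd : DifferentiableAt ℝ (fun s : ℝ => L (s • v)) 0 :=
          DifferentiableAt.comp (g := L) (f := fun s : ℝ => s • v) 0
            (by rw [zero_smul]; exact hLs.self_of_nhds.differentiableAt (by simp)) hl.differentiableAt
        have := ((hl1.pow 2).mul hkd.hasDerivAt).add (hl2.mul hLd.hasDerivAt)
        refine (this.congr_deriv ?_).congr_of_eventuallyEq (hlt.eventually hM)
        rw [zero_smul, show (0 : ℝ × ℝ) = (0, 0) from rfl]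
        simp
      -- Near this corner φ is `coordPlus` of μ, and μ is q L to first order. So X decreases in q
      -- and is stationary in y.
      have hX : HasDerivAt (fun s : ℝ => φ ((c (s • v)).1, (c (s • v)).2))
          (deriv coordPlus 0 * (v.2 * L (0, 0))) 0 := by
        have e1 : HasDerivAt coordPlus (deriv coordPlus 0) (c ((0:ℝ) • v)).2 := by
          rw [zero_smul, show (0 : ℝ × ℝ) = (0, 0) from rfl, hc0]
          exact ((contDiffAt_coordPlus one_pos).differentiableAt (by simp)).hasDerivAt
        refine (e1.comp (0:ℝ) hm).congr_of_eventuallyEq ?_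
        filter_upwards [hlt.eventually (hct.eventually hφ.corner)] with s hs using hs
      have hY : HasDerivAt (fun s : ℝ => φ ((s • v).1, (c (s • v)).2)) (v.1 * partialU φ (0, 0)) 0 := by
        have := hasDerivAt_comp_pair (g := φ) (hφ.smooth.differentiable (by simp) _) hl1 hm
        refine this.congr_deriv ?_
        rw [zero_smul, show (0 : ℝ × ℝ) = (0, 0) from rfl, hc0]
        simp [hφ.partialM_axis]
      have hE := (((hX.add hY).sub_const 1).mul_const (Real.sin (Real.pi * t₀))).add
        ((hX.sub hY).mul_const (Real.cos (Real.pi * t₀)))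
      refine fderiv_eq_of_line (hes.self_of_nhds.differentiableAt (by simp)) ?_
      refine (hE.congr_deriv (by ring)).congr_of_eventuallyEq (Eventually.of_forall fun s => ?_)
      have hs : ((((0:ℝ), (0:ℝ)), t₀) + s • (v, (0:ℝ))) = (s • v, t₀) := by
        ext <;> simp
      change rayDefect φ (((((0:ℝ), (0:ℝ)), t₀) + s • (v, (0:ℝ))).2)
        (P ((((0:ℝ), (0:ℝ)), t₀) + s • (v, (0:ℝ))).1) = _
      rw [hs]
      rfl
    refine exists_localBranch_of_corner hφ.smooth hray (P := P) (D := fun z => z.1 * z.2) (C := 1)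
      (e := fun w => rayDefect φ w.2 (P w.1)) hε ?_ hes ?_ ?_ ?_ (hPt.mono_left nhdsWithin_le_nhds)
      (fun z hz => (hbox z hz).2) (fun z hz => (hbox z hz).1 hz.1.1 hz.2.1) (fun z hz t => rfl) ?_
    · intro z hz
      obtain ⟨y, q⟩ := z
      have hd : DifferentiableAt ℝ (fun z : ℝ × ℝ => z.1 * z.2) (y, q) := by fun_prop
      have e1 : partialU (fun z : ℝ × ℝ => z.1 * z.2) (y, q) = q := by
        refine (hasDerivAt_slice_fst hd).unique ?_
        exact ((hasDerivAt_id y).mul_const q).congr_deriv (by simp)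
      have e2 : partialM (fun z : ℝ × ℝ => z.1 * z.2) (y, q) = y := by
        refine (hasDerivAt_slice_snd hd).unique ?_
        exact ((hasDerivAt_id q).const_mul y).congr_deriv (by simp)
      rw [e1, e2]
      exact ⟨by fun_prop, hz.2.1, hz.1.1, mul_pos hz.1.1 hz.2.1, by simp⟩
    · simp only [hP0]
      exact (onRay_iff.1 hray).1
    · rw [hline]
      simp only [zero_mul, mul_zero, zero_add, one_mul]
      exact mul_pos hφ.pos_zero hτpos
    · rw [hline]
      simp only [zero_mul, add_zero, one_mul]
      refine mul_neg_of_neg_of_pos (mul_neg_of_neg_of_pos ?_ hL0) hσpos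
      rw [(hasDerivAt_coordPlus one_pos).deriv]
      exact div_neg_of_neg_of_pos (by norm_num) (by
        have := (coordPlus_mem 0).1
        simp only [sub_zero, Real.sqrt_one]; linarith)
    · intro ε' hε' _
      filter_upwards [hinv, hqt.eventually (eventually_box hε')] with p h1 h2 d hd hp
      obtain ⟨hy, hz, hPz⟩ := h1 d hd hp
      rw [hz] at h2
      exact ⟨_, h2 hy (by rw [show -g _ / _ = _ from congrArg Prod.snd hz]; exact div_pos hd hy), hPz, by simp only; field_simp⟩

end cornerBranch

/-! ### Blow-up of the equations at the origin. -/

section blowup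

variable {g φ : ℝ × ℝ → ℝ} {K : ℝ × ℝ × ℝ → ℝ} {a b : ℝ} {um up : ℝ → ℝ}

/-- The implicit function theorem for an equation that is decreasing in its unknown. -/
theorem exists_implicit_of_antitone {F : (ℝ × ℝ) × ℝ → ℝ} (hF : ContDiff ℝ ∞ F) {M : ℝ} (hM : 0 ≤ M) :
    ∃ m : ℝ × ℝ → ℝ, ∀ p₀, 0 < F (p₀, 0) → F (p₀, M) < 0 →
      (∀ s ∈ Icc 0 M, fderiv ℝ F (p₀, s) (0, 1) < 0) → ∀ᶠ p in 𝓝 p₀, m p ∈ Ioo 0 M ∧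
        F (p, m p) = 0 ∧ ContDiffAt ℝ ∞ m p ∧ ∀ s ∈ Icc 0 M, F (p, s) = 0 → s = m p := by
  let U : ℝ × ℝ → Prop := fun p => 0 < F (p, 0) ∧ F (p, M) < 0 ∧
    ∀ s ∈ Icc 0 M, fderiv ℝ F (p, s) (0, 1) < 0
  have hc := hF.continuous
  have hFm : Continuous fun w => fderiv ℝ F w (0, 1) :=
    ((hF.fderiv_right (m := ∞) (by norm_cast)).continuous).clm_apply continuous_const
  have hU : ∀ p₀, U p₀ → ∀ᶠ p in 𝓝 p₀, U p := by
    rintro p₀ ⟨h1, h2, h3⟩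
    have e1 : ContinuousAt (fun p : ℝ × ℝ => F (p, 0)) p₀ := by fun_prop
    have e2 : ContinuousAt (fun p : ℝ × ℝ => F (p, M)) p₀ := by fun_prop
    have e3 : ∀ᶠ p in 𝓝 p₀, ∀ s ∈ Icc 0 M, fderiv ℝ F (p, s) (0, 1) < 0 :=
      isCompact_Icc.eventually_forall_of_forall_eventually fun s hs =>
        hFm.continuousAt.eventually_lt_const (h3 s hs)
    filter_upwards [e1.eventually_const_lt h1, e2.eventually_lt_const h2, e3] with p h1 h2 h3
      using ⟨h1, h2, h3⟩
  have hd : ∀ p s, HasDerivAt (fun s => F (p, s)) (fderiv ℝ F (p, s) (0, 1)) s := fun p s =>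
    (hF.differentiable (by simp) (p, s)).hasFDerivAt.comp_hasDerivAt s
      ((hasDerivAt_const s p).prodMk (hasDerivAt_id s))
  have hanti : ∀ p, U p → StrictMonoOn (fun s => -F (p, s)) (Icc 0 M) := fun p hp =>
    strictMonoOn_of_hasDerivAt (convex_Icc _ _) (fun s _ => (hd p s).neg)
      fun s hs => neg_pos.2 (hp.2.2 s hs)
  -- The zero is chosen in the fixed interval before any base point is; uniqueness there makes one
  -- function m serve near all base points, which the local theorem alone would not give.
  have hex : ∀ p, ∃ s, U p → s ∈ Ioo 0 M ∧ F (p, s) = 0 := by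
    intro p
    by_cases hp : U p
    · obtain ⟨s, hs, h0⟩ := intermediate_value_Icc' hM
        ((by fun_prop : Continuous fun s => F (p, s)).continuousOn) ⟨hp.2.1.le, hp.1.le⟩
      refine ⟨s, fun _ => ⟨⟨lt_of_le_of_ne hs.1 ?_, lt_of_le_of_ne hs.2 ?_⟩, h0⟩⟩
      · rintro rfl; exact hp.1.ne' h0
      · rintro rfl; exact hp.2.1.ne h0
    · exact ⟨0, fun h => absurd h hp⟩
  choose m hm using hex
  have huniq : ∀ p, U p → ∀ s ∈ Icc 0 M, F (p, s) = 0 → s = m p := fun p hp s hs h0 =>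
    (hanti p hp).injOn hs (Ioo_subset_Icc_self (hm p hp).1) (by simp only [h0, (hm p hp).2])
  refine ⟨m, fun p₀ h1 h2 h3 => ?_⟩
  filter_upwards [hU p₀ ⟨h1, h2, h3⟩] with p hp
  refine ⟨(hm p hp).1, (hm p hp).2, ?_, huniq p hp⟩
  obtain ⟨c, hc0, hcs, hiff⟩ := exists_implicit (E := F) (q₀ := p) (p₀ := m p)
    (Eventually.of_forall fun z => hF.contDiffAt) (hm p hp).2 (by
      intro v hv
      rw [show ((0 : ℝ × ℝ), v) = v • ((0 : ℝ × ℝ), (1:ℝ)) by simp, map_smul, smul_eq_mul] at hv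
      exact (mul_eq_zero.1 hv).resolve_right (hp.2.2 _ (Ioo_subset_Icc_self (hm p hp).1)).ne)
  refine hcs.self_of_nhds.congr_of_eventuallyEq ?_
  have hcc := hcs.self_of_nhds.continuousAt
  have hct : Tendsto (fun q => (q, c q)) (𝓝 p) (𝓝 (p, m p)) := by
    have := (continuousAt_id (x := p)).prodMk hcc
    rw [ContinuousAt, hc0] at this
    exact this
  have hcI : ∀ᶠ q in 𝓝 p, c q ∈ Ioo 0 M := hcc.eventually (isOpen_Ioo.mem_nhds (by
    rw [hc0]; exact (hm p hp).1))
  filter_upwards [hct.eventually hiff, hU p hp, hcI] with q e1 e2 e3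
  exact (huniq q e2 _ (Ioo_subset_Icc_self e3) (e1.2 rfl)).symm

theorem eq_of_sub_mul_eq {h k : ℝ → ℝ} (hh : Continuous h) (hk : Continuous k)
    (e : ∀ r, (1 - r) * h r = (1 - r) * k r) : h = k := by
  refine Continuous.ext_on (dense_compl_singleton (1:ℝ)) hh hk fun r hr => ?_
  exact mul_left_cancel₀ (sub_ne_zero.2 (Ne.symm hr)) (e r)

/-- The solutions near the origin in the coordinates `x` and `r = y / x`: there, `μ = x² m` and
`d = x² r w`. -/
structure IsBlowup (a b : ℝ) (g : ℝ × ℝ → ℝ) (K : ℝ × ℝ × ℝ → ℝ) (α β M : ℝ) (m w : ℝ × ℝ → ℝ) :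
    Prop where
  posα : 0 < α
  posβ : 0 < β
  smooth : ∀ r ∈ Icc (0:ℝ) 2, ∀ᶠ p in 𝓝 ((0:ℝ), r), ContDiffAt ℝ ∞ m p ∧ ContDiffAt ℝ ∞ w p
  bound : ∀ r ∈ Icc (0:ℝ) 2, ∀ᶠ p in 𝓝 ((0:ℝ), r), m p ∈ Ioo 0 M
  balance : ∀ r ∈ Icc (0:ℝ) 2, ∀ᶠ p in 𝓝 ((0:ℝ), r),
    balance a b g (p.1, p.2 * p.1, p.1 ^ 2 * m p) = 0 ∧
      K (p.1, p.2 * p.1, p.1 ^ 2 * m p) = p.1 * (w p * (b + a * p.2))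
  m_zero : ∀ r ∈ Icc (0:ℝ) 2, ∀ᶠ s in 𝓝 r, m (0, s) = α * (b + a * s ^ 3) / (β * (b + a * s))
  w_zero : ∀ r ∈ Icc (0:ℝ) 2, ∀ᶠ s in 𝓝 r, w (0, s) = α * (1 + s) / (b + a * s)

/-- The pitchfork scaling makes g(s x, x² m) divisible by x², with quotient α s² - β m at x = 0.
There the balance is affine and decreasing in m, and the divided difference carries a single factor
x. Ratios r ≤ 2 suffice, since the cones y < 2 x and x < 2 y cover the quadrant. -/
theorem Profile.exists_isBlowup (hg : Profile g um up) (hK : IsDividedDifference g K) (ha : 0 < a)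
    (hb : 0 < b) : ∃ α β M m w, IsBlowup a b g K α β M m w := by
  obtain ⟨A, B, hA, hB, hAB, hA0, hB0⟩ := exists_fold_form hg.smooth hg.g_zero (hg.partialU_zero 0)
  simp only [sub_zero] at hAB
  set α := B 0 with hα
  set β := -A (0, 0) with hβ
  have hα0 : 0 < α := by linarith [hg.pitch_uu]
  have hβ0 : 0 < β := by rw [hβ, hA0]; linarith [hg.pitch_μ]
  let G : ℝ × ℝ × ℝ → ℝ := fun q => q.2.2 * A (q.1 * q.2.1, q.2.1 ^ 2 * q.2.2) + q.1 ^ 2 * B (q.1 * q.2.1)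
  have hG : ContDiff ℝ ∞ G := by
    have h1 : ContDiff ℝ ∞ fun q : ℝ × ℝ × ℝ => A (q.1 * q.2.1, q.2.1 ^ 2 * q.2.2) :=
      hA.comp (by fun_prop)
    have h2 : ContDiff ℝ ∞ fun q : ℝ × ℝ × ℝ => B (q.1 * q.2.1) := hB.comp (by fun_prop)
    fun_prop
  have hgG : ∀ s x μ, g (s * x, x ^ 2 * μ) = x ^ 2 * G (s, x, μ) := fun s x μ => by
    rw [hAB]; simp only [G]; ring
  have hG0 : ∀ s μ, G (s, 0, μ) = -(β * μ) + s ^ 2 * α := fun s μ => by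
    simp only [G, mul_zero, zero_mul, zero_pow two_ne_zero, hα, hβ]; ring
  obtain ⟨Q, hQ, hQs, -, -⟩ := exists_dividedDifference hG
  let F : (ℝ × ℝ) × ℝ → ℝ := fun z => b * G (1, z.1.1, z.2) + a * z.1.2 * G (z.1.2, z.1.1, z.2)
  have hF : ContDiff ℝ ∞ F := by
    have h1 : ContDiff ℝ ∞ fun z : (ℝ × ℝ) × ℝ => G (1, z.1.1, z.2) := hG.comp (by fun_prop)
    have h2 : ContDiff ℝ ∞ fun z : (ℝ × ℝ) × ℝ => G (z.1.2, z.1.1, z.2) := hG.comp (by fun_prop)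
    fun_prop
  have hF0 : ∀ r μ, F ((0, r), μ) = α * (b + a * r ^ 3) - β * μ * (b + a * r) := fun r μ => by
    simp only [F, hG0]; ring
  -- For r ≤ 2 one has r³ ≤ 4 r, so the zero α (b + a r³) / (β (b + a r)) is at most 4 α / β.
  set M := 4 * α / β + 1 with hMdef
  have hM : 0 ≤ M := by positivity
  have hMβ : β * M = 4 * α + β := by rw [hMdef]; field_simp
  obtain ⟨m, hm⟩ := exists_implicit_of_antitone hF hM
  have hbr : ∀ r ∈ Icc (0:ℝ) 2, 0 < b + a * r := fun r hr => by have := hr.1; positivity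
  have key : ∀ r ∈ Icc (0:ℝ) 2, ∀ᶠ p in 𝓝 ((0:ℝ), r), m p ∈ Ioo 0 M ∧ F (p, m p) = 0 ∧
      ContDiffAt ℝ ∞ m p ∧ ∀ s ∈ Icc 0 M, F (p, s) = 0 → s = m p := by
    intro r hr
    have hr0 := hr.1
    have hbr' := hbr r hr
    refine hm (0, r) ?_ ?_ fun s hs => ?_
    · rw [hF0]
      have : 0 < α * (b + a * r ^ 3) := by positivity
      linarith
    · rw [hF0, hMβ]
      have h1 : r ^ 3 ≤ 4 * r := by nlinarith [hr.2, mul_nonneg hr0 hr0]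
      have h2 : α * (b + a * r ^ 3) ≤ α * (4 * (b + a * r)) := by
        have : a * r ^ 3 ≤ a * (4 * r) := by gcongr
        gcongr
        linarith
      nlinarith [mul_pos hβ0 hbr']
    · have h1 : HasDerivAt (fun s => F ((0, r), s)) (fderiv ℝ F ((0, r), s) (0, 1)) s :=
        (hF.differentiable (by simp) _).hasFDerivAt.comp_hasDerivAt s
          ((hasDerivAt_const s ((0:ℝ), r)).prodMk (hasDerivAt_id s))
      have h2 : HasDerivAt (fun s => F ((0, r), s)) (-(β * (b + a * r))) s := by
        rw [funext (hF0 r)]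
        exact ((((hasDerivAt_id s).const_mul β).mul_const (b + a * r)).const_sub _).congr_deriv
          (by simp)
      rw [h1.unique h2]
      linarith [mul_pos hβ0 hbr']
  have hbr_ev : ∀ r ∈ Icc (0:ℝ) 2, ∀ᶠ p in 𝓝 ((0:ℝ), r), 0 < b + a * p.2 := fun r hr =>
    (by fun_prop : ContinuousAt (fun p : ℝ × ℝ => b + a * p.2) (0, r)).eventually_const_lt (hbr r hr)
  let w : ℝ × ℝ → ℝ := fun p => Q (1, p.2, p.1, m p) / (b + a * p.2)
  have ht : ∀ r : ℝ, Tendsto (fun s : ℝ => ((0:ℝ), s)) (𝓝 r) (𝓝 (0, r)) := fun r =>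
    (by fun_prop : Continuous fun s : ℝ => ((0:ℝ), s)).tendsto _
  refine ⟨α, β, M, m, w, hα0, hβ0, ?_, fun r hr => (key r hr).mono fun p h => h.1, ?_, ?_, ?_⟩
  · intro r hr
    filter_upwards [key r hr, hbr_ev r hr] with p h1 h2
    refine ⟨h1.2.2.1, ContDiffAt.div ?_ (by fun_prop) h2.ne'⟩
    exact hQ.contDiffAt.comp p (contDiffAt_const.prodMk (contDiffAt_snd.prodMk
      (contDiffAt_fst.prodMk h1.2.2.1)))
  · intro r hr
    filter_upwards [key r hr, hbr_ev r hr] with p h1 h2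
    obtain ⟨x, r⟩ := p
    have e0 := h1.2.1
    simp only [F] at e0 h2 ⊢
    set μ := m (x, r)
    have e1 := hgG 1 x μ
    rw [one_mul] at e1
    constructor
    · simp only [balance, e1, hgG]
      linear_combination x ^ 3 * e0
    · have e2 : K (x, r * x, x ^ 2 * μ) = x * Q (1, r, x, μ) := by
        rcases eq_or_ne x 0 with rfl | hx
        · rw [mul_zero, hK.diag, zero_mul, hg.partialU_zero]
        · have c1 : Continuous fun r => K (x, r * x, x ^ 2 * μ) :=
            hK.smooth.continuous.comp (by fun_prop)
          have c2 : Continuous fun r => x * Q (1, r, x, μ) := by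
            have := hQ.continuous
            fun_prop
          refine congrFun (eq_of_sub_mul_eq c1 c2 fun r => ?_) r
          have f1 := hK.sub_eq x (r * x) (x ^ 2 * μ)
          have f2 := hQs 1 r (x, μ)
          rw [hgG] at f1
          rw [e1] at f1
          have : x * ((1 - r) * K (x, r * x, x ^ 2 * μ)) = x * ((1 - r) * (x * Q (1, r, x, μ))) := by
            linear_combination -f1 + x ^ 2 * f2
          exact mul_left_cancel₀ hx this
      rw [e2]
      simp only [w]
      field_simp
      rfl
  · intro r hr
    filter_upwards [(ht r).eventually (key r hr), (ht r).eventually (hbr_ev r hr)] with s h1 h2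
    have e0 := h1.2.1
    rw [hF0] at e0
    rw [eq_div_iff (by positivity)]
    linear_combination -e0
  · intro r hr
    filter_upwards with s
    have e1 : ∀ μ : ℝ, Q (1, s, 0, μ) = α * (1 + s) := by
      intro μ
      have c1 : Continuous fun s => Q (1, s, 0, μ) := by
        have := hQ.continuous
        fun_prop
      refine congrFun (eq_of_sub_mul_eq c1 (k := fun s => α * (1 + s)) (by fun_prop) fun r => ?_) s
      have f2 := hQs 1 r (0, μ)
      rw [hG0, hG0] at f2
      linear_combination -f2
    simp only [w, e1]

end blowup

/-! ### The field tangent to the levels of d in blow-up coordinates. -/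

section blowupField

variable {g φ : ℝ × ℝ → ℝ} {K : ℝ × ℝ × ℝ → ℝ} {a b α β M : ℝ} {um up : ℝ → ℝ} {m w : ℝ × ℝ → ℝ}

/-- The field tangent to the level sets of `x² r w(x, r)`. -/
noncomputable def levelField (w : ℝ × ℝ → ℝ) (p : ℝ × ℝ) : ℝ × ℝ :=
  (-(p.1 * ((w p + p.2 * partialM w p) / (2 * w p + p.1 * partialU w p))), p.2)

theorem contDiffAt_partialU {f : ℝ × ℝ → ℝ} {p : ℝ × ℝ} (h : ContDiffAt ℝ ∞ f p) :
    ContDiffAt ℝ ∞ (partialU f) p :=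
  (h.fderiv_right (m := ∞) (by norm_cast)).clm_apply contDiffAt_const

theorem contDiffAt_partialM {f : ℝ × ℝ → ℝ} {p : ℝ × ℝ} (h : ContDiffAt ℝ ∞ f p) :
    ContDiffAt ℝ ∞ (partialM f) p :=
  (h.fderiv_right (m := ∞) (by norm_cast)).clm_apply contDiffAt_const

theorem contDiffAt_levelField {p : ℝ × ℝ} (h : ContDiffAt ℝ ∞ w p)
    (h0 : 2 * w p + p.1 * partialU w p ≠ 0) : ContDiffAt ℝ ∞ (levelField w) p := by
  have h1 := contDiffAt_partialU h
  have h2 := contDiffAt_partialM h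
  have h3 : ContDiffAt ℝ ∞ (fun p => w p + p.2 * partialM w p) p := h.add (contDiffAt_snd.mul h2)
  have h4 : ContDiffAt ℝ ∞ (fun p => 2 * w p + p.1 * partialU w p) p :=
    (contDiffAt_const.mul h).add (contDiffAt_fst.mul h1)
  exact (contDiffAt_fst.mul (h3.div h4 h0)).neg.prodMk contDiffAt_snd

/-- On x = 0 the field reduces to r ∂_r, so only the limit profile in r matters. -/
theorem fieldDeriv_levelField_axis {f : ℝ × ℝ → ℝ} {k : ℝ → ℝ} {r k' : ℝ}
    (hf : DifferentiableAt ℝ f (0, r)) (he : ∀ᶠ s in 𝓝 r, f (0, s) = k s) (hk : HasDerivAt k k' r) :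
    fieldDeriv (levelField w) f (0, r) = r * k' := by
  have h1 : partialM f (0, r) = k' :=
    (hasDerivAt_slice_snd hf).unique (hk.congr_of_eventuallyEq he)
  rw [fieldDeriv, levelField, fderiv_pair, h1]
  simp

/-- The operator `f ↦ θ f - f`, where `θ` is the derivative along the field. -/
noncomputable def shiftedField (w f : ℝ × ℝ → ℝ) (p : ℝ × ℝ) : ℝ :=
  fieldDeriv (levelField w) f p - f p

/-- On the level d = x² r w one has μ = (d / r) (m / w), and the field sends 1 / r to -1 / r. The
positive factor d / r can thus be carried in front, at the cost of the shift by -1. -/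
theorem fieldDeriv_div_snd {f : ℝ × ℝ → ℝ} {p : ℝ × ℝ} (d : ℝ) (hf : DifferentiableAt ℝ f p)
    (hp : p.2 ≠ 0) : fieldDeriv (levelField w) (fun q => d / q.2 * f q) p =
      d / p.2 * shiftedField w f p := by
  have h1 : DifferentiableAt ℝ (fun q : ℝ × ℝ => d / q.2) p :=
    ((differentiableAt_const d).div differentiableAt_id hp).comp p differentiableAt_snd
  have h2 : fieldDeriv (levelField w) (fun q : ℝ × ℝ => d / q.2) p = -(d / p.2) := by
    have e0 : HasFDerivAt (Prod.snd : ℝ × ℝ → ℝ) (ContinuousLinearMap.snd ℝ ℝ ℝ) p := hasFDerivAt_snd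
    have e1 : HasFDerivAt (fun q : ℝ × ℝ => d / q.2) _ p :=
      HasDerivAt.comp_hasFDerivAt p ((hasDerivAt_const p.2 d).div (hasDerivAt_id p.2) hp) e0
    rw [fieldDeriv, e1.fderiv]
    simp [levelField]
    field_simp
  rw [fieldDeriv_mul h1 hf, h2, shiftedField]
  ring

/-- These are the inequalities needed for D = x y w(x, y / x): its size, the signs of its partial
derivatives, a nonzero denominator in `levelField`, and the convexity of μ. All are open conditions,
so they are checked at x = 0 on the explicit profiles. -/
theorem IsBlowup.eventually (h : IsBlowup a b g K α β M m w) (ha : 0 < a) (hb : 0 < b) {r : ℝ}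
    (hr : r ∈ Icc (0:ℝ) 2) : ∀ᶠ p in 𝓝 ((0:ℝ), r),
      (0 < w p ∧ w p < 3 * α / b + 1) ∧ 0 < w p + p.2 * partialM w p ∧
      0 < w p - p.2 * partialM w p + p.1 * partialU w p ∧ 0 < 2 * w p + p.1 * partialU w p ∧
      0 < shiftedField w (shiftedField w fun q => m q / w q) p := by
  have hr0 := hr.1
  have hα := h.posα
  have hβ := h.posβ
  have hbr : 0 < b + a * r := by positivity
  have hs := h.smooth r hr
  have hw := hs.self_of_nhds.2
  have hmw := hs.self_of_nhds.1
  have hwc := hw.continuousAt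
  have hwU := (contDiffAt_partialU hw).continuousAt
  have hwM := (contDiffAt_partialM hw).continuousAt
  have w0 := (h.w_zero r hr).self_of_nhds
  have wpos : 0 < w (0, r) := by rw [w0]; positivity
  have wM : partialM w (0, r) = α * (b - a) / (b + a * r) ^ 2 := by
    refine (hasDerivAt_slice_snd (hw.differentiableAt (by simp))).unique ?_
    have e1 : HasDerivAt (fun s : ℝ => α * (1 + s)) α r :=
      (((hasDerivAt_id r).const_add 1).const_mul α).congr_deriv (by simp)
    have e2 : HasDerivAt (fun s : ℝ => b + a * s) a r :=
      (((hasDerivAt_id r).const_mul a).const_add b).congr_deriv (by simp)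
    refine ((e1.div e2 hbr.ne').congr_of_eventuallyEq (h.w_zero r hr)).congr_deriv ?_
    field_simp
    ring
  have k1 : 0 < w (0, r) + r * partialM w (0, r) := by
    rw [w0, wM]
    have : α * (1 + r) / (b + a * r) + r * (α * (b - a) / (b + a * r) ^ 2) =
      α * (b + a * r ^ 2 + 2 * b * r) / (b + a * r) ^ 2 := by field_simp; ring
    rw [this]; positivity
  have k2 : 0 < w (0, r) - r * partialM w (0, r) := by
    rw [w0, wM]
    have : α * (1 + r) / (b + a * r) - r * (α * (b - a) / (b + a * r) ^ 2) =
      α * (b + a * r ^ 2 + 2 * a * r) / (b + a * r) ^ 2 := by field_simp; ring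
    rw [this]; positivity
  have kb : w (0, r) < 3 * α / b + 1 := by
    rw [w0]
    have : α * (1 + r) / (b + a * r) ≤ 3 * α / b := by
      have h2 : α * (1 + r) ≤ 3 * α := by nlinarith [hr.2]
      have h3 : b ≤ b + a * r := by linarith [mul_nonneg ha.le hr0]
      gcongr
    linarith
  -- the second derivative along the field
  set κ : ℝ × ℝ → ℝ := fun q => m q / w q with hκ
  have hκs : ∀ᶠ p in 𝓝 ((0:ℝ), r), ContDiffAt ℝ ∞ κ p ∧ ContDiffAt ℝ ∞ (shiftedField w κ) p ∧
      ContDiffAt ℝ ∞ (shiftedField w (shiftedField w κ)) p := by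
    have hden : ∀ᶠ p in 𝓝 ((0:ℝ), r), 2 * w p + p.1 * partialU w p ≠ 0 := by
      have : ContinuousAt (fun p : ℝ × ℝ => 2 * w p + p.1 * partialU w p) (0, r) := by fun_prop
      exact this.eventually_ne (by simp only [zero_mul, add_zero]; positivity)
    filter_upwards [hs, hden, hwc.eventually_ne wpos.ne'] with p h1 h2 h3
    have e1 : ContDiffAt ℝ ∞ κ p := h1.1.div h1.2 h3
    have e2 := (contDiffAt_fieldDeriv (contDiffAt_levelField h1.2 h2) e1).sub e1
    exact ⟨e1, e2, (contDiffAt_fieldDeriv (contDiffAt_levelField h1.2 h2) e2).sub e2⟩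
  have ht : Tendsto (fun s : ℝ => ((0:ℝ), s)) (𝓝 r) (𝓝 (0, r)) :=
    (by fun_prop : Continuous fun s : ℝ => ((0:ℝ), s)).tendsto _
  have hq : ∀ᶠ s in 𝓝 r, 0 < 1 + s :=
    (by fun_prop : ContinuousAt (fun s : ℝ => 1 + s) r).eventually_const_lt (by linarith)
  have hbs : ∀ᶠ s in 𝓝 r, 0 < b + a * s :=
    (by fun_prop : ContinuousAt (fun s : ℝ => b + a * s) r).eventually_const_lt hbr
  have e0 : ∀ᶠ s in 𝓝 r, κ (0, s) = (b + a * s ^ 3) / (β * (1 + s)) := by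
    filter_upwards [h.m_zero r hr, h.w_zero r hr, hq, hbs] with s h1 h2 h3 h4
    simp only [hκ, h1, h2]
    field_simp
  have hlin : ∀ s : ℝ, HasDerivAt (fun s : ℝ => 1 + s) 1 s := fun s => (hasDerivAt_id s).const_add 1
  have e1 : ∀ᶠ s in 𝓝 r, shiftedField w κ (0, s) =
      (a * s ^ 4 + 2 * a * s ^ 3 - 2 * b * s - b) / (β * (1 + s) ^ 2) := by
    filter_upwards [e0.eventually_nhds, hq, ht.eventually hκs] with s h1 h2 h3
    have d1 : HasDerivAt (fun s : ℝ => b + a * s ^ 3) (3 * a * s ^ 2) s :=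
      (((hasDerivAt_pow 3 s).const_mul a).const_add b).congr_deriv (by simp; ring)
    have d2 := d1.div ((hlin s).const_mul β) (by positivity)
    rw [shiftedField, fieldDeriv_levelField_axis (h3.1.differentiableAt (by simp)) h1 d2,
      h1.self_of_nhds]
    field_simp
    ring
  -- This is (r ∂_r - 1)² applied to (b + a r³) / (β (1 + r)); every coefficient in the numerator
  -- turns out positive.
  have e2 : shiftedField w (shiftedField w κ) (0, r) =
      (a * r ^ 3 * (r ^ 2 + 3 * r + 4) + b * (4 * r ^ 2 + 3 * r + 1)) / (β * (1 + r) ^ 3) := by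
    have hr1 := hq.self_of_nhds
    have d1 : HasDerivAt (fun s : ℝ => a * s ^ 4 + 2 * a * s ^ 3 - 2 * b * s - b)
        (4 * a * r ^ 3 + 6 * a * r ^ 2 - 2 * b) r :=
      (((((hasDerivAt_pow 4 r).const_mul a).add ((hasDerivAt_pow 3 r).const_mul (2 * a))).sub
        ((hasDerivAt_id r).const_mul (2 * b))).sub_const b).congr_deriv (by simp; ring)
    have d2 := d1.div (((hlin r).pow 2).const_mul β) (by simp only [Pi.pow_apply]; positivity)
    rw [shiftedField, fieldDeriv_levelField_axis
      (hκs.self_of_nhds.2.1.differentiableAt (by simp)) e1 d2, e1.self_of_nhds]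
    simp only [Pi.pow_apply]
    field_simp
    ring
  have p2 : 0 < shiftedField w (shiftedField w κ) (0, r) := by rw [e2]; positivity
  have c1 : ContinuousAt (fun p : ℝ × ℝ => w p + p.2 * partialM w p) (0, r) := by fun_prop
  have c2 : ContinuousAt (fun p : ℝ × ℝ => w p - p.2 * partialM w p + p.1 * partialU w p) (0, r) := by
    fun_prop
  have c3 : ContinuousAt (fun p : ℝ × ℝ => 2 * w p + p.1 * partialU w p) (0, r) := by fun_prop
  filter_upwards [hwc.eventually_const_lt wpos, hwc.eventually_lt_const kb, c1.eventually_const_lt k1,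
    c2.eventually_const_lt (by simp only [zero_mul, add_zero]; exact k2), c3.eventually_const_lt (by simp only [zero_mul, add_zero]; positivity),
    hκs.self_of_nhds.2.2.continuousAt.eventually_const_lt p2] with p h1 h2 h3 h4 h5 h6
  exact ⟨⟨h1, h2⟩, h3, h4, h5, h6⟩

end blowupField

/-! ### Small positive solutions as a graph over (x, y). -/

section origin

variable {g φ : ℝ × ℝ → ℝ} {K : ℝ × ℝ × ℝ → ℝ} {a b α β B : ℝ} {um up : ℝ → ℝ} {m w : ℝ × ℝ → ℝ}

/-- Near the origin g_μ < 0, so for x, y > 0 the balance is strictly decreasing in μ. Small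
solutions are therefore the ones found by the blow-up. -/
theorem Profile.exists_balance_injective (hg : Profile g um up) (ha : 0 < a) (hb : 0 < b) :
    ∃ η > 0, ∀ x y μ μ' : ℝ, 0 < x → x < η → 0 < y → y < η → |μ| < η → |μ'| < η →
      balance a b g (x, y, μ) = 0 → balance a b g (x, y, μ') = 0 → μ = μ' := by
  have h1 : ∀ᶠ p in 𝓝 ((0:ℝ), (0:ℝ)), partialM g p < 0 :=
    (contDiff_partialM hg.smooth).continuous.continuousAt.eventually_lt_const hg.pitch_μ
  obtain ⟨η, hη, h⟩ := Metric.eventually_nhds_iff.1 h1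
  refine ⟨η, hη, fun x y μ μ' hx hxη hy hyη hμ hμ' e1 e2 => ?_⟩
  have hc : Convex ℝ {s : ℝ | |s| < η} := by
    have : {s : ℝ | |s| < η} = Ioo (-η) η := by ext s; simp [abs_lt]
    rw [this]; exact convex_Ioo _ _
  have hneg : ∀ u s, 0 < u → u < η → |s| < η → partialM g (u, s) < 0 := by
    intro u s hu hu' hs
    refine h ?_
    simp only [Prod.dist_eq, Real.dist_eq, sub_zero, max_lt_iff]
    exact ⟨by rwa [abs_of_pos hu], hs⟩
  have hm : StrictMonoOn (fun s => -balance a b g (x, y, s)) {s | |s| < η} := by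
    refine strictMonoOn_of_hasDerivAt hc (h' := fun s => -(b * (x * partialM g (x, s)) +
      a * (y * partialM g (y, s)))) (fun s _ => ?_) fun s hs => ?_
    · exact ((((hasDerivAt_snd hg.smooth x s).const_mul x).const_mul b).add
        (((hasDerivAt_snd hg.smooth y s).const_mul y).const_mul a)).neg
    · have f1 := mul_neg_of_pos_of_neg hb (mul_neg_of_pos_of_neg hx (hneg x s hx hxη hs))
      have f2 := mul_neg_of_pos_of_neg ha (mul_neg_of_pos_of_neg hy (hneg y s hy hyη hs))
      linarith
  exact hm.injOn hμ hμ' (by simp only [e1, e2])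

/-- Convexity of `μ` along a curve of solutions in the blow-up coordinates. -/
theorem IsBlowup.convex_along {σ : ℝ → ℝ × ℝ × ℝ} {t d x y : ℝ} (hd : 0 < d) (hx : 0 < x) (hy : 0 < y)
    (hσt : ((σ t).1, (σ t).2.1) = (x, y))
    (hs : ∀ᶠ p in 𝓝 (x, y / x), (ContDiffAt ℝ ∞ m p ∧ ContDiffAt ℝ ∞ w p) ∧ 0 < w p ∧
      0 < 2 * w p + p.1 * partialU w p ∧ 0 < shiftedField w (shiftedField w fun q => m q / w q) p)
    (hσ : ContDiffAt ℝ ∞ σ t)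
    (hM : ∀ᶠ s in 𝓝 t, (σ s).2.2 = (σ s).1 ^ 2 * m ((σ s).1, (σ s).2.1 / (σ s).1) ∧
      d = (σ s).1 * (σ s).2.1 * w ((σ s).1, (σ s).2.1 / (σ s).1))
    (hσ' : deriv σ t ≠ 0) (hcrit : deriv (fun s => (σ s).2.2) t = 0) :
    0 < iteratedDeriv 2 (fun s => (σ s).2.2) t := by
  simp only [Prod.mk.injEq] at hσt
  obtain ⟨ht1, ht2⟩ := hσt
  have hxs : ContDiffAt ℝ ∞ (fun s => (σ s).1) t := contDiffAt_fst.comp t hσ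
  have hys : ContDiffAt ℝ ∞ (fun s => (σ s).2.1) t := contDiffAt_fst.comp t (contDiffAt_snd.comp t hσ)
  have hxp : ∀ᶠ s in 𝓝 t, 0 < (σ s).1 := hxs.continuousAt.eventually_const_lt (by simp only [ht1]; exact hx)
  have hyp : ∀ᶠ s in 𝓝 t, 0 < (σ s).2.1 := hys.continuousAt.eventually_const_lt (by simp only [ht2]; exact hy)
  set ρ : ℝ → ℝ := fun s => (σ s).2.1 / (σ s).1 with hρ
  have hρs : ContDiffAt ℝ ∞ ρ t := hys.div hxs (by rw [ht1]; exact hx.ne')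
  set z : ℝ → ℝ × ℝ := fun s => ((σ s).1, ρ s) with hz
  have hzt : z t = (x, y / x) := by simp only [hz, hρ, ht1, ht2]
  have ediff : ∀ {f : ℝ → ℝ}, ContDiffAt ℝ ∞ f t → ∀ᶠ s in 𝓝 t, HasDerivAt f (deriv f s) s := by
    intro f hf
    filter_upwards [(hf.of_le (m := 1) (by norm_cast)).eventually (by simp)] with s hs
    exact (hs.differentiableAt (by simp)).hasDerivAt
  have hzs : ∀ᶠ s in 𝓝 t, ∀ᶠ p in 𝓝 (z s), (ContDiffAt ℝ ∞ m p ∧ ContDiffAt ℝ ∞ w p) ∧ 0 < w p ∧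
      0 < 2 * w p + p.1 * partialU w p ∧ 0 < shiftedField w (shiftedField w fun q => m q / w q) p := by
    have hc : ContinuousAt z t := hxs.continuousAt.prodMk hρs.continuousAt
    have := hc.tendsto
    rw [hzt] at this
    exact this.eventually hs.eventually_nhds
  have hDd : ∀ᶠ s in 𝓝 t, (σ s).1 ^ 2 * ρ s * w (z s) = d := by
    filter_upwards [hM, hxp] with s h1 h2
    rw [h1.2]
    simp only [hρ, hz]
    field_simp
  set τ : ℝ → ℝ := fun s => deriv ρ s / ρ s with hτ
  have hρp : ∀ᶠ s in 𝓝 t, 0 < ρ s := by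
    filter_upwards [hxp, hyp] with s h1 h2 using div_pos h2 h1
  -- A solution curve keeps x² r w = d, so it follows the field; as the second component of the
  -- field is r, the speed is τ = r' / r.
  have hzd : ∀ᶠ s in 𝓝 t, HasDerivAt z (τ s • levelField w (z s)) s := by
    filter_upwards [ediff hxs, ediff hρs, hzs, hDd.eventually_nhds, hxp, hρp] with s h1 h2 h3 h4 h5 h6
    obtain ⟨⟨-, k1⟩, k2, k3, -⟩ := h3.self_of_nhds
    have e1 := hasDerivAt_comp_pair (g := w) (x := fun s => (σ s).1) (m := ρ)
      (k1.differentiableAt (by simp)) h1 h2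
    have e2 := ((h1.pow 2).mul h2).mul e1
    have h4' : ((fun s => (σ s).1) ^ 2 * ρ * fun s => w ((σ s).1, ρ s)) =ᶠ[𝓝 s] fun _ => d := h4
    have e3 := (e2.congr_of_eventuallyEq h4'.symm).unique (hasDerivAt_const s d)
    simp only [Pi.pow_apply, Pi.mul_apply] at e3
    change 0 < 2 * w (z s) + (σ s).1 * partialU w (z s) at k3
    change _ + (σ s).1 ^ 2 * ρ s * (_ * partialU w (z s) + _ * partialM w (z s)) = 0 at e3
    have key₀ : ∀ X' r r' X W U V : ℝ, X ≠ 0 →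
        (2 * X ^ (2 - 1) * X' * r + X ^ 2 * r') * W + X ^ 2 * r * (X' * U + r' * V) = 0 →
        r * X' * (2 * W + X * U) = -(X * r' * (W + r * V)) := by
      intro X' r r' X W U V h1 h2
      apply mul_left_cancel₀ h1
      rw [show 2 - 1 = 1 from rfl] at h2
      linear_combination h2
    have e4 := key₀ _ _ _ _ _ _ _ h5.ne' e3
    have key : ∀ X' r r' X W U V : ℝ, r ≠ 0 → 2 * W + X * U ≠ 0 →
        r * X' * (2 * W + X * U) = -(X * r' * (W + r * V)) →
        X' = r' / r * -(X * ((W + r * V) / (2 * W + X * U))) := by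
      intro X' r r' X W U V h1 h2 h3
      generalize hq : 2 * W + X * U = q at *
      field_simp
      linear_combination h3
    refine (h1.prodMk h2).congr_deriv ?_
    simp only [levelField, Prod.smul_mk, smul_eq_mul, hτ, Prod.mk.injEq]
    constructor
    · change _ = deriv ρ s / ρ s * -((σ s).1 * ((w (z s) + ρ s * partialM w (z s)) /
        (2 * w (z s) + (σ s).1 * partialU w (z s))))
      exact key _ _ _ _ _ _ _ h6.ne' k3.ne' e4
    · change _ = deriv ρ s / ρ s * ρ s
      field_simp
  set κ : ℝ × ℝ → ℝ := fun q => m q / w q with hκ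
  have hμz : (fun s => (σ s).2.2) =ᶠ[𝓝 t] fun s => d / (z s).2 * κ (z s) := by
    filter_upwards [hM, hDd, hρp, hzs] with s h1 h2 h3 h4
    have hw := h4.self_of_nhds.2.1
    rw [h1.1, ← h2]
    change _ = (σ s).1 ^ 2 * ρ s * w (z s) / ρ s * (m (z s) / w (z s))
    change (σ s).1 ^ 2 * m (z s) = _
    field_simp
  rw [hμz.deriv_eq] at hcrit
  rw [show iteratedDeriv 2 (fun s => (σ s).2.2) t = _ from hμz.iteratedDeriv_eq 2]
  obtain ⟨⟨k0, k1⟩, k2, k3, k4⟩ := hzs.self_of_nhds.self_of_nhds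
  have hρ0 := hρp.self_of_nhds
  have hκs : ∀ᶠ p in 𝓝 (z t), ContDiffAt ℝ ∞ κ p ∧ ContDiffAt ℝ ∞ (shiftedField w κ) p ∧ p.2 ≠ 0 := by
    have : ∀ᶠ p in 𝓝 (z t), p.2 ≠ 0 := continuousAt_snd.eventually_ne hρ0.ne'
    filter_upwards [hzs.self_of_nhds, this] with p h1 h2
    have e1 : ContDiffAt ℝ ∞ κ p := h1.1.1.div h1.1.2 h1.2.1.ne'
    exact ⟨e1, (contDiffAt_fieldDeriv (contDiffAt_levelField h1.1.2 h1.2.2.1.ne') e1).sub e1, h2⟩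
  refine iteratedDeriv_pos_of_fieldDeriv (M := fun q => d / q.2 * κ q)
    (contDiffAt_levelField k1 k3.ne') ?_ hzd ?_ ?_ ?_ hcrit
  · exact (ContDiffAt.div contDiffAt_const contDiffAt_snd hρ0.ne').mul hκs.self_of_nhds.1
  · exact ((contDiffAt_deriv hρs).differentiableAt (by simp)).div (hρs.differentiableAt (by simp)) hρ0.ne'
  · intro h0
    have hz0 := hzd.self_of_nhds
    rw [h0, zero_smul] at hz0
    have f1 : HasDerivAt (fun s => (σ s).1) 0 t := hz0.fst
    have f2 : HasDerivAt ρ 0 t := hz0.snd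
    have f3 : HasDerivAt (fun s => (σ s).2.1) 0 t := by
      refine ((f1.mul f2).congr_deriv (by simp)).congr_of_eventuallyEq ?_
      filter_upwards [hxp] with s hs
      simp only [hρ, Pi.mul_apply]
      field_simp
    have f4 : HasDerivAt (fun s => (σ s).2.2) 0 t := by
      have : DifferentiableAt ℝ (fun s => (σ s).2.2) t :=
        (contDiffAt_snd.comp t (contDiffAt_snd.comp t hσ)).differentiableAt (by simp)
      rw [← hcrit, ← hμz.deriv_eq]
      exact this.hasDerivAt
    exact hσ' (f1.prodMk (f3.prodMk f4)).deriv
  · have e1 : fieldDeriv (levelField w) (fun q => d / q.2 * κ q) =ᶠ[𝓝 (z t)]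
        fun q => d / q.2 * shiftedField w κ q := by
      filter_upwards [hκs] with p hp
      exact fieldDeriv_div_snd d (hp.1.differentiableAt (by simp)) hp.2.2
    rw [(fieldDeriv_congr e1).self_of_nhds,
      fieldDeriv_div_snd d (hκs.self_of_nhds.2.1.differentiableAt (by simp)) hρ0.ne']
    exact mul_pos (div_pos hd hρ0) k4

/-- The solutions in a cone at the origin. -/
theorem Profile.exists_cone (hg : Profile g um up) (hK : IsDividedDifference g K) (ha : 0 < a)
    (hb : 0 < b) : ∃ ε > 0, ∃ C > 0, ∃ M D : ℝ × ℝ → ℝ, ∀ x y, 0 < x → x < ε → 0 < y → y < 2 * x →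
      (x, y, M (x, y)) ∈ branchSet a b g K (D (x, y)) ∧ (0 < M (x, y) ∧ M (x, y) ≤ C * x ^ 2) ∧
      (ContDiffAt ℝ ∞ M (x, y) ∧ ContDiffAt ℝ ∞ D (x, y) ∧ 0 < partialU D (x, y) ∧
        0 < partialM D (x, y) ∧ 0 < D (x, y) ∧ D (x, y) ≤ C * x * y) ∧
      (∀ μ d, |μ| < ε → (x, y, μ) ∈ branchSet a b g K d → μ = M (x, y) ∧ d = D (x, y)) ∧
      ∀ (σ : ℝ → ℝ × ℝ × ℝ) (t d : ℝ), 0 < d → σ t = (x, y, M (x, y)) → |M (x, y)| < ε →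
        ContDiffAt ℝ ∞ σ t → (∀ᶠ s in 𝓝 t, σ s ∈ branchSet a b g K d) → deriv σ t ≠ 0 →
        deriv (fun s => (σ s).2.2) t = 0 → 0 < iteratedDeriv 2 (fun s => (σ s).2.2) t := by
  obtain ⟨α, β, B, m, w, hm⟩ := hg.exists_isBlowup hK ha hb
  obtain ⟨η, hη, hinj⟩ := hg.exists_balance_injective ha hb
  -- Compactness of the interval of ratios makes all local statements hold for 0 < x < ε₀ and every
  -- r in [0, 2].
  have htube := isCompact_Icc.eventually_forall_of_forall_eventually
    (x₀ := (0:ℝ)) (K := Icc (0:ℝ) 2) (P := fun x r => ∀ᶠ p in 𝓝 (x, r),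
      ((ContDiffAt ℝ ∞ m p ∧ ContDiffAt ℝ ∞ w p) ∧ m p ∈ Ioo 0 B ∧
      (balance a b g (p.1, p.2 * p.1, p.1 ^ 2 * m p) = 0 ∧
        K (p.1, p.2 * p.1, p.1 ^ 2 * m p) = p.1 * (w p * (b + a * p.2)))) ∧
      ((0 < w p ∧ w p < 3 * α / b + 1) ∧ 0 < w p + p.2 * partialM w p ∧
      0 < w p - p.2 * partialM w p + p.1 * partialU w p ∧ 0 < 2 * w p + p.1 * partialU w p ∧
      0 < shiftedField w (shiftedField w fun q => m q / w q) p)) (fun r hr =>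
        (((hm.smooth r hr).and ((hm.bound r hr).and (hm.balance r hr))).and
          (hm.eventually ha hb hr)).eventually_nhds)
  obtain ⟨ε₀, hε₀, htube⟩ := Metric.eventually_nhds_iff.1 htube
  have hα := hm.posα
  have hB : 0 < B := by
    have := (hm.bound 0 (by simp)).self_of_nhds
    exact this.1.trans this.2
  set C := max B (3 * α / b + 1) with hC
  have hC0 : 0 < C := hB.trans_le (le_max_left _ _)
  -- The bound η / 2 keeps y < 2 x below η, and the bounds 1 and η / C keep M ≤ C x² below η, as
  -- uniqueness of μ requires.
  set ε := min (min ε₀ 1) (min (η / 2) (η / C)) with hε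
  have hε0 : 0 < ε := by positivity
  have b1 : ε ≤ ε₀ := (min_le_left _ _).trans (min_le_left _ _)
  have b2 : ε ≤ 1 := (min_le_left _ _).trans (min_le_right _ _)
  have b3 : ε ≤ η / 2 := (min_le_right _ _).trans (min_le_left _ _)
  have b4 : C * ε ≤ η := by
    have : ε ≤ η / C := (min_le_right _ _).trans (min_le_right _ _)
    rwa [le_div_iff₀ hC0, mul_comm] at this
  have hall := fun (x y : ℝ) (hx : 0 < x) (hxε : x < ε) (hy : 0 < y) (hyx : y < 2 * x) => by
    refine htube (y := x) ?_ (y / x) ⟨by positivity, ?_⟩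
    · rw [Real.dist_eq, sub_zero, abs_of_pos hx]; exact hxε.trans_le b1
    · rw [div_le_iff₀ hx]; exact hyx.le
  set M : ℝ × ℝ → ℝ := fun z => z.1 ^ 2 * m (z.1, z.2 / z.1) with hMdef
  set D : ℝ × ℝ → ℝ := fun z => z.1 * z.2 * w (z.1, z.2 / z.1) with hDdef
  have hmem : ∀ x y, 0 < x → x < ε → 0 < y → y < 2 * x →
      (x, y, M (x, y)) ∈ branchSet a b g K (D (x, y)) ∧ (0 < M (x, y) ∧ M (x, y) ≤ C * x ^ 2) := by
    intro x y hx hxε hy hyx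
    obtain ⟨⟨-, h2, h3, h4⟩, -⟩ := (hall x y hx hxε hy hyx).self_of_nhds
    have hr : y / x * x = y := by field_simp
    simp only [hr] at h3 h4
    refine ⟨⟨⟨hx, hy⟩, h3, ?_⟩, mul_pos (by positivity) h2.1, ?_⟩
    · simp only [hMdef, hDdef, h4]
      field_simp
    · simp only [hMdef]
      have : m (x, y / x) ≤ C := h2.2.le.trans (le_max_left _ _)
      nlinarith [sq_nonneg x]
  have huniq : ∀ x y, 0 < x → x < ε → 0 < y → y < 2 * x → ∀ μ d, |μ| < ε →
      (x, y, μ) ∈ branchSet a b g K d → μ = M (x, y) ∧ d = D (x, y) := by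
    intro x y hx hxε hy hyx μ d hμ hp
    obtain ⟨h1, h2, h3⟩ := hmem x y hx hxε hy hyx
    have hMη : |M (x, y)| < η := by
      rw [abs_of_pos h2]
      have : C * x ^ 2 < C * ε := by
        have : x ^ 2 < ε := by nlinarith
        gcongr
      linarith
    have e := hinj x y μ (M (x, y)) hx (by linarith) hy (by linarith) (by linarith) hMη hp.2.1 h1.2.1
    refine ⟨e, ?_⟩
    have h4 := hp.2.2
    rw [e, h1.2.2] at h4
    exact (mul_right_cancel₀ (by simp only; positivity) h4).symm
  refine ⟨ε, hε0, C, hC0, M, D, fun x y hx hxε hy hyx => ⟨(hmem x y hx hxε hy hyx).1,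
    (hmem x y hx hxε hy hyx).2, ?_, huniq x y hx hxε hy hyx, ?_⟩⟩
  · obtain ⟨⟨⟨s1, s2⟩, -⟩, ⟨w1, w2⟩, k1, k2, -⟩ := (hall x y hx hxε hy hyx).self_of_nhds
    have hq : ContDiffAt ℝ ∞ (fun z : ℝ × ℝ => (z.1, z.2 / z.1)) (x, y) :=
      contDiffAt_fst.prodMk (contDiffAt_snd.div contDiffAt_fst hx.ne')
    have hDs : ContDiffAt ℝ ∞ D (x, y) :=
      (contDiffAt_fst.mul contDiffAt_snd).mul (ContDiffAt.comp (g := w) (x, y) s2 hq)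
    have hwd := s2.differentiableAt (by simp)
    refine ⟨(contDiffAt_fst.pow 2).mul (ContDiffAt.comp (g := m) (x, y) s1 hq), hDs, ?_, ?_, ?_, ?_⟩
    · have e1 : HasDerivAt (fun x => x * y) y x := ((hasDerivAt_id x).mul_const y).congr_deriv (by simp)
      have e2 : HasDerivAt (fun x => y / x) (-y / x ^ 2) x :=
        ((hasDerivAt_const x y).div (hasDerivAt_id x) hx.ne').congr_deriv (by simp)
      have e3 := e1.mul (hasDerivAt_comp_pair (g := w) hwd (hasDerivAt_id x) e2)
      rw [(hasDerivAt_slice_fst (hDs.differentiableAt (by simp))).unique e3]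
      have : 0 < y * (w (x, y / x) - y / x * partialM w (x, y / x) + x * partialU w (x, y / x)) :=
        mul_pos hy k2
      convert this using 1
      simp only [id]
      field_simp
      ring
    · have e1 : HasDerivAt (fun y => x * y) x y := ((hasDerivAt_id y).const_mul x).congr_deriv (by simp)
      have e2 : HasDerivAt (fun y => y / x) (1 / x) y := (hasDerivAt_id y).div_const x
      have e3 := e1.mul (hasDerivAt_comp_pair (g := w) hwd (hasDerivAt_const y x) e2)
      rw [(hasDerivAt_slice_snd (hDs.differentiableAt (by simp))).unique e3]
      have : 0 < x * (w (x, y / x) + y / x * partialM w (x, y / x)) := mul_pos hx k1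
      convert this using 1
      field_simp
      ring
    · exact mul_pos (mul_pos hx hy) w1
    · simp only [hDdef]
      have : w (x, y / x) ≤ C := w2.le.trans (le_max_right _ _)
      nlinarith [mul_pos hx hy]
  · intro σ t d hd hσt hMε hσ hσm hσ' hcrit
    have hc := hσ.continuousAt
    have hev : ∀ᶠ s in 𝓝 t, 0 < (σ s).1 ∧ (σ s).1 < ε ∧ 0 < (σ s).2.1 ∧ (σ s).2.1 < 2 * (σ s).1 ∧
        |(σ s).2.2| < ε := by
      have : IsOpen {p : ℝ × ℝ × ℝ | 0 < p.1 ∧ p.1 < ε ∧ 0 < p.2.1 ∧ p.2.1 < 2 * p.1 ∧ |p.2.2| < ε} := by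
        have c1 : Continuous fun p : ℝ × ℝ × ℝ => p.1 := continuous_fst
        have c2 : Continuous fun p : ℝ × ℝ × ℝ => p.2.1 := continuous_fst.comp continuous_snd
        have c3 : Continuous fun p : ℝ × ℝ × ℝ => p.2.2 := continuous_snd.comp continuous_snd
        exact (isOpen_lt continuous_const c1).inter ((isOpen_lt c1 continuous_const).inter
          ((isOpen_lt continuous_const c2).inter ((isOpen_lt c2 (c1.const_mul 2)).inter
          (isOpen_lt c3.abs continuous_const))))
      exact hc.eventually (this.mem_nhds (by rw [hσt]; exact ⟨hx, hxε, hy, hyx, hMε⟩))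
    refine IsBlowup.convex_along (m := m) (w := w) hd hx hy (by rw [hσt]) ?_ hσ ?_ hσ' hcrit
    · filter_upwards [hall x y hx hxε hy hyx] with p hp
      exact ⟨hp.1.1, hp.2.1.1, hp.2.2.2.2.1, hp.2.2.2.2.2⟩
    · filter_upwards [hev, hσm] with s h1 h2
      exact huniq _ _ h1.1 h1.2.1 h1.2.2.1 h1.2.2.2.1 _ d h1.2.2.2.2 h2

end origin

/-! ### The corner at the origin and the list of all local branches. -/

section origin

variable {g φ : ℝ × ℝ → ℝ} {K : ℝ × ℝ × ℝ → ℝ} {a b : ℝ} {um up : ℝ → ℝ}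

theorem deriv_swapXY_comp_ne_zero {σ : ℝ → ℝ × ℝ × ℝ} {t : ℝ} (hσ : DifferentiableAt ℝ σ t)
    (h : deriv σ t ≠ 0) : deriv (fun s => swapXY (σ s)) t ≠ 0 := by
  intro h0
  have h1 : DifferentiableAt ℝ (fun s => swapXY (σ s)) t :=
    DifferentiableAt.comp (g := swapXY) t (contDiff_swapXY.differentiable (by simp) _) hσ
  have h2 := h1.hasDerivAt
  rw [h0] at h2
  have h3 := ((contDiff_swapXY.differentiable (by simp) (swapXY (σ t))).hasFDerivAt).comp_hasDerivAt t h2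
  rw [map_zero] at h3
  apply h
  have e : (swapXY ∘ fun s => swapXY (σ s)) = σ := funext fun s => swapXY_swapXY _
  rw [e] at h3
  exact h3.deriv

/-- The small positive solutions form a graph over a square. -/
theorem Profile.exists_square (hg : Profile g um up) (hK : IsDividedDifference g K) (ha : 0 < a)
    (hb : 0 < b) : ∃ ε > 0, ∃ C > 0, ∃ M D : ℝ × ℝ → ℝ, ∀ x y, 0 < x → x < ε → 0 < y → y < ε →
      (x, y, M (x, y)) ∈ branchSet a b g K (D (x, y)) ∧
      (0 < M (x, y) ∧ M (x, y) ≤ C * (x ^ 2 + y ^ 2)) ∧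
      (ContDiffAt ℝ ∞ M (x, y) ∧ ContDiffAt ℝ ∞ D (x, y) ∧ 0 < partialU D (x, y) ∧
        0 < partialM D (x, y) ∧ 0 < D (x, y) ∧ D (x, y) ≤ C * x * y) ∧
      (∀ μ d, |μ| < ε → (x, y, μ) ∈ branchSet a b g K d → μ = M (x, y) ∧ d = D (x, y)) ∧
      ∀ (σ : ℝ → ℝ × ℝ × ℝ) (t d : ℝ), 0 < d → σ t = (x, y, M (x, y)) → ContDiffAt ℝ ∞ σ t →
        (∀ᶠ s in 𝓝 t, σ s ∈ branchSet a b g K d) → deriv σ t ≠ 0 →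
        deriv (fun s => (σ s).2.2) t = 0 → 0 < iteratedDeriv 2 (fun s => (σ s).2.2) t := by
  obtain ⟨ε₁, hε₁, C₁, hC₁, M₁, D₁, h₁⟩ := hg.exists_cone hK ha hb
  obtain ⟨ε₂, hε₂, C₂, hC₂, M₂, D₂, h₂⟩ := hg.exists_cone hK hb ha
  set C := C₁ + C₂ + 1 with hC
  have hC0 : 0 < C := by positivity
  set ε := min 1 (min ε₁ ε₂ / C) with hε
  have hε0 : 0 < ε := by positivity
  have hε1 : ε ≤ 1 := min_le_left _ _
  have hεC : C * ε ≤ min ε₁ ε₂ := by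
    have : ε ≤ min ε₁ ε₂ / C := min_le_right _ _
    rwa [le_div_iff₀ hC0, mul_comm] at this
  have hεm : ε ≤ min ε₁ ε₂ := by
    refine le_trans ?_ hεC
    nlinarith
  have hεε₁ := hεm.trans (min_le_left _ _)
  have hεε₂ := hεm.trans (min_le_right _ _)
  have hsmall : ∀ x m c, 0 < x → x < ε → 0 < m → 0 < c → c ≤ C → m ≤ c * x ^ 2 → |m| < min ε₁ ε₂ := by
    intro x m c hx hxε hm hc hcC h
    rw [abs_of_pos hm]
    have h1 : x ^ 2 < ε := by nlinarith
    have h2 : c * x ^ 2 < C * ε := by nlinarith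
    linarith
  have hC₁C : C₁ ≤ C := by linarith
  have hC₂C : C₂ ≤ C := by linarith
  -- Where the cones y < 2 x and x < 2 y overlap, uniqueness makes both formulas agree, so the case
  -- distinction does not harm smoothness.
  set M : ℝ × ℝ → ℝ := fun z => if z.2 < 2 * z.1 then M₁ z else M₂ z.swap with hM
  set D : ℝ × ℝ → ℝ := fun z => if z.2 < 2 * z.1 then D₁ z else D₂ z.swap with hD
  have hA : ∀ z : ℝ × ℝ, z.2 < 2 * z.1 → M z = M₁ z ∧ D z = D₁ z := fun z hz => by simp [hM, hD, hz]
  have hB : ∀ z : ℝ × ℝ, 0 < z.1 → z.1 < ε → 0 < z.2 → z.2 < ε → z.1 < 2 * z.2 →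
      M z = M₂ z.swap ∧ D z = D₂ z.swap := by
    rintro ⟨x, y⟩ hx hxε hy hyε hxy
    simp only at hx hxε hy hyε hxy
    by_cases hyx : y < 2 * x
    · obtain ⟨e1, e2⟩ := hA (x, y) hyx
      obtain ⟨k1, k2, -⟩ := h₂ y x hy (hyε.trans_le hεε₂) hx hxy
      have k3 := (h₁ x y hx (hxε.trans_le hεε₁) hy hyx).2.2.2.1 (M₂ (y, x)) (D₂ (y, x))
        ((hsmall y _ C₂ hy hyε k2.1 hC₂ hC₂C k2.2).trans_le (min_le_left _ _))
        ((swap_mem_branchSet hK).2 k1)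
      exact ⟨e1.trans k3.1.symm, e2.trans k3.2.symm⟩
    · simp [hM, hD, hyx]
  refine ⟨ε, hε0, C, hC0, M, D, fun x y hx hxε hy hyε => ?_⟩
  by_cases hyx : y < 2 * x
  · obtain ⟨e1, e2⟩ := hA (x, y) hyx
    have hev : ∀ᶠ z in 𝓝 (x, y), M z = M₁ z ∧ D z = D₁ z := by
      have : ∀ᶠ z in 𝓝 (x, y), z.2 < 2 * z.1 :=
        ContinuousAt.eventually_lt (f := fun z : ℝ × ℝ => z.2) (by fun_prop) (by fun_prop) hyx
      filter_upwards [this] with z hz using hA z hz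
    have hevM : M =ᶠ[𝓝 (x, y)] M₁ := hev.mono fun z hz => hz.1
    have hevD : D =ᶠ[𝓝 (x, y)] D₁ := hev.mono fun z hz => hz.2
    obtain ⟨k1, k2, ⟨k3, k4, k5, k6, k7, k8⟩, k9, k10⟩ := h₁ x y hx (hxε.trans_le hεε₁) hy hyx
    rw [e1, e2]
    have hpU : partialU D (x, y) = partialU D₁ (x, y) := by simp only [partialU, hevD.fderiv_eq]
    have hpM : partialM D (x, y) = partialM D₁ (x, y) := by simp only [partialM, hevD.fderiv_eq]
    refine ⟨k1, ⟨k2.1, k2.2.trans ?_⟩, ⟨k3.congr_of_eventuallyEq hevM, k4.congr_of_eventuallyEq hevD,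
      by rwa [hpU], by rwa [hpM], k7, k8.trans ?_⟩, fun μ d hμ hp => k9 μ d (hμ.trans_le hεε₁) hp,
      fun σ t d hd hσ => k10 σ t d hd hσ
        ((hsmall x _ C₁ hx hxε k2.1 hC₁ hC₁C k2.2).trans_le (min_le_left _ _))⟩
    · nlinarith [sq_nonneg x, sq_nonneg y]
    · gcongr
  · have hxy : x < 2 * y := by linarith
    obtain ⟨e1, e2⟩ := hB (x, y) hx hxε hy hyε hxy
    have hev : ∀ᶠ z in 𝓝 (x, y), M z = M₂ z.swap ∧ D z = D₂ z.swap := by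
      have c1 : ∀ᶠ z : ℝ × ℝ in 𝓝 (x, y), z.1 ∈ Ioo 0 ε := continuousAt_fst.eventually (Ioo_mem_nhds hx hxε)
      have c2 : ∀ᶠ z : ℝ × ℝ in 𝓝 (x, y), z.2 ∈ Ioo 0 ε := continuousAt_snd.eventually (Ioo_mem_nhds hy hyε)
      have : ∀ᶠ z in 𝓝 (x, y), z.1 < 2 * z.2 :=
        ContinuousAt.eventually_lt (f := fun z : ℝ × ℝ => z.1) (by fun_prop) (by fun_prop) hxy
      filter_upwards [c1, c2, this] with z z1 z2 z3 using hB z z1.1 z1.2 z2.1 z2.2 z3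
    have hevM : M =ᶠ[𝓝 (x, y)] M₂ ∘ Prod.swap := hev.mono fun z hz => hz.1
    have hevD : D =ᶠ[𝓝 (x, y)] D₂ ∘ Prod.swap := hev.mono fun z hz => hz.2
    obtain ⟨k1, k2, ⟨k3, k4, k5, k6, k7, k8⟩, k9, k10⟩ := h₂ y x hy (hyε.trans_le hεε₂) hx hxy
    rw [e1, e2]
    have hsw : ContDiff ℝ ∞ (Prod.swap : ℝ × ℝ → ℝ × ℝ) := contDiff_snd.prodMk contDiff_fst
    have s3 : ContDiffAt ℝ ∞ M (x, y) :=
      (ContDiffAt.comp (g := M₂) (x, y) k3 hsw.contDiffAt).congr_of_eventuallyEq hevM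
    have s4 : ContDiffAt ℝ ∞ D (x, y) :=
      (ContDiffAt.comp (g := D₂) (x, y) k4 hsw.contDiffAt).congr_of_eventuallyEq hevD
    have hpU : partialU D (x, y) = partialM D₂ (y, x) := by
      refine (hasDerivAt_slice_fst (s4.differentiableAt (by simp))).unique
        ((hasDerivAt_slice_snd (k4.differentiableAt (by simp))).congr_of_eventuallyEq ?_)
      exact ((by fun_prop : Continuous fun s : ℝ => (s, y)).tendsto x).eventually hevD
    have hpM : partialM D (x, y) = partialU D₂ (y, x) := by
      refine (hasDerivAt_slice_snd (s4.differentiableAt (by simp))).unique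
        ((hasDerivAt_slice_fst (k4.differentiableAt (by simp))).congr_of_eventuallyEq ?_)
      exact ((by fun_prop : Continuous fun s : ℝ => (x, s)).tendsto y).eventually hevD
    simp only [Prod.swap_prod_mk]
    refine ⟨(swap_mem_branchSet hK).2 k1, ⟨k2.1, k2.2.trans ?_⟩, ⟨s3, s4, by rwa [hpU], by rwa [hpM], k7,
      k8.trans ?_⟩, fun μ d hμ hp => k9 μ d (hμ.trans_le hεε₂) ((swap_mem_branchSet hK).1 hp), ?_⟩
    · nlinarith [sq_nonneg x, sq_nonneg y]
    · rw [mul_assoc, mul_assoc, mul_comm y x]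
      gcongr
    · intro σ t d hd hσt hσ hσm hσ' hcrit
      refine k10 (fun s => swapXY (σ s)) t d hd (by simp only [hσt]; rfl)
        ((hsmall y _ C₂ hy hyε k2.1 hC₂ hC₂C k2.2).trans_le (min_le_right _ _))
        (contDiff_swapXY.contDiffAt.comp t hσ) ?_
        (deriv_swapXY_comp_ne_zero (hσ.differentiableAt (by simp)) hσ') hcrit
      filter_upwards [hσm] with s hs using (swap_mem_branchSet hK).2 hs

/-- The chart is (x, y) ↦ (x, y, M). In the strip φ does not depend on μ, so the angular equation
involves x, y and t only and is smooth although M is controlled only inside the quadrant. At X = Y =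
0 its coefficients 1 - 2 Y and 2 X - 1 have opposite signs. -/
theorem Profile.origin_corner (hg : Profile g um up) (hφ : IsCoordinate um up φ)
    (hK : IsDividedDifference g K) (ha : 0 < a) (hb : 0 < b) {t₀ : ℝ}
    (hray : OnRay t₀ (planar φ (0, 0, 0))) :
    IsConvexCorner a b g K (0, 0, 0) ∧
      ∃ c, IsLocalBranch (branchSet a b g K) (planar φ) t₀ (0, 0, 0) c := by
  obtain ⟨ε, hε, C, hC, M, D, h⟩ := hg.exists_square hK ha hb
  have hnear : ∀ ε' > 0, ∀ᶠ p : ℝ × ℝ × ℝ in 𝓝 (0, 0, 0), |p.1| < ε' ∧ |p.2.1| < ε' ∧ |p.2.2| < ε' := by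
    intro ε' hε'
    filter_upwards [Metric.ball_mem_nhds ((0:ℝ), (0:ℝ), (0:ℝ)) hε'] with p hp
    simpa [Prod.dist_eq] using hp
  refine ⟨?_, ?_⟩
  · filter_upwards [hnear ε hε] with p hp d hd hpS
    obtain ⟨x, y, μ⟩ := p
    obtain ⟨hx, hy⟩ := hpS.1
    obtain ⟨h1, h2, h3⟩ := hp
    obtain ⟨-, k2, -, k4, k5⟩ := h x y hx ((le_abs_self _).trans_lt h1) hy ((le_abs_self _).trans_lt h2)
    obtain ⟨rfl, rfl⟩ := k4 μ d h3 hpS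
    exact ⟨k2.1, fun σ t hσt hσ => k5 σ t _ hd hσt hσ⟩
  · obtain ⟨ε₁, hε₁, hstrip⟩ := hφ.strip
    set η := min ε ε₁ with hη
    have hη0 : 0 < η := lt_min hε hε₁
    obtain ⟨ρ, hρ, r1, r2⟩ := hray.coeffs
    simp only [hφ.zero] at r1 r2
    have hσpos : 0 < Real.sin (Real.pi * t₀) + Real.cos (Real.pi * t₀) :=
      pos_of_mul_pos_right (by rw [r1]; norm_num) hρ.le
    have hτneg : Real.sin (Real.pi * t₀) - Real.cos (Real.pi * t₀) < 0 :=
      neg_of_mul_neg_right (by rw [r2]; norm_num) hρ.le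
    set e : (ℝ × ℝ) × ℝ → ℝ := fun w => rayDefect φ w.2 (w.1.1, w.1.2, 0) with he
    have hes : ContDiff ℝ ∞ e := by
      have h1 : ContDiff ℝ ∞ fun w : (ℝ × ℝ) × ℝ => planar φ (w.1.1, w.1.2, 0) :=
        (contDiff_planar hφ.smooth).comp (by fun_prop)
      have h2 : ContDiff ℝ ∞ fun w : (ℝ × ℝ) × ℝ => Real.sin (Real.pi * w.2) :=
        Real.contDiff_sin.comp (by fun_prop)
      have h3 : ContDiff ℝ ∞ fun w : (ℝ × ℝ) × ℝ => Real.cos (Real.pi * w.2) :=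
        Real.contDiff_cos.comp (by fun_prop)
      exact (h1.fst.mul h2).add (h1.snd.mul h3)
    have hline : ∀ v : ℝ × ℝ, fderiv ℝ e ((0, 0), t₀) (v, 0) =
        v.1 * partialU φ (0, 0) * (Real.sin (Real.pi * t₀) + Real.cos (Real.pi * t₀)) +
        v.2 * partialU φ (0, 0) * (Real.sin (Real.pi * t₀) - Real.cos (Real.pi * t₀)) := by
      intro v
      have hl : ∀ r : ℝ, HasDerivAt (fun s : ℝ => φ (0 + s * r, 0)) (r * partialU φ (0, 0)) 0 := by
        intro r
        have e1 : HasDerivAt (fun s : ℝ => 0 + s * r) r 0 :=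
          (((hasDerivAt_id (0:ℝ)).mul_const r).const_add _).congr_deriv (by simp)
        have := hasDerivAt_comp_pair (g := φ) (hφ.smooth.differentiable (by simp) _) e1
          (hasDerivAt_const (0:ℝ) (0:ℝ))
        exact this.congr_deriv (by simp)
      have hE := ((((hl v.1).add (hl v.2)).sub_const 1).mul_const (Real.sin (Real.pi * t₀))).add
        (((hl v.1).sub (hl v.2)).mul_const (Real.cos (Real.pi * t₀)))
      refine fderiv_eq_of_line (hes.differentiable (by simp) _) ?_
      refine (hE.congr_deriv (by ring)).congr_of_eventuallyEq (Eventually.of_forall fun s => ?_)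
      simp [he, rayDefect, planar]
    have hbox : ∀ z : ℝ × ℝ, z ∈ Ioo 0 η ×ˢ Ioo 0 η → _ := fun z hz =>
      h z.1 z.2 hz.1.1 (hz.1.2.trans_le (min_le_left _ _)) hz.2.1 (hz.2.2.trans_le (min_le_left _ _))
    refine exists_localBranch_of_corner hφ.smooth hray (P := fun z => (z.1, z.2, M z)) (D := D) (C := C)
      (e := e) hη0 (fun z hz => ?_) (Eventually.of_forall fun w => hes.contDiffAt) ?_ ?_ ?_ ?_ ?_
      (fun z hz => (hbox z hz).1) ?_ ?_
    · obtain ⟨-, -, ⟨-, k4, k5, k6, k7, k8⟩, -⟩ := hbox z hz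
      exact ⟨k4, k5, k6, k7, k8⟩
    · exact (onRay_iff.1 hray).1
    · rw [hline]
      simp only [zero_mul, add_zero, one_mul]
      exact mul_pos hφ.pos_zero hσpos
    · rw [hline]
      simp only [zero_mul, zero_add, one_mul]
      exact mul_neg_of_pos_of_neg hφ.pos_zero hτneg
    · have hM : Tendsto M (𝓝[Ioo 0 η ×ˢ Ioo 0 η] (0, 0)) (𝓝 0) := by
        have hc : Tendsto (fun z : ℝ × ℝ => C * (z.1 ^ 2 + z.2 ^ 2)) (𝓝[Ioo 0 η ×ˢ Ioo 0 η] (0, 0)) (𝓝 0) := by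
          have : Continuous fun z : ℝ × ℝ => C * (z.1 ^ 2 + z.2 ^ 2) := by fun_prop
          have := this.tendsto ((0:ℝ), (0:ℝ))
          simp only [ne_eq, OfNat.ofNat_ne_zero, not_false_eq_true, zero_pow, add_zero, mul_zero] at this
          exact this.mono_left nhdsWithin_le_nhds
        refine tendsto_of_tendsto_of_tendsto_of_le_of_le' tendsto_const_nhds hc ?_ ?_
        · filter_upwards [self_mem_nhdsWithin] with z hz using (hbox z hz).2.1.1.le
        · filter_upwards [self_mem_nhdsWithin] with z hz using (hbox z hz).2.1.2
      exact ((continuous_fst.tendsto ((0:ℝ), (0:ℝ))).mono_left nhdsWithin_le_nhds).prodMk_nhds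
        (((continuous_snd.tendsto ((0:ℝ), (0:ℝ))).mono_left nhdsWithin_le_nhds).prodMk_nhds hM)
    · intro z hz
      exact contDiffAt_fst.prodMk (contDiffAt_snd.prodMk (hbox z hz).2.2.1.1)
    · intro z hz t
      have s1 := hstrip z.1 (M z) (by rw [abs_of_pos hz.1.1]; exact hz.1.2.le.trans (min_le_right _ _))
      have s2 := hstrip z.2 (M z) (by rw [abs_of_pos hz.2.1]; exact hz.2.2.le.trans (min_le_right _ _))
      simp only [he, rayDefect, planar, s1, s2]
    · intro ε' hε' hεη
      filter_upwards [hnear ε' hε'] with p hp d hd hpS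
      obtain ⟨x, y, μ⟩ := p
      obtain ⟨hx, hy⟩ := hpS.1
      obtain ⟨h1, h2, h3⟩ := hp
      have hx' := (le_abs_self x).trans_lt h1
      have hy' := (le_abs_self y).trans_lt h2
      obtain ⟨-, -, -, k4, -⟩ := hbox (x, y) ⟨⟨hx, hx'.trans_le hεη⟩, ⟨hy, hy'.trans_le hεη⟩⟩
      obtain ⟨rfl, rfl⟩ := k4 μ d (h3.trans_le (hεη.trans (min_le_left _ _))) hpS
      exact ⟨(x, y), ⟨⟨hx, hx'⟩, ⟨hy, hy'⟩⟩, rfl, rfl⟩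

/-- Every point of the singular curve has a good branch. -/
theorem IsSingularParam.exists_isGoodBranch {γ₀ : ℝ → ℝ × ℝ × ℝ} (hg : Profile g um up)
    (hφ : IsCoordinate um up φ) (hK : IsDividedDifference g K) (hγ : IsSingularParam um up φ γ₀)
    (ha : 0 < a) (hb : 0 < b) (t₀ : ℝ) : ∃ c, IsGoodBranch a b g K φ γ₀ t₀ c := by
  have key : ∀ a b : ℝ, 0 < a → 0 < b → ∀ t₀, γ₀ t₀ ∈ halfAB um up →
      ∃ c, IsGoodBranch a b g K φ γ₀ t₀ c := by
    intro a b ha hb t₀ hp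
    rcases hp.1.1.eq_or_lt with h0 | h0
    · have hcase : γ₀ t₀ = (0, 0, 0) ∨ γ₀ t₀ = (up 0, 0, 0) := by
        obtain ⟨-, h⟩ := hp
        rw [← h0, hg.um_zero] at h
        rcases h with h | h | h
        · exact Or.inl (Prod.ext h.1 (Prod.ext h.2 h0.symm))
        · exact Or.inr (Prod.ext h.1 (Prod.ext h.2 h0.symm))
        · exact Or.inr (Prod.ext h.1 (Prod.ext h.2 h0.symm))
      have hray := hγ.ray t₀
      rcases hcase with h | h
      · rw [h] at hray
        obtain ⟨h1, c, h2⟩ := hg.origin_corner hφ hK ha hb hray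
        exact ⟨c, IsConvexCorner.isGoodBranch hφ.smooth (by rw [h]; exact h1) h0.symm (by rw [h]; exact h2)⟩
      · rw [h] at hray
        obtain ⟨h1, c, h2⟩ := hg.upper_corner hφ hK ha hb hray
        exact ⟨c, IsConvexCorner.isGoodBranch hφ.smooth (by rw [h]; exact h1) h0.symm (by rw [h]; exact h2)⟩
    · exact hγ.exists_regular hg hφ hK ha hb hp h0
  rcases hγ.mem t₀ with h | h
  · exact key a b ha hb t₀ h
  · obtain ⟨c, hc⟩ := key b a hb ha (-t₀) (by rw [hγ.neg]; exact h)
    exact ⟨_, hc.swap hK hγ⟩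

end origin

/-! ### Counting critical points under a singular perturbation. -/

section critical

theorem not_eventually_const_of_deriv2_neg {m : ℝ → ℝ} {s : ℝ}
    (h : deriv m s = 0 → iteratedDeriv 2 m s < 0) (c : ℝ) : ¬ ∀ᶠ t in 𝓝 s, m t = c := by
  intro hc
  have h0 : m =ᶠ[𝓝 s] fun _ => c := hc
  have h1 : deriv m =ᶠ[𝓝 s] fun _ => 0 := h0.deriv.trans (by simp)
  have h2 : iteratedDeriv 2 m s = 0 := by
    rw [iteratedDeriv_succ, iteratedDeriv_one, h1.deriv_eq]; simp
  have := h h1.self_of_nhds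
  linarith

theorem eventually_le_of_deriv2_neg {m : ℝ → ℝ} (hm : ContDiff ℝ 2 m) {s : ℝ} (h1 : deriv m s = 0)
    (h2 : iteratedDeriv 2 m s < 0) : ∀ᶠ t in 𝓝 s, m t ≤ m s := by
  refine isLocalMax_of_deriv_deriv_neg ?_ h1 hm.continuous.continuousAt
  rwa [iteratedDeriv_succ, iteratedDeriv_one] at h2

/-- The low values at the ends force an interior maximum. With two critical points, the minimum over
the interval between them would also be a local maximum, so the function would be locally constant,
against the strict second-derivative condition. -/
theorem existsUnique_critical {m : ℝ → ℝ} (hm : ContDiff ℝ 2 m) {α β τ : ℝ} (hτ : τ ∈ Ioo α β)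
    (hα : m α < m τ) (hβ : m β < m τ)
    (h : ∀ t ∈ Ioo α β, deriv m t = 0 → iteratedDeriv 2 m t < 0) :
    ∃! t, t ∈ Ioo α β ∧ deriv m t = 0 := by
  have hαβ := hτ.1.trans hτ.2
  have uniq : ∀ s t, s ∈ Ioo α β → t ∈ Ioo α β → deriv m s = 0 → deriv m t = 0 → ¬ s < t := by
    intro s t hs ht es et hst
    obtain ⟨x, hx, hmin⟩ := isCompact_Icc.exists_isMinOn (nonempty_Icc.2 hst.le) hm.continuous.continuousOn
    have hxI : x ∈ Ioo α β := ⟨hs.1.trans_le hx.1, hx.2.trans_lt ht.2⟩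
    have hle : ∀ᶠ y in 𝓝 x, m y ≤ m x := by
      rcases hx.1.eq_or_lt with rfl | h1
      · exact eventually_le_of_deriv2_neg hm es (h s hs es)
      · rcases hx.2.eq_or_lt with rfl | h2
        · exact eventually_le_of_deriv2_neg hm et (h x ht et)
        · have hd : deriv m x = 0 := (hmin.isLocalMin (Icc_mem_nhds h1 h2)).deriv_eq_zero
          exact eventually_le_of_deriv2_neg hm hd (h x hxI hd)
    have hcl : x ∈ closure (Ioo s t) := by rw [closure_Ioo hst.ne]; exact hx
    obtain ⟨y, hy1, hy2⟩ := mem_closure_iff_nhds.1 hcl _ hle.eventually_nhds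
    refine not_eventually_const_of_deriv2_neg (s := y) (h y ⟨hs.1.trans hy2.1, hy2.2.trans ht.2⟩) (m x) ?_
    have hy1' : ∀ᶠ z in 𝓝 y, m z ≤ m x := hy1
    filter_upwards [hy1', Icc_mem_nhds hy2.1 hy2.2] with z h1 h2
    exact le_antisymm h1 (hmin h2)
  obtain ⟨x, hx, hmax⟩ := isCompact_Icc.exists_isMaxOn (nonempty_Icc.2 hαβ.le) hm.continuous.continuousOn
  have hτx : m τ ≤ m x := hmax ⟨hτ.1.le, hτ.2.le⟩
  have h1 : α < x := lt_of_le_of_ne hx.1 (by rintro rfl; linarith)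
  have h2 : x < β := lt_of_le_of_ne hx.2 (by rintro rfl; linarith)
  have hd : deriv m x = 0 := (hmax.isLocalMax (Icc_mem_nhds h1 h2)).deriv_eq_zero
  refine ⟨x, ⟨⟨h1, h2⟩, hd⟩, fun y hy => ?_⟩
  exact le_antisymm (not_lt.1 (uniq x y ⟨h1, h2⟩ hy.1 hd hy.2)) (not_lt.1 (uniq y x hy.1 ⟨h1, h2⟩ hy.2 hd))

/-- Continuity alone carries the strict maximum of the limit over: for small d the values at τ ± ρ
are below the value at τ. -/
theorem eventually_existsUnique_critical {m : ℝ → ℝ → ℝ} {m₀ : ℝ → ℝ} {d₀ τ : ℝ} (hd₀ : 0 < d₀)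
    (hm : ∀ d ∈ Ioo 0 d₀, ContDiff ℝ 2 (m d))
    (hlim : ∀ t, Tendsto (fun q : ℝ × ℝ => m q.1 q.2) (posFilter t) (𝓝 (m₀ t)))
    (hiso : ∀ᶠ t in 𝓝[≠] τ, m₀ t < m₀ τ)
    (h : ∀ᶠ q in posFilter τ, deriv (m q.1) q.2 = 0 → iteratedDeriv 2 (m q.1) q.2 < 0) :
    ∃ ρ₀ > 0, ∀ ρ ∈ Ioo 0 ρ₀, ∃ r > 0, ∀ d ∈ Ioo 0 r, ∃! t, |t - τ| < ρ ∧ deriv (m d) t = 0 := by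
  obtain ⟨r₁, hr₁, h1⟩ := eventually_posFilter.1 h
  obtain ⟨r₂, hr₂, h2⟩ := Metric.mem_nhdsWithin_iff.1 hiso
  refine ⟨min r₁ r₂, by positivity, fun ρ hρ => ?_⟩
  have hside : ∀ s, |s| = ρ → ∃ r > 0, ∀ d ∈ Ioo 0 r, m d (τ + s) < m d τ := by
    intro s hs
    have hlt : m₀ (τ + s) < m₀ τ := by
      refine h2 ⟨?_, ?_⟩
      · simp only [Metric.mem_ball, Real.dist_eq, add_sub_cancel_left, hs]
        exact hρ.2.trans_le (min_le_right _ _)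
      · simp only [mem_compl_iff, mem_singleton_iff, add_eq_left]
        rintro rfl
        rw [abs_zero] at hs
        exact hρ.1.ne hs
    obtain ⟨c, hc1, hc2⟩ := exists_between hlt
    obtain ⟨r, hr, e1⟩ := eventually_posFilter.1 ((hlim (τ + s)).eventually_lt_const hc1)
    obtain ⟨r', hr', e2⟩ := eventually_posFilter.1 ((hlim τ).eventually_const_lt hc2)
    refine ⟨min r r', by positivity, fun d hd => ?_⟩
    exact (e1 d ⟨hd.1, hd.2.trans_le (min_le_left _ _)⟩ _ (by simpa using hr)).trans
      (e2 d ⟨hd.1, hd.2.trans_le (min_le_right _ _)⟩ _ (by simpa using hr'))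
  obtain ⟨r₃, hr₃, h3⟩ := hside (-ρ) (by rw [abs_neg, abs_of_pos hρ.1])
  obtain ⟨r₄, hr₄, h4⟩ := hside ρ (abs_of_pos hρ.1)
  refine ⟨min (min d₀ r₁) (min r₃ r₄), by positivity, fun d hd => ?_⟩
  have hI : ∀ t, |t - τ| < ρ ↔ t ∈ Ioo (τ + -ρ) (τ + ρ) := by
    intro t
    rw [abs_lt, mem_Ioo]
    constructor <;> rintro ⟨a, b⟩ <;> constructor <;> linarith
  simp only [hI]
  refine existsUnique_critical (hm d ⟨hd.1, hd.2.trans_le ((min_le_left _ _).trans (min_le_left _ _))⟩)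
    (τ := τ) ⟨by linarith [hρ.1], by linarith [hρ.1]⟩
    (h3 d ⟨hd.1, hd.2.trans_le ((min_le_right _ _).trans (min_le_left _ _))⟩)
    (h4 d ⟨hd.1, hd.2.trans_le ((min_le_right _ _).trans (min_le_right _ _))⟩) fun t ht => ?_
  exact h1 d ⟨hd.1, hd.2.trans_le ((min_le_left _ _).trans (min_le_right _ _))⟩ t
    (((hI t).2 ht).trans (hρ.2.trans_le (min_le_left _ _)))

/-- A family of periodic functions has as many critical points as its singular limit has extrema. -/
theorem ncard_critical {m : ℝ → ℝ → ℝ} {m₀ : ℝ → ℝ} {d₀ : ℝ} (hd₀ : 0 < d₀)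
    (hper : ∀ d ∈ Ioo 0 d₀, Function.Periodic (m d) 2) (hper₀ : Function.Periodic m₀ 2)
    (hm : ∀ d ∈ Ioo 0 d₀, ContDiff ℝ 2 (m d))
    (hlim : ∀ t, Tendsto (fun q : ℝ × ℝ => m q.1 q.2) (posFilter t) (𝓝 (m₀ t)))
    (hrange : ∀ t, m₀ t ∈ Icc (0:ℝ) 1)
    (hfin : {t ∈ Ico (-1:ℝ) 1 | m₀ t ∉ Ioo 0 1}.Finite)
    (hiso : ∀ τ, ∀ᶠ t in 𝓝[≠] τ, m₀ t ∈ Ioo 0 1)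
    (hmono : ∀ τ, m₀ τ ∈ Ioo 0 1 → ∀ᶠ q in posFilter τ, deriv (m q.1) q.2 ≠ 0)
    (hone : ∀ τ, m₀ τ = 1 → ∀ᶠ q in posFilter τ, deriv (m q.1) q.2 = 0 → iteratedDeriv 2 (m q.1) q.2 < 0)
    (hzero : ∀ τ, m₀ τ = 0 → ∀ᶠ q in posFilter τ, deriv (m q.1) q.2 = 0 →
      0 < iteratedDeriv 2 (m q.1) q.2) :
    ∃ r > 0, ∀ d ∈ Ioo 0 r,
      {t ∈ Ico (-1:ℝ) 1 | deriv (m d) t = 0}.ncard = {t ∈ Ico (-1:ℝ) 1 | m₀ t ∉ Ioo 0 1}.ncard ∧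
      ∀ t, deriv (m d) t = 0 → iteratedDeriv 2 (m d) t ≠ 0 := by
  set T : Set ℝ := {t | m₀ t ∉ Ioo 0 1} with hT
  have hTcase : ∀ t ∈ T, m₀ t = 0 ∨ m₀ t = 1 := by
    intro t ht
    by_contra! hne
    exact ht ⟨lt_of_le_of_ne (hrange t).1 hne.1.symm, lt_of_le_of_ne (hrange t).2 hne.2⟩
  have hTper : ∀ (t : ℝ) (n : ℤ), t + n * 2 ∈ T ↔ t ∈ T := by
    intro t n
    simp only [hT, mem_ofPred_eq, (hper₀.int_mul n) t]
  have hdper : ∀ d ∈ Ioo 0 d₀, ∀ t (n : ℤ), deriv (m d) (t + n * 2) = deriv (m d) t := by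
    intro d hd t n
    have e : (fun s => m d (s + n * 2)) = m d := funext ((hper d hd).int_mul n)
    have := deriv_comp_add_const (f := m d) (a := (n * 2 : ℝ)) (x := t)
    rw [e] at this
    exact this.symm
  have hddper : ∀ d ∈ Ioo 0 d₀, ∀ t, iteratedDeriv 2 (m d) (t + 2) = iteratedDeriv 2 (m d) t := by
    intro d hd t
    have e : (fun s => m d (s + 2)) = m d := funext (hper d hd)
    have := congrFun (iteratedDeriv_comp_add_const 2 (m d) 2) t
    rw [e] at this
    exact this.symm
  -- local uniqueness at the extrema
  have hloc : ∀ τ ∈ T, ∃ ρ₀ > 0, ∀ ρ ∈ Ioo 0 ρ₀, ∃ r > 0, ∀ d ∈ Ioo 0 r,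
      ∃! t, |t - τ| < ρ ∧ deriv (m d) t = 0 := by
    intro τ hτ
    rcases hTcase τ hτ with h | h
    -- Minima are treated as maxima of -m.
    · have := eventually_existsUnique_critical (m := fun d t => -m d t) (m₀ := fun t => -m₀ t) (τ := τ) hd₀
        (fun d hd => (hm d hd).neg) (fun t => (hlim t).neg) ?_ ?_
      · simpa using this
      · filter_upwards [hiso τ] with t ht
        rw [h]; linarith [ht.1]
      · filter_upwards [hzero τ h] with q hq hd
        have e1 : deriv (fun t => -m q.1 t) q.2 = -deriv (m q.1) q.2 := by simp
        rw [e1, neg_eq_zero] at hd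
        have e2 : iteratedDeriv 2 (fun t => -m q.1 t) q.2 = -iteratedDeriv 2 (m q.1) q.2 :=
          iteratedDeriv_neg 2 (m q.1) q.2
        rw [e2]; linarith [hq hd]
    · refine eventually_existsUnique_critical hd₀ hm hlim ?_ (hone τ h)
      filter_upwards [hiso τ] with t ht
      rw [h]; exact ht.2
  -- separation of the extrema
  obtain ⟨ρ₁, hρ₁, hsep⟩ : ∃ r > 0, ∀ t, ∀ t', |t' - t| < r → t ∈ T → t' ∈ T → t' = t := by
    refine uniform_of_local (A := fun r t => ∀ t', |t' - t| < r → t ∈ T → t' ∈ T → t' = t) ?_ ?_ ?_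
    · exact fun r r' t hr h t' ht' => h t' (ht'.trans_le hr)
    · intro r t
      have e2 : t + 2 ∈ T ↔ t ∈ T := by simpa using hTper t 1
      constructor
      · intro h t' h1 h2 h3
        have := h (t' + 2) (by rwa [add_sub_add_right_eq_sub]) (e2.2 h2) (by simpa using (hTper t' 1).2 h3)
        linarith
      · intro h t' h1 h2 h3
        have := h (t' - 2) (by rwa [sub_sub, add_comm (2:ℝ)]) (e2.1 h2)
          ((by simpa using hTper (t' - 2) 1 : t' ∈ T ↔ t' - 2 ∈ T).1 h3)
        linarith
    · intro t₀
      obtain ⟨r, hr, h⟩ := Metric.mem_nhdsWithin_iff.1 (hiso t₀)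
      have hu : ∀ t, |t - t₀| < r → t ∈ T → t = t₀ := by
        intro t ht hT'
        by_contra hne
        exact hT' (h ⟨by rwa [Metric.mem_ball, Real.dist_eq], hne⟩)
      refine ⟨r / 2, by positivity, fun t ht t' ht' h1 h2 => ?_⟩
      have e1 := hu t (by linarith) h1
      have e2 := hu t' (by
        have := abs_sub_le t' t t₀
        linarith) h2
      rw [e1, e2]
  -- a common radius
  have hS : ∃ ρ > 0, 2 * ρ < ρ₁ ∧ ∃ r > 0, r ≤ d₀ ∧ ∀ τ ∈ {t ∈ Ico (-1:ℝ) 1 | m₀ t ∉ Ioo 0 1},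
      ∀ d ∈ Ioo 0 r, ∃! t, |t - τ| < ρ ∧ deriv (m d) t = 0 := by
    have h1 : ∀ᶠ ρ in 𝓝[>] (0:ℝ), ∀ τ ∈ {t ∈ Ico (-1:ℝ) 1 | m₀ t ∉ Ioo 0 1},
        ∀ᶠ r in 𝓝[>] (0:ℝ), ∀ d ∈ Ioo 0 r, ∃! t, |t - τ| < ρ ∧ deriv (m d) t = 0 := by
      refine (eventually_all_finite hfin).2 fun τ hτ => ?_
      obtain ⟨ρ₀, hρ₀, h⟩ := hloc τ hτ.2
      filter_upwards [Ioo_mem_nhdsGT hρ₀] with ρ hρ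
      obtain ⟨r, hr, h⟩ := h ρ hρ
      filter_upwards [Ioo_mem_nhdsGT hr] with r' hr' d hd
      exact h d ⟨hd.1, hd.2.trans hr'.2⟩
    obtain ⟨ρ, h2, hρ⟩ := (h1.and (Ioo_mem_nhdsGT (half_pos hρ₁))).exists
    obtain ⟨r, h3, hr⟩ := (((eventually_all_finite hfin).2 h2).and (Ioo_mem_nhdsGT hd₀)).exists
    exact ⟨ρ, hρ.1, by linarith [hρ.2], r, hr.1, hr.2.le, h3⟩
  obtain ⟨ρ, hρ, hρρ, r₁, hr₁, hr₁d, hex⟩ := hS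
  -- For small d every critical point is within ρ of an extremum of the limit, because `hmono`
  -- excludes the rest of the period.
  obtain ⟨r₂, hr₂, hnear⟩ := uniform_of_posFilter
    (P := fun q => q.1 < d₀ → 0 < q.1 → deriv (m q.1) q.2 = 0 → ∃ τ ∈ T, |q.2 - τ| < ρ)
    (fun d t => by
      refine forall_congr' fun h1 => forall_congr' fun h2 => ?_
      have := hdper d ⟨h2, h1⟩ t 1
      simp only [Int.cast_one, one_mul] at this
      simp only [this]
      refine forall_congr' fun _ => ?_
      constructor
      · rintro ⟨τ, hτ, h⟩
        refine ⟨τ - 2, (by simpa using hTper (τ - 2) 1 : τ ∈ T ↔ τ - 2 ∈ T).1 hτ, ?_⟩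
        rwa [show t - (τ - 2) = t + 2 - τ by ring]
      · rintro ⟨τ, hτ, h⟩
        refine ⟨τ + 2, by simpa using (hTper τ 1).2 hτ, ?_⟩
        rwa [add_sub_add_right_eq_sub])
    (fun t₀ => by
      by_cases ht : t₀ ∈ T
      · have : ∀ᶠ q in posFilter t₀, |q.2 - t₀| < ρ := by
          have h1 := (tendsto_snd_posFilter t₀).eventually (Metric.ball_mem_nhds t₀ hρ)
          filter_upwards [h1] with q hq using by simpa [Real.dist_eq] using hq
        filter_upwards [this] with q hq _ _ _
        exact ⟨t₀, ht, hq⟩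
      · filter_upwards [hmono t₀ (not_not.1 ht)] with q hq _ _ h
        exact absurd h hq)
  obtain ⟨r₃, hr₃, hnd⟩ := uniform_of_posFilter
    (P := fun q => q.1 < d₀ → 0 < q.1 → deriv (m q.1) q.2 = 0 → iteratedDeriv 2 (m q.1) q.2 ≠ 0)
    (fun d t => by
      refine forall_congr' fun h1 => forall_congr' fun h2 => ?_
      have := hdper d ⟨h2, h1⟩ t 1
      simp only [Int.cast_one, one_mul] at this
      simp only [this, hddper d ⟨h2, h1⟩])
    (fun t₀ => by
      by_cases ht : t₀ ∈ T
      · rcases hTcase t₀ ht with h | h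
        · filter_upwards [hzero t₀ h] with q hq _ _ h0 using (hq h0).ne'
        · filter_upwards [hone t₀ h] with q hq _ _ h0 using (hq h0).ne
      · filter_upwards [hmono t₀ (not_not.1 ht)] with q hq _ _ h
        exact absurd h hq)
  refine ⟨min r₁ (min r₂ r₃), by positivity, fun d hd => ?_⟩
  have hd1 : d ∈ Ioo 0 r₁ := ⟨hd.1, hd.2.trans_le (min_le_left _ _)⟩
  have hd2 : d ∈ Ioo 0 r₂ := ⟨hd.1, hd.2.trans_le ((min_le_right _ _).trans (min_le_left _ _))⟩
  have hd3 : d ∈ Ioo 0 r₃ := ⟨hd.1, hd.2.trans_le ((min_le_right _ _).trans (min_le_right _ _))⟩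
  have hdd : d ∈ Ioo 0 d₀ := ⟨hd.1, hd1.2.trans_le hr₁d⟩
  refine ⟨?_, fun t => hnd d hd3 t hdd.2 hd.1⟩
  have h2 : (0:ℝ) < 2 := two_pos
  have hmod : ∀ t : ℝ, ∃ n : ℤ, t + n * 2 ∈ Ico (-1:ℝ) 1 := by
    intro t
    refine ⟨-toIcoDiv h2 (-1) t, ?_⟩
    have := toIcoMod_mem_Ico h2 (-1) t
    rw [toIcoMod, zsmul_eq_mul, mem_Ico] at this
    rw [mem_Ico]
    push_cast
    constructor <;> linarith [this.1, this.2]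
  have hIco : ∀ t t' (n : ℤ), t ∈ Ico (-1:ℝ) 1 → t' ∈ Ico (-1:ℝ) 1 → t' = t + n * 2 → t' = t := by
    intro t t' n h1 h2 h
    have e1 : (-1:ℝ) < n := by linarith [h1.1, h1.2, h2.1, h2.2]
    have e2 : (n:ℝ) < 1 := by linarith [h1.1, h1.2, h2.1, h2.2]
    have e3 : n = 0 := by
      have e1' : -1 < n := by exact_mod_cast e1
      have e2' : n < 1 := by exact_mod_cast e2
      omega
    rw [h, e3]; simp
  choose! c hc hcu using fun τ hτ => hex τ hτ d hd1
  choose n hn using hmod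
  symm
  -- The critical point near an extremum may fall outside [-1, 1), so it is shifted by whole
  -- periods. Since 2 ρ < ρ₁, distinct extrema keep distinct images.
  refine ncard_congr (fun τ _ => c τ + n (c τ) * 2) (fun τ hτ => ?_) (fun τ τ' hτ hτ' h => ?_) fun t ht => ?_
  · exact ⟨hn _, by rw [hdper d hdd]; exact (hc τ hτ).2⟩
  · have e1 := (hc τ hτ).1
    have e2 := (hc τ' hτ').1
    have e3 : τ' = τ + (n (c τ) - n (c τ') : ℤ) * 2 := by
      refine hsep _ _ ?_ ((hTper τ _).2 hτ.2) hτ'.2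
      rw [abs_lt] at e1 e2 ⊢
      push_cast
      constructor <;> linarith [e1.1, e1.2, e2.1, e2.2]
    exact (hIco τ τ' _ hτ.1 hτ'.1 e3).symm
  · obtain ⟨τ, hτ, hτt⟩ := hnear d hd2 t hdd.2 hd.1 ht.2
    have hτ' : τ + n τ * 2 ∈ {t ∈ Ico (-1:ℝ) 1 | m₀ t ∉ Ioo 0 1} := ⟨hn τ, (hTper τ _).2 hτ⟩
    refine ⟨_, hτ', ?_⟩
    have e := hcu _ hτ' (t + n τ * 2) ⟨by rwa [add_sub_add_right_eq_sub], by rw [hdper d hdd]; exact ht.2⟩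
    refine hIco t _ (n τ + n (c (τ + n τ * 2))) ht.1 (hn _) ?_
    simp only [← e]
    push_cast
    ring

end critical

/-! ### The family of closed curves in (x, y, μ). -/

section family

variable {g φ : ℝ × ℝ → ℝ} {K : ℝ × ℝ × ℝ → ℝ} {a b : ℝ} {um up : ℝ → ℝ} {γ₀ : ℝ → ℝ × ℝ × ℝ}

theorem IsSingularParam.periodic (hγ : IsSingularParam um up φ γ₀) (t : ℝ) : γ₀ (t + 2) = γ₀ t :=
  (hγ.unique (t + 2) (γ₀ t) (hγ.mem t) (OnRay.add_two.2 (hγ.ray t))).symm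

theorem exists_add_mem_Ico (t : ℝ) : ∃ n : ℤ, t + n * 2 ∈ Ico (-1:ℝ) 1 := by
  refine ⟨-toIcoDiv two_pos (-1) t, ?_⟩
  have := toIcoMod_mem_Ico (two_pos (α := ℝ)) (-1) t
  rw [toIcoMod, zsmul_eq_mul, mem_Ico] at this
  rw [mem_Ico]
  push_cast
  constructor <;> linarith [this.1, this.2]

theorem eq_of_mem_Ico {t t' : ℝ} {n : ℤ} (h1 : t ∈ Ico (-1:ℝ) 1) (h2 : t' ∈ Ico (-1:ℝ) 1)
    (h : t' = t + n * 2) : t' = t := by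
  have e1 : (-1:ℝ) < n := by linarith [h1.1, h1.2, h2.1, h2.2]
  have e2 : (n:ℝ) < 1 := by linarith [h1.1, h1.2, h2.1, h2.2]
  have e3 : n = 0 := by
    have e1' : -1 < n := by exact_mod_cast e1
    have e2' : n < 1 := by exact_mod_cast e2
    omega
  rw [h, e3]; simp

theorem injOn_of_onRay {γ : ℝ → ℝ × ℝ × ℝ} (h : ∀ t, OnRay t (planar φ (γ t))) :
    InjOn γ (Ico (-1) 1) := by
  intro t ht t' ht' e
  have h' := h t'
  rw [← e] at h'
  obtain ⟨n, hn⟩ := (h t).eq_add h'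
  exact (eq_of_mem_Ico ht ht' (n := n) (by linarith)).symm

theorem IsSingularParam.exists_eq (hg : Profile g um up) (hφ : IsCoordinate um up φ)
    (hγ : IsSingularParam um up φ γ₀) {p : ℝ × ℝ × ℝ} (hp : p ∈ singularCurve um up) :
    ∃ t ∈ Ico (-1:ℝ) 1, γ₀ t = p := by
  obtain ⟨t, -, ht⟩ := exists_onRay (hg.planar_ne_zero hφ hp)
  obtain ⟨n, hn⟩ := exists_add_mem_Ico t
  refine ⟨_, hn, ?_⟩
  rw [Function.Periodic.int_mul hγ.periodic n t]
  exact (hγ.unique t p hp ht.1).symm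

/-- The three corners at μ = 0, with x₀ in the role of u₊(0), and the three folds at μ = 1. -/
def levelExtrema (x₀ : ℝ) : Set (ℝ × ℝ × ℝ) :=
  {(0, 0, 0), (x₀, 0, 0), (0, x₀, 0), (1, 0, 1), (0, 1, 1), (1, 1, 1)}

theorem ncard_levelExtrema {x₀ : ℝ} (h : 0 < x₀) : (levelExtrema x₀).ncard = 6 := by
  have h' := h.ne'
  have h'' := h.ne
  unfold levelExtrema
  repeat rw [ncard_insert_of_notMem (by simp [h', h''])]
  rw [ncard_singleton]

theorem Profile.singularCurve_extreme (hg : Profile g um up) :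
    {p ∈ singularCurve um up | p.2.2 ∉ Ioo (0:ℝ) 1} = levelExtrema (up 0) := by
  have h0 := hg.um_zero
  have h1 := hg.um_one
  have h2 := hg.up_one
  ext ⟨x, y, μ⟩
  simp only [mem_ofPred_eq, singularCurve, halfCD, mem_union, mem_preimage, halfAB, swapXY, levelExtrema,
    mem_insert_iff, mem_singleton_iff, Prod.mk.injEq]
  constructor
  · rintro ⟨h, hμ⟩
    have hI : μ ∈ Icc (0:ℝ) 1 := by rcases h with h | h <;> exact h.1
    have hc : μ = 0 ∨ μ = 1 := by
      by_contra! hne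
      exact hμ ⟨lt_of_le_of_ne hI.1 hne.1.symm, lt_of_le_of_ne hI.2 hne.2⟩
    rcases hc with rfl | rfl
    · rcases h with ⟨-, h | h | h⟩ | ⟨-, h | h | h⟩ <;> simp [h.1, h.2, h0]
    · rcases h with ⟨-, h | h | h⟩ | ⟨-, h | h | h⟩ <;> simp [h.1, h.2, h1, h2]
  · have i0 : (0:ℝ) ∈ Icc (0:ℝ) 1 := by simp
    have i1 : (1:ℝ) ∈ Icc (0:ℝ) 1 := by simp
    rintro (h | h | h | h | h | h) <;> obtain ⟨rfl, rfl, rfl⟩ := h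
    · exact ⟨Or.inl ⟨i0, Or.inl ⟨h0.symm, rfl⟩⟩, by simp⟩
    · exact ⟨Or.inl ⟨i0, Or.inr (Or.inl ⟨rfl, rfl⟩)⟩, by simp⟩
    · exact ⟨Or.inr ⟨i0, Or.inr (Or.inl ⟨rfl, rfl⟩)⟩, by simp⟩
    · exact ⟨Or.inl ⟨i1, Or.inl ⟨h1.symm, rfl⟩⟩, by simp⟩
    · exact ⟨Or.inr ⟨i1, Or.inl ⟨h1.symm, rfl⟩⟩, by simp⟩
    · exact ⟨Or.inl ⟨i1, Or.inr (Or.inr ⟨h2.symm, h1.symm⟩)⟩, by simp⟩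

theorem IsSingularParam.ncard_extreme (hg : Profile g um up) (hφ : IsCoordinate um up φ)
    (hγ : IsSingularParam um up φ γ₀) : {t ∈ Ico (-1:ℝ) 1 | (γ₀ t).2.2 ∉ Ioo (0:ℝ) 1}.ncard = 6 := by
  rw [← ncard_levelExtrema (hg.up_pos (μ := 0) (by simp)), ← hg.singularCurve_extreme]
  refine ncard_congr (fun t _ => γ₀ t) (fun t ht => ⟨hγ.mem t, ht.2⟩)
    (fun t t' ht ht' h => injOn_of_onRay hγ.ray ht.1 ht'.1 h) fun p hp => ?_
  obtain ⟨t, ht, rfl⟩ := hγ.exists_eq hg hφ hp.1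
  exact ⟨t, ⟨ht, hp.2⟩, rfl⟩

/-- The exceptional points are finitely many, and the curve returns to any one of them only after a
full period. -/
theorem IsSingularParam.eventually_ne_extreme (hg : Profile g um up)
    (hγ : IsSingularParam um up φ γ₀) (τ : ℝ) : ∀ᶠ t in 𝓝[≠] τ, (γ₀ t).2.2 ∈ Ioo (0:ℝ) 1 := by
  have hfin : (levelExtrema (up 0) \ {γ₀ τ}).Finite := by
    unfold levelExtrema
    exact (Set.toFinite _).sdiff
  have h1 : ∀ᶠ t in 𝓝 τ, γ₀ t ∈ (levelExtrema (up 0) \ {γ₀ τ})ᶜ :=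
    hγ.cont.continuousAt.eventually (hfin.isClosed.isOpen_compl.mem_nhds (by simp))
  have h2 : ∀ᶠ t in 𝓝 τ, |t - τ| < 2 := by
    filter_upwards [Metric.ball_mem_nhds τ two_pos] with t ht using by simpa [Real.dist_eq] using ht
  filter_upwards [nhdsWithin_le_nhds h1, nhdsWithin_le_nhds h2, self_mem_nhdsWithin] with t ht1 ht2 ht3
  by_contra hμ
  have hE : γ₀ t ∈ levelExtrema (up 0) := by
    rw [← hg.singularCurve_extreme]; exact ⟨hγ.mem t, hμ⟩
  have e : γ₀ t = γ₀ τ := by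
    by_contra hne
    exact ht1 ⟨hE, hne⟩
  have hr := hγ.ray t
  rw [e] at hr
  obtain ⟨n, hn⟩ := (hγ.ray τ).eq_add hr
  rw [hn, abs_lt] at ht2
  have e1 : (-1:ℝ) < n := by linarith [ht2.1]
  have e2 : (n:ℝ) < 1 := by linarith [ht2.2]
  have e1' : -1 < n := by exact_mod_cast e1
  have e2' : n < 1 := by exact_mod_cast e2
  have e3 : n = 0 := by omega
  apply ht3
  rw [hn, e3]; simp

theorem singularCurve_level {p : ℝ × ℝ × ℝ} (hp : p ∈ singularCurve um up) :
    p.2.2 ∈ Icc (0:ℝ) 1 := by rcases hp with h | h <;> exact h.1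

/-- A family of closed curves of solutions that perturbs the singular curve `γ₀`. -/
structure IsBranchFamily (a b : ℝ) (g : ℝ × ℝ → ℝ) (K : ℝ × ℝ × ℝ → ℝ) (φ : ℝ × ℝ → ℝ)
    (γ₀ : ℝ → ℝ × ℝ × ℝ) (d₀ : ℝ) (γ : ℝ → ℝ → ℝ × ℝ × ℝ) : Prop where
  zero : γ 0 = γ₀
  periodic : ∀ d ∈ Ico 0 d₀, Function.Periodic (γ d) 2
  ray : ∀ d ∈ Ico 0 d₀, ∀ t, OnRay t (planar φ (γ d t))
  mem : ∀ d ∈ Ioo 0 d₀, ∀ t, γ d t ∈ branchSet a b g K d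
  smooth : ∀ d ∈ Ioo 0 d₀, ∀ t, ContDiffAt ℝ ∞ (Function.uncurry γ) (d, t)
  tendsto : ∀ t, Tendsto (Function.uncurry γ) (posFilter t) (𝓝 (γ₀ t))
  level : ∀ d ∈ Ioo 0 d₀, ∀ t, (γ d t).2.2 ∈ Ioo (0:ℝ) 1
  regular : ∀ t, (γ₀ t).2.2 ≠ 0 → ∃ c : ℝ × ℝ → ℝ × ℝ × ℝ, (∀ᶠ q in 𝓝 (0, t), ContDiffAt ℝ ∞ c q) ∧
    ∃ r > 0, ∀ d ∈ Ico 0 r, ∀ s, |s - t| < r → γ d s = c (d, s)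
  critical : ∀ d ∈ Ioo 0 d₀, {t ∈ Ico (-1:ℝ) 1 | deriv (fun s => (γ d s).2.2) t = 0}.ncard = 6 ∧
    ∀ t, deriv (fun s => (γ d s).2.2) t = 0 → iteratedDeriv 2 (fun s => (γ d s).2.2) t ≠ 0
  near : ∃ δ > 0, δ ≤ d₀ ∧ ∀ d ∈ Ioo 0 δ, ∀ t p, dist p (γ₀ t) < δ → p ∈ branchSet a b g K d →
    ∃ t', p = γ d t'

/-- Every property of the local branches holds for small d near each t, hence uniformly over a
period; d₀ is the smallest of the bounds that arise. -/
theorem IsSingularParam.exists_isBranchFamily (hg : Profile g um up) (hφ : IsCoordinate um up φ)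
    (hK : IsDividedDifference g K) (hγ : IsSingularParam um up φ γ₀) (ha : 0 < a) (hb : 0 < b) :
    ∃ d₀ > 0, ∃ γ, IsBranchFamily a b g K φ γ₀ d₀ γ := by
  choose c hc using hγ.exists_isGoodBranch hg hφ hK ha hb
  obtain ⟨d₁, hd₁, γ, hγ0, hper, hray, hmem, hloc, δ, hδ, hδd, hnear⟩ := exists_family
    (contDiff_planar hφ.smooth).continuous hγ.cont hγ.ray hγ.periodic fun t => ⟨c t, (hc t).branch⟩
  have heq : ∀ t, ∀ᶠ q in posFilter t, γ q.1 q.2 = c t q := fun t => hloc t _ (hc t).branch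
  have heq' : ∀ t, ∀ᶠ q in posFilter t, ∀ᶠ q' in 𝓝 q, γ q'.1 q'.2 = c t q' := fun t =>
    eventually_nhds_of_posFilter (heq t)
  have hslice : ∀ t, ∀ᶠ q in posFilter t,
      (fun s => (γ q.1 s).2.2) =ᶠ[𝓝 q.2] fun s => (c t (q.1, s)).2.2 := by
    intro t
    filter_upwards [heq' t] with q hq
    have ht : Tendsto (fun s : ℝ => (q.1, s)) (𝓝 q.2) (𝓝 q) :=
      (by fun_prop : Continuous fun s : ℝ => (q.1, s)).tendsto _
    filter_upwards [ht.eventually hq] with s hs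
    rw [hs]
  have hsh : ∀ d ∈ Ioo 0 d₁, ∀ t, γ d (t + 2) = γ d t := fun d hd => hper d ⟨hd.1.le, hd.2⟩
  have hT : ∀ t, Tendsto (Function.uncurry γ) (posFilter t) (𝓝 (γ₀ t)) := by
    intro t
    refine (hc t).branch.tendsto.congr' ?_
    filter_upwards [heq t] with q hq using hq.symm
  obtain ⟨d₂, hd₂, hsm⟩ := uniform_of_posFilter
    (P := fun q => q.1 ∈ Ioo 0 d₁ → ContDiffAt ℝ ∞ (Function.uncurry γ) q)
    (fun d t => by
      refine forall_congr' fun hd => ?_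
      have hsft : ∀ r : ℝ, ContDiff ℝ ∞ fun q : ℝ × ℝ => (q.1, q.2 + r) := fun r => by fun_prop
      have hev : ∀ s : ℝ, ∀ᶠ q : ℝ × ℝ in 𝓝 (d, s), q.1 ∈ Ioo 0 d₁ := fun s =>
        continuousAt_fst.eventually (isOpen_Ioo.mem_nhds hd)
      constructor
      · intro h
        have := ContDiffAt.comp (g := Function.uncurry γ) (f := fun q : ℝ × ℝ => (q.1, q.2 + 2)) (d, t) h (hsft 2).contDiffAt
        refine this.congr_of_eventuallyEq ?_
        filter_upwards [hev t] with q hq using (hsh q.1 hq q.2).symm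
      · intro h
        have := ContDiffAt.comp (g := Function.uncurry γ) (f := fun q : ℝ × ℝ => (q.1, q.2 + -2)) (d, t + 2)
          (by simpa using h) (hsft (-2)).contDiffAt
        refine this.congr_of_eventuallyEq ?_
        filter_upwards [hev (t + 2)] with q hq
        have := hsh q.1 hq (q.2 + -2)
        rw [neg_add_cancel_right] at this
        exact this)
    (fun t => by
      filter_upwards [heq' t, (hc t).branch.smooth] with q h1 h2 _
      exact h2.congr_of_eventuallyEq h1)
  obtain ⟨d₃, hd₃, hlev⟩ := uniform_of_posFilter
    (P := fun q => q.1 ∈ Ioo 0 d₁ → (γ q.1 q.2).2.2 ∈ Ioo (0:ℝ) 1)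
    (fun d t => forall_congr' fun hd => by rw [hsh d hd])
    (fun t => by
      filter_upwards [heq t, (hc t).level] with q h1 h2 _
      rw [h1]; exact h2)
  have hd₁₂ : 0 < min d₁ d₂ := lt_min hd₁ hd₂
  have hsm' : ∀ d ∈ Ioo 0 (min d₁ d₂), ∀ t, ContDiffAt ℝ ∞ (Function.uncurry γ) (d, t) := fun d hd t =>
    hsm d ⟨hd.1, hd.2.trans_le (min_le_right _ _)⟩ t ⟨hd.1, hd.2.trans_le (min_le_left _ _)⟩
  have hIcc : ∀ t, (γ₀ t).2.2 ∈ Icc (0:ℝ) 1 := fun t => singularCurve_level (hγ.mem t)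
  have hc22 : Continuous fun p : ℝ × ℝ × ℝ => p.2.2 := by fun_prop
  have h6 := hγ.ncard_extreme hg hφ
  obtain ⟨d₄, hd₄, hcrit⟩ := ncard_critical (m := fun d t => (γ d t).2.2) (m₀ := fun t => (γ₀ t).2.2) hd₁₂
    (fun d hd t => by simp only [hsh d ⟨hd.1, hd.2.trans_le (min_le_left _ _)⟩ t])
    (fun t => by simp only [hγ.periodic])
    (fun d hd => by
      refine contDiff_iff_contDiffAt.2 fun t => ?_
      have h1 : ContDiffAt ℝ ∞ (γ d) t :=
        ContDiffAt.comp (g := Function.uncurry γ) (f := fun s : ℝ => (d, s)) t (hsm' d hd t) (by fun_prop)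
      exact (contDiffAt_snd.comp t (contDiffAt_snd.comp t h1)).of_le (by norm_cast))
    (fun t => (hc22.tendsto _).comp (hT t)) hIcc
    (finite_of_ncard_ne_zero (by rw [h6]; norm_num)) (hγ.eventually_ne_extreme hg)
    (fun τ hτ => by
      filter_upwards [hslice τ, (hc τ).monotone hτ.1 hτ.2] with q h1 h2
      rw [h1.deriv_eq]; exact h2)
    (fun τ hτ => by
      filter_upwards [hslice τ, (hc τ).fold hτ] with q h1 h2
      rw [h1.deriv_eq, h1.iteratedDeriv_eq]; exact h2)
    (fun τ hτ => by
      filter_upwards [hslice τ, (hc τ).corner hτ] with q h1 h2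
      rw [h1.deriv_eq, h1.iteratedDeriv_eq]; exact h2)
  rw [h6] at hcrit
  set d₀ := min (min d₁ d₂) (min d₃ d₄) with hd₀
  have l1 : d₀ ≤ min d₁ d₂ := min_le_left _ _
  have l1' : d₀ ≤ d₁ := l1.trans (min_le_left _ _)
  have l3 : d₀ ≤ d₃ := (min_le_right _ _).trans (min_le_left _ _)
  have l4 : d₀ ≤ d₄ := (min_le_right _ _).trans (min_le_right _ _)
  have hpos : 0 < d₀ := by positivity
  refine ⟨d₀, hpos, γ, ⟨hγ0, fun d hd => hper d ⟨hd.1, hd.2.trans_le l1'⟩,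
    fun d hd => hray d ⟨hd.1, hd.2.trans_le l1'⟩, fun d hd => hmem d ⟨hd.1, hd.2.trans_le l1'⟩,
    fun d hd => hsm' d ⟨hd.1, hd.2.trans_le l1⟩, hT,
    fun d hd t => hlev d ⟨hd.1, hd.2.trans_le l3⟩ t ⟨hd.1, hd.2.trans_le l1'⟩, ?_,
    fun d hd => hcrit d ⟨hd.1, hd.2.trans_le l4⟩, min δ d₀, lt_min hδ hpos, min_le_right _ _,
    fun d hd t p hp => hnear d ⟨hd.1, hd.2.trans_le (min_le_left _ _)⟩ t p (hp.trans_le (min_le_left _ _))⟩⟩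
  intro t ht
  obtain ⟨h1, h2⟩ := (hc t).regular ht
  refine ⟨c t, h1, ?_⟩
  obtain ⟨r, hr, h3⟩ := eventually_posFilter.1 (heq t)
  obtain ⟨r', hr', h4⟩ := Metric.eventually_nhds_iff.1 h2
  refine ⟨min r r', lt_min hr hr', fun d hd s hs => ?_⟩
  rcases hd.1.eq_or_lt with rfl | h
  · rw [h4 (by rw [Real.dist_eq]; exact hs.trans_le (min_le_right _ _)), hγ0]
  · exact h3 d ⟨h, hd.2.trans_le (min_le_left _ _)⟩ s (hs.trans_le (min_le_left _ _))

variable {d₀ : ℝ} {γ : ℝ → ℝ → ℝ × ℝ × ℝ}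

/-- Reads the velocity off a function smooth on a full neighbourhood of (d, t), including negative d
when d = 0. Continuity of the velocity down to d = 0 then follows by restriction to d ≥ 0. -/
theorem IsBranchFamily.slice (h : IsBranchFamily a b g K φ γ₀ d₀ γ) {d : ℝ} (hd : d ∈ Ico 0 d₀) {t : ℝ}
    (h0 : d = 0 → (γ₀ t).2.2 ≠ 0) : ∃ c : ℝ × ℝ → ℝ × ℝ × ℝ, ContDiffAt ℝ ∞ c (d, t) ∧
      (γ d =ᶠ[𝓝 t] fun s => c (d, s)) ∧
      (∀ᶠ q in 𝓝[Ici 0 ×ˢ univ] (d, t), deriv (γ q.1) q.2 = fderiv ℝ c q (0, 1)) := by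
  have hderiv : ∀ c : ℝ × ℝ → ℝ × ℝ × ℝ, ∀ q : ℝ × ℝ, DifferentiableAt ℝ c q →
      HasDerivAt (fun s => c (q.1, s)) (fderiv ℝ c q (0, 1)) q.2 := by
    intro c q hc
    exact hc.hasFDerivAt.comp_hasDerivAt q.2 ((hasDerivAt_const q.2 q.1).prodMk (hasDerivAt_id q.2))
  rcases hd.1.eq_or_lt with rfl | hpos
  · obtain ⟨c, hc, r, hr, he⟩ := h.regular t (h0 rfl)
    have hev : ∀ d ∈ Ico 0 r, ∀ s, |s - t| < r → γ d =ᶠ[𝓝 s] fun s => c (d, s) := by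
      intro d hd s hs
      have : ∀ᶠ s' in 𝓝 s, |s' - t| < r :=
        (by fun_prop : Continuous fun s' : ℝ => |s' - t|).continuousAt.eventually_lt_const hs
      filter_upwards [this] with s' hs' using he d hd s' hs'
    refine ⟨c, hc.self_of_nhds, hev 0 ⟨le_rfl, hr⟩ t (by simpa using hr), ?_⟩
    have h1 : ∀ᶠ q : ℝ × ℝ in 𝓝 (0, t), q.1 < r ∧ |q.2 - t| < r := by
      refine (continuousAt_fst.eventually_lt_const (by simpa using hr)).and ?_
      exact (by fun_prop : Continuous fun q : ℝ × ℝ => |q.2 - t|).continuousAt.eventually_lt_const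
        (by simpa using hr)
    filter_upwards [self_mem_nhdsWithin, nhdsWithin_le_nhds h1, nhdsWithin_le_nhds hc] with q q1 q2 q3
    rw [(hev q.1 ⟨q1.1, q2.1⟩ q.2 q2.2).deriv_eq]
    exact (hderiv c q (q3.differentiableAt (by simp))).deriv
  · refine ⟨Function.uncurry γ, h.smooth d ⟨hpos, hd.2⟩ t, EventuallyEq.rfl, ?_⟩
    have h1 : ∀ᶠ q : ℝ × ℝ in 𝓝 (d, t), q.1 ∈ Ioo 0 d₀ :=
      continuousAt_fst.eventually (isOpen_Ioo.mem_nhds ⟨hpos, hd.2⟩)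
    filter_upwards [nhdsWithin_le_nhds h1] with q hq
    exact (hderiv (Function.uncurry γ) q ((h.smooth q.1 hq q.2).differentiableAt (by simp))).deriv

theorem IsBranchFamily.differentiableAt (h : IsBranchFamily a b g K φ γ₀ d₀ γ) {d : ℝ}
    (hd : d ∈ Ico 0 d₀) {t : ℝ} (h0 : d = 0 → (γ₀ t).2.2 ≠ 0) : DifferentiableAt ℝ (γ d) t := by
  obtain ⟨c, h1, h2, -⟩ := h.slice hd h0
  refine DifferentiableAt.congr_of_eventuallyEq ?_ h2
  exact DifferentiableAt.comp (g := c) t (h1.differentiableAt (by simp)) (by fun_prop)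

theorem IsBranchFamily.velocity_ne_zero (hφ : ContDiff ℝ ∞ φ) (h : IsBranchFamily a b g K φ γ₀ d₀ γ)
    {d : ℝ} (hd : d ∈ Ico 0 d₀) {t : ℝ} (h0 : d = 0 → (γ₀ t).2.2 ≠ 0) : deriv (γ d) t ≠ 0 :=
  velocity_ne_zero_of_onRay hφ (h.differentiableAt hd h0) (Eventually.of_forall (h.ray d hd))

theorem IsBranchFamily.velocity_continuous (h : IsBranchFamily a b g K φ γ₀ d₀ γ)
    {d : ℝ} (hd : d ∈ Ico 0 d₀) {t : ℝ} (h0 : d = 0 → (γ₀ t).2.2 ≠ 0) :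
    ContinuousWithinAt (fun q : ℝ × ℝ => deriv (γ q.1) q.2) (Ici 0 ×ˢ univ) (d, t) := by
  obtain ⟨c, h1, -, h3⟩ := h.slice hd h0
  have h4 : ContinuousAt (fun q => fderiv ℝ c q (0, 1)) (d, t) :=
    (ContDiffAt.clm_apply (h1.fderiv_right (m := ∞) (by norm_cast)) contDiffAt_const).continuousAt
  refine h4.continuousWithinAt.congr_of_eventuallyEq h3 ?_
  exact h3.self_of_nhdsWithin ⟨hd.1, mem_univ _⟩

theorem IsBranchFamily.continuousOn (hγ : Continuous γ₀) (h : IsBranchFamily a b g K φ γ₀ d₀ γ) :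
    ContinuousOn (Function.uncurry γ) (Ico 0 d₀ ×ˢ univ) := by
  rintro ⟨d, t⟩ ⟨hd, -⟩
  rcases hd.1.eq_or_lt with rfl | hpos
  · have hsub : (Ico 0 d₀ ×ˢ univ : Set (ℝ × ℝ)) ⊆ {q | 0 < q.1} ∪ {q | q.1 = 0} := by
      rintro q ⟨hq, -⟩
      rcases hq.1.eq_or_lt with e | e
      · exact Or.inr e.symm
      · exact Or.inl e
    refine ContinuousWithinAt.mono ?_ hsub
    have hval : Function.uncurry γ (0, t) = γ₀ t := congrFun h.zero t
    refine ContinuousWithinAt.union ?_ ?_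
    · rw [ContinuousWithinAt, hval]; exact h.tendsto t
    · have h1 : ContinuousWithinAt (fun q : ℝ × ℝ => γ₀ q.2) {q : ℝ × ℝ | q.1 = 0} (0, t) :=
        (hγ.comp continuous_snd).continuousWithinAt
      refine h1.congr (fun q hq => ?_) hval
      obtain ⟨q1, q2⟩ := q
      obtain rfl : q1 = 0 := hq
      exact congrFun h.zero q2
  · exact (h.smooth d ⟨hpos, hd.2⟩ t).continuousAt.continuousWithinAt

end family

/-! ### Expansions of μ at the two homogeneous points. -/

section endpoints

variable {g φ : ℝ × ℝ → ℝ} {K : ℝ × ℝ × ℝ → ℝ} {a b : ℝ} {um up : ℝ → ℝ} {γ₀ : ℝ → ℝ × ℝ × ℝ}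

theorem exists_quotient {h : ℝ × ℝ → ℝ} (hh : ContDiff ℝ ∞ h) (h0 : ∀ μ, h (0, μ) = 0) :
    ∃ q : ℝ × ℝ → ℝ, ContDiff ℝ ∞ q ∧ (∀ u μ, h (u, μ) = u * q (u, μ)) ∧
      ∀ μ, q (0, μ) = partialU h (0, μ) := by
  obtain ⟨K, hK⟩ := exists_isDividedDifference hh
  refine ⟨fun p => K (p.1, 0, p.2), hK.smooth.comp (by fun_prop), fun u μ => ?_, fun μ => hK.diag 0 μ⟩
  have := hK.sub_eq u 0 μ
  rwa [h0, sub_zero, sub_zero] at this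

theorem partialU_eq {h : ℝ × ℝ → ℝ} (hh : ContDiff ℝ ∞ h) {u μ h' : ℝ}
    (H : HasDerivAt (fun u => h (u, μ)) h' u) : partialU h (u, μ) = h' :=
  (hasDerivAt_fst hh u μ).unique H

/-- Evenness of g in u removes all odd powers. Without it the term u³ C in g_u would be only u² C,
and the error in the expansion would not be O(d²). -/
theorem Profile.exists_pitchfork_form (hg : Profile g um up) : ∃ (A : ℝ → ℝ) (B C : ℝ × ℝ → ℝ),
    ContDiff ℝ ∞ A ∧ ContDiff ℝ ∞ B ∧ ContDiff ℝ ∞ C ∧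
    (∀ u μ, g (u, μ) = μ * (partialM g (0, 0) + μ * A μ) + u ^ 2 * B (u, μ)) ∧
    (∀ u μ, partialU g (u, μ) = 2 * u * B (u, μ) + u ^ 3 * C (u, μ)) ∧ 0 < B (0, 0) := by
  have hs := hg.smooth
  obtain ⟨q, hq, q1, q2⟩ := exists_quotient (h := fun p => g p - g (0, p.2))
    (hs.sub (hs.comp (by fun_prop))) (fun μ => by simp)
  have hpU : ∀ μ, partialU (fun p => g p - g (0, p.2)) (0, μ) = 0 := fun μ => by
    refine partialU_eq (hs.sub (hs.comp (by fun_prop))) ?_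
    refine ((hasDerivAt_fst hs 0 μ).sub_const (g (0, μ))).congr_deriv ?_
    exact hg.partialU_zero μ
  obtain ⟨B, hB, b1, b2⟩ := exists_quotient hq (fun μ => by rw [q2, hpU])
  have hgB : ∀ u μ, g (u, μ) = g (0, μ) + u ^ 2 * B (u, μ) := by
    intro u μ
    have := q1 u μ
    simp only [b1] at this
    linear_combination this
  have heven : ∀ u μ, B (-u, μ) = B (u, μ) := by
    intro u μ
    by_cases hu : u = 0
    · rw [hu, _root_.neg_zero]
    · have h1 := hgB u μ
      have h2 := hgB (-u) μ
      rw [hg.even, neg_sq, h1] at h2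
      have h3 : u ^ 2 ≠ 0 := pow_ne_zero 2 hu
      exact (mul_left_cancel₀ h3 (by linarith)).symm
  have hB0 : ∀ μ, partialU B (0, μ) = 0 := by
    intro μ
    have h1 := hasDerivAt_fst hB 0 μ
    have h1' : HasDerivAt (fun u => B (u, μ)) (partialU B (0, μ)) (-0) := by rw [_root_.neg_zero]; exact h1
    have h2 := h1'.scomp (0:ℝ) (hasDerivAt_neg (0:ℝ))
    have h3 : ((fun u => B (u, μ)) ∘ Neg.neg) = fun u => B (u, μ) := funext fun u => heven u μ
    rw [h3] at h2
    have := h1.unique h2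
    simp only [smul_eq_mul] at this
    linarith
  obtain ⟨C, hC, c1, -⟩ := exists_quotient (contDiff_partialU hB) hB0
  have hgU : ∀ u μ, partialU g (u, μ) = 2 * u * B (u, μ) + u ^ 3 * C (u, μ) := by
    intro u μ
    refine partialU_eq hs ?_
    have h1 := ((((hasDerivAt_id u).pow 2).mul (hasDerivAt_fst hB u μ)).const_add (g (0, μ)))
    refine (h1.congr_of_eventuallyEq (Eventually.of_forall fun u => ?_)).congr_deriv ?_
    · simp [hgB u μ]
    · simp only [id, Nat.cast_ofNat, Pi.pow_apply, c1]
      ring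
  obtain ⟨A₁, hA₁, a1, a2⟩ := exists_hadamard (h := fun μ => g (0, μ)) (hs.comp (by fun_prop)) 0
  obtain ⟨A₂, hA₂, a3, -⟩ := exists_hadamard hA₁ 0
  refine ⟨A₂, B, C, hA₂, hB, hC, fun u μ => ?_, hgU, ?_⟩
  · have e1 := a1 μ
    simp only [hg.g_zero, sub_zero, zero_add] at e1
    have e2 := a3 μ
    rw [a2, (hasDerivAt_snd hs 0 0).deriv, sub_zero] at e2
    rw [hgB, e1, e2]
  · have : partialU (partialU g) (0, 0) = 2 * B (0, 0) := by
      refine partialU_eq (contDiff_partialU hs) ?_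
      have h1 := (((hasDerivAt_id (0:ℝ)).const_mul 2).mul (hasDerivAt_fst hB 0 0)).add
        (((hasDerivAt_id (0:ℝ)).pow 3).mul (hasDerivAt_fst hC 0 0))
      refine (h1.congr_of_eventuallyEq (Eventually.of_forall fun u => ?_)).congr_deriv ?_
      · simp [hgU]
      · simp
    linarith [hg.pitch_uu]

theorem isBigO_of_eq_mul {l : Filter ℝ} {F G H : ℝ → ℝ} {c : ℝ} (h : ∀ᶠ d in l, F d = G d * H d)
    (hH : Tendsto H l (𝓝 c)) : F =O[l] G := by
  have := (isBigO_refl G l).mul (hH.isBigO_one ℝ)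
  simp only [mul_one] at this
  exact this.congr' (h.mono fun d hd => hd.symm) EventuallyEq.rfl

/-- Write q = g_μ(0, 0). The zero equation is -2 μ (q + μ A) = 2 u² B, and the other one is 2 u² B +
u⁴ C = D. Both u² and μ are O(D), and the difference gives -2 q μ - D = 2 μ² A - u⁴ C = O(D²). -/
theorem Profile.pitchfork_asymptotics (hg : Profile g um up) {z : ℝ → ℝ × ℝ} {D : ℝ → ℝ}
    {l : Filter ℝ} (hz : Tendsto z l (𝓝 (0, 0))) (h0 : ∀ᶠ d in l, g (z d) = 0)
    (hD : ∀ᶠ d in l, (z d).1 * partialU g (z d) = D d) :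
    (fun d => (z d).2 - D d / (2 * -partialM g (0, 0))) =O[l] fun d => D d ^ 2 := by
  obtain ⟨A, B, C, hA, hB, hC, hgf, hgU, hB0⟩ := hg.exists_pitchfork_form
  have hq := hg.pitch_μ.ne
  set q := partialM g (0, 0) with hqdef
  have hx : Tendsto (fun d => (z d).1) l (𝓝 0) := (continuous_fst.tendsto ((0:ℝ), (0:ℝ))).comp hz
  have hμ : Tendsto (fun d => (z d).2) l (𝓝 0) := (continuous_snd.tendsto ((0:ℝ), (0:ℝ))).comp hz
  have tA : Tendsto (fun d => A (z d).2) l (𝓝 (A 0)) := (hA.continuous.tendsto 0).comp hμ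
  have tB : Tendsto (fun d => B (z d)) l (𝓝 (B (0, 0))) := (hB.continuous.tendsto _).comp hz
  have tC : Tendsto (fun d => C (z d)) l (𝓝 (C (0, 0))) := (hC.continuous.tendsto _).comp hz
  have tE : Tendsto (fun d => 2 * B (z d) + (z d).1 ^ 2 * C (z d)) l (𝓝 (2 * B (0, 0))) := by
    have := (tB.const_mul 2).add ((hx.pow 2).mul tC)
    simpa using this
  have tF : Tendsto (fun d => q + (z d).2 * A (z d).2) l (𝓝 q) := by
    have := (hμ.mul tA).const_add q
    simpa using this
  have x2 : (fun d => (z d).1 ^ 2) =O[l] D := by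
    refine isBigO_of_eq_mul ?_ (tE.inv₀ (by positivity))
    filter_upwards [hD, tE.eventually_ne (by positivity : 2 * B (0, 0) ≠ 0)] with d h1 h2
    rw [← h1, eq_mul_inv_iff_mul_eq₀ h2, show z d = ((z d).1, (z d).2) from rfl, hgU]
    ring
  have m2 : (fun d => (z d).2) =O[l] fun d => (z d).1 ^ 2 := by
    refine isBigO_of_eq_mul ?_ (tB.neg.div tF hq)
    filter_upwards [h0, tF.eventually_ne hq] with d h1 h2
    have := hgf (z d).1 (z d).2
    rw [h1] at this
    simp only [Pi.div_apply]
    rw [← mul_div_assoc, eq_div_iff h2]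
    linarith
  have mD := m2.trans x2
  have e1 : (fun d => (z d).2 ^ 2 * (2 * A (z d).2) - ((z d).1 ^ 2) ^ 2 * C (z d)) =O[l]
      fun d => D d ^ 2 := by
    refine IsBigO.sub ?_ ?_
    · have := (mD.pow 2).mul ((tA.const_mul 2).isBigO_one ℝ)
      simpa using this
    · have := (x2.pow 2).mul (tC.isBigO_one ℝ)
      simpa using this
  refine (e1.const_mul_left (2 * -q)⁻¹).congr' ?_ EventuallyEq.rfl
  filter_upwards [h0, hD] with d h1 h2
  have e2 := hgf (z d).1 (z d).2
  rw [h1] at e2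
  rw [← h2, show z d = ((z d).1, (z d).2) from rfl, hgU]
  have h3 : 2 * -q ≠ 0 := mul_ne_zero two_ne_zero (neg_ne_zero.2 hq)
  rw [inv_mul_eq_iff_eq_mul₀ h3, mul_sub, mul_div_cancel₀ _ h3]
  simp only
  linear_combination (-2) * e2

theorem Profile.fold_asymptotics (hg : Profile g um up) {z : ℝ → ℝ × ℝ} {D : ℝ → ℝ}
    {l : Filter ℝ} (hz : Tendsto z l (𝓝 (1, 1))) (h0 : ∀ᶠ d in l, g (z d) = 0)
    (hD : ∀ᶠ d in l, (z d).1 * partialU g (z d) = D d) :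
    (fun d => (z d).2 - (1 - D d ^ 2 / (2 * partialM g (1, 1) * partialU (partialU g) (1, 1))))
      =O[l] fun d => D d ^ 3 := by
  have hs := hg.smooth
  obtain ⟨A, B, hA, hB, hAB, hA1, hB1⟩ := exists_fold_form hs hg.g_one hg.fold_u
  have hp := hg.fold_μ.ne
  have hr := hg.fold_uu.ne
  set p := partialM g (1, 1) with hpdef
  set r := partialU (partialU g) (1, 1) with hrdef
  have hFs : ContDiff ℝ ∞ fun w : ℝ × ℝ => w.1 * partialU g w - (w.1 - 1) * r :=
    (contDiff_fst.mul (contDiff_partialU hs)).sub (by fun_prop)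
  obtain ⟨A', B', hA', hB', hAB', -, -⟩ := exists_fold_form (u₀ := 1) (μ₀ := 1) hFs
    (by simp [hg.fold_u]) (by
      refine partialU_eq hFs ?_
      have h1 := ((hasDerivAt_id (1:ℝ)).mul (hasDerivAt_fst (contDiff_partialU hs) 1 1)).sub
        (((hasDerivAt_id (1:ℝ)).sub_const 1).mul_const r)
      exact h1.congr_deriv (by simp [hg.fold_u, hrdef]))
  set k : ℝ × ℝ → ℝ := fun w => -B w.1 / A w with hk
  set E : ℝ × ℝ → ℝ := fun w => r + (w.1 - 1) * (k w * A' w + B' w.1) with hE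
  -- With v = u - 1 one has μ - 1 = v² k and D = v E, so the error is v² R. The constant 2 p r is
  -- the one for which R vanishes at (1, 1), and differentiability of R supplies the third factor v.
  set R : ℝ × ℝ → ℝ := fun w => k w + E w ^ 2 / (2 * p * r) with hR
  have hA1' : A (1, 1) ≠ 0 := by rw [hA1]; exact hp
  have hks : ContDiffAt ℝ ∞ k (1, 1) :=
    (ContDiffAt.comp (g := B) ((1:ℝ), (1:ℝ)) hB.contDiffAt contDiffAt_fst).neg.div hA.contDiffAt hA1'
  have hB's : ContDiff ℝ ∞ fun w : ℝ × ℝ => B' w.1 := hB'.comp contDiff_fst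
  have hEs : ContDiffAt ℝ ∞ E (1, 1) :=
    contDiffAt_const.add ((contDiffAt_fst.sub contDiffAt_const).mul
      ((hks.mul hA'.contDiffAt).add hB's.contDiffAt))
  have hRs : ContDiffAt ℝ ∞ R (1, 1) := hks.add ((hEs.pow 2).div_const _)
  have hE1 : E (1, 1) = r := by simp [hE]
  have hR1 : R (1, 1) = 0 := by
    simp only [hR, hE1, hk, hA1]
    have : B 1 = r / 2 := by linarith
    rw [this]
    field_simp
    ring
  have hx : Tendsto (fun d => (z d).1 - 1) l (𝓝 0) := by
    have := ((continuous_fst.tendsto ((1:ℝ), (1:ℝ))).comp hz).sub_const 1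
    simpa using this
  have tk := hks.continuousAt.tendsto.comp hz
  have tE := hEs.continuousAt.tendsto.comp hz
  rw [hE1] at tE
  have hAne : ∀ᶠ d in l, A (z d) ≠ 0 := ((hA.continuous.tendsto _).comp hz).eventually_ne hA1'
  have hs' : ∀ᶠ d in l, (z d).2 - 1 = ((z d).1 - 1) ^ 2 * k (z d) := by
    filter_upwards [h0, hAne] with d h1 h2
    have := hAB (z d).1 (z d).2
    rw [h1] at this
    simp only [hk]
    rw [← mul_div_assoc, eq_div_iff h2]
    linear_combination -this
  have hDE : ∀ᶠ d in l, D d = ((z d).1 - 1) * E (z d) := by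
    filter_upwards [hD, hs'] with d h1 h2
    have := hAB' (z d).1 (z d).2
    simp only [h2] at this
    rw [← h1]
    simp only [hE]
    linear_combination this
  have vD : (fun d => (z d).1 - 1) =O[l] D := by
    refine isBigO_of_eq_mul ?_ (tE.inv₀ hr)
    filter_upwards [hDE, tE.eventually_ne hr] with d h1 h2
    rw [h1]
    exact (mul_inv_cancel_right₀ h2 _).symm
  have sv : (fun d => (z d).2 - 1) =O[l] fun d => (z d).1 - 1 := by
    refine isBigO_of_eq_mul (H := fun d => ((z d).1 - 1) * k (z d)) ?_ (hx.mul tk)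
    filter_upwards [hs'] with d h
    rw [h]; ring
  have hRO : (fun d => R (z d)) =O[l] fun d => (z d).1 - 1 := by
    have h1 := (hRs.differentiableAt (by simp)).isBigO_sub.comp_tendsto hz
    simp only [hR1, sub_zero] at h1
    refine h1.trans ?_
    exact (isBigO_refl _ _).prod_left sv
  have := ((vD.pow 2).mul (hRO.trans vD))
  refine this.congr' ?_ (Eventually.of_forall fun d => by simp only; ring)
  filter_upwards [hs', hDE] with d h1 h2
  rw [h2, show (z d).2 = 1 + ((z d).2 - 1) by ring, h1]
  simp only [hR]
  ring

theorem eventually_injective_slice (hφ : ContDiff ℝ ∞ φ) {u₀ μ₀ : ℝ} (h : 0 < partialU φ (u₀, μ₀)) :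
    ∀ᶠ p : ℝ × ℝ × ℝ in 𝓝 (u₀, u₀, μ₀), φ (p.1, p.2.2) = φ (p.2.1, p.2.2) → p.1 = p.2.1 := by
  obtain ⟨η, hη, hpos⟩ := Metric.eventually_nhds_iff.1
    ((contDiff_partialU hφ).continuous.continuousAt.eventually_const_lt h)
  filter_upwards [Metric.ball_mem_nhds _ hη] with p hp he
  obtain ⟨x, y, μ⟩ := p
  simp only [Metric.mem_ball, Prod.dist_eq, max_lt_iff] at hp
  obtain ⟨h1, h2, h3⟩ := hp
  have hm : StrictMonoOn (fun u => φ (u, μ)) (Metric.ball u₀ η) :=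
    strictMonoOn_of_hasDerivAt (convex_ball _ _) (fun u _ => hasDerivAt_fst hφ u μ) fun u hu => by
      refine hpos ?_
      rw [Prod.dist_eq]
      exact max_lt hu h3
  exact hm.injOn h1 h2 he

variable {d₀ : ℝ} {γ : ℝ → ℝ → ℝ × ℝ × ℝ}

theorem IsBranchFamily.tendsto_slice (h : IsBranchFamily a b g K φ γ₀ d₀ γ) (t : ℝ) :
    Tendsto (fun d => γ d t) (𝓝[>] 0) (𝓝 (γ₀ t)) := by
  refine (h.tendsto t).comp (f := fun d => (d, t)) (tendsto_nhdsWithin_iff.2 ⟨?_, self_mem_nhdsWithin⟩)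
  exact ((by fun_prop : Continuous fun d : ℝ => (d, t)).tendsto 0).mono_left nhdsWithin_le_nhds

/-- On a horizontal ray X = Y, hence x = y since φ is injective in u near the limit. The balance
becomes g = 0, and K on the diagonal gives x g_u = (a + b) d > 0; the sign of g_u rules out the
branch u₊. -/
theorem IsBranchFamily.eventually_homogeneous (hg : Profile g um up) (hφ : ContDiff ℝ ∞ φ)
    (hK : IsDividedDifference g K) (ha : 0 < a) (hb : 0 < b) (hd₀ : 0 < d₀)
    (h : IsBranchFamily a b g K φ γ₀ d₀ γ)
    {t u₀ μ₀ : ℝ} (ht : Real.sin (Real.pi * t) = 0) (hγ : γ₀ t = (u₀, u₀, μ₀))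
    (hpos : 0 < partialU φ (u₀, μ₀)) :
    ∀ᶠ d in 𝓝[>] 0, (γ d t).1 = (γ d t).2.1 ∧ g ((γ d t).1, (γ d t).2.2) = 0 ∧
      (γ d t).1 * partialU g ((γ d t).1, (γ d t).2.2) = (a + b) * d ∧
      (γ d t).1 = um (γ d t).2.2 := by
  have hT := h.tendsto_slice t
  rw [hγ] at hT
  filter_upwards [hT.eventually (eventually_injective_slice hφ hpos), Ioo_mem_nhdsGT hd₀] with d hinj hd
  have hray := h.ray d ⟨hd.1.le, hd.2⟩ t
  obtain ⟨hS1, hS2, hS3⟩ := h.mem d hd t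
  have hlev := h.level d hd t
  obtain ⟨ρ, -, hw⟩ := hray
  rw [ht, mul_zero] at hw
  have hxy := hinj (sub_eq_zero.1 (congrArg Prod.snd hw))
  generalize γ d t = p at *
  obtain ⟨x, y, μ⟩ := p
  simp only at hxy hS1 hS2 hS3 hlev ⊢
  subst hxy
  have hx := hS1.1
  have hg0 : g (x, μ) = 0 := by
    have e : (b + a) * (x * g (x, μ)) = 0 := by
      rw [← hS2]; simp only [balance]; ring
    exact (mul_eq_zero.1 ((mul_eq_zero.1 e).resolve_left (by positivity))).resolve_left hx.ne'
  have hgU : x * partialU g (x, μ) = (a + b) * d := by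
    rw [hK.diag] at hS3
    apply mul_left_cancel₀ hx.ne'
    linear_combination hS3
  refine ⟨rfl, hg0, hgU, (hg.zeros μ ⟨hlev.1.le, hlev.2.le⟩ x hx hg0).resolve_right fun e => ?_⟩
  have h1 := hg.stable μ ⟨hlev.1.le, hlev.2⟩
  rw [← e] at h1
  have h2 : 0 < (a + b) * d := by have := hd.1; positivity
  nlinarith

end endpoints

/-! ### From f to g = f / u. -/

section reduction

variable {f : ℝ → ℝ → ℝ} {um up : ℝ → ℝ}

theorem deriv_mul_slice {g : ℝ × ℝ → ℝ} (hg : ContDiff ℝ ∞ g) (hfg : ∀ u μ, f u μ = u * g (u, μ))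
    (u μ : ℝ) : deriv (fun u => f u μ) u = g (u, μ) + u * partialU g (u, μ) := by
  have h : HasDerivAt (fun u => u * g (u, μ)) (1 * g (u, μ) + u * partialU g (u, μ)) u :=
    (hasDerivAt_id u).mul (hasDerivAt_fst hg u μ)
  simp only [hfg]
  rw [h.deriv, one_mul]

theorem iteratedDeriv_two_mul_slice {g : ℝ × ℝ → ℝ} (hg : ContDiff ℝ ∞ g)
    (hfg : ∀ u μ, f u μ = u * g (u, μ)) (u μ : ℝ) : iteratedDeriv 2 (fun u => f u μ) u =
      2 * partialU g (u, μ) + u * partialU (partialU g) (u, μ) := by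
  rw [iteratedDeriv_succ, iteratedDeriv_one, show deriv (fun u => f u μ) = _ from
    funext fun u => deriv_mul_slice hg hfg u μ]
  have h : HasDerivAt (fun u => g (u, μ) + u * partialU g (u, μ)) (partialU g (u, μ) +
      (1 * partialU g (u, μ) + u * partialU (partialU g) (u, μ))) u :=
    (hasDerivAt_fst hg u μ).add ((hasDerivAt_id u).mul (hasDerivAt_fst (contDiff_partialU hg) u μ))
  rw [h.deriv]; ring

theorem iteratedDeriv_three_mul_slice {g : ℝ × ℝ → ℝ} (hg : ContDiff ℝ ∞ g)
    (hfg : ∀ u μ, f u μ = u * g (u, μ)) (μ : ℝ) : iteratedDeriv 3 (fun u => f u μ) 0 =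
      3 * partialU (partialU g) (0, μ) := by
  rw [iteratedDeriv_succ, show iteratedDeriv 2 (fun u => f u μ) = _ from
    funext fun u => iteratedDeriv_two_mul_slice hg hfg u μ]
  have hU := contDiff_partialU hg
  have h := ((hasDerivAt_fst hU 0 μ).const_mul 2).add
    ((hasDerivAt_id (0:ℝ)).mul (hasDerivAt_fst (contDiff_partialU hU) 0 μ))
  refine h.deriv.trans ?_
  simp only [id, zero_mul, one_mul, add_zero]
  ring

/-- Oddness of f gives f(0, μ) = 0, so f is divisible by u and the quotient is even. At a zero u > 0
of g one has f_u = u g_u, so stability signs carry over; at u = 0 one has f_u = g and f_uuu = 3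
g_uu. -/
theorem IsBistable.exists_profile (hf : IsBistable f um up) : ∃ g : ℝ × ℝ → ℝ, Profile g um up ∧
    (∀ u μ, f u μ = u * g (u, μ)) ∧
    deriv (fun μ => deriv (fun u => f u μ) 0) 0 = partialM g (0, 0) ∧
    deriv (fun μ => f 1 μ) 1 = partialM g (1, 1) ∧
    iteratedDeriv 2 (fun u => f u 1) 1 = partialU (partialU g) (1, 1) := by
  have h0 : ∀ μ, f 0 μ = 0 := fun μ => by
    have := hf.odd 0 μ
    rw [neg_zero] at this
    linarith
  obtain ⟨g, hg, hfg', -⟩ := exists_quotient hf.smooth h0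
  have hfg : ∀ u μ, f u μ = u * g (u, μ) := hfg'
  have hU := deriv_mul_slice hg hfg
  have hUU := iteratedDeriv_two_mul_slice hg hfg
  have hUUU := iteratedDeriv_three_mul_slice hg hfg
  have hU0 : ∀ μ, deriv (fun u => f u μ) 0 = g (0, μ) := fun μ => by rw [hU, zero_mul, add_zero]
  have e1 : deriv (fun μ => deriv (fun u => f u μ) 0) 0 = partialM g (0, 0) := by
    simp only [hU0]
    exact (hasDerivAt_snd hg 0 0).deriv
  have e2 : deriv (fun μ => f 1 μ) 1 = partialM g (1, 1) := by
    simp only [hfg, one_mul]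
    exact (hasDerivAt_snd hg 1 1).deriv
  have upos : ∀ μ ∈ Ioc (0:ℝ) 1, 0 < um μ := by
    intro μ hμ
    rcases hμ.2.eq_or_lt with rfl | h
    · rw [hf.uminus_at_one]; exact one_pos
    · exact (hf.order μ ⟨hμ.1, h⟩).1
  have hlt : ∀ μ ∈ Ico (0:ℝ) 1, um μ < up μ := by
    intro μ hμ
    rcases hμ.1.eq_or_lt with rfl | h
    · rw [hf.uminus_at_zero]; exact hf.uplus_at_zero
    · exact (hf.order μ ⟨h, hμ.2⟩).2
  have hppos : ∀ μ ∈ Icc (0:ℝ) 1, 0 < up μ := by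
    intro μ hμ
    rcases hμ.1.eq_or_lt with rfl | h
    · exact hf.uplus_at_zero
    · rcases hμ.2.eq_or_lt with rfl | h'
      · rw [hf.uplus_at_one]; exact one_pos
      · exact (upos μ ⟨h, hμ.2⟩).trans (hlt μ ⟨hμ.1, h'⟩)
  have hg0 : ∀ μ ∈ Icc (0:ℝ) 1, ∀ u > 0, f u μ = 0 → g (u, μ) = 0 := fun μ _ u hu h => by
    rw [hfg] at h
    exact (mul_eq_zero.1 h).resolve_left hu.ne'
  have hzp : ∀ μ ∈ Icc (0:ℝ) 1, g (up μ, μ) = 0 := fun μ hμ =>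
    hg0 μ hμ _ (hppos μ hμ) ((hf.zeros μ hμ _ (hppos μ hμ).le).2 (Or.inr (Or.inr rfl)))
  have hzm : ∀ μ ∈ Icc (0:ℝ) 1, g (um μ, μ) = 0 := fun μ hμ => by
    rcases hμ.1.eq_or_lt with rfl | h
    · rw [hf.uminus_at_zero, ← hU0]; exact hf.pitchfork_u
    · have := upos μ ⟨h, hμ.2⟩
      exact hg0 μ hμ _ this ((hf.zeros μ hμ _ this.le).2 (Or.inr (Or.inl rfl)))
  have hg11 : g (1, 1) = 0 := by
    have := hzm 1 (by simp)
    rwa [hf.uminus_at_one] at this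
  have hf1 : partialU g (1, 1) = 0 := by
    have := hf.fold_u
    rw [hU, hg11, zero_add, one_mul] at this
    exact this
  have e3 : iteratedDeriv 2 (fun u => f u 1) 1 = partialU (partialU g) (1, 1) := by
    rw [hUU, hf1]; ring
  refine ⟨g, ?_, hfg, e1, e2, e3⟩
  exact
    { smooth := hg
      even := fun u μ => by
        by_cases hu : u = 0
        · rw [hu, neg_zero]
        · have := hf.odd u μ
          rw [hfg, hfg] at this
          apply mul_left_cancel₀ hu
          linarith
      zero_um := hzm
      zero_up := hzp
      zeros := fun μ hμ u hu h => ((hf.zeros μ hμ u hu.le).1 (by rw [hfg, h, mul_zero])).resolve_left hu.ne'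
      um_zero := hf.uminus_at_zero
      um_one := hf.uminus_at_one
      up_one := hf.uplus_at_one
      um_pos := upos
      lt := hlt
      cont_um := hf.continuousOn_uminus
      cont_up := hf.continuousOn_uplus
      neg_zero := fun μ hμ => by rw [← hU0]; exact hf.stable_zero μ hμ
      stable := fun μ hμ => by
        have h1 := hf.stable_uplus μ hμ
        have hI : μ ∈ Icc (0:ℝ) 1 := ⟨hμ.1, hμ.2.le⟩
        rw [hU, hzp μ hI, zero_add] at h1
        exact neg_of_mul_neg_right h1 (hppos μ hI).le
      unstable := fun μ hμ => by
        have h1 := hf.unstable_uminus μ hμ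
        rw [hU, hzm μ ⟨hμ.1.le, hμ.2.le⟩, zero_add] at h1
        exact pos_of_mul_pos_right h1 (upos μ ⟨hμ.1, hμ.2.le⟩).le
      pitch_μ := by rw [← e1]; exact hf.pitchfork_uμ
      pitch_uu := by
        have := hf.pitchfork_uuu
        rw [hUUU] at this
        linarith
      fold_u := hf1
      fold_μ := by rw [← e2]; exact hf.fold_μ
      fold_uu := by rw [← e3]; exact hf.fold_uu }

end reduction

/-! ### Two-block vectors and the coupled system. -/

section blocks

variable {f : ℝ → ℝ → ℝ} {N k : ℕ}

/-- The embedding of the two-block patterns. -/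
noncomputable def blockEmbed (N k : ℕ) : ℝ × ℝ × ℝ →L[ℝ] (Fin N → ℝ) × ℝ :=
  (ContinuousLinearMap.pi fun n : Fin N => if (n : ℕ) < k then ContinuousLinearMap.fst ℝ ℝ (ℝ × ℝ) else
    (ContinuousLinearMap.fst ℝ ℝ ℝ).comp (ContinuousLinearMap.snd ℝ ℝ (ℝ × ℝ))).prod
  ((ContinuousLinearMap.snd ℝ ℝ ℝ).comp (ContinuousLinearMap.snd ℝ ℝ (ℝ × ℝ)))

theorem blockEmbed_apply (p : ℝ × ℝ × ℝ) : blockEmbed N k p = (blockVec N k p.1 p.2.1, p.2.2) := by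
  refine Prod.ext (funext fun n => ?_) rfl
  simp only [blockEmbed, blockVec, ContinuousLinearMap.prod_apply, ContinuousLinearMap.coe_pi']
  split_ifs <;> rfl

/-- Both blocks are nonempty, so the maximum norm on ℝᴺ sees both values; neighbourhoods of the
singular curve in the two spaces then correspond. -/
theorem isometry_blockEmbed (hk : 1 ≤ k) (hkN : k < N) : Isometry (blockEmbed N k) := by
  refine Isometry.of_dist_eq fun p q => ?_
  rw [blockEmbed_apply, blockEmbed_apply, Prod.dist_eq, Prod.dist_eq, Prod.dist_eq, ← max_assoc]
  congr 1
  refine le_antisymm ((dist_pi_le_iff (by positivity)).2 fun n => ?_) (max_le ?_ ?_)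
  · simp only [blockVec]
    split_ifs
    · exact le_max_left _ _
    · exact le_max_right _ _
  · have := dist_le_pi_dist (blockVec N k p.1 p.2.1) (blockVec N k q.1 q.2.1) ⟨0, by omega⟩
    simpa [blockVec, show 0 < k by omega] using this
  · have := dist_le_pi_dist (blockVec N k p.1 p.2.1) (blockVec N k q.1 q.2.1) ⟨k, hkN⟩
    simpa [blockVec] using this

/-- Transpositions inside a block force equal entries there. If the two block values agreed, a
transposition across the blocks would fix U as well. -/
theorem hasBlockIsotropy_iff (hk : 1 ≤ k) (hkN : k < N) {U : Fin N → ℝ} :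
    HasBlockIsotropy k U ↔ ∃ x y, x ≠ y ∧ U = blockVec N k x y := by
  constructor
  · intro h
    have hsame : ∀ i j : Fin N, ((i : ℕ) < k ↔ (j : ℕ) < k) → U i = U j := by
      intro i j hij
      have h1 := (h (Equiv.swap i j)).2 fun n => by
        by_cases hi : n = i
        · rw [hi, Equiv.swap_apply_left]; exact hij.symm
        · by_cases hj : n = j
          · rw [hj, Equiv.swap_apply_right]; exact hij
          · rw [Equiv.swap_apply_of_ne_of_ne hi hj]
      have := h1 j
      rwa [Equiv.swap_apply_right] at this
    have h0 : ((⟨0, by omega⟩ : Fin N) : ℕ) < k := hk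
    have hkk : ¬ ((⟨k, hkN⟩ : Fin N) : ℕ) < k := lt_irrefl k
    refine ⟨U ⟨0, by omega⟩, U ⟨k, hkN⟩, fun e => ?_, funext fun n => ?_⟩
    · have hconst : ∀ n, U n = U ⟨k, hkN⟩ := by
        intro n
        by_cases hn : (n : ℕ) < k
        · rw [← e]; exact hsame _ _ (iff_of_true hn h0)
        · exact hsame _ _ (iff_of_false hn hkk)
      have := (h (Equiv.swap ⟨0, by omega⟩ ⟨k, hkN⟩)).1 (fun n => by rw [hconst, hconst n]) ⟨k, hkN⟩
      rw [Equiv.swap_apply_right] at this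
      exact hkk (this.1 h0)
    · simp only [blockVec]
      split_ifs with hn
      · exact hsame _ _ (iff_of_true hn h0)
      · exact hsame _ _ (iff_of_false hn hkk)
  · rintro ⟨x, y, hxy, rfl⟩ σ
    refine forall_congr' fun n => ?_
    simp only [blockVec]
    by_cases h1 : ((σ n : Fin N) : ℕ) < k <;> by_cases h2 : (n : ℕ) < k <;> simp [h1, h2, hxy, hxy.symm]

theorem sum_blockVec_sub (hkN : k < N) (x y c : ℝ) :
    ∑ j, (blockVec N k x y j - c) = k * (x - c) + ((N : ℝ) - k) * (y - c) := by
  obtain ⟨m, rfl⟩ := Nat.exists_eq_add_of_le hkN.le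
  rw [Fin.sum_univ_add]
  simp [blockVec]
  ring

theorem isSteadyState_blockVec_iff (hk : 1 ≤ k) (hkN : k < N) {d x y μ : ℝ} :
    IsSteadyState f d (blockVec N k x y) μ ↔
      d * (((N : ℝ) - k) * (y - x)) + f x μ = 0 ∧ d * (k * (x - y)) + f y μ = 0 := by
  simp only [IsSteadyState, sum_blockVec_sub hkN]
  constructor
  · intro h
    have h1 := h ⟨0, by omega⟩
    have h2 := h ⟨k, hkN⟩
    simp only [blockVec, show 0 < k by omega, if_true, lt_irrefl, if_false, sub_self, mul_zero, zero_add,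
      add_zero] at h1 h2
    exact ⟨h1, h2⟩
  · rintro ⟨h1, h2⟩ n
    simp only [blockVec]
    split_ifs
    · simpa using h1
    · simpa using h2

/-- Weighting the two equations by b and a cancels the coupling; weighting them by y and -x produces
x - y times the second equation of `branchSet`. The change is invertible because b x + a y > 0 and x
≠ y. -/
theorem mem_branchSet_iff {g : ℝ × ℝ → ℝ} {K : ℝ × ℝ × ℝ → ℝ} (hK : IsDividedDifference g K)
    {a b d x y μ : ℝ} (ha : 0 < a) (hb : 0 < b) (hx : 0 < x) (hy : 0 < y) (hxy : x ≠ y) :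
    (x, y, μ) ∈ branchSet a b g K d ↔
      d * (a * (y - x)) + x * g (x, μ) = 0 ∧ d * (b * (x - y)) + y * g (y, μ) = 0 := by
  have hne : x - y ≠ 0 := sub_ne_zero.2 hxy
  have hsum : 0 < b * x + a * y := by positivity
  have hK' := hK.sub_eq x y μ
  simp only [branchSet, balance, mem_ofPred_eq]
  constructor
  · rintro ⟨-, h1, h2⟩
    have h3 : x * y * (g (x, μ) - g (y, μ)) = d * (b * x + a * y) * (x - y) := by
      rw [hK', ← h2]; ring
    constructor <;> apply mul_left_cancel₀ hsum.ne'
    · linear_combination x * h1 + a * h3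
    · linear_combination y * h1 - b * h3
  · rintro ⟨h1, h2⟩
    refine ⟨⟨hx, hy⟩, by linear_combination b * h1 + a * h2, ?_⟩
    apply mul_left_cancel₀ hne
    linear_combination (-x * y) * hK' + y * h1 - x * h2

theorem isPosBlockSolution_iff {g : ℝ × ℝ → ℝ} {K : ℝ × ℝ × ℝ → ℝ} (hK : IsDividedDifference g K)
    (hfg : ∀ u μ, f u μ = u * g (u, μ)) (hk : 1 ≤ k) (hkN : k < N) {d : ℝ} {p : (Fin N → ℝ) × ℝ} :
    IsPosBlockSolution f d k p ↔
      ∃ q ∈ branchSet ((N : ℝ) - k) k g K d, q.1 ≠ q.2.1 ∧ blockEmbed N k q = p := by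
  have ha : (0:ℝ) < (N : ℝ) - k := sub_pos.2 (by exact_mod_cast hkN)
  have hb : (0:ℝ) < k := by exact_mod_cast hk
  obtain ⟨U, μ⟩ := p
  simp only [IsPosBlockSolution, hasBlockIsotropy_iff hk hkN]
  constructor
  · rintro ⟨h1, h2, x, y, hxy, rfl⟩
    have hx : 0 < x := by simpa [blockVec, show 0 < k by omega] using h2 ⟨0, by omega⟩
    have hy : 0 < y := by simpa [blockVec] using h2 ⟨k, hkN⟩
    refine ⟨(x, y, μ), (mem_branchSet_iff hK ha hb hx hy hxy).2 ?_, hxy, blockEmbed_apply _⟩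
    rw [isSteadyState_blockVec_iff hk hkN] at h1
    rwa [← hfg, ← hfg]
  · rintro ⟨⟨x, y, ν⟩, h1, hxy, h2⟩
    rw [blockEmbed_apply, Prod.mk.injEq] at h2
    obtain ⟨rfl, rfl⟩ := h2
    obtain ⟨hx, hy⟩ := h1.1
    refine ⟨(isSteadyState_blockVec_iff hk hkN).2 ?_, fun n => ?_, x, y, hxy, rfl⟩
    · have := (mem_branchSet_iff hK ha hb hx hy hxy).1 h1
      rwa [← hfg, ← hfg] at this
    · simp only [blockVec]
      split_ifs
      · exact hx
      · exact hy

theorem gammaAB_eq (um up : ℝ → ℝ) : gammaAB um up N k = blockEmbed N k '' halfAB um up := by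
  ext p
  simp only [gammaAB, mem_iUnion, mem_insert_iff, mem_singleton_iff, mem_image, halfAB, mem_ofPred_eq,
    exists_prop]
  constructor
  · rintro ⟨μ, hμ, rfl | rfl | rfl⟩
    · exact ⟨(um μ, 0, μ), ⟨hμ, Or.inl ⟨rfl, rfl⟩⟩, blockEmbed_apply _⟩
    · exact ⟨(up μ, 0, μ), ⟨hμ, Or.inr (Or.inl ⟨rfl, rfl⟩)⟩, blockEmbed_apply _⟩
    · exact ⟨(up μ, um μ, μ), ⟨hμ, Or.inr (Or.inr ⟨rfl, rfl⟩)⟩, blockEmbed_apply _⟩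
  · rintro ⟨⟨x, y, μ⟩, ⟨hμ, h⟩, rfl⟩
    refine ⟨μ, hμ, ?_⟩
    simp only [blockEmbed_apply]
    rcases h with h | h | h <;> obtain ⟨h1, h2⟩ := h <;> simp only at h1 h2 <;> subst h1 <;> subst h2
    · exact Or.inl rfl
    · exact Or.inr (Or.inl rfl)
    · exact Or.inr (Or.inr rfl)

theorem gammaCD_eq (um up : ℝ → ℝ) : gammaCD um up N k = blockEmbed N k '' halfCD um up := by
  ext p
  simp only [gammaCD, mem_iUnion, mem_insert_iff, mem_singleton_iff, mem_image, halfCD, halfAB, swapXY,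
    mem_preimage, mem_ofPred_eq, exists_prop]
  constructor
  · rintro ⟨μ, hμ, rfl | rfl | rfl⟩
    · exact ⟨(0, um μ, μ), ⟨hμ, Or.inl ⟨rfl, rfl⟩⟩, blockEmbed_apply _⟩
    · exact ⟨(0, up μ, μ), ⟨hμ, Or.inr (Or.inl ⟨rfl, rfl⟩)⟩, blockEmbed_apply _⟩
    · exact ⟨(um μ, up μ, μ), ⟨hμ, Or.inr (Or.inr ⟨rfl, rfl⟩)⟩, blockEmbed_apply _⟩
  · rintro ⟨⟨x, y, μ⟩, ⟨hμ, h⟩, rfl⟩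
    refine ⟨μ, hμ, ?_⟩
    simp only [blockEmbed_apply]
    rcases h with h | h | h <;> obtain ⟨h1, h2⟩ := h <;> simp only at h1 h2 <;> subst h1 <;> subst h2
    · exact Or.inl rfl
    · exact Or.inr (Or.inl rfl)
    · exact Or.inr (Or.inr rfl)

end blocks

/-! ### Limits of positive solutions as d → 0. -/

section limits

variable {g φ : ℝ × ℝ → ℝ} {K : ℝ × ℝ × ℝ → ℝ} {a b : ℝ} {um up : ℝ → ℝ}

/-- Limits of positive solutions as `d → 0` lie on the singular curve. -/
theorem Profile.mem_singularCurve_of_eq_zero (hg : Profile g um up) (hK : IsDividedDifference g K)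
    (ha : 0 < a) (hb : 0 < b) {p : ℝ × ℝ × ℝ} (hx : 0 ≤ p.1) (hy : 0 ≤ p.2.1) (hμ : p.2.2 ∈ Icc (0:ℝ) 1)
    (h1 : balance a b g p = 0) (h2 : p.1 * p.2.1 * K p = 0) :
    p ∈ singularCurve um up ∨ (p.1 = 0 ∧ p.2.1 = 0 ∧ 0 < p.2.2) := by
  obtain ⟨x, y, μ⟩ := p
  simp only [balance] at hx hy hμ h1 h2 ⊢
  rcases hx.eq_or_lt with rfl | hx
  · rcases hy.eq_or_lt with rfl | hy
    · rcases hμ.1.eq_or_lt with rfl | hμ0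
      · exact Or.inl (Or.inl ⟨hμ, Or.inl ⟨hg.um_zero.symm, rfl⟩⟩)
      · exact Or.inr ⟨rfl, rfl, hμ0⟩
    · simp only [zero_mul, mul_zero, zero_add, mul_eq_zero, ha.ne', hy.ne', false_or] at h1
      refine Or.inl (Or.inr ⟨hμ, ?_⟩)
      rcases hg.zeros μ hμ y hy h1 with e | e
      · exact Or.inl ⟨e, rfl⟩
      · exact Or.inr (Or.inl ⟨e, rfl⟩)
  · rcases hy.eq_or_lt with rfl | hy
    · simp only [zero_mul, mul_zero, add_zero, mul_eq_zero, hb.ne', hx.ne', false_or] at h1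
      refine Or.inl (Or.inl ⟨hμ, ?_⟩)
      rcases hg.zeros μ hμ x hx h1 with e | e
      · exact Or.inl ⟨e, rfl⟩
      · exact Or.inr (Or.inl ⟨e, rfl⟩)
    · left
      have hK0 : K (x, y, μ) = 0 := (mul_eq_zero.1 h2).resolve_left (by positivity)
      have he : g (x, μ) = g (y, μ) := by
        have := hK.sub_eq x y μ
        rw [hK0, mul_zero] at this
        linarith
      have hgx : g (x, μ) = 0 := by
        have : (b * x + a * y) * g (x, μ) = 0 := by rw [← h1, ← he]; ring
        exact (mul_eq_zero.1 this).resolve_left (by positivity)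
      have hgy : g (y, μ) = 0 := he ▸ hgx
      have hne : x = y → x = 1 ∧ μ = 1 := by
        rintro rfl
        rw [hK.diag] at hK0
        rcases hμ.2.eq_or_lt with rfl | hμ1
        · rcases hg.zeros 1 hμ x hx hgx with e | e
          · exact ⟨e.trans hg.um_one, rfl⟩
          · exact ⟨e.trans hg.up_one, rfl⟩
        · exfalso
          rcases hg.zeros μ hμ x hx hgx with e | e
          · rcases hμ.1.eq_or_lt with rfl | hμ0
            · rw [hg.um_zero] at e; exact hx.ne' e
            · have := hg.unstable μ ⟨hμ0, hμ1⟩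
              rw [← e] at this; linarith
          · have := hg.stable μ ⟨hμ.1, hμ1⟩
            rw [← e] at this; linarith
      rcases hg.zeros μ hμ x hx hgx with e | e <;> rcases hg.zeros μ hμ y hy hgy with e' | e'
      · obtain ⟨h3, rfl⟩ := hne (e.trans e'.symm)
        exact Or.inl ⟨hμ, Or.inr (Or.inr ⟨by rw [h3, hg.up_one], e'⟩)⟩
      · exact Or.inr ⟨hμ, Or.inr (Or.inr ⟨e', e⟩)⟩
      · exact Or.inl ⟨hμ, Or.inr (Or.inr ⟨e, e'⟩)⟩
      · obtain ⟨h3, rfl⟩ := hne (e.trans e'.symm)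
        exact Or.inl ⟨hμ, Or.inr (Or.inr ⟨e, by rw [e', hg.up_one, hg.um_one]⟩)⟩

/-- The points of a bounded neighbourhood at distance at least η from the singular curve, with x, y
≥ 0 and μ in [0, 1], form a compact set. Each of them has a neighbourhood free of positive solutions
for small d > 0. -/
theorem Profile.eventually_near_singularCurve (hg : Profile g um up) (hK : IsDividedDifference g K)
    (ha : 0 < a) (hb : 0 < b) (δ : ℝ) {η : ℝ} (hη : 0 < η) : ∀ᶠ d in 𝓝 (0:ℝ), 0 < d →
      ∀ p ∈ branchSet a b g K d, p ∈ Metric.cthickening δ (singularCurve um up) →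
        p.2.2 ∈ Icc (0:ℝ) 1 → Metric.infDist p (singularCurve um up) < η := by
  have c1 : Continuous fun p : ℝ × ℝ × ℝ => p.1 := continuous_fst
  have c2 : Continuous fun p : ℝ × ℝ × ℝ => p.2.1 := continuous_fst.comp continuous_snd
  have c3 : Continuous fun p : ℝ × ℝ × ℝ => p.2.2 := continuous_snd.comp continuous_snd
  set Z : Set (ℝ × ℝ × ℝ) := Metric.cthickening δ (singularCurve um up) ∩ {p | 0 ≤ p.1 ∧ 0 ≤ p.2.1 ∧
    p.2.2 ∈ Icc (0:ℝ) 1 ∧ η ≤ Metric.infDist p (singularCurve um up)} with hZ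
  have hZc : IsCompact Z := by
    refine hg.isCompact_singularCurve.cthickening.inter_right ?_
    exact (isClosed_le continuous_const c1).inter ((isClosed_le continuous_const c2).inter
      ((isClosed_Icc.preimage c3).inter (isClosed_le continuous_const (Metric.continuous_infDist_pt _))))
  have hZs : ∀ p ∈ Z, ∀ᶠ w : ℝ × (ℝ × ℝ × ℝ) in 𝓝 (0, p), 0 < w.1 → w.2 ∉ branchSet a b g K w.1 := by
    rintro p ⟨-, hx, hy, hμ, hd⟩
    have hbc := (contDiff_balance (a := a) (b := b) hg.smooth).continuous
    by_cases h1 : balance a b g p = 0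
    · by_cases h2 : p.1 * p.2.1 * K p = 0
      · rcases hg.mem_singularCurve_of_eq_zero hK ha hb hx hy hμ h1 h2 with h | ⟨e1, e2, h⟩
        · rw [Metric.infDist_zero_of_mem h] at hd
          linarith
        -- Near a trivial state with μ > 0 both g(x, μ) and g(y, μ) are negative, so the balance of
        -- a positive point cannot vanish.
        · have hneg : ∀ᶠ q : ℝ × ℝ in 𝓝 (0, p.2.2), g q < 0 :=
            hg.smooth.continuous.continuousAt.eventually_lt_const (hg.neg_zero _ ⟨h, hμ.2⟩)
          have t1 : Tendsto (fun w : ℝ × (ℝ × ℝ × ℝ) => (w.2.1, w.2.2.2)) (𝓝 (0, p)) (𝓝 (0, p.2.2)) := by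
            have := ((c1.comp continuous_snd).prodMk (c3.comp continuous_snd)).tendsto ((0:ℝ), p)
            simp only [Function.comp, e1] at this
            exact this
          have t2 : Tendsto (fun w : ℝ × (ℝ × ℝ × ℝ) => (w.2.2.1, w.2.2.2)) (𝓝 (0, p)) (𝓝 (0, p.2.2)) := by
            have := ((c2.comp continuous_snd).prodMk (c3.comp continuous_snd)).tendsto ((0:ℝ), p)
            simp only [Function.comp, e2] at this
            exact this
          filter_upwards [t1.eventually hneg, t2.eventually hneg] with w w1 w2 _ hw
          have f1 := mul_neg_of_pos_of_neg hb (mul_neg_of_pos_of_neg hw.1.1 w1)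
          have f2 := mul_neg_of_pos_of_neg ha (mul_neg_of_pos_of_neg hw.1.2 w2)
          have f3 : b * (w.2.1 * g (w.2.1, w.2.2.2)) + a * (w.2.2.1 * g (w.2.2.1, w.2.2.2)) = 0 := hw.2.1
          linarith
      · have hc : Continuous fun w : ℝ × (ℝ × ℝ × ℝ) => w.2.1 * w.2.2.1 * K w.2 -
            w.1 * (b * w.2.1 + a * w.2.2.1) := by
          have k1 : Continuous fun w : ℝ × (ℝ × ℝ × ℝ) => K w.2 := hK.smooth.continuous.comp continuous_snd
          have k2 := c1.comp (continuous_snd (X := ℝ))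
          have k3 := c2.comp (continuous_snd (X := ℝ))
          exact ((k2.mul k3).mul k1).sub (continuous_fst.mul ((k2.const_mul b).add (k3.const_mul a)))
        filter_upwards [hc.continuousAt.eventually_ne (x := (0, p)) (y := 0) (by simpa using h2)] with w hw _ hS
        exact hw (sub_eq_zero.2 hS.2.2)
    · filter_upwards [(hbc.comp continuous_snd).continuousAt.eventually_ne (x := ((0:ℝ), p)) h1]
        with w hw _ hS
      exact hw hS.2.1
  filter_upwards [hZc.eventually_forall_of_forall_eventually
    (P := fun d p => 0 < d → p ∉ branchSet a b g K d) hZs] with d h hd p hp hpδ hμ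
  by_contra! hη'
  exact h p ⟨hpδ, hp.1.1.le, hp.1.2.le, hμ, hη'⟩ hd hp

end limits

/-! ### The closed curves in ℝᴺ × ℝ and the conclusion. -/

section closedCurves

variable {g φ : ℝ × ℝ → ℝ} {K : ℝ × ℝ × ℝ → ℝ} {a b d₀ : ℝ} {um up : ℝ → ℝ} {γ₀ : ℝ → ℝ × ℝ × ℝ}
  {γ : ℝ → ℝ → ℝ × ℝ × ℝ} {N k : ℕ}

theorem IsBranchFamily.isClosedCurveFamily (hφ : ContDiff ℝ ∞ φ) (hγ : Continuous γ₀)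
    (h : IsBranchFamily a b g K φ γ₀ d₀ γ) (hk : 1 ≤ k) (hkN : k < N) :
    IsClosedCurveFamily d₀ fun d t => blockEmbed N k (γ d t) := by
  have hE := (isometry_blockEmbed hk hkN).injective
  have hz : ∀ d t : ℝ, (d = 0 → (blockEmbed N k (γ 0 t)).2 ≠ 0) → d = 0 → (γ₀ t).2.2 ≠ 0 := by
    intro d t h1 h2
    have := h1 h2
    rwa [blockEmbed_apply, h.zero] at this
  have hd : ∀ d ∈ Ico 0 d₀, ∀ t, (d = 0 → (blockEmbed N k (γ 0 t)).2 ≠ 0) →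
      deriv (fun t => blockEmbed N k (γ d t)) t = blockEmbed N k (deriv (γ d) t) := by
    intro d hd t h0
    exact ((blockEmbed N k).hasFDerivAt.comp_hasDerivAt t
      (h.differentiableAt hd (hz d t h0)).hasDerivAt).deriv
  refine ⟨fun d hd t => by simp only [h.periodic d hd t], fun d hd => ?_, ?_, ?_, ?_, ?_⟩
  · exact hE.comp_injOn (injOn_of_onRay (h.ray d hd))
  · exact (blockEmbed N k).continuous.comp_continuousOn (h.continuousOn hγ)
  · rintro ⟨d, t⟩ ⟨hd, -⟩
    exact ((blockEmbed N k).contDiff.contDiffAt.comp (d, t) (h.smooth d hd t)).contDiffWithinAt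
  · intro d hd' t h0 h1
    refine h.velocity_ne_zero hφ hd' (hz d t h0) (hE ?_)
    rw [map_zero, ← hd d hd' t h0]
    exact h1
  · rintro ⟨d, t⟩ ⟨hd', h0⟩
    have h1 : ContinuousWithinAt (fun q : ℝ × ℝ => blockEmbed N k (deriv (γ q.1) q.2))
        {q | q.1 ∈ Ico 0 d₀ ∧ (q.1 = 0 → (blockEmbed N k (γ 0 q.2)).2 ≠ 0)} (d, t) := by
      refine (blockEmbed N k).continuous.continuousAt.comp_continuousWithinAt ?_
      exact (h.velocity_continuous hd' (hz d t h0)).mono fun q hq => ⟨hq.1.1, mem_univ _⟩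
    exact h1.congr (fun q hq => hd q.1 hq.1 q.2 hq.2) (hd d hd' t h0)

theorem IsBranchFamily.mono {d₁ : ℝ} (h : IsBranchFamily a b g K φ γ₀ d₀ γ) (h0 : 0 < d₁)
    (hd : d₁ ≤ d₀) : IsBranchFamily a b g K φ γ₀ d₁ γ := by
  have hI : ∀ d ∈ Ioo 0 d₁, d ∈ Ioo 0 d₀ := fun d h => ⟨h.1, h.2.trans_le hd⟩
  have hI' : ∀ d ∈ Ico 0 d₁, d ∈ Ico 0 d₀ := fun d h => ⟨h.1, h.2.trans_le hd⟩
  obtain ⟨δ, hδ, hδd, hn⟩ := h.near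
  exact ⟨h.zero, fun d hd => h.periodic d (hI' d hd), fun d hd => h.ray d (hI' d hd),
    fun d hd => h.mem d (hI d hd), fun d hd => h.smooth d (hI d hd), h.tendsto,
    fun d hd => h.level d (hI d hd), h.regular, fun d hd => h.critical d (hI d hd),
    min δ d₁, lt_min hδ h0, min_le_right _ _, fun d hd t p hp =>
      hn d ⟨hd.1, hd.2.trans_le (min_le_left _ _)⟩ t p (hp.trans_le (min_le_left _ _))⟩

theorem IsBranchFamily.uniform_dist (h : IsBranchFamily a b g K φ γ₀ d₀ γ) (hγ : Continuous γ₀)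
    (hper : ∀ t, γ₀ (t + 2) = γ₀ t) (hd₀ : 0 < d₀) {δ : ℝ} (hδ : 0 < δ) :
    ∃ r > 0, ∀ d ∈ Ioo 0 r, ∀ t, dist (γ d t) (γ₀ t) < δ := by
  obtain ⟨r, hr, h1⟩ := uniform_of_posFilter
    (P := fun q => q.1 ∈ Ico 0 d₀ → dist (γ q.1 q.2) (γ₀ q.2) < δ)
    (fun d t => forall_congr' fun hd => by rw [h.periodic d hd, hper])
    (fun t => by
      have := (h.tendsto t).dist ((hγ.tendsto t).comp (tendsto_snd_posFilter t))
      rw [dist_self] at this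
      filter_upwards [this.eventually_lt_const hδ] with q hq _ using hq)
  exact ⟨min r d₀, lt_min hr hd₀, fun d hd t => h1 d ⟨hd.1, hd.2.trans_le (min_le_left _ _)⟩ t
    ⟨hd.1.le, hd.2.trans_le (min_le_right _ _)⟩⟩

theorem sin_pi_mul_ne_zero_of_mem {t : ℝ} (ht : t ∈ Ioo (0:ℝ) 1 ∪ Ioo (-1) 0) : Real.sin (Real.pi * t) ≠ 0 := by
  have hpi := Real.pi_pos
  rcases ht with ht | ht
  · exact (Real.sin_pos_of_pos_of_lt_pi (by nlinarith [ht.1]) (by nlinarith [ht.2])).ne'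
  · exact (Real.sin_neg_of_neg_of_neg_pi_lt (by nlinarith [ht.2]) (by nlinarith [ht.1])).ne

end closedCurves

theorem theorem4 (f : ℝ → ℝ → ℝ) (uminus uplus : ℝ → ℝ) (hf : IsBistable f uminus uplus)
    (N k : ℕ) (hk : 1 ≤ k) (hkN : k ≤ N / 2) :
    ∃ d₀ > 0, ∃ δ₀ > 0, ∃ γ : ℝ → ℝ → (Fin N → ℝ) × ℝ,
      -- smooth closed curves, smoothly depending on `d`, that converge to `Γ_all^k`
      IsClosedCurveFamily d₀ γ ∧
      γ 0 '' Icc 0 1 = gammaAB uminus uplus N k ∧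
      γ 0 '' Icc (-1) 0 = gammaCD uminus uplus N k ∧
      (∀ d ∈ Ioo 0 d₀, ∀ t, (γ d t).2 ∈ Ioo 0 1) ∧
      -- the two branches start and end on the homogeneous branch `u_n = u₋(μ)`
      (∀ d ∈ Ioo 0 d₀, (γ d 0).1 = (fun _ => uminus (γ d 0).2) ∧
        (γ d 1).1 = (fun _ => uminus (γ d 1).2)) ∧
      (fun d => (γ d 0).2 - N * d / (2 * -deriv (fun μ => deriv (fun u => f u μ) 0) 0))
        =O[𝓝[>] 0] (fun d => d ^ 2) ∧
      (fun d => (γ d 1).2 - (1 - (N * d) ^ 2 /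
          (2 * deriv (fun μ => f 1 μ) 1 * iteratedDeriv 2 (fun u => f u 1) 1)))
        =O[𝓝[>] 0] (fun d => d ^ 3) ∧
      -- six saddle nodes on each closed curve
      (∀ d ∈ Ioo 0 d₀, {t ∈ Ico (-1 : ℝ) 1 | deriv (fun s => (γ d s).2) t = 0}.ncard = 6 ∧
        ∀ t, deriv (fun s => (γ d s).2) t = 0 → iteratedDeriv 2 (fun s => (γ d s).2) t ≠ 0) ∧
      -- the two branches lie near `Γ_all^k` and are all the solutions there
      ∀ δ > 0, ∃ dδ ∈ Ioc 0 d₀, ∀ d ∈ Ioo 0 dδ,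
        (∀ t, γ d t ∈ Metric.thickening δ (gammaAll uminus uplus N k)) ∧
        ∀ p ∈ Metric.thickening δ (gammaAll uminus uplus N k),
          (δ ≤ δ₀ ∨ p.2 ∈ Icc 0 1) →
          (IsPosBlockSolution f d k p ↔ p ∈ γ d '' Ioo 0 1 ∪ γ d '' Ioo (-1) 0) := by
  have hkN' : k < N := by omega
  have ha : (0:ℝ) < (N : ℝ) - k := sub_pos.2 (by exact_mod_cast hkN')
  have hb : (0:ℝ) < k := by exact_mod_cast hk
  obtain ⟨g, hg, hfg, e1, e2, e3⟩ := hf.exists_profile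
  obtain ⟨φ, hφ⟩ := hg.exists_isCoordinate
  obtain ⟨K, hK⟩ := exists_isDividedDifference hg.smooth
  obtain ⟨γ₀, c1, c2, c3, c4, -, c6, hAB, hCD⟩ := hg.exists_singular_param hφ
  have hγ : IsSingularParam uminus uplus φ γ₀ := ⟨c1, c2, c3, c4, c6⟩
  obtain ⟨d₁, hd₁, γ, hfam₁⟩ := hγ.exists_isBranchFamily hg hφ hK ha hb
  have hγ00 : γ₀ 0 = (0, 0, 0) := by
    refine (c4 0 _ (Or.inl ⟨by simp, Or.inl ⟨hg.um_zero.symm, rfl⟩⟩) ⟨1, one_pos, ?_⟩).symm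
    simp [planar, hφ.zero]
  have hγ01 : γ₀ 1 = (1, 1, 1) := by
    refine (c4 1 _ (Or.inl ⟨by simp, Or.inr (Or.inr ⟨hg.up_one.symm, hg.um_one.symm⟩)⟩)
      ⟨1, one_pos, ?_⟩).symm
    simp [planar, hφ.at_one hg]
  have hh0 := hfam₁.eventually_homogeneous hg hφ.smooth hK ha hb hd₁ (t := 0) (by simp) hγ00 hφ.pos_zero
  have hh1 := hfam₁.eventually_homogeneous hg hφ.smooth hK ha hb hd₁ (t := 1) (by simp) hγ01 hφ.pos_fold
  obtain ⟨r, hr, hhom⟩ := (mem_nhdsGT_iff_exists_Ioo_subset).1 (hh0.and hh1)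
  have hr : 0 < r := hr
  have hd₀ : 0 < min d₁ r := lt_min hd₁ hr
  set d₀ := min d₁ r with hd₀def
  have hfam := hfam₁.mono hd₀ (min_le_left _ _)
  have hhom : ∀ d ∈ Ioo 0 d₀, _ := fun d hd => hhom ⟨hd.1, hd.2.trans_le (min_le_right _ _)⟩
  obtain ⟨η, hη, hηd, hnear⟩ := hfam.near
  have hE := isometry_blockEmbed (N := N) (k := k) hk hkN'
  have hz := hfam.zero
  -- Equal blocks have X = Y, so their ray is horizontal and t is an integer; on the open
  -- half-periods the two values differ.
  have hcase : ∀ d ∈ Ioo 0 d₀, ∀ t ∈ Ioo (0:ℝ) 1 ∪ Ioo (-1) 0, (γ d t).1 ≠ (γ d t).2.1 := by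
    intro d hd t ht he
    obtain ⟨ρ, hρ, hw⟩ := hfam.ray d ⟨hd.1.le, hd.2⟩ t
    have hw2 := congrArg Prod.snd hw
    simp only [planar, he, sub_self] at hw2
    exact mul_ne_zero hρ.ne' (sin_pi_mul_ne_zero_of_mem ht) hw2.symm
  have hall : gammaAll uminus uplus N k = blockEmbed N k '' singularCurve uminus uplus := by
    rw [gammaAll, gammaAB_eq, gammaCD_eq, singularCurve, image_union]
  have hsing : ∀ {d : ℝ}, d ∈ Ioo 0 η → ∀ q ∈ branchSet ((N:ℝ) - k) k g K d, q.1 ≠ q.2.1 →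
      (∃ s ∈ singularCurve uminus uplus, dist q s < η) →
      ∃ t ∈ Ioo (0:ℝ) 1 ∪ Ioo (-1) 0, γ d t = q := by
    rintro d hd q hq hne ⟨s, hs, hqs⟩
    have hdd : d ∈ Ioo 0 d₀ := ⟨hd.1, hd.2.trans_le hηd⟩
    obtain ⟨t, -, rfl⟩ := hγ.exists_eq hg hφ hs
    obtain ⟨t', rfl⟩ := hnear d hd t q hqs hq
    obtain ⟨n, hn⟩ := exists_add_mem_Ico t'
    have hp : γ d (t' + n * 2) = γ d t' := (hfam.periodic d ⟨hdd.1.le, hdd.2⟩).int_mul n t'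
    refine ⟨_, ?_, hp⟩
    rw [← hp] at hne
    set τ := t' + n * 2
    rcases lt_trichotomy τ 0 with h | h | h
    -- The parameter -1 is a period away from the homogeneous point t = 1, so it is excluded.
    · refine Or.inr ⟨lt_of_le_of_ne hn.1 fun h' => hne ?_, h⟩
      have := hfam.periodic d ⟨hdd.1.le, hdd.2⟩ (-1)
      rw [show (-1:ℝ) + 2 = 1 by norm_num] at this
      rw [← h', ← this]
      exact (hhom d hdd).2.1
    · rw [h] at hne
      exact absurd (hhom d hdd).1.1 hne
    · exact Or.inl ⟨h, hn.2⟩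
  have hblock : ∀ (t d : ℝ), (γ d t).1 = (γ d t).2.1 → (γ d t).1 = uminus (γ d t).2.2 →
      (blockEmbed N k (γ d t)).1 = fun _ => uminus (blockEmbed N k (γ d t)).2 := by
    intro t d h1 h2
    rw [blockEmbed_apply]
    funext n
    simp only [blockVec, ← h1, ← h2, ite_self]
  have hpow : ∀ n : ℕ, (fun d : ℝ => ((N : ℝ) * d) ^ n) =O[𝓝[>] 0] fun d => d ^ n := fun n => by
    simp only [mul_pow]
    exact (isBigO_refl _ _).const_mul_left _
  -- The radius δ₀ is the η of `hnear`, within which every solution lies on the curve whatever the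
  -- value of μ.
  refine ⟨d₀, hd₀, η, hη, fun d t => blockEmbed N k (γ d t),
    hfam.isClosedCurveFamily hφ.smooth c1 hk hkN', ?_, ?_, ?_, ?_, ?_, ?_, ?_, ?_⟩
  · change (fun t => blockEmbed N k (γ 0 t)) '' Icc 0 1 = _
    rw [gammaAB_eq, ← hAB, hz, image_image]
  · change (fun t => blockEmbed N k (γ 0 t)) '' Icc (-1) 0 = _
    rw [gammaCD_eq, ← hCD, hz, image_image]
  · exact fun d hd t => hfam.level d hd t
  · intro d hd
    obtain ⟨h0, h1⟩ := hhom d hd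
    exact ⟨hblock 0 d h0.1 h0.2.2.2, hblock 1 d h1.1 h1.2.2.2⟩
  · rw [e1]
    have ht : Tendsto (fun d => ((γ d 0).1, (γ d 0).2.2)) (𝓝[>] 0) (𝓝 (0, 0)) := by
      have := hfam.tendsto_slice 0
      rw [hγ00] at this
      exact ((by fun_prop : Continuous fun p : ℝ × ℝ × ℝ => (p.1, p.2.2)).tendsto _).comp this
    refine (hg.pitchfork_asymptotics (D := fun d => N * d) ht ?_ ?_).trans (hpow 2)
    · filter_upwards [hh0] with d hd using hd.2.1
    · filter_upwards [hh0] with d hd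
      rw [hd.2.2.1]; ring
  · rw [e2, e3]
    have ht : Tendsto (fun d => ((γ d 1).1, (γ d 1).2.2)) (𝓝[>] 0) (𝓝 (1, 1)) := by
      have := hfam.tendsto_slice 1
      rw [hγ01] at this
      exact ((by fun_prop : Continuous fun p : ℝ × ℝ × ℝ => (p.1, p.2.2)).tendsto _).comp this
    refine (hg.fold_asymptotics (D := fun d => N * d) ht ?_ ?_).trans (hpow 3)
    · filter_upwards [hh1] with d hd using hd.2.1
    · filter_upwards [hh1] with d hd
      rw [hd.2.2.1]; ring
  · exact hfam.critical
  · intro δ hδ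
    obtain ⟨r₁, hr₁, hdist⟩ := hfam.uniform_dist c1 hγ.periodic hd₀ hδ
    obtain ⟨r₂, hr₂, hclose⟩ := Metric.eventually_nhds_iff.1
      (hg.eventually_near_singularCurve hK ha hb δ hη)
    refine ⟨min d₀ (min r₁ (min r₂ η)), ⟨by positivity, min_le_left _ _⟩, fun d hd => ?_⟩
    simp only [mem_Ioo, lt_min_iff] at hd
    obtain ⟨hd0, hdd, hd1, hd2, hdη⟩ := hd
    rw [hall]
    refine ⟨fun t => Metric.mem_thickening_iff.2 ⟨_, mem_image_of_mem _ (c2 t), ?_⟩, fun p hp hcond => ?_⟩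
    · rw [hE.dist_eq]; exact hdist d ⟨hd0, hd1⟩ t
    · rw [isPosBlockSolution_iff hK hfg hk hkN', ← image_union]
      constructor
      · rintro ⟨q, hq, hne, rfl⟩
        obtain ⟨_, ⟨s, hs, rfl⟩, hqs⟩ := Metric.mem_thickening_iff.1 hp
        rw [hE.dist_eq] at hqs
        have hex : ∃ s ∈ singularCurve uminus uplus, dist q s < η := by
          -- For δ ≤ δ₀ the solution is already within η of the singular curve. Otherwise 0 ≤ μ ≤ 1,
          -- and compactness brings it there for small d.
          rcases hcond with hle | hμ
          · exact ⟨s, hs, hqs.trans_le hle⟩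
          · refine (Metric.infDist_lt_iff ⟨s, hs⟩).1 ?_
            refine hclose (by rw [Real.dist_eq, sub_zero, abs_of_pos hd0]; exact hd2) hd0 q hq
              (Metric.thickening_subset_cthickening _ _ (Metric.mem_thickening_iff.2 ⟨s, hs, hqs⟩)) ?_
            rwa [blockEmbed_apply] at hμ
        obtain ⟨t, ht, rfl⟩ := hsing ⟨hd0, hdη⟩ q hq hne hex
        exact ⟨t, ht, rfl⟩
      · rintro ⟨t, ht, rfl⟩
        exact ⟨γ d t, hfam.mem d ⟨hd0, hdd⟩ t, hcase d ⟨hd0, hdd⟩ t ht, rfl⟩
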